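/- **Notation.** Fix an integer $m\ge 1$ and angles $-\pi/2\le\psi_-<0<\psi_+\le\pi/2$; let $S^-=\{\psi_-<\arg p<0\}$, $S^+=\{0<\arg p<\psi_+\}$. A *staircase distribution* ($T\in\mathcal D'_m$) is a distribution on $(0,\infty)$ that is, on each $(0,k+1)$, $k\in\mathbb N$, the $mk$-th derivative of a function in $L^1(0,k+1)$; it has a unique decomposition $T=\sum_{i\ge0}\Delta_i^{(mi)}$ with $\Delta_i\in L^1$ supported in $[i,i+1]$. Put $\|T\|_{m,\nu}=c\sum_i\nu^{mi}\int e^{-\nu t}|\Delta_i(t)|\,dt$ with a fixed constant $c>3$ (so that the norm is submultiplicative for large $\nu$), and $\mathcal D'_{m,\nu}=\{\|T\|_{m,\nu}<\infty\}$. With $\mathcal P^{mk}T=\sum_{j\le k}\mathcal P^{m(k-j)}\Delta_j$ on $(0,k+1)$, $\mathcal Pf(p)=\int_0^pf$, convolution is $T*S=\big((\mathcal P^{mk}T)*(\mathcal P^{mk}S)\big)^{(2mk)}$ on $(0,k+1)$, where $(F*G)(p)=\int_0^pF(s)G(p-s)\,ds$. For $T\in\mathcal D'_m$, $T(p-j)$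 is the translate of $T$ extended by $0$, and $[T(p-j)]^{(mj)}=\sum_i(\Delta_i(p-j))^{(m(i+j))}$. $\mathcal R'_1$ is the Riemann surface consisting of the base sheet $S^-\cup(0,1)\cup S^+$ and, for each $j\ge1$, the sheets reached from $S^-$ (from $S^+$) by crossing the interval $(j,j+1)$ into $j+S^+$ (into $j+S^-$). For $f$ analytic in $\mathcal R'_1$, $f^{-j+}$ is its continuation from $S^-$ across $(j,j+1)$. All limits of functions below are limits of $t\mapsto f(te^{i\theta})$ as $\theta\to0^\pm$ in $\mathcal D'_{m,\nu}$, for all large $\nu$. The class $\mathcal F(\mathcal R'_1)$ consists of the $f$ analytic in $\mathcal R'_1$ that have boundary values $f^\pm=f_0^\pm$ (from $S^\pm$) and for which there are functions $g_j$ analytic in $S^+$, $g_0=f$, with boundary values $f_j^+\in\mathcal D'_{m,\nu}$, such that for all $j\ge0$ $$f^{-j+}(z)=\sum_{i=0}^{j}g_i^{(mi)}(z-i)\quad(z\in j+S^+),\qquad f^-=\sum_{i=0}^{j}[f_i^+(p-i)]^{(mi)}\quad\text{on }(0,j+1);$$ similarly with $+$ and $-$ interchanged (components $f_j^-$); and such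 that for some $K(\nu)\ge0$ with $K(\nu)\to0$ as $\nu\to\infty$ one has $\|[f_j^\pm(p-j)]^{(mj)}\|_{m,\nu}\le K(\nu)^j$ for all $j$ and all large $\nu$. Such a $K$ is called admissible for $f$. (The $f_j^\pm$ are unique.) For $\alpha\in\mathbb C$ let $$\mathcal A_\alpha f=\sum_{j\ge0}\alpha^j[f_j^+(p-j)]^{(mj)}.$$ **Proposition.** (i) If $f,g\in\mathcal F(\mathcal R'_1)$, then $f*g$, defined on $(0,1)$ by $\int_0^pf(s)g(p-s)\,ds$, extends to an element of $\mathcal F(\mathcal R'_1)$. Its components are $(f*g)_j^\pm=\sum_{s=0}^jf_s^\pm*g_{j-s}^\pm$, and if $K_f,K_g$ are admissible for $f,g$ then $K_f+K_g$ is admissible for $f*g$. If $h$ is analytic and bounded in $\{\operatorname{Re}p>0\}$ then $hf\in\mathcal F(\mathcal R'_1)$. (ii) For every $\alpha\in\mathbb C$ and $f\in\mathcal F(\mathcal R'_1)$ the series $\mathcal A_\alpha f$ converges in $\mathcal D'_{m,\nu}$ for all large $\nu$. For $f,g\in\mathcal F(\mathcal R'_1)$ and $a,b\in\mathbb C$,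 $af+bg\in\mathcal F(\mathcal R'_1)$ and $\mathcal A_\alpha(af+bg)=a\mathcal A_\alpha f+b\mathcal A_\alpha g$; $1\in\mathcal F(\mathcal R'_1)$ and $\mathcal A_\alpha1=1$; $\mathcal A_\alpha(f*g)=\mathcal A_\alpha f*\mathcal A_\alpha g$; and if $h$ is analytic in $\{p\neq 0,\ \psi_-<\arg p<\psi_+\}$ and $hf\in\mathcal F(\mathcal R'_1)$ then $\mathcal A_\alpha(hf)=h\,\mathcal A_\alpha f$. (iii) Identify $f\in\mathcal F(\mathcal R'_1)$ with $f^+$. Let $M_{\mathbf l}$ ($\mathbf l\in\mathbb N^n$, $|\mathbf l|=\sum_i l_i\ge1$) be linear operators $\mathcal D'_{m,\nu}\to(\mathcal D'_{m,\nu})^n$ for all large $\nu$, with $\|M_{\mathbf l}\|_\nu\le C_\nu\kappa^{|\mathbf l|}$ and $\max_{|\mathbf l|=1}\|M_{\mathbf l}\|_\nu\to0$ as $\nu\to\infty$. Suppose that $M_{\mathbf l}(\mathcal F(\mathcal R'_1))\subset\mathcal F(\mathcal R'_1)^n$ and $\mathcal A_\alpha M_{\mathbf l}=M_{\mathbf l}\mathcal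 A_\alpha$ on $\mathcal F(\mathcal R'_1)$. Let $\mathbf F_0\in\mathcal F(\mathcal R'_1)^n$ with $\mathcal A_\alpha\mathbf F_0=\mathbf F_0$, and $\mathbf M(\mathbf Y)=\mathbf F_0+\sum_{|\mathbf l|\ge1}M_{\mathbf l}(\mathbf Y^{*\mathbf l})$. In $\mathcal F(\mathcal R'_1)^n$, $\mathbf M(\mathbf Y)=\mathbf Z$ means that the sum converges to $\mathbf Z$ in $\mathcal D'_{m,\nu}$ (for large $\nu$) along each branch $f\mapsto f^{-j+}=\sum_{i\le j}[f_i^+(p-i)]^{(mi)}$, $j\ge0$; on $n$-tuples of distributions, that it converges in $\mathcal D'_{m,\nu}$ for all large $\nu$. If $\mathbf Y,\mathbf Z\in\mathcal F(\mathcal R'_1)^n$ and $\mathbf M(\mathbf Y)=\mathbf Z$, then $\mathbf M(\mathcal A_\alpha\mathbf Y)=\mathcal A_\alpha\mathbf Z$. In particular, if $\mathbf Y$ is a fixed point of $\mathbf M$, then so is $\mathcal A_\alpha\mathbf Y$. (iv) Let $M_{\mathbf l}(f)=\mathbf G_{\mathbf l}*f$ with $\mathbf G_{\mathbf l}$ analytic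 in $\{p\neq0,\ \psi_-<\arg p<\psi_+\}$ and $|\mathbf G_{\mathbf l}(p)|\le e^{\kappa|p|}$ there, for some $\kappa$ and all $\mathbf l$. Then the hypotheses of (iii) on the $M_{\mathbf l}$ hold for every $\alpha$. Moreover, for $\mathbf F_0$ as in (iii) and $\mathbf Y,\mathbf Z\in\mathcal F(\mathcal R'_1)^n$, it suffices that $\mathbf Z^+=\mathbf M(\mathbf Y^+)$ as distributions on $(0,\infty)$ to conclude that $\mathcal A_\alpha\mathbf Z=\mathbf M(\mathcal A_\alpha\mathbf Y)$. -/

import Mathlib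

open Filter Topology MeasureTheory Set
open scoped Distributions NNReal ENNReal

noncomputable section

namespace Staircase

/-! ### Distributions on the open half line -/

/-- The open half line `(0, ∞)`. -/
def posHalfLine : TopologicalSpace.Opens ℝ := ⟨Ioi 0, isOpen_Ioi⟩

/-- Complex valued distributions on `(0, ∞)`. -/
abbrev Dist : Type := 𝓓'(posHalfLine, ℂ)

/-- The distribution `φ ↦ ∫ φ F` of a function `F` that is locally integrable on `(0, ∞)`. -/
def Dist.ofFun (F : ℝ → ℂ) : Dist :=
  UniformConvergenceCLM.ofFun (RingHom.id ℝ) ℂ {S | IsCompact S}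
    (TestFunction.integralAgainstBilinCLM (ContinuousLinearMap.lsmul ℝ ℝ) volume F)

/-- The distributional derivative. -/
def Dist.deriv (T : Dist) : Dist := Distribution.lineDerivCLM (1 : ℝ) T

/-- `T = S` on the test functions supported in `(0, R)`. -/
def EqBelow (R : ℝ) (T S : Dist) : Prop :=
  ∀ φ : 𝓓(posHalfLine, ℝ), tsupport φ ⊆ Iio R → T φ = S φ

/-- `B = h A`, the product of the distribution `A` with the complex function `h` (smooth on
`(0, ∞)`): `B(φ) = A(h φ)`, where `A` is extended to complex test functions by linearity. -/
def IsMul (h : ℝ → ℂ) (A B : Dist) : Prop :=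
  ∀ φ φr φi : 𝓓(posHalfLine, ℝ), (∀ t, 0 < t → φr t = (h t).re * φ t) →
    (∀ t, 0 < t → φi t = (h t).im * φ t) → B φ = A φr + Complex.I * A φi

/-! ### Staircase distributions -/

/-- The staircase decomposition `T = ∑ᵢ Δᵢ^(mi)`, with `Δᵢ` integrable and supported in
`[i, i+1]`. The distributions that have one are the staircase distributions `𝓓'_m`, that is
those which are on each `(0, k+1)` the `mk`-th derivative of an integrable function, and their
decomposition is unique up to null sets. The sum is locally finite. -/
def IsStairDecomp (m : ℕ) (T : Dist) (Δ : ℕ → ℝ → ℂ) : Prop :=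
  (∀ i, Integrable (Δ i)) ∧
  (∀ i : ℕ, ∀ t : ℝ, t ∉ Icc (i : ℝ) (i + 1) → Δ i t = 0) ∧
  ∀ k : ℕ, EqBelow (k + 1) T
    (∑ i ∈ Finset.range (k + 1), Dist.deriv^[m * i] (Dist.ofFun (Δ i)))

/-- The norm `‖T‖_{m,ν} = c ∑ᵢ ν^(mi) ∫ e^{-νt} |Δᵢ(t)| dt`. It is infinite if `T` is not a
staircase distribution; `𝓓'_{m,ν}` consists of the `T` for which it is finite. The infimum is
over the decompositions of `T`, which agree almost everywhere and give the same value. -/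
def stairNorm (c : ℝ≥0) (m : ℕ) (ν : ℝ) (T : Dist) : ℝ≥0∞ :=
  ⨅ (Δ : ℕ → ℝ → ℂ) (_ : IsStairDecomp m T Δ),
    c * ∑' i : ℕ, ENNReal.ofReal ν ^ (m * i) *
      ∫⁻ t, ENNReal.ofReal (Real.exp (-ν * t)) * ‖Δ i t‖ₑ

/-- `S = ∑ᵢ Tᵢ` in `𝓓'_{m,ν}` (unconditionally). -/
def StairHasSum (c : ℝ≥0) (m : ℕ) (ν : ℝ) {ι : Type} (T : ι → Dist) (S : Dist) : Prop :=
  Tendsto (fun s : Finset ι => stairNorm c m ν (S - ∑ i ∈ s, T i)) atTop (𝓝 0)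

/-- The operator `𝒫`. -/
def primitive (F : ℝ → ℂ) : ℝ → ℂ := fun x => ∫ s in (0 : ℝ)..x, F s

/-- `𝒫^{mk} T` on `(0, k+1)`, namely `∑_{j ≤ k} 𝒫^{m(k-j)} Δ_j`. -/
def stairPrimitive (m : ℕ) (Δ : ℕ → ℝ → ℂ) (k : ℕ) : ℝ → ℂ :=
  fun x => ∑ j ∈ Finset.range (k + 1), (primitive^[m * (k - j)] (Δ j)) x

/-- Convolution of functions on the half line. -/
def convFun (F G : ℝ → ℂ) : ℝ → ℂ := fun t => ∫ s in (0 : ℝ)..t, F s * G (t - s)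

/-- `U = T * S` in `𝓓'_m`: on `(0, k+1)` it is the `2mk`-th derivative of
`(𝒫^{mk} T) * (𝒫^{mk} S)`. -/
def IsStairConv (m : ℕ) (T S U : Dist) : Prop :=
  ∃ Δ Δ' : ℕ → ℝ → ℂ, IsStairDecomp m T Δ ∧ IsStairDecomp m S Δ' ∧
    ∀ k : ℕ, EqBelow (k + 1) U
      (Dist.deriv^[2 * m * k]
        (Dist.ofFun (convFun (stairPrimitive m Δ k) (stairPrimitive m Δ' k))))

/-- The convolution of `𝓓'_m` as a function. -/
def stairConv (m : ℕ) (T S : Dist) : Dist := Classical.epsilon (IsStairConv m T S)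

/-- `U = [T(p - j)]^(mj)`, where `T ∈ 𝓓'_m` is extended by zero to the left of the origin before
it is translated: if `T = ∑ᵢ Δᵢ^(mi)` then `U = ∑ᵢ (Δᵢ(p - j))^(m(i+j))`. -/
def IsShiftDeriv (m j : ℕ) (T U : Dist) : Prop :=
  ∃ Δ : ℕ → ℝ → ℂ, IsStairDecomp m T Δ ∧
    ∀ k : ℕ, EqBelow (k + 1) U
      (∑ i ∈ Finset.range (k + 1),
        Dist.deriv^[m * (i + j)] (Dist.ofFun fun t => Δ i (t - j)))

/-- `[T(p - j)]^(mj)`. -/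
def shiftDeriv (m j : ℕ) (T : Dist) : Dist := Classical.epsilon (IsShiftDeriv m j T)

/-! ### Functions on the Riemann surface -/

/-- `{0 < arg z < ψ}`. -/
def upperSector (ψ : ℝ) : Set ℂ := {z | 0 < z.arg ∧ z.arg < ψ}

/-- `{ψ < arg z < 0}`. -/
def lowerSector (ψ : ℝ) : Set ℂ := {z | ψ < z.arg ∧ z.arg < 0}

/-- The sector `{ψm < arg z < ψp}`, the origin excluded. -/
def sector (ψm ψp : ℝ) : Set ℂ := {z | z ≠ 0 ∧ ψm < z.arg ∧ z.arg < ψp}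

/-- The part of the surface that is swept by the paths which start in the sector `A`, cross the
real axis between `j` and `j + 1`, and go on in the translated sector `j + B`. -/
def crossing (A B : Set ℂ) (j : ℕ) : Set ℂ :=
  A ∪ (Complex.ofReal '' Ioo (j : ℝ) (j + 1)) ∪ {z | z - j ∈ B}

/-- As `θ` tends to its limit along `l`, the functions `t ↦ f (t e^{iθ})` converge to `T` in
`𝓓'_{m,ν}`. -/
def HasRayLimit (c : ℝ≥0) (m : ℕ) (ν : ℝ) (l : Filter ℝ) (f : ℂ → ℂ) (T : Dist) : Prop :=
  stairNorm c m ν T < ⊤ ∧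
  Tendsto (fun θ : ℝ => stairNorm c m ν
    (Dist.ofFun (fun t : ℝ => f (t * Complex.exp (θ * Complex.I))) - T)) l (𝓝 0)

/-- The decomposition of `f` relative to the continuations that start on the side `A` of the real
axis and cross to the side `B`. The boundary value of `f` from the side `B` is `D 0`, and `T` is
the one from the side `A`. The components `g j` are analytic in `B`, with boundary values `D j`.
The continuation `b` of `f` from `A` across `(j, j+1)` exists; in `j + B` it is
`∑_{i ≤ j} (g i)^(mi)(z - i)`, and the corresponding relation holds between the distributions on
the real axis, where along the path the boundary value on `(0, j+1)` is `T`. -/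
def IsDecomposition (c : ℝ≥0) (m : ℕ) (A B : Set ℂ) (lA lB : Filter ℝ) (f : ℂ → ℂ)
    (D : ℕ → Dist) : Prop :=
  ∃ (g : ℕ → ℂ → ℂ) (T : Dist),
    g 0 = f ∧
    (∀ j, AnalyticOnNhd ℂ (g j) B) ∧
    (∀ᶠ ν in atTop, HasRayLimit c m ν lA f T) ∧
    (∀ᶠ ν in atTop, ∀ j, HasRayLimit c m ν lB (g j) (D j)) ∧
    (∀ j : ℕ, ∃ b : ℂ → ℂ, AnalyticOnNhd ℂ b (crossing A B j) ∧ EqOn b f A ∧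
      ∀ z : ℂ, z - j ∈ B →
        b z = ∑ i ∈ Finset.range (j + 1), iteratedDeriv (m * i) (g i) (z - i)) ∧
    ∀ j : ℕ, EqBelow (j + 1) T (∑ i ∈ Finset.range (j + 1), shiftDeriv m i (D i))

/-- `D j = f_j^+`. -/
def IsUpperDecomp (c : ℝ≥0) (m : ℕ) (ψm ψp : ℝ) (f : ℂ → ℂ) (D : ℕ → Dist) : Prop :=
  IsDecomposition c m (lowerSector ψm) (upperSector ψp) (𝓝[<] 0) (𝓝[>] 0) f D

/-- `D j = f_j^-`. -/
def IsLowerDecomp (c : ℝ≥0) (m : ℕ) (ψm ψp : ℝ) (f : ℂ → ℂ) (D : ℕ → Dist) : Prop :=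
  IsDecomposition c m (upperSector ψp) (lowerSector ψm) (𝓝[>] 0) (𝓝[<] 0) f D

/-- `K` tends to `0` at infinity and `‖[f_j^±(p - j)]^(mj)‖_{m,ν} ≤ K(ν)^j` for all `j` and all
large `ν`. -/
def IsGrowthBound (c : ℝ≥0) (m : ℕ) (ψm ψp : ℝ) (f : ℂ → ℂ) (K : ℝ → ℝ≥0) : Prop :=
  Tendsto K atTop (𝓝 0) ∧
  ∃ Dp Dm : ℕ → Dist, IsUpperDecomp c m ψm ψp f Dp ∧ IsLowerDecomp c m ψm ψp f Dm ∧
    ∀ᶠ ν in atTop, ∀ j : ℕ,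
      stairNorm c m ν (shiftDeriv m j (Dp j)) ≤ (K ν : ℝ≥0∞) ^ j ∧
      stairNorm c m ν (shiftDeriv m j (Dm j)) ≤ (K ν : ℝ≥0∞) ^ j

/-- The class `ℱ(𝓡'_1)`. An element is given by its values on the sector `ψm < arg z < ψp` cut
along `[1, ∞)`; its values on the other sheets are the continuations of these. -/
def MemF (c : ℝ≥0) (m : ℕ) (ψm ψp : ℝ) (f : ℂ → ℂ) : Prop :=
  AnalyticOnNhd ℂ f (crossing (lowerSector ψm) (upperSector ψp) 0) ∧
  ∃ K : ℝ → ℝ≥0, IsGrowthBound c m ψm ψp f K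

/-- `h = f * g` for small argument. -/
def IsConvNearZero (f g h : ℂ → ℂ) : Prop :=
  ∀ x : ℝ, x ∈ Ioo (0 : ℝ) 1 → h x = ∫ s in (0 : ℝ)..x, f s * g (x - s)

/-- `T = f^+`, the boundary value of `f` on the half line from above. -/
def IsBoundaryValue (c : ℝ≥0) (m : ℕ) (f : ℂ → ℂ) (T : Dist) : Prop :=
  ∀ᶠ ν in atTop, HasRayLimit c m ν (𝓝[>] 0) f T

/-- `S = f^{-j+}`, the boundary value of the continuation of `f` along the paths that cross
from below to above between `j` and `j + 1`. -/
def IsBranchValue (c : ℝ≥0) (m : ℕ) (ψm ψp : ℝ) (j : ℕ) (f : ℂ → ℂ) (S : Dist) : Prop :=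
  ∃ D : ℕ → Dist, IsUpperDecomp c m ψm ψp f D ∧
    S = ∑ i ∈ Finset.range (j + 1), shiftDeriv m i (D i)

/-- `A = 𝓐_α f = ∑ⱼ α^j [f_j^+(p - j)]^(mj)`, convergent in `𝓓'_{m,ν}` for all large `ν`. -/
def IsAverage (c : ℝ≥0) (m : ℕ) (ψm ψp : ℝ) (α : ℂ) (f : ℂ → ℂ) (A : Dist) : Prop :=
  ∃ D : ℕ → Dist, IsUpperDecomp c m ψm ψp f D ∧
    ∀ᶠ ν in atTop, StairHasSum c m ν (fun j : ℕ => α ^ j • shiftDeriv m j (D j)) A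

/-! ### Nonlinear convolution operators -/

/-- Multi-indices `l` with `|l| ≥ 1`. -/
abbrev MIdx (n : ℕ) : Type := {l : Fin n → ℕ // l ≠ 0}

/-- The convolution of the members of a nonempty list. -/
def listConv (m : ℕ) : List Dist → Dist
  | [] => 0
  | [T] => T
  | T :: S :: L => stairConv m T (listConv m (S :: L))

/-- `Y^{*l} = Y_1^{*l_1} * ⋯ * Y_n^{*l_n}`, factors with `l_i = 0` being omitted. -/
def multiConv (m : ℕ) {n : ℕ} (Y : Fin n → Dist) (l : MIdx n) : Dist :=
  listConv m ((List.finRange n).flatMap fun i => List.replicate (l.1 i) (Y i))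

/-- The standing assumptions on the operators `M_l : 𝓓'_{m,ν} → (𝓓'_{m,ν})^n`, for large `ν`:
linearity, `‖M_l‖_ν ≤ C_ν κ^{|l|}`, and `max_{|l|=1} ‖M_l‖_ν → 0` as `ν → ∞`. -/
def IsAdmissible (c : ℝ≥0) (m : ℕ) {n : ℕ} (M : MIdx n → Dist → Fin n → Dist) : Prop :=
  ∃ (κ : ℝ≥0) (C ε : ℝ → ℝ≥0), Tendsto ε atTop (𝓝 0) ∧ ∀ᶠ ν in atTop, ∀ l : MIdx n,
    (∀ (T S : Dist) (a b : ℂ), stairNorm c m ν T < ⊤ → stairNorm c m ν S < ⊤ →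
      M l (a • T + b • S) = a • M l T + b • M l S) ∧
    (∀ T : Dist, stairNorm c m ν T < ⊤ →
      ∑ i, stairNorm c m ν (M l T i) ≤ C ν * κ ^ (∑ i, l.1 i) * stairNorm c m ν T) ∧
    (∑ i, l.1 i = 1 → ∀ T : Dist, stairNorm c m ν T < ⊤ →
      ∑ i, stairNorm c m ν (M l T i) ≤ ε ν * stairNorm c m ν T)

/-- `B = 𝐌(A) = F₀ + ∑_{|l| ≥ 1} M_l(A^{*l})`, convergent in `𝓓'_{m,ν}` for all large `ν`. -/
def IsMValue (c : ℝ≥0) (m : ℕ) {n : ℕ} (M : MIdx n → Dist → Fin n → Dist)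
    (F₀ A B : Fin n → Dist) : Prop :=
  ∀ i, ∀ᶠ ν in atTop,
    StairHasSum c m ν (fun l : MIdx n => M l (multiConv m A l) i) (B i - F₀ i)

/-- `Z = 𝐌(Y) = F₀ + ∑_{|l| ≥ 1} M_l(Y^{*l})` in `ℱ(𝓡'_1)^n`. The elements of `ℱ(𝓡'_1)` are
identified with their boundary values `f^+`, on which the `M_l` act, so that `U l` is
`M_l(Y^{*l})`; the sum converges along each of the branches `f^{-j+}`. -/
def IsSurfaceMValue (c : ℝ≥0) (m : ℕ) (ψm ψp : ℝ) {n : ℕ} (M : MIdx n → Dist → Fin n → Dist)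
    (F₀ Y Z : Fin n → ℂ → ℂ) : Prop :=
  ∃ (T : Fin n → Dist) (U : MIdx n → Fin n → ℂ → ℂ),
    (∀ i, IsBoundaryValue c m (Y i) (T i)) ∧
    (∀ l i, MemF c m ψm ψp (U l i) ∧
      IsBoundaryValue c m (U l i) (M l (multiConv m T l) i)) ∧
    ∀ (i : Fin n) (j : ℕ), ∃ (SZ SF : Dist) (SU : MIdx n → Dist),
      IsBranchValue c m ψm ψp j (Z i) SZ ∧ IsBranchValue c m ψm ψp j (F₀ i) SF ∧
      (∀ l, IsBranchValue c m ψm ψp j (U l i) (SU l)) ∧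
      ∀ᶠ ν in atTop, StairHasSum c m ν SU (SZ - SF)

/-- The `M_l` map `ℱ(𝓡'_1)` to `ℱ(𝓡'_1)^n`, and `𝓐_α M_l = M_l 𝓐_α`. -/
def CommutesWithAverage (c : ℝ≥0) (m : ℕ) (ψm ψp : ℝ) (α : ℂ) {n : ℕ}
    (M : MIdx n → Dist → Fin n → Dist) : Prop :=
  ∀ (l : MIdx n) (f : ℂ → ℂ) (T A : Dist), MemF c m ψm ψp f → IsBoundaryValue c m f T →
    IsAverage c m ψm ψp α f A →
    ∃ u : Fin n → ℂ → ℂ, ∀ i, MemF c m ψm ψp (u i) ∧ IsBoundaryValue c m (u i) (M l T i) ∧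
      IsAverage c m ψm ψp α (u i) (M l A i)

/-- The convolution operators `M_l T = G_l * T`. -/
def convOperator (m : ℕ) {n : ℕ} (G : MIdx n → Fin n → ℂ → ℂ) :
    MIdx n → Dist → Fin n → Dist :=
  fun l T i => stairConv m (Dist.ofFun fun t => G l i t) T

end Staircase

end

set_option linter.unusedSectionVars false

noncomputable section

open scoped ContDiff
open ENNReal (ofReal ofReal_mul ofReal_ne_top ofReal_lt_top ofReal_le_ofReal ofReal_pow
  ofReal_le_one ofReal_one mul_lt_top mul_ne_top add_lt_top tendsto_ofReal pow_ne_top pow_lt_top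
  tsum_le_tsum le_tsum sum_le_tsum mul_top coe_lt_top one_lt_top)
open Complex (I continuous_re norm_exp_ofReal_mul_I)
open Finset (sum_congr sum_cons cons_induction sum_range_succ mul_sum sum_eq_zero sum_le_sum
  mem_range_succ_iff sum_singleton sum_add_distrib sum_empty smul_sum)
open Real (exp exp_add exp_nonneg sin)
open Function (iterate_succ_apply' iterate_add_apply)
open Metric (closedBall ball isOpen_ball sphere_subset_closedBall nhds_basis_closedBall
  ball_subset_closedBall)
open intervalIntegral (integral_of_le integral_add_adjacent_intervals)

namespace Staircase

section

/-! ### Causal functions -/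

variable {F G : ℝ → ℂ}

/-- Locally integrable functions on the line that vanish on the negative half line. -/
structure Causal (F : ℝ → ℂ) : Prop where
  locInt : LocallyIntegrable F
  zero : ∀ t < 0, F t = 0

lemma one_le_of_three_lt {c : ℝ≥0} (hc : 3 < c) : 1 ≤ c :=
  (by norm_num : (1 : ℝ≥0) ≤ 3).trans hc.le

lemma tendsto_zero_of_le {ι : Type*} {l : Filter ι} {f g : ι → ℝ≥0∞} (hg : Tendsto g l (𝓝 0))
    (h : ∀ᶠ x in l, f x ≤ g x) : Tendsto f l (𝓝 0) :=
  tendsto_of_tendsto_of_tendsto_of_le_of_le' tendsto_const_nhds hg (.of_forall fun _ => zero_le) h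

lemma eventually_ge_succ (m : ℕ) : ∀ᶠ ν : ℝ in atTop, (m : ℝ) + 1 ≤ ν := eventually_ge_atTop _

lemma one_le_of_succ_le {m : ℕ} {ν : ℝ} (h : (m : ℝ) + 1 ≤ ν) : 1 ≤ ν := by
  linarith [(Nat.cast_nonneg m : (0 : ℝ) ≤ m)]

lemma ae_ne (a : ℝ) : ∀ᵐ t : ℝ, t ≠ a := by simp [ae_iff, measure_singleton]

/-- The Heaviside function. -/
def heaviside : ℝ → ℂ := (Ici (0 : ℝ)).indicator fun _ => 1

/-- The Laplace weight `∫ e^{-μt} |F(t)| dt`. -/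
def lap (μ : ℝ) (F : ℝ → ℂ) : ℝ≥0∞ := ∫⁻ t, ofReal (exp (-μ * t)) * ‖F t‖ₑ

lemma Causal.aesm (h : Causal F) : AEStronglyMeasurable F :=
  h.locInt.aestronglyMeasurable

lemma Causal.intervalIntegrable (h : Causal F) (a b : ℝ) : IntervalIntegrable F volume a b :=
  (h.locInt.integrableOn_isCompact isCompact_uIcc).intervalIntegrable

lemma causal_zero : Causal (fun _ => 0) := ⟨locallyIntegrable_const 0, fun _ _ => rfl⟩

lemma Causal.add (hF : Causal F) (hG : Causal G) : Causal (fun t => F t + G t) :=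
  ⟨hF.locInt.add hG.locInt, fun t ht => by simp [hF.zero t ht, hG.zero t ht]⟩

lemma Causal.const_mul (hF : Causal F) (a : ℂ) : Causal (fun t => a * F t) :=
  ⟨hF.locInt.smul a, fun t ht => by simp [hF.zero t ht]⟩

lemma Causal.finset_sum {ι : Type*} {F : ι → ℝ → ℂ} (s : Finset ι) (hF : ∀ i ∈ s, Causal (F i)) :
    Causal (fun t => ∑ i ∈ s, F i t) := by
  simpa [funext_iff, Finset.sum_fn] using
    Finset.sum_induction F Causal (fun _ _ h h' => h.add h') causal_zero hF

lemma Causal.indicator (hF : Causal F) {S : Set ℝ} (hS : MeasurableSet S) :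
    Causal (S.indicator F) :=
  ⟨hF.locInt.indicator hS, fun t ht => by simp [Set.indicator, hF.zero t ht]⟩

lemma causal_of_integrable (h : Integrable F) (h0 : ∀ t < 0, F t = 0) : Causal F :=
  ⟨h.locallyIntegrable, h0⟩

lemma locallyIntegrable_of_Iio (h : ∀ R : ℝ, IntegrableOn F (Iio R)) : LocallyIntegrable F := by
  rw [locallyIntegrable_iff]
  intro K hK
  obtain ⟨R, hR⟩ := hK.bddAbove
  exact (h (R + 1)).mono_set fun x hx => lt_of_le_of_lt (hR hx) (by simp)

lemma Causal.integrableOn_Iio (h : Causal F) (R : ℝ) : IntegrableOn F (Iio R) := by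
  have h1 : IntegrableOn F (Icc 0 R) :=
    h.locInt.integrableOn_isCompact isCompact_Icc
  have h2 : IntegrableOn F (Iio 0) :=
    (integrableOn_congr_fun (fun t ht => h.zero t ht) measurableSet_Iio).2 integrableOn_zero
  refine (h2.union h1).mono_set fun x hx => ?_
  by_cases h0 : x < 0
  · exact Or.inl h0
  · exact Or.inr ⟨not_lt.1 h0, le_of_lt hx⟩

lemma Causal.integrable_cut (h : Causal F) (R : ℝ) : Integrable ((Iio R).indicator F) :=
  (integrable_indicator_iff measurableSet_Iio).2 (h.integrableOn_Iio R)

lemma Causal.translate (h : Causal F) {a : ℝ} (ha : 0 ≤ a) : Causal (fun t => F (t - a)) := by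
  refine ⟨locallyIntegrable_of_Iio fun R => ?_, fun t ht => h.zero _ (by linarith)⟩
  have := (h.integrable_cut (R - a)).comp_sub_right a
  rw [← integrable_indicator_iff measurableSet_Iio]
  refine this.congr (.of_forall fun t => ?_)
  simp only [Set.indicator, mem_Iio, sub_lt_sub_iff_right]

lemma causal_heaviside : Causal heaviside :=
  ⟨(locallyIntegrable_const 1).indicator measurableSet_Ici, fun t ht => by
    simp [heaviside, Set.indicator, not_le.2 ht]⟩

/-! ### Convolution of causal functions -/

lemma Causal.conv_eq (hF : Causal F) (hG : Causal G) (t : ℝ) :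
    convFun F G t = ∫ s, F s * G (t - s) := by
  unfold convFun
  rcases le_or_gt 0 t with ht | ht
  · rw [integral_of_le ht]
    apply setIntegral_eq_integral_of_ae_compl_eq_zero
    filter_upwards [ae_ne 0] with s hs hs'
    rcases lt_or_gt_of_ne hs with h | h
    · simp [hF.zero s h]
    · have : t - s < 0 := by
        by_contra hcon
        exact hs' ⟨h, by linarith⟩
      simp [hG.zero _ this]
  · rw [intervalIntegral.integral_of_ge ht.le, setIntegral_eq_zero_of_ae_eq_zero, neg_zero, eq_comm]
    · refine integral_eq_zero_of_ae (?_)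
      refine .of_forall fun s => ?_
      rcases lt_or_ge s 0 with h | h
      · simp [hF.zero s h]
      · simp [hG.zero (t - s) (by linarith)]
    · filter_upwards [ae_ne 0] with s hs hs'
      simp [hF.zero s (lt_of_le_of_ne hs'.2 hs)]

lemma Causal.conv_comm (hF : Causal F) (hG : Causal G) : convFun F G = convFun G F := by
  funext t
  rw [hF.conv_eq hG, hG.conv_eq hF, ← integral_sub_left_eq_self _ volume t]
  simp [mul_comm]

lemma Causal.conv_cut (hF : Causal F) (hG : Causal G) {R t : ℝ} (ht : t < R) :
    convFun F G t = ∫ s, (Iio R).indicator F s * (Iio R).indicator G (t - s) := by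
  rw [hF.conv_eq hG]
  refine integral_congr_ae (.of_forall fun s => ?_)
  simp only [Set.indicator, mem_Iio]
  split_ifs with h1 h2 h2
  · rfl
  · simp [hF.zero s (by linarith)]
  · simp [hG.zero (t - s) (by linarith)]
  · simp [hG.zero (t - s) (by linarith)]

lemma Causal.integrable_prod (hF : Causal F) (hG : Causal G) (R : ℝ) :
    Integrable (fun p : ℝ × ℝ => (Iio R).indicator F p.2 * (Iio R).indicator G (p.1 - p.2))
      (volume.prod volume) :=
  (hF.integrable_cut R).convolution_integrand (ContinuousLinearMap.mul ℝ ℂ) (hG.integrable_cut R)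

lemma Causal.conv (hF : Causal F) (hG : Causal G) : Causal (convFun F G) := by
  refine ⟨locallyIntegrable_of_Iio fun R => ?_, fun t ht => ?_⟩
  · have := (hF.integrable_prod hG R).integral_prod_left
    exact this.integrableOn.congr_fun (fun t ht => (hF.conv_cut hG ht).symm) measurableSet_Iio
  · rw [hF.conv_eq hG]
    refine integral_eq_zero_of_ae (.of_forall fun s => ?_)
    rcases lt_or_ge s 0 with h | h
    · simp [hF.zero s h]
    · simp [hG.zero (t - s) (by linarith)]

/-- Convolution tested with a continuous function of compact support. -/
lemma Causal.integral_mul_conv (hF : Causal F) (hG : Causal G) {ψ : ℝ → ℂ} (hψ : Continuous ψ)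
    (hc : HasCompactSupport ψ) : ∫ t, ψ t * convFun F G t = ∫ r, G r * ∫ s, ψ (s + r) * F s := by
  obtain ⟨R, hR⟩ := hc.isCompact.bddAbove
  have hz : ∀ t, R < t → ψ t = 0 := fun t ht => by
    by_contra h
    exact absurd (hR (subset_tsupport _ h)) (not_le.2 ht)
  obtain ⟨K, hK⟩ := hψ.bounded_above_of_compact_support hc
  set F' := (Iio (R + 1)).indicator F
  set G' := (Iio (R + 1)).indicator G
  have e1 : ∀ t, ψ t * convFun F G t = ∫ s, ψ t * (F' s * G' (t - s)) := fun t => by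
    rw [integral_const_mul]
    rcases lt_or_ge t (R + 1) with h | h
    · rw [hF.conv_cut hG h]
    · simp [hz t (by linarith)]
  have hint : Integrable (fun p : ℝ × ℝ => ψ p.1 * (F' p.2 * G' (p.1 - p.2)))
      (volume.prod volume) :=
    (hF.integrable_prod hG (R + 1)).bdd_mul (c := K)
      (hψ.comp continuous_fst).aestronglyMeasurable (.of_forall fun p => hK p.1)
  simp_rw [e1]
  rw [integral_integral_swap hint]
  have e2 : ∀ s, ∫ t, ψ t * (F' s * G' (t - s)) = ∫ r, ψ (s + r) * (F' s * G' r) := fun s => by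
    rw [← integral_add_right_eq_self _ s]
    simp [add_comm]
  simp_rw [e2]
  rw [integral_integral_swap]
  · refine integral_congr_ae (.of_forall fun r => ?_)
    show ∫ s, ψ (s + r) * (F' s * G' r) = G r * ∫ s, ψ (s + r) * F s
    rw [← integral_const_mul]
    refine integral_congr_ae (.of_forall fun s => ?_)
    simp only [F', G', Set.indicator, mem_Iio]
    rcases lt_or_ge s 0 with h | h
    · simp [hF.zero s h]
    rcases lt_or_ge r 0 with h' | h'
    · simp [hG.zero r h']
    split_ifs with h1 h2 h2
    · ring
    · simp [hz (s + r) (by linarith)]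
    · simp [hz (s + r) (by linarith)]
    · simp [hz (s + r) (by linarith)]
  · exact ((hF.integrable_cut (R + 1)).mul_prod (hG.integrable_cut (R + 1))).bdd_mul (c := K)
      (hψ.comp (continuous_fst.add continuous_snd)).aestronglyMeasurable
      (.of_forall fun p => hK _)

lemma lap_congr {μ : ℝ} (h : F =ᵐ[volume] G) : lap μ F = lap μ G :=
  lintegral_congr_ae (h.mono fun t ht => by simp [ht])

lemma Causal.lap_conv_le (hF : Causal F) (hG : Causal G) (μ : ℝ) :
    lap μ (convFun F G) ≤ lap μ F * lap μ G := by
  have hmE : Measurable fun t : ℝ => ofReal (exp (-μ * t)) := by fun_prop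
  set f := fun t => ofReal (exp (-μ * t)) * ‖F t‖ₑ with hf
  set g := fun t => ofReal (exp (-μ * t)) * ‖G t‖ₑ with hg
  have hfm : AEMeasurable f := hmE.aemeasurable.mul hF.aesm.enorm
  have hgm : AEMeasurable g := hmE.aemeasurable.mul hG.aesm.enorm
  calc lap μ (convFun F G) ≤ ∫⁻ t, ∫⁻ s, f s * g (t - s) := by
        refine lintegral_mono fun t => ?_
        rw [hF.conv_eq hG]
        calc _ ≤ ofReal (exp (-μ * t)) * ∫⁻ s, ‖F s * G (t - s)‖ₑ := by
              gcongr; exact enorm_integral_le_lintegral_enorm _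
          _ = ∫⁻ s, ofReal (exp (-μ * t)) * ‖F s * G (t - s)‖ₑ := by
              rw [lintegral_const_mul']; exact ofReal_ne_top
          _ = ∫⁻ s, f s * g (t - s) := by
              refine lintegral_congr fun s => ?_
              have : exp (-μ * t) = exp (-μ * s) * exp (-μ * (t - s)) := by
                rw [← exp_add]; ring_nf
              rw [this, ofReal_mul (exp_nonneg _), enorm_mul]
              simp only [hf, hg]; ring
    _ = ∫⁻ s, ∫⁻ t, f s * g (t - s) := by
        rw [lintegral_lintegral_swap]
        exact (hfm.comp_quasiMeasurePreserving Measure.quasiMeasurePreserving_snd).mul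
          (hgm.comp_quasiMeasurePreserving (quasiMeasurePreserving_sub_of_right_invariant volume volume))
    _ = ∫⁻ s, f s * lap μ G := by
        refine lintegral_congr fun s => ?_
        have h1 : AEMeasurable (fun t => g (t - s)) := hgm.comp_quasiMeasurePreserving
          (measurePreserving_sub_right volume s).quasiMeasurePreserving
        rw [lintegral_const_mul'' _ h1, lintegral_sub_right_eq_self g s]
        rfl
    _ = lap μ F * lap μ G := by rw [lintegral_mul_const'' _ hfm]; rfl

end

section

/-! ### Primitives of causal functions -/

variable {F G ψ : ℝ → ℂ} {a t R μ : ℝ}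

lemma Causal.primitive_eq_conv (hF : Causal F) : primitive F = convFun F heaviside := by
  funext t
  rcases le_or_gt 0 t with ht | ht
  · refine intervalIntegral.integral_congr fun s hs => ?_
    rw [uIcc_of_le ht] at hs
    simp [heaviside, Set.indicator, hs.2]
  · rw [(hF.conv causal_heaviside).zero t ht, primitive, intervalIntegral.integral_of_ge ht.le,
      setIntegral_eq_zero_of_ae_eq_zero, neg_zero]
    filter_upwards [ae_ne 0] with s hs hs'
    exact hF.zero s (lt_of_le_of_ne hs'.2 hs)

lemma Causal.primitive (hF : Causal F) : Causal (primitive F) := by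
  rw [hF.primitive_eq_conv]; exact hF.conv causal_heaviside

lemma Causal.primitive_iterate (hF : Causal F) (k : ℕ) : Causal (Staircase.primitive^[k] F) := by
  induction k with
  | zero => exact hF
  | succ k ih => rw [iterate_succ_apply']; exact ih.primitive

lemma Causal.continuous_primitive (hF : Causal F) : Continuous (Staircase.primitive F) :=
  intervalIntegral.continuous_primitive (fun a b => hF.intervalIntegrable a b) 0

/-- A causal function that vanishes before `a` has a primitive that vanishes before `a`. -/
lemma primitive_eq_zero (ha : 0 ≤ a) (hF : ∀ t < a, F t = 0) (ht : t ≤ a) : primitive F t = 0 := by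
  refine intervalIntegral.integral_zero_ae ?_
  filter_upwards [ae_ne a] with s hs hs'
  refine hF s (lt_of_le_of_ne (le_trans hs'.2 (max_le ha ht)) hs)

lemma primitive_iterate_eq_zero (ha : 0 ≤ a) (hF : ∀ t < a, F t = 0) (k : ℕ) :
    ∀ t < a, (primitive^[k] F) t = 0 := by
  induction k with
  | zero => exact hF
  | succ k ih =>
    intro t ht
    rw [iterate_succ_apply']
    exact primitive_eq_zero ha ih ht.le

/-- Primitives only depend on the values to the left, up to null sets. -/
lemma primitive_congr_ae (hR : 0 ≤ R) (h : ∀ᵐ t, t < R → F t = G t) (ht : t ≤ R) :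
    primitive F t = primitive G t := by
  refine intervalIntegral.integral_congr_ae ?_
  filter_upwards [h, ae_ne R] with s hs hs2 hs'
  exact hs (lt_of_le_of_ne (le_trans hs'.2 (max_le hR ht)) hs2)

lemma primitive_iterate_congr_ae (hR : 0 ≤ R) (h : ∀ᵐ t, t < R → F t = G t) (k : ℕ) :
    ∀ᵐ t, t < R → (primitive^[k] F) t = (primitive^[k] G) t := by
  induction k with
  | zero => exact h
  | succ k ih =>
    refine .of_forall fun t ht => ?_
    rw [iterate_succ_apply', iterate_succ_apply']
    exact primitive_congr_ae hR ih ht.le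

lemma primitive_iterate_congr_ae' (hR : 0 ≤ R) (h : ∀ᵐ t, t < R → F t = G t) (k : ℕ) (ht : t ≤ R) :
    (primitive^[k + 1] F) t = (primitive^[k + 1] G) t := by
  rw [iterate_succ_apply', iterate_succ_apply']
  exact primitive_congr_ae hR (primitive_iterate_congr_ae hR h k) ht

lemma primitive_add (hF : Causal F) (hG : Causal G) :
    primitive (fun t => F t + G t) = fun t => primitive F t + primitive G t := by
  funext t
  exact intervalIntegral.integral_add (hF.intervalIntegrable _ _) (hG.intervalIntegrable _ _)

lemma primitive_const_mul (a : ℂ) (F : ℝ → ℂ) :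
    primitive (fun t => a * F t) = fun t => a * primitive F t := by
  funext t
  exact intervalIntegral.integral_const_mul _ _

lemma primitive_iterate_add (hF : Causal F) (hG : Causal G) (k : ℕ) :
    primitive^[k] (fun t => F t + G t) = fun t => (primitive^[k] F) t + (primitive^[k] G) t := by
  induction k with
  | zero => rfl
  | succ k ih =>
    rw [iterate_succ_apply', ih,
      primitive_add (hF.primitive_iterate k) (hG.primitive_iterate k)]
    simp_rw [iterate_succ_apply']

lemma primitive_iterate_const_mul (a : ℂ) (F : ℝ → ℂ) (k : ℕ) :
    primitive^[k] (fun t => a * F t) = fun t => a * (primitive^[k] F) t := by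
  induction k with
  | zero => rfl
  | succ k ih =>
    rw [iterate_succ_apply', ih, primitive_const_mul]
    simp_rw [iterate_succ_apply']

lemma primitive_zero : primitive (fun _ => 0) = fun _ => 0 := by
  funext t; simp [primitive]

lemma primitive_iterate_zero (k : ℕ) : primitive^[k] (fun _ => 0) = fun _ => 0 := by
  induction k with
  | zero => rfl
  | succ k ih => rw [iterate_succ_apply', ih, primitive_zero]

lemma primitive_iterate_sum {ι : Type*} (s : Finset ι) {F : ι → ℝ → ℂ} (hF : ∀ i, Causal (F i))
    (k : ℕ) : primitive^[k] (fun t => ∑ i ∈ s, F i t)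
      = fun t => ∑ i ∈ s, (primitive^[k] (F i)) t := by
  induction s using cons_induction with
  | empty => simpa using primitive_iterate_zero k
  | cons i s hi ih =>
    simp_rw [sum_cons hi]
    rw [primitive_iterate_add (hF i) (Causal.finset_sum s fun j _ => hF j), ih]

lemma primitive_translate (hF : Causal F) (ha : 0 ≤ a) :
    primitive (fun t => F (t - a)) = fun t => primitive F (t - a) := by
  funext t
  unfold primitive
  rw [intervalIntegral.integral_comp_sub_right (fun s => F s) a]
  rw [← integral_add_adjacent_intervals (b := 0)
    (hF.intervalIntegrable _ _) (hF.intervalIntegrable _ _)]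
  have : ∫ s in (0 - a)..0, F s = 0 := by
    have := primitive_eq_zero (F := F) le_rfl hF.zero (t := 0 - a) (by linarith)
    rw [intervalIntegral.integral_symm]
    simpa [primitive] using this
  rw [this, zero_add]

lemma primitive_iterate_translate (hF : Causal F) (ha : 0 ≤ a) (k : ℕ) :
    primitive^[k] (fun t => F (t - a)) = fun t => (primitive^[k] F) (t - a) := by
  induction k with
  | zero => rfl
  | succ k ih =>
    rw [iterate_succ_apply', ih, primitive_translate (hF.primitive_iterate k) ha]
    simp_rw [iterate_succ_apply']

lemma lap_heaviside (hμ : 0 < μ) : lap μ heaviside = ofReal (1 / μ) := by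
  have h1 : lap μ heaviside = ∫⁻ t in Ioi (0 : ℝ), ofReal (exp (-μ * t)) := by
    rw [← lintegral_indicator measurableSet_Ioi]
    refine lintegral_congr_ae ?_
    filter_upwards [ae_ne 0] with s hs
    simp only [heaviside, Set.indicator, mem_Ici, mem_Ioi]
    split_ifs with h1 h2 h2
    · simp
    · exact absurd (lt_of_le_of_ne h1 (Ne.symm hs)) h2
    · exact absurd h2.le h1
    · simp
  rw [h1, ← ofReal_integral_eq_lintegral_ofReal (integrableOn_exp_mul_Ioi (by linarith) 0)
    (.of_forall fun t => exp_nonneg _), integral_exp_mul_Ioi (by linarith)]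
  simp

lemma Causal.lap_primitive_le (hF : Causal F) (hμ : 0 < μ) :
    lap μ (Staircase.primitive F) ≤ ofReal (1 / μ) * lap μ F := by
  rw [hF.primitive_eq_conv, ← lap_heaviside hμ, mul_comm]
  exact hF.lap_conv_le causal_heaviside μ

lemma Causal.lap_primitive_iterate_le (hF : Causal F) (hμ : 0 < μ) (k : ℕ) :
    lap μ (Staircase.primitive^[k] F) ≤ ofReal (1 / μ) ^ k * lap μ F := by
  induction k with
  | zero => simp
  | succ k ih =>
    rw [iterate_succ_apply', pow_succ']
    refine ((hF.primitive_iterate k).lap_primitive_le hμ).trans ?_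
    rw [mul_assoc]; gcongr

/-! ### Weak derivatives -/

lemma Causal.integral_deriv_mul_primitive (hF : Causal F) (hψ : ContDiff ℝ ∞ ψ)
    (hc : HasCompactSupport ψ) : ∫ t, deriv ψ t * Staircase.primitive F t = -∫ t, ψ t * F t := by
  rw [hF.primitive_eq_conv, hF.conv_comm causal_heaviside, causal_heaviside.integral_mul_conv hF
    (hψ.continuous_deriv (by simp)) hc.deriv, ← integral_neg]
  refine integral_congr_ae (.of_forall fun r => ?_)
  have h2 : ∫ s, deriv ψ (s + r) * heaviside s = ∫ s in Ioi (0 : ℝ), deriv ψ (s + r) := by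
    rw [← integral_Ici_eq_integral_Ioi, ← integral_indicator measurableSet_Ici]
    refine integral_congr_ae (.of_forall fun s => ?_)
    simp only [heaviside, Set.indicator]; split_ifs <;> simp
  have hc' : HasCompactSupport fun s => ψ (s + r) := hc.comp_homeomorph (Homeomorph.addRight r)
  have hs' : ContDiff ℝ 1 fun s => ψ (s + r) :=
    (hψ.of_le (by simp)).comp (contDiff_id.add contDiff_const)
  have h3 : ∫ s in Ioi (0 : ℝ), deriv ψ (s + r) = - ψ r := by
    have := hc'.integral_Ioi_deriv_eq hs' 0
    simpa [deriv_comp_add_const] using this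
  show F r * ∫ s, deriv ψ (s + r) * heaviside s = _
  rw [h2, h3]
  ring

lemma hasCompactSupport_iteratedDeriv (hc : HasCompactSupport ψ) (k : ℕ) :
    HasCompactSupport (iteratedDeriv k ψ) := by
  induction k with
  | zero => simpa using hc
  | succ k ih => rw [iteratedDeriv_succ]; exact ih.deriv

lemma contDiff_iteratedDeriv (hψ : ContDiff ℝ ∞ ψ) (k : ℕ) : ContDiff ℝ ∞ (iteratedDeriv k ψ) := by
  induction k with
  | zero => simpa using hψ
  | succ k ih =>
    rw [iteratedDeriv_succ]; exact (contDiff_infty_iff_deriv.1 ih).2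

lemma tsupport_iteratedDeriv_subset (k : ℕ) : tsupport (iteratedDeriv k ψ) ⊆ tsupport ψ := by
  induction k with
  | zero => simp
  | succ k ih => rw [iteratedDeriv_succ]; exact (closure_minimal (support_deriv_subset) (isClosed_tsupport _)).trans ih

lemma iteratedDeriv_add_index (a b : ℕ) :
    iteratedDeriv a (iteratedDeriv b ψ) = iteratedDeriv (a + b) ψ := by
  simp only [iteratedDeriv_eq_iterate, iterate_add_apply]

lemma Causal.integral_iteratedDeriv_mul_primitive (hF : Causal F) (hψ : ContDiff ℝ ∞ ψ)
    (hc : HasCompactSupport ψ) (k : ℕ) :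
    ∫ t, iteratedDeriv k ψ t * (Staircase.primitive^[k] F) t = (-1) ^ k * ∫ t, ψ t * F t := by
  induction k with
  | zero => simp
  | succ k ih =>
    rw [iterate_succ_apply', iteratedDeriv_succ,
      (hF.primitive_iterate k).integral_deriv_mul_primitive (contDiff_iteratedDeriv hψ k)
        (hasCompactSupport_iteratedDeriv hc k), ih]
    ring

lemma Causal.integrable_mul (hF : Causal F) (hψ : Continuous ψ) (hc : HasCompactSupport ψ) :
    Integrable (fun t => ψ t * F t) := by
  simpa using hF.locInt.integrable_smul_left_of_hasCompactSupport hψ hc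

/-- Convolution commutes with primitives, in the weak sense. -/
lemma Causal.integral_conv_primitive_left (hF : Causal F) (hG : Causal G) (hψ : ContDiff ℝ ∞ ψ)
    (hc : HasCompactSupport ψ) (k : ℕ) :
    ∫ t, iteratedDeriv k ψ t * convFun (Staircase.primitive^[k] F) G t = (-1) ^ k * ∫ t, ψ t *
      convFun F G t := by
  rw [(hF.primitive_iterate k).integral_mul_conv hG (contDiff_iteratedDeriv hψ k).continuous
    (hasCompactSupport_iteratedDeriv hc k), hF.integral_mul_conv hG hψ.continuous hc,
    ← integral_const_mul]
  refine integral_congr_ae (.of_forall fun r => ?_)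
  have hc' : HasCompactSupport fun s => ψ (s + r) := hc.comp_homeomorph (Homeomorph.addRight r)
  have hs' : ContDiff ℝ ∞ fun s => ψ (s + r) := hψ.comp (contDiff_id.add contDiff_const)
  have h1 : iteratedDeriv k (fun s => ψ (s + r)) = fun s => iteratedDeriv k ψ (s + r) :=
    iteratedDeriv_comp_add_const k ψ r
  have := hF.integral_iteratedDeriv_mul_primitive hs' hc' k
  rw [h1] at this
  show G r * ∫ s, iteratedDeriv k ψ (s + r) * _ = _
  rw [this]; ring

lemma Causal.integral_conv_primitive (hF : Causal F) (hG : Causal G) (hψ : ContDiff ℝ ∞ ψ)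
    (hc : HasCompactSupport ψ) (a b : ℕ) :
    ∫ t, iteratedDeriv (a + b) ψ t * convFun (Staircase.primitive^[a] F) (Staircase.primitive^[b] G)
      t = (-1) ^ (a + b) * ∫ t, ψ t * convFun F G t := by
  rw [← iteratedDeriv_add_index, hF.integral_conv_primitive_left (hG.primitive_iterate b)
    (contDiff_iteratedDeriv hψ b) (hasCompactSupport_iteratedDeriv hc b),
    hF.conv_comm (hG.primitive_iterate b), hG.integral_conv_primitive_left hF hψ hc,
    hF.conv_comm hG]
  ring

/-! ### Test functions -/

/-- Complex test functions on the half line. -/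
structure IsTest (ψ : ℝ → ℂ) : Prop where
  smooth : ContDiff ℝ ∞ ψ
  compact : HasCompactSupport ψ
  supp : tsupport ψ ⊆ Ioi 0

lemma IsTest.iteratedDeriv (h : IsTest ψ) (k : ℕ) : IsTest (iteratedDeriv k ψ) :=
  ⟨contDiff_iteratedDeriv h.smooth k, hasCompactSupport_iteratedDeriv h.compact k,
    (tsupport_iteratedDeriv_subset k).trans h.supp⟩

/-- A test function that is, on `(a, ∞)`, the primitive of a given one. -/
lemma IsTest.exists_antideriv {φ : ℝ → ℂ} (hφ : IsTest φ) (hR : tsupport φ ⊆ Iio R) (ha : 0 < a) :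
    ∃ Φ, IsTest Φ ∧ tsupport Φ ⊆ Iio R ∧ ∀ t > a, deriv Φ t = φ t := by
  obtain ⟨R', hR', hsup⟩ : ∃ R' < R, ∀ t ∈ tsupport φ, t ≤ R' := by
    rcases (tsupport φ).eq_empty_or_nonempty with h | h
    · exact ⟨R - 1, by linarith, by simp [h]⟩
    · obtain ⟨x, hx⟩ := hφ.compact.isCompact.exists_isGreatest h
      exact ⟨x, hR hx.1, fun t ht => hx.2 ht⟩
  have hz : ∀ t, R' < t → φ t = 0 := fun t ht => by
    by_contra h
    exact absurd (hsup t (subset_tsupport _ h)) (not_le.2 ht)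
  set P : ℝ → ℂ := fun t => ∫ s in R'..t, φ s
  have hP : ∀ t, HasDerivAt P (φ t) t := fun t =>
    hφ.smooth.continuous.integral_hasStrictDerivAt R' t |>.hasDerivAt
  have hP' : deriv P = φ := funext fun t => (hP t).deriv
  have hPs : ContDiff ℝ ∞ P := contDiff_infty_iff_deriv.2
    ⟨fun t => (hP t).differentiableAt, hP' ▸ hφ.smooth⟩
  have hP0 : ∀ t, R' < t → P t = 0 := fun t ht => by
    refine intervalIntegral.integral_zero_ae (.of_forall fun s hs => ?_)
    rw [uIoc_of_le ht.le] at hs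
    exact hz s hs.1
  set χ : ℝ → ℂ := fun t => ((Real.smoothTransition (2 / a * t - 1) : ℝ) : ℂ)
  have hχs : ContDiff ℝ ∞ χ := Complex.ofRealCLM.contDiff.comp
    (Real.smoothTransition.contDiff.comp ((contDiff_const.mul contDiff_id).sub contDiff_const))
  have hχ0 : ∀ t < a / 2, χ t = 0 := fun t ht => by
    simp only [χ, Complex.ofReal_eq_zero]
    apply Real.smoothTransition.zero_of_nonpos
    have : 2 / a * t ≤ 2 / a * (a / 2) := by gcongr
    have h2 : 2 / a * (a / 2) = 1 := by field_simp
    linarith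
  have hχ1 : ∀ t, a ≤ t → χ t = 1 := fun t ht => by
    simp only [χ]
    rw [Real.smoothTransition.one_of_one_le]; · simp
    have : 2 / a * a ≤ 2 / a * t := by gcongr
    have h2 : 2 / a * a = 2 := by field_simp
    linarith
  have hsub : tsupport (fun t => χ t * P t) ⊆ Icc (a / 2) R' := by
    refine closure_minimal (fun t ht => ⟨?_, ?_⟩) isClosed_Icc
    · by_contra h
      exact ht (by simp [hχ0 t (not_le.1 h)])
    · by_contra h
      exact ht (by simp [hP0 t (not_le.1 h)])
  refine ⟨fun t => χ t * P t, ⟨hχs.mul hPs, ?_, ?_⟩, ?_, ?_⟩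
  · exact isCompact_Icc.of_isClosed_subset (isClosed_tsupport _) hsub
  · exact hsub.trans fun t ht => lt_of_lt_of_le (by positivity) ht.1
  · exact hsub.trans fun t ht => lt_of_le_of_lt ht.2 hR'
  · intro t ht
    have : (fun t => χ t * P t) =ᶠ[𝓝 t] P := by
      filter_upwards [Ioi_mem_nhds ht] with s hs
      simp [hχ1 s (le_of_lt hs)]
    rw [this.deriv_eq, hP']

lemma integral_mul_congr_of_support {ψ' : ℝ → ℂ} (hF : ∀ᵐ t, t < a → F t = 0) (h : ∀ t > a, ψ t =
    ψ' t) : ∫ t, ψ t * F t = ∫ t, ψ' t * F t := by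
  refine integral_congr_ae ?_
  filter_upwards [ae_ne a, hF] with t ht hF
  rcases lt_or_gt_of_ne ht with h1 | h1
  · simp [hF h1]
  · show ψ t * F t = ψ' t * F t
    rw [h t h1]

/-- A function that vanishes near the origin is determined by any of its weak derivatives. -/
lemma integral_eq_zero_of_iteratedDeriv (ha : 0 < a) (hF : ∀ᵐ t, t < a → F t = 0) (K : ℕ)
    (h : ∀ ψ, IsTest ψ → tsupport ψ ⊆ Iio R → ∫ t, iteratedDeriv K ψ t * F t = 0) :
    ∀ ψ, IsTest ψ → tsupport ψ ⊆ Iio R → ∫ t, ψ t * F t = 0 := by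
  induction K with
  | zero => simpa using h
  | succ K ih =>
    apply ih
    intro ψ hψ hR
    obtain ⟨Φ, hΦ, hΦR, hd⟩ := hψ.exists_antideriv hR ha
    rw [← h Φ hΦ hΦR]
    refine integral_mul_congr_of_support hF fun t ht => ?_
    rw [iteratedDeriv_succ']
    refine (Filter.EventuallyEq.iteratedDeriv_eq K ?_).symm
    filter_upwards [Ioi_mem_nhds ht] with s hs using hd s hs

lemma ae_eq_zero_of_integral_isTest (hF : LocallyIntegrableOn F (Ioo 0 R)) (h : ∀ ψ, IsTest ψ →
    tsupport ψ ⊆ Iio R → ∫ t, ψ t * F t = 0) : ∀ᵐ t, t ∈ Ioo 0 R → F t = 0 := by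
  refine isOpen_Ioo.ae_eq_zero_of_integral_contDiff_smul_eq_zero hF fun g hg hc hs => ?_
  have hs' : tsupport (fun t => (g t : ℂ)) ⊆ tsupport g :=
    closure_mono fun t ht => by simpa using ht
  have := h (fun t => (g t : ℂ)) ⟨Complex.ofRealCLM.contDiff.comp hg,
    hc.comp_left (g := fun x : ℝ => (x : ℂ)) (by simp), fun t ht => (hs (hs' ht)).1⟩
    fun t ht => (hs (hs' ht)).2
  simpa using this

end

section

/-! ### Distributions on complex test functions -/

variable {ψ F : ℝ → ℂ} {T S : Dist} {u Δ v : ℕ → ℝ → ℂ} {N N' m : ℕ}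

lemma IsTest.tsupport_comp {L : ℂ → ℝ} (hL : L 0 = 0) :
    tsupport (fun t => L (ψ t)) ⊆ tsupport ψ :=
  closure_mono fun t ht h => ht (by simp [h, hL])

/-- The real part of a complex test function. -/
def IsTest.re {ψ : ℝ → ℂ} (h : IsTest ψ) : 𝓓(posHalfLine, ℝ) :=
  ⟨fun t => (ψ t).re, Complex.reCLM.contDiff.comp h.smooth,
    h.compact.comp_left (g := Complex.re) rfl,
    (IsTest.tsupport_comp (L := Complex.re) rfl).trans h.supp⟩

/-- The imaginary part of a complex test function. -/
def IsTest.im {ψ : ℝ → ℂ} (h : IsTest ψ) : 𝓓(posHalfLine, ℝ) :=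
  ⟨fun t => (ψ t).im, Complex.imCLM.contDiff.comp h.smooth,
    h.compact.comp_left (g := Complex.im) rfl,
    (IsTest.tsupport_comp (L := Complex.im) rfl).trans h.supp⟩

open Classical in
/-- The complex linear extension of a distribution to complex test functions. -/
def Dist.cval (T : Dist) (ψ : ℝ → ℂ) : ℂ :=
  if h : IsTest ψ then T h.re + I * T h.im else 0

lemma IsTest.cval (h : IsTest ψ) (T : Dist) : T.cval ψ = T h.re + I * T h.im := dif_pos h

lemma isTest_ofReal (φ : 𝓓(posHalfLine, ℝ)) : IsTest (fun t => (φ t : ℂ)) := by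
  refine ⟨Complex.ofRealCLM.contDiff.comp φ.contDiff,
    φ.hasCompactSupport.comp_left (g := fun x : ℝ => (x : ℂ)) (by simp), ?_⟩
  exact (closure_mono (s := Function.support fun t => (φ t : ℂ)) (t := Function.support φ)
    fun t ht h => ht (by simp [h])).trans φ.tsupport_subset

lemma tsupport_ofReal (φ : 𝓓(posHalfLine, ℝ)) :
    tsupport (fun t => (φ t : ℂ)) ⊆ tsupport φ :=
  closure_mono fun t ht h => ht (by simp [h])

@[simp] lemma cval_ofReal (T : Dist) (φ : 𝓓(posHalfLine, ℝ)) :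
    T.cval (fun t => (φ t : ℂ)) = T φ := by
  rw [(isTest_ofReal φ).cval]
  have h1 : (isTest_ofReal φ).re = φ := by ext t; rfl
  have h2 : (isTest_ofReal φ).im = 0 := by ext t; rfl
  rw [h1, h2, map_zero]; simp

lemma Dist.ext_cval (h : ∀ ψ, IsTest ψ → T.cval ψ = S.cval ψ) : T = S := by
  ext φ
  simpa using h _ (isTest_ofReal φ)

lemma eqBelow_iff {R : ℝ} :
    EqBelow R T S ↔ ∀ ψ, IsTest ψ → tsupport ψ ⊆ Iio R → T.cval ψ = S.cval ψ := by
  constructor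
  · intro h ψ hψ hR
    rw [hψ.cval, hψ.cval, h _ ((IsTest.tsupport_comp (L := Complex.re) rfl).trans hR),
      h _ ((IsTest.tsupport_comp (L := Complex.im) rfl).trans hR)]
  · intro h φ hR
    simpa using h _ (isTest_ofReal φ) ((tsupport_ofReal φ).trans hR)

lemma cval_add (T S : Dist) (ψ : ℝ → ℂ) : (T + S).cval ψ = T.cval ψ + S.cval ψ := by
  unfold Dist.cval; split_ifs
  · simp; ring
  · simp

lemma cval_smul (a : ℂ) (T : Dist) (ψ : ℝ → ℂ) : (a • T).cval ψ = a * T.cval ψ := by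
  unfold Dist.cval; split_ifs
  · simp; ring
  · simp

@[simp] lemma cval_zero (ψ : ℝ → ℂ) : (0 : Dist).cval ψ = 0 := by
  unfold Dist.cval; split_ifs <;> simp

lemma cval_sub (T S : Dist) (ψ : ℝ → ℂ) : (T - S).cval ψ = T.cval ψ - S.cval ψ := by
  unfold Dist.cval; split_ifs
  · simp; ring
  · simp

lemma cval_sum {ι : Type*} (s : Finset ι) (T : ι → Dist) (ψ : ℝ → ℂ) :
    (∑ i ∈ s, T i).cval ψ = ∑ i ∈ s, (T i).cval ψ :=
  map_sum (AddMonoidHom.mk' (fun T : Dist => T.cval ψ) fun T S => cval_add T S ψ) T s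

lemma cval_ofFun (hF : LocallyIntegrableOn F (Ioi 0)) (h : IsTest ψ) :
    (Dist.ofFun F).cval ψ = ∫ t, ψ t * F t := by
  have key : ∀ φ : 𝓓(posHalfLine, ℝ), Dist.ofFun F φ = ∫ t, φ t • F t := fun φ =>
    TestFunction.integralAgainstBilinCLM_eq_integral hF
  have hi : ∀ φ : 𝓓(posHalfLine, ℝ), Integrable (fun t => φ t • F t) := fun φ =>
    TestFunction.integrable_bilin (ContinuousLinearMap.lsmul ℝ ℝ) hF φ
  rw [h.cval, key, key, ← integral_const_mul, ← integral_add (hi _) ((hi _).const_mul _)]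
  congr 1 with t
  show ((ψ t).re : ℝ) • F t + I * ((ψ t).im • F t) = ψ t * F t
  conv_rhs => rw [← Complex.re_add_im (ψ t)]
  simp only [Complex.real_smul]; ring

lemma IsTest.eq_zero {t : ℝ} (h : IsTest ψ) (ht : ¬ 0 < t) : ψ t = 0 :=
  image_eq_zero_of_notMem_tsupport fun h' => ht (h.supp h')

lemma ofFun_smul_congr {a : ℂ} {G : ℝ → ℂ} (hF : LocallyIntegrableOn F (Ioi 0))
    (h : ∀ t > 0, G t = a * F t) : Dist.ofFun G = a • Dist.ofFun F := by
  have hl : LocallyIntegrableOn G (Ioi 0) := (hF.smul a).congr (by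
    filter_upwards [ae_restrict_mem measurableSet_Ioi] with t ht using (h t ht).symm)
  refine Dist.ext_cval fun φ hφ => ?_
  rw [cval_ofFun hl hφ, cval_smul, cval_ofFun hF hφ, ← integral_const_mul]
  congr 1 with t
  by_cases ht : 0 < t
  · simp only [h t ht]; ring
  · simp [hφ.eq_zero ht]

lemma IsTest.integrable_mul (h : IsTest ψ) (hF : LocallyIntegrableOn F (Ioi 0)) :
    Integrable fun t => ψ t * F t := by
  rw [← integrableOn_iff_integrable_of_support_subset (s := tsupport ψ)
    fun t ht => subset_tsupport _ fun h0 => ht (by simp [h0])]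
  exact (hF.integrableOn_compact_subset h.supp h.compact).continuousOn_mul
    h.smooth.continuous.continuousOn h.compact

lemma IsTest.deriv (h : IsTest ψ) : IsTest (deriv ψ) := by
  simpa using h.iteratedDeriv 1

lemma cval_deriv (T : Dist) (h : IsTest ψ) : T.deriv.cval ψ = - T.cval (deriv ψ) := by
  rw [h.cval, h.deriv.cval]
  have key : ∀ φ : 𝓓(posHalfLine, ℝ), T.deriv φ = - T (TestFunction.lineDerivCLM ℝ (1 : ℝ) φ) :=
    fun φ => rfl
  have hd : ∀ t, HasDerivAt ψ (_root_.deriv ψ t) t := fun t =>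
    (h.smooth.differentiable (by simp) t).hasDerivAt
  have h1 : TestFunction.lineDerivCLM ℝ (1 : ℝ) h.re = h.deriv.re := by
    ext t
    rw [TestFunction.lineDerivCLM_apply_of_le (by simp), (h.re.contDiff.differentiable (by simp) t).lineDeriv_eq_fderiv, fderiv_apply_one_eq_deriv]
    exact (Complex.reCLM.hasFDerivAt.comp_hasDerivAt t (hd t)).deriv
  have h2 : TestFunction.lineDerivCLM ℝ (1 : ℝ) h.im = h.deriv.im := by
    ext t
    rw [TestFunction.lineDerivCLM_apply_of_le (by simp), (h.im.contDiff.differentiable (by simp) t).lineDeriv_eq_fderiv, fderiv_apply_one_eq_deriv]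
    exact (Complex.imCLM.hasFDerivAt.comp_hasDerivAt t (hd t)).deriv
  rw [key, key, h1, h2]; ring

lemma cval_deriv_iterate (T : Dist) (h : IsTest ψ) (k : ℕ) :
    (Dist.deriv^[k] T).cval ψ = (-1) ^ k * T.cval (iteratedDeriv k ψ) := by
  induction k generalizing ψ with
  | zero => simp
  | succ k ih =>
    rw [iterate_succ_apply', cval_deriv _ h, ih h.deriv, ← iteratedDeriv_succ']
    ring

lemma cval_deriv_ofFun (hF : LocallyIntegrableOn F (Ioi 0)) (h : IsTest ψ) (k : ℕ) :
    (Dist.deriv^[k] (Dist.ofFun F)).cval ψ = (-1) ^ k * ∫ t, iteratedDeriv k ψ t * F t := by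
  rw [cval_deriv_iterate _ h, cval_ofFun hF (h.iteratedDeriv k)]

lemma Causal.locOn (hF : Causal F) : LocallyIntegrableOn F (Ioi 0) :=
  hF.locInt.locallyIntegrableOn _

/-! ### Loose staircase representations -/

/-- Families `u` with `u n` locally integrable and supported in `[n, ∞)`. -/
structure Loose (u : ℕ → ℝ → ℂ) : Prop where
  locInt : ∀ n, LocallyIntegrable (u n)
  zero : ∀ (n : ℕ) (t : ℝ), t < n → u n t = 0

/-- The distribution `∑ₙ (u n)^(mn)` tested with `ψ`, for `ψ` supported in `(0, N)`. -/
def loosePair (m : ℕ) (u : ℕ → ℝ → ℂ) (N : ℕ) (ψ : ℝ → ℂ) : ℂ :=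
  ∑ n ∈ Finset.range N, (-1) ^ (m * n) * ∫ t, iteratedDeriv (m * n) ψ t * u n t

/-- `T = ∑ₙ (u n)^(mn)`, where, in contrast to a staircase decomposition, the support of `u n`
is only required to lie in `[n, ∞)`. -/
structure IsLoose (m : ℕ) (u : ℕ → ℝ → ℂ) (T : Dist) : Prop extends Loose u where
  pair : ∀ ψ, IsTest ψ → ∀ N : ℕ, tsupport ψ ⊆ Iio (N : ℝ) → T.cval ψ = loosePair m u N ψ

lemma Loose.causal (h : Loose u) (n : ℕ) : Causal (u n) :=
  ⟨h.locInt n, fun t ht => h.zero n t (ht.trans_le (by positivity))⟩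

lemma IsTest.exists_nat (h : IsTest ψ) : ∃ N : ℕ, tsupport ψ ⊆ Iio (N : ℝ) := by
  obtain ⟨R, hR⟩ := h.compact.isCompact.bddAbove
  obtain ⟨N, hN⟩ := exists_nat_gt R
  exact ⟨N, fun t ht => lt_of_le_of_lt (hR ht) hN⟩

lemma IsTest.exists_nat_succ (h : IsTest ψ) : ∃ N : ℕ, tsupport ψ ⊆ Iio (N + 1 : ℝ) :=
  let ⟨N, hN⟩ := h.exists_nat
  ⟨N, hN.trans (Iio_subset_Iio (by linarith))⟩

lemma integral_eq_zero_of_disjoint {a : ℝ} (hF : ∀ t < a, F t = 0) (hψ : tsupport ψ ⊆ Iio a) (k : ℕ)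
    : ∫ t, iteratedDeriv k ψ t * F t = 0 := by
  refine integral_eq_zero_of_ae (.of_forall fun t => ?_)
  rcases lt_or_ge t a with h | h
  · simp [hF t h]
  · have : t ∉ tsupport (iteratedDeriv k ψ) := fun ht =>
      absurd (hψ (tsupport_iteratedDeriv_subset k ht)) (not_lt.2 h)
    simp [image_eq_zero_of_notMem_tsupport this]

lemma Loose.pair_le (h : Loose u) (m : ℕ) (hN : N ≤ N') (hs : tsupport ψ ⊆ Iio (N : ℝ)) :
    loosePair m u N' ψ = loosePair m u N ψ := by
  symm
  refine Finset.sum_subset (Finset.range_mono hN) fun n _ hn => ?_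
  rw [Finset.mem_range, not_lt] at hn
  rw [integral_eq_zero_of_disjoint (h.zero n) (hs.trans (Iio_subset_Iio (by exact_mod_cast hn))),
    mul_zero]

lemma Loose.pair_eq (h : Loose u) (m : ℕ) (hs : tsupport ψ ⊆ Iio (N : ℝ)) (hs' : tsupport ψ ⊆ Iio
    (N' : ℝ)) : loosePair m u N' ψ = loosePair m u N ψ := by
  rcases le_total N N' with hN | hN
  · exact h.pair_le m hN hs
  · exact (h.pair_le m hN hs').symm

/-- To represent `T` it suffices to have the pairing below the integers `k + 1`. -/
lemma Loose.isLoose (h : Loose u) (hp : ∀ ψ, IsTest ψ → ∀ k : ℕ, tsupport ψ ⊆ Iio (k + 1 : ℝ) →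
    T.cval ψ = loosePair m u (k + 1) ψ) : IsLoose m u T := by
  refine ⟨h, fun ψ hψ N hN => ?_⟩
  rw [hp ψ hψ N (hN.trans (Iio_subset_Iio (by linarith)))]
  exact h.pair_le m (Nat.le_succ N) hN

lemma cval_sum_deriv (h : Loose u) (m N : ℕ) (hψ : IsTest ψ) :
    (∑ i ∈ Finset.range N, Dist.deriv^[m * i] (Dist.ofFun (u i))).cval ψ = loosePair m u N ψ := by
  rw [cval_sum]
  exact sum_congr rfl fun n _ => cval_deriv_ofFun (h.causal n).locOn hψ _

lemma IsStairDecomp.loose (h : IsStairDecomp m T Δ) : Loose Δ :=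
  ⟨fun n => (h.1 n).locallyIntegrable, fun n t ht => h.2.1 n t fun h' => absurd h'.1 (not_le.2 ht)⟩

lemma IsStairDecomp.isLoose (h : IsStairDecomp m T Δ) : IsLoose m Δ T := by
  refine h.loose.isLoose fun ψ hψ k hk => ?_
  rw [eqBelow_iff.1 (h.2.2 k) ψ hψ hk, cval_sum_deriv h.loose m _ hψ]

lemma IsLoose.isStairDecomp (h : IsLoose m Δ T) (hi : ∀ i, Integrable (Δ i)) (hz : ∀ i : ℕ, ∀ t : ℝ,
    t ∉ Icc (i : ℝ) (i + 1) → Δ i t = 0) : IsStairDecomp m T Δ := by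
  refine ⟨hi, hz, fun k => eqBelow_iff.2 fun ψ hψ hk => ?_⟩
  rw [cval_sum_deriv h.toLoose m _ hψ, h.pair ψ hψ (k + 1) (by exact_mod_cast hk)]

lemma Loose.add (hu : Loose u) (hv : Loose v) : Loose (fun n t => u n t + v n t) :=
  ⟨fun n => (hu.locInt n).add (hv.locInt n), fun n t h => by simp [hu.zero n t h, hv.zero n t h]⟩

lemma Loose.const_mul (hu : Loose u) (a : ℂ) : Loose (fun n t => a * u n t) :=
  ⟨fun n => (hu.locInt n).smul a, fun n t h => by simp [hu.zero n t h]⟩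

lemma IsLoose.add (hu : IsLoose m u T) (hv : IsLoose m v S) :
    IsLoose m (fun n t => u n t + v n t) (T + S) := by
  refine ⟨hu.toLoose.add hv.toLoose, fun ψ hψ N hN => ?_⟩
  rw [cval_add, hu.pair ψ hψ N hN, hv.pair ψ hψ N hN, loosePair, loosePair, loosePair,
    ← sum_add_distrib]
  refine sum_congr rfl fun n _ => ?_
  have h1 := (hu.causal n).integrable_mul (hψ.iteratedDeriv (m * n)).smooth.continuous
    (hψ.iteratedDeriv (m * n)).compact
  have h2 := (hv.causal n).integrable_mul (hψ.iteratedDeriv (m * n)).smooth.continuous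
    (hψ.iteratedDeriv (m * n)).compact
  simp_rw [mul_add]
  rw [integral_add h1 h2]; ring

lemma IsLoose.smul (hu : IsLoose m u T) (a : ℂ) : IsLoose m (fun n t => a * u n t) (a • T) := by
  refine ⟨hu.toLoose.const_mul a, fun ψ hψ N hN => ?_⟩
  rw [cval_smul, hu.pair ψ hψ N hN, loosePair, loosePair, mul_sum]
  refine sum_congr rfl fun n _ => ?_
  simp_rw [mul_left_comm _ a, integral_const_mul]; ring

@[simp]
lemma Dist.smul_zero (a : ℂ) : a • (0 : Dist) = 0 := by module

@[simp]
lemma Dist.zero_smul (T : Dist) : (0 : ℂ) • T = 0 := _root_.zero_smul ℂ T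

lemma Dist.neg_one_smul (T : Dist) : (-1 : ℂ) • T = -T := _root_.neg_one_smul ℂ T

lemma IsLoose.sub (hu : IsLoose m u T) (hv : IsLoose m v S) :
    IsLoose m (fun n t => u n t + -1 * v n t) (T - S) := by
  have := hu.add (hv.smul (-1))
  rwa [Dist.neg_one_smul, ← sub_eq_add_neg] at this

lemma isLoose_zero (m : ℕ) : IsLoose m (fun _ _ => 0) 0 :=
  ⟨⟨fun _ => locallyIntegrable_const 0, fun _ _ _ => rfl⟩, fun ψ _ N _ => by simp [loosePair]⟩

/-- Every loose family represents a distribution. -/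
lemma Loose.exists_isLoose (h : Loose u) (m : ℕ) : ∃ T, IsLoose m u T := by
  classical
  set S : ℕ → Dist := fun N => ∑ i ∈ Finset.range N, Dist.deriv^[m * i] (Dist.ofFun (u i)) with hS
  have hSv : ∀ N (φ : 𝓓(posHalfLine, ℝ)), S N φ = loosePair m u N (fun t => (φ t : ℂ)) :=
    fun N φ => by rw [← cval_ofReal, cval_sum_deriv h m N (isTest_ofReal φ)]
  have hex : ∀ φ : 𝓓(posHalfLine, ℝ), ∃ N : ℕ, tsupport (fun t => (φ t : ℂ)) ⊆ Iio (N : ℝ) :=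
    fun φ => (isTest_ofReal φ).exists_nat
  have hK : ∀ K : TopologicalSpace.Compacts ℝ, ∃ N : ℕ, (K : Set ℝ) ⊆ Iio (N : ℝ) := fun K => by
    obtain ⟨R, hR⟩ := K.isCompact.bddAbove
    obtain ⟨N, hN⟩ := exists_nat_gt R
    exact ⟨N, fun t ht => lt_of_le_of_lt (hR ht) hN⟩
  let T0 : 𝓓(posHalfLine, ℝ) →L[ℝ] ℂ := TestFunction.limitCLM ℝ
    (fun φ => loosePair m u (hex φ).choose (fun t => (φ t : ℂ)))
    (fun K hKs => ((UniformConvergenceCLM.ofFun (RingHom.id ℝ) ℂ {S | IsCompact S}).symm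
      (S (hK K).choose)).comp (TestFunction.ofSupportedInCLM ℝ hKs))
    (fun K hKs f => by
      set φ := TestFunction.ofSupportedIn hKs f
      show _ = S (hK K).choose φ
      rw [hSv]
      refine h.pair_eq m ?_ (hex φ).choose_spec
      refine (tsupport_ofReal φ).trans ((closure_minimal ?_ K.isCompact.isClosed).trans
        (hK K).choose_spec)
      intro t ht
      by_contra hcon
      exact ht (f.zero_on_compl hcon))
  refine ⟨UniformConvergenceCLM.ofFun (RingHom.id ℝ) ℂ {S | IsCompact S} T0,
    h, fun ψ hψ N hN => ?_⟩
  have key : ∀ φ : 𝓓(posHalfLine, ℝ), tsupport φ ⊆ Iio (N : ℝ) →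
      (UniformConvergenceCLM.ofFun (RingHom.id ℝ) ℂ {S | IsCompact S} T0 : Dist) φ = S N φ := by
    intro φ hφ
    rw [hSv]
    exact h.pair_eq m ((tsupport_ofReal φ).trans hφ) (hex φ).choose_spec
  rw [hψ.cval, key _ ((IsTest.tsupport_comp (L := Complex.re) rfl).trans hN),
    key _ ((IsTest.tsupport_comp (L := Complex.im) rfl).trans hN), ← hψ.cval,
    cval_sum_deriv h m N hψ]

end

section

/-! ### Iterated primitives of loose families -/

variable {u v Δ : ℕ → ℝ → ℂ} {F ψ : ℝ → ℂ} {m : ℕ} {T S : Dist}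

/-- The `mk`-fold primitive on `(0, k+1)` of the distribution represented by a loose family. -/
def SP (m : ℕ) (u : ℕ → ℝ → ℂ) : ℕ → ℝ → ℂ
  | 0 => u 0
  | k + 1 => fun t => (primitive^[m] (SP m u k)) t + u (k + 1) t

lemma Loose.causal_SP (h : Loose u) (m k : ℕ) : Causal (SP m u k) := by
  induction k with
  | zero => exact h.causal 0
  | succ k ih => exact (ih.primitive_iterate m).add (h.causal _)

lemma Causal.integrable_test (hF : Causal F) (hψ : IsTest ψ) (k : ℕ) :
    Integrable (fun t => iteratedDeriv k ψ t * F t) :=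
  hF.integrable_mul (hψ.iteratedDeriv k).smooth.continuous (hψ.iteratedDeriv k).compact

lemma Loose.pair_SP (h : Loose u) (m k : ℕ) (hψ : IsTest ψ) :
    loosePair m u (k + 1) ψ = (-1) ^ (m * k) * ∫ t, iteratedDeriv (m * k) ψ t * SP m u k t := by
  induction k with
  | zero => simp [loosePair, SP]
  | succ k ih =>
    rw [loosePair, sum_range_succ, ← loosePair, ih]
    have e : ∀ t, iteratedDeriv (m * (k + 1)) ψ t * SP m u (k + 1) t =
        iteratedDeriv (m * (k + 1)) ψ t * (primitive^[m] (SP m u k)) t +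
        iteratedDeriv (m * (k + 1)) ψ t * u (k + 1) t := fun t => by simp only [SP]; ring
    simp_rw [e]
    rw [integral_add (((h.causal_SP m k).primitive_iterate m).integrable_test hψ _)
      ((h.causal _).integrable_test hψ _)]
    have h2 := (h.causal_SP m k).integral_iteratedDeriv_mul_primitive
      (hψ.iteratedDeriv (m * k)).smooth (hψ.iteratedDeriv (m * k)).compact m
    rw [iteratedDeriv_add_index, show m + m * k = m * (k + 1) by ring] at h2
    have h3 : ((-1 : ℂ) ^ m) * (-1) ^ m = 1 := by rw [← mul_pow]; simp
    rw [h2, show m * (k + 1) = m * k + m by ring, pow_add]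
    linear_combination (-(-1 : ℂ) ^ (m * k) * ∫ t, iteratedDeriv (m * k) ψ t * SP m u k t) * h3

lemma SP_add (hu : Loose u) (hv : Loose v) (m k : ℕ) :
    SP m (fun n t => u n t + v n t) k = fun t => SP m u k t + SP m v k t := by
  induction k with
  | zero => rfl
  | succ k ih =>
    funext t
    simp only [SP]
    rw [ih, primitive_iterate_add (hu.causal_SP m k) (hv.causal_SP m k)]
    ring

lemma SP_const_mul (a : ℂ) (u : ℕ → ℝ → ℂ) (m k : ℕ) :
    SP m (fun n t => a * u n t) k = fun t => a * SP m u k t := by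
  induction k with
  | zero => rfl
  | succ k ih =>
    funext t
    simp only [SP]
    rw [ih, primitive_iterate_const_mul]
    ring

/-- The distribution represented by a loose family determines the iterated primitives. -/
lemma Loose.SP_ae_eq_zero (h : Loose u) (m N : ℕ) (hz : ∀ ψ, IsTest ψ → tsupport ψ ⊆ Iio (N : ℝ) →
    loosePair m u N ψ = 0) (k : ℕ) (hk : k < N) : ∀ᵐ t, t < (k : ℝ) + 1 → SP m u k t = 0 := by
  have fin : ∀ k : ℕ,
      (∀ ψ, IsTest ψ → tsupport ψ ⊆ Iio ((k : ℝ) + 1) → ∫ t, ψ t * SP m u k t = 0) →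
      ∀ᵐ t, t < (k : ℝ) + 1 → SP m u k t = 0 := by
    intro k H
    have := ae_eq_zero_of_integral_isTest ((h.causal_SP m k).locInt.locallyIntegrableOn _) H
    filter_upwards [this, ae_ne 0] with t ht h0 hk
    rcases lt_or_gt_of_ne h0 with h1 | h1
    · exact (h.causal_SP m k).zero t h1
    · exact ht ⟨h1, hk⟩
  have key : ∀ k < N, ∀ ψ, IsTest ψ → tsupport ψ ⊆ Iio ((k : ℝ) + 1) →
      ∫ t, iteratedDeriv (m * k) ψ t * SP m u k t = 0 := by
    intro k hk ψ hψ hs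
    have h1 : (k : ℝ) + 1 ≤ N := by exact_mod_cast hk
    have h2 := hz ψ hψ (hs.trans (Iio_subset_Iio h1))
    rw [h.pair_le m (N := k + 1) hk (by exact_mod_cast hs), h.pair_SP m k hψ] at h2
    simpa using h2
  induction k with
  | zero => exact fin 0 (by simpa using key 0 hk)
  | succ k ih =>
    apply fin
    refine integral_eq_zero_of_iteratedDeriv (a := (k : ℝ) + 1) (by positivity) ?_ _ (key _ hk)
    have h1 := primitive_iterate_congr_ae (G := fun _ => 0) (by positivity) (ih (by omega)) m
    filter_upwards [h1] with t ht htk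
    simp only [SP]
    rw [h.zero (k + 1) t (by exact_mod_cast htk), add_zero, ht htk, primitive_iterate_zero]

lemma IsLoose.SP_ae_eq {N : ℕ} (hu : IsLoose m u T) (hv : IsLoose m v S) (hTS : EqBelow N T S)
    (k : ℕ) (hk : k < N) : ∀ᵐ t, t < (k : ℝ) + 1 → SP m u k t = SP m v k t := by
  have h := hu.sub hv
  have h1 := h.toLoose.SP_ae_eq_zero m N (fun ψ hψ hs => by
    rw [← h.pair ψ hψ N hs, cval_sub, eqBelow_iff.1 hTS ψ hψ hs, sub_self]) k hk
  rw [SP_add hu.toLoose (hv.toLoose.const_mul _), SP_const_mul] at h1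
  filter_upwards [h1] with t ht htk
  linear_combination ht htk

lemma eqBelow_refl (R : ℝ) (T : Dist) : EqBelow R T T := fun _ _ => rfl

lemma IsLoose.SP_ae_eq' (hu : IsLoose m u T) (hv : IsLoose m v T) (k : ℕ) :
    ∀ᵐ t, t < (k : ℝ) + 1 → SP m u k t = SP m v k t :=
  hu.SP_ae_eq hv (eqBelow_refl (k + 1 : ℕ) T) k (by omega)

/-- Families with the same iterated primitives represent the same distribution. -/
lemma IsLoose.of_SP (hu : IsLoose m u T) (hv : Loose v) (h : ∀ k : ℕ, ∀ᵐ t, t < (k : ℝ) + 1 →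
    SP m u k t = SP m v k t) : IsLoose m v T := by
  refine hv.isLoose fun ψ hψ k hs => ?_
  rw [hu.pair ψ hψ (k + 1) (by exact_mod_cast hs), hu.toLoose.pair_SP m k hψ, hv.pair_SP m k hψ]
  congr 1
  refine integral_congr_ae ?_
  filter_upwards [h k] with t ht
  rcases lt_or_ge t (k + 1) with h1 | h1
  · show _ * SP m u k t = _ * SP m v k t
    rw [ht h1]
  · have : t ∉ tsupport (iteratedDeriv (m * k) ψ) := fun ht =>
      absurd (hs (tsupport_iteratedDeriv_subset _ ht)) (not_lt.2 h1)
    simp [image_eq_zero_of_notMem_tsupport this]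

lemma IsLoose.unique (hT : IsLoose m u T) (hS : IsLoose m u S) : T = S := by
  refine Dist.ext_cval fun ψ hψ => ?_
  obtain ⟨N, hN⟩ := hψ.exists_nat
  rw [hT.pair ψ hψ N hN, hS.pair ψ hψ N hN]

lemma primitive_iterate_congr {G : ℝ → ℂ} (h : F =ᵐ[volume] G) (k : ℕ) :
    primitive^[k] F =ᵐ[volume] primitive^[k] G := by
  induction k with
  | zero => exact h
  | succ k ih =>
    rw [iterate_succ_apply', iterate_succ_apply']
    exact .of_forall fun t => intervalIntegral.integral_congr_ae (ih.mono fun s hs _ => hs)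

/-- The staircase decomposition is unique up to null sets. -/
lemma IsStairDecomp.ae_eq {Δ' : ℕ → ℝ → ℂ} (h : IsStairDecomp m T Δ) (h' : IsStairDecomp m T Δ')
    (k : ℕ) : Δ k =ᵐ[volume] Δ' k := by
  have fin : ∀ k : ℕ, (∀ᵐ t, t < (k : ℝ) + 1 → Δ k t = Δ' k t) → Δ k =ᵐ[volume] Δ' k := by
    intro k h1
    filter_upwards [h1, ae_ne (k + 1)] with t ht hne
    rcases lt_or_gt_of_ne hne with hlt | hgt
    · exact ht hlt
    · rw [h.2.1 k t fun hm => absurd hm.2 (not_le.2 hgt),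
        h'.2.1 k t fun hm => absurd hm.2 (not_le.2 hgt)]
  have key : ∀ k, Δ k =ᵐ[volume] Δ' k ∧ SP m Δ k =ᵐ[volume] SP m Δ' k := by
    intro k
    induction k with
    | zero =>
      have := fin 0 (h.isLoose.SP_ae_eq' h'.isLoose 0)
      exact ⟨this, this⟩
    | succ k ih =>
      have h2 := primitive_iterate_congr ih.2 m
      have h3 : Δ (k + 1) =ᵐ[volume] Δ' (k + 1) := by
        apply fin
        filter_upwards [h.isLoose.SP_ae_eq' h'.isLoose (k + 1), h2] with t ht ht2 htk
        have := ht htk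
        simp only [SP] at this
        rw [ht2] at this
        exact add_left_cancel this
      refine ⟨h3, ?_⟩
      filter_upwards [h2, h3] with t ht2 ht3
      simp only [SP]
      rw [ht2, ht3]
  exact (key k).1

lemma stairPrimitive_eq_SP (h : Loose Δ) (k : ℕ) : stairPrimitive m Δ k = SP m Δ k := by
  induction k with
  | zero => funext t; simp [stairPrimitive, SP]
  | succ k ih =>
    funext t
    simp only [stairPrimitive, SP] at ih ⊢
    have e : primitive^[m] (stairPrimitive m Δ k) =
        fun t => ∑ j ∈ Finset.range (k + 1), (primitive^[m] (primitive^[m * (k - j)] (Δ j))) t :=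
      primitive_iterate_sum _ (fun j => (h.causal j).primitive_iterate _) m
    rw [sum_range_succ, ← ih, e]
    simp only [Nat.sub_self, Nat.mul_zero, Function.iterate_zero, id]
    congr 1
    refine sum_congr rfl fun j hj => ?_
    have : j ≤ k := by simpa [Nat.lt_succ_iff] using hj
    rw [← iterate_add_apply, show m * (k + 1 - j) = m + m * (k - j) by
      rw [show k + 1 - j = (k - j) + 1 by omega]; ring]

/-! ### From loose representations to staircase decompositions -/

/-- The successive remainders in the passage from a loose family to a staircase decomposition. -/
def remainder (m : ℕ) (u : ℕ → ℝ → ℂ) : ℕ → ℝ → ℂ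
  | 0 => u 0
  | n + 1 => fun t =>
      u (n + 1) t + (primitive^[m] ((Ici ((n : ℝ) + 1)).indicator (remainder m u n))) t

/-- The staircase decomposition obtained from a loose family: what exceeds `[n, n+1]` at level `n`
is integrated `m` times and passed on to level `n + 1`. -/
def restair (m : ℕ) (u : ℕ → ℝ → ℂ) (n : ℕ) : ℝ → ℂ :=
  (Ico (n : ℝ) (n + 1)).indicator (remainder m u n)

lemma Loose.remainder (h : Loose u) (m : ℕ) : Loose (remainder m u) := by
  have hc : ∀ n, Causal (Staircase.remainder m u n) := by
    intro n
    induction n with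
    | zero => exact h.causal 0
    | succ n ih => exact (h.causal _).add ((ih.indicator measurableSet_Ici).primitive_iterate m)
  refine ⟨fun n => (hc n).locInt, fun n t ht => ?_⟩
  rcases n with _ | n
  · exact h.zero 0 t ht
  · simp only [Staircase.remainder]
    rw [h.zero _ t ht, zero_add]
    refine primitive_iterate_eq_zero (a := (n : ℝ) + 1) (by positivity) (fun s hs => ?_) m t
      (by exact_mod_cast ht)
    simp [Set.indicator, not_le.2 hs]

lemma Loose.remainder_eq (h : Loose u) (m n : ℕ) (t : ℝ) :
    Staircase.remainder m u n t = restair m u n t + (Ici ((n : ℝ) + 1)).indicator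
      (Staircase.remainder m u n) t := by
  simp only [restair, Set.indicator, mem_Ico, mem_Ici]
  rcases lt_or_ge t n with h1 | h1
  · simp [(h.remainder m).zero n t h1]
  · by_cases h2 : (n : ℝ) + 1 ≤ t <;> simp [h1, h2]

lemma IsLoose.isStairDecomp_restair (h : IsLoose m u T) : IsStairDecomp m T (restair m u) := by
  have hR := h.toLoose.remainder m
  have hΔ : Loose (restair m u) := ⟨fun n => (hR.locInt n).indicator measurableSet_Ico,
    fun n t ht => by simp [restair, Set.indicator, not_le.2 ht]⟩
  have tele : ∀ N ψ, IsTest ψ → loosePair m (restair m u) (N + 1) ψ + (-1) ^ (m * N) *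
      ∫ t, iteratedDeriv (m * N) ψ t * (Ici ((N : ℝ) + 1)).indicator (remainder m u N) t
      = loosePair m u (N + 1) ψ := by
    intro N ψ hψ
    have split : ∀ n k, ∫ t, iteratedDeriv k ψ t * remainder m u n t =
        (∫ t, iteratedDeriv k ψ t * restair m u n t) +
        ∫ t, iteratedDeriv k ψ t * (Ici ((n : ℝ) + 1)).indicator (remainder m u n) t := by
      intro n k
      rw [← integral_add ((hΔ.causal n).integrable_test hψ k)
        (((hR.causal n).indicator measurableSet_Ici).integrable_test hψ k)]
      congr 1 with t
      rw [h.toLoose.remainder_eq m n t]; ring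
    induction N with
    | zero =>
      have := split 0 0
      simp only [loosePair, sum_range_succ, Finset.sum_range_zero, mul_zero, pow_zero,
        one_mul, zero_add] at this ⊢
      exact this.symm
    | succ N ih =>
      rw [loosePair, sum_range_succ, ← loosePair]
      conv_rhs => rw [loosePair, sum_range_succ, ← loosePair, ← ih]
      have h2 := ((hR.causal N).indicator (measurableSet_Ici (a := (N : ℝ) + 1)))
        |>.integral_iteratedDeriv_mul_primitive
        (hψ.iteratedDeriv (m * N)).smooth (hψ.iteratedDeriv (m * N)).compact m
      rw [iteratedDeriv_add_index, show m + m * N = m * (N + 1) by ring] at h2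
      have h3 := split (N + 1) (m * (N + 1))
      have h4 : ∫ t, iteratedDeriv (m * (N + 1)) ψ t * remainder m u (N + 1) t =
          (∫ t, iteratedDeriv (m * (N + 1)) ψ t * u (N + 1) t) +
          ∫ t, iteratedDeriv (m * (N + 1)) ψ t *
            (primitive^[m] ((Ici ((N : ℝ) + 1)).indicator (remainder m u N))) t := by
        rw [← integral_add ((h.causal (N + 1)).integrable_test hψ _)
          ((((hR.causal N).indicator measurableSet_Ici).primitive_iterate m).integrable_test hψ _)]
        congr 1 with t
        simp only [remainder]; ring
      rw [h2] at h4
      rw [h4] at h3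
      have h5 : ((-1 : ℂ) ^ m) * (-1) ^ m = 1 := by rw [← mul_pow]; simp
      rw [show (-1 : ℂ) ^ (m * (N + 1)) = (-1) ^ (m * N) * (-1) ^ m by rw [← pow_add]; ring_nf]
      linear_combination (-(-1 : ℂ) ^ (m * N) * (-1) ^ m) * h3 + ((-1 : ℂ) ^ (m * N) *
        ∫ t, iteratedDeriv (m * N) ψ t * (Ici ((N : ℝ) + 1)).indicator (remainder m u N) t) * h5
  have hl : IsLoose m (restair m u) T := by
    refine hΔ.isLoose fun ψ hψ k hk => ?_
    rw [h.pair ψ hψ (k + 1) (by exact_mod_cast hk), ← tele k ψ hψ,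
      integral_eq_zero_of_disjoint (a := (k : ℝ) + 1) (fun t ht => by
        simp [Set.indicator, not_le.2 ht]) hk, mul_zero, add_zero]
  refine hl.isStairDecomp (fun i => ?_) fun i t ht => ?_
  · rw [restair, integrable_indicator_iff measurableSet_Ico]
    exact ((hR.locInt i).integrableOn_isCompact isCompact_Icc).mono_set Ico_subset_Icc_self
  · exact indicator_of_notMem (fun hm => ht (Ico_subset_Icc_self hm)) _

end

section

/-! ### The staircase norm -/

variable {F G : ℝ → ℂ} {μ ν a : ℝ} {c : ℝ≥0} {m : ℕ} {T : Dist} {Δ u : ℕ → ℝ → ℂ}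

lemma measurable_expWeight (μ : ℝ) :
    Measurable fun t : ℝ => ofReal (exp (-μ * t)) := by fun_prop

lemma aemeasurable_lap (hF : AEStronglyMeasurable F) (μ : ℝ) :
    AEMeasurable fun t => ofReal (exp (-μ * t)) * ‖F t‖ₑ :=
  (measurable_expWeight μ).aemeasurable.mul hF.enorm

lemma lap_add_le (hF : AEStronglyMeasurable F) (μ : ℝ) :
    lap μ (fun t => F t + G t) ≤ lap μ F + lap μ G := by
  rw [lap, lap, lap, ← lintegral_add_left' (aemeasurable_lap hF μ)]
  refine lintegral_mono fun t => ?_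
  rw [← mul_add]
  gcongr
  exact enorm_add_le _ _

lemma lap_const_mul (a : ℂ) (F : ℝ → ℂ) (μ : ℝ) :
    lap μ (fun t => a * F t) = ‖a‖ₑ * lap μ F := by
  rw [lap, lap, ← lintegral_const_mul' _ _ enorm_ne_top]
  refine lintegral_congr fun t => ?_
  rw [enorm_mul]; ring

lemma lap_zero (μ : ℝ) : lap μ (fun _ => 0) = 0 := by simp [lap]

lemma lap_mono (μ : ℝ) (h : ∀ t, ‖F t‖ ≤ ‖G t‖) : lap μ F ≤ lap μ G := by
  refine lintegral_mono fun t => ?_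
  gcongr
  simpa [enorm_le_iff_norm_le] using h t

lemma lap_finset_sum_le {ι : Type*} (s : Finset ι) {F : ι → ℝ → ℂ}
    (hF : ∀ i ∈ s, AEStronglyMeasurable (F i)) (μ : ℝ) :
    lap μ (fun t => ∑ i ∈ s, F i t) ≤ ∑ i ∈ s, lap μ (F i) := by
  induction s using cons_induction with
  | empty => simp [lap_zero]
  | cons i s hi ih =>
    simp_rw [sum_cons hi]
    exact (lap_add_le (hF i (by simp)) μ).trans
      (by gcongr; exact ih fun k hk => hF k (by simp [hk]))

lemma lap_translate (F : ℝ → ℂ) (μ a : ℝ) :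
    lap μ (fun t => F (t - a)) = ofReal (exp (-μ * a)) * lap μ F := by
  rw [lap, ← lintegral_add_right_eq_self _ a, lap, ← lintegral_const_mul' _ _ ofReal_ne_top]
  refine lintegral_congr fun t => ?_
  rw [add_sub_cancel_right, ← mul_assoc, ← ofReal_mul (exp_nonneg _), ← exp_add]
  ring_nf

/-- Comparison of Laplace weights for functions supported in `[a, ∞)`. -/
lemma lap_le_of_support_ge (h : μ ≤ ν) (hF : ∀ t < a, F t = 0) :
    lap ν F ≤ ofReal (exp (-(ν - μ) * a)) * lap μ F := by
  rw [lap, lap, ← lintegral_const_mul' _ _ ofReal_ne_top]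
  refine lintegral_mono fun t => ?_
  rcases lt_or_ge t a with h1 | h1
  · simp [hF t h1]
  · rw [← mul_assoc, ← ofReal_mul (exp_nonneg _), ← exp_add]
    gcongr
    nlinarith

/-- Comparison of Laplace weights for functions supported in `(-∞, a]`. -/
lemma lap_le_of_support_le (h : μ ≤ ν) (hF : ∀ t > a, F t = 0) :
    lap μ F ≤ ofReal (exp ((ν - μ) * a)) * lap ν F := by
  rw [lap, lap, ← lintegral_const_mul' _ _ ofReal_ne_top]
  refine lintegral_mono fun t => ?_
  rcases le_or_gt t a with h1 | h1
  · rw [← mul_assoc, ← ofReal_mul (exp_nonneg _), ← exp_add]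
    gcongr
    nlinarith
  · simp [hF t h1]

/-- The norm of a staircase decomposition, without the constant. -/
def stairSum (m : ℕ) (ν : ℝ) (Δ : ℕ → ℝ → ℂ) : ℝ≥0∞ :=
  ∑' i : ℕ, ofReal ν ^ (m * i) * lap ν (Δ i)

/-- A weight for loose families that dominates the norm of the represented distribution. The
Laplace exponent is lowered by `1/2`; the factor `e^{t/2}` pays for carrying mass
to the higher levels. -/
def looseSum (m : ℕ) (ν : ℝ) (u : ℕ → ℝ → ℂ) : ℝ≥0∞ :=
  ∑' i : ℕ, ofReal ν ^ (m * i) * ofReal (exp (-(1 / 2) * i)) *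
    lap (ν - 1 / 2) (u i)

lemma stairNorm_eq (h : IsStairDecomp m T Δ) (ν : ℝ) : stairNorm c m ν T = c * stairSum m ν Δ := by
  have key : ∀ Δ', IsStairDecomp m T Δ' → stairSum m ν Δ' = stairSum m ν Δ := fun Δ' h' =>
    tsum_congr fun i => by rw [lap_congr (h'.ae_eq h i)]
  refine le_antisymm (iInf₂_le Δ h) (le_iInf₂ fun Δ' h' => ?_)
  rw [← key Δ' h']; rfl

lemma exists_isStairDecomp (h : stairNorm c m ν T < ⊤) : ∃ Δ, IsStairDecomp m T Δ := by
  by_contra hcon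
  push Not at hcon
  simp [stairNorm, hcon] at h

lemma weight_step (hν : m + 1 ≤ ν) :
    ofReal ν ^ m * ofReal (exp (-(1 / 2))) * ofReal (1 / (ν - 1 / 2)) ^
      m ≤ 1 := by
  have hm : (0 : ℝ) ≤ m := by positivity
  have h0 : 0 < ν - 1 / 2 := by linarith
  have hν0 : 0 ≤ ν := by linarith
  rw [← ofReal_pow hν0, ← ofReal_pow (one_div_nonneg.2 h0.le),
    ← ofReal_mul (by positivity), ← ofReal_mul (by positivity),
    ofReal_le_one]
  have h1 : ν / (ν - 1 / 2) ≤ exp (1 / 2 / (ν - 1 / 2)) := by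
    have := Real.add_one_le_exp (1 / 2 / (ν - 1 / 2))
    refine le_trans (le_of_eq ?_) this
    rw [div_add_one h0.ne']; ring_nf
  have h2 : (ν / (ν - 1 / 2)) ^ m ≤ exp (1 / 2) := by
    calc (ν / (ν - 1 / 2)) ^ m ≤ exp (1 / 2 / (ν - 1 / 2)) ^ m := by
          gcongr
      _ = exp (m * (1 / 2 / (ν - 1 / 2))) := by rw [← Real.exp_nat_mul]
      _ ≤ exp (1 / 2) := by
          gcongr
          rw [mul_div_assoc', div_le_iff₀ h0]; linarith
  calc ν ^ m * exp (-(1 / 2)) * (1 / (ν - 1 / 2)) ^ m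
      = (ν / (ν - 1 / 2)) ^ m * exp (-(1 / 2)) := by rw [div_pow, div_pow, one_pow]; ring
    _ ≤ exp (1 / 2) * exp (-(1 / 2)) := by gcongr
    _ = 1 := by rw [← exp_add]; simp

/-- Passing to the staircase decomposition does not increase the weight. -/
lemma stairSum_restair_le (h : Loose u) (hν : m + 1 ≤ ν) :
    stairSum m ν (restair m u) ≤ looseSum m ν u := by
  have hm : (0 : ℝ) ≤ m := by positivity
  have hR := h.remainder m
  set w : ℕ → ℝ≥0∞ := fun n => ofReal ν ^ (m * n) *
    ofReal (exp (-(1 / 2) * n)) with hw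
  set rest : ℕ → ℝ → ℂ := fun n => (Ici ((n : ℝ) + 1)).indicator (remainder m u n) with hrest
  have hsplit : ∀ n, ofReal ν ^ (m * n) * lap ν (restair m u n) +
      w n * lap (ν - 1 / 2) (rest n) ≤ w n * lap (ν - 1 / 2) (remainder m u n) := by
    intro n
    have h1 : lap (ν - 1 / 2) (remainder m u n) =
        lap (ν - 1 / 2) (restair m u n) + lap (ν - 1 / 2) (rest n) := by
      rw [lap, lap, lap, ← lintegral_add_left' (f := fun t =>
        ofReal (exp (-(ν - 1 / 2) * t)) * ‖restair m u n t‖ₑ) (aemeasurable_lap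
        ((hR.causal n).indicator measurableSet_Ico).aesm _)]
      refine lintegral_congr fun t => ?_
      rw [h.remainder_eq m n t, ← mul_add]
      congr 1
      simp only [hrest, restair, Set.indicator, mem_Ico, mem_Ici]
      by_cases h2 : (n : ℝ) + 1 ≤ t
      · simp [h2, not_lt.2 h2]
      · simp [h2]
    rw [h1, mul_add]
    gcongr ?_ + _
    have h2 : lap ν (restair m u n) ≤ ofReal (exp (-(1 / 2) * n)) *
        lap (ν - 1 / 2) (restair m u n) := by
      have := lap_le_of_support_ge (F := restair m u n) (μ := ν - 1 / 2) (ν := ν) (a := n)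
        (by linarith) (fun t ht => by simp [restair, Set.indicator, not_le.2 ht])
      simpa using this
    calc _ ≤ ofReal ν ^ (m * n) * (ofReal (exp (-(1 / 2) * n)) *
        lap (ν - 1 / 2) (restair m u n)) := by gcongr
      _ = _ := by rw [hw, mul_assoc]
  have hstep : ∀ n, w (n + 1) * lap (ν - 1 / 2) (remainder m u (n + 1)) ≤
      w (n + 1) * lap (ν - 1 / 2) (u (n + 1)) + w n * lap (ν - 1 / 2) (rest n) := by
    intro n
    have hc : Causal (rest n) := (hR.causal n).indicator measurableSet_Ici
    calc w (n + 1) * lap (ν - 1 / 2) (remainder m u (n + 1))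
        ≤ w (n + 1) * (lap (ν - 1 / 2) (u (n + 1)) +
          ofReal (1 / (ν - 1 / 2)) ^ m * lap (ν - 1 / 2) (rest n)) := by
          gcongr
          refine (lap_add_le (h.causal (n + 1)).aesm _).trans ?_
          gcongr
          exact hc.lap_primitive_iterate_le (by linarith) m
      _ = w (n + 1) * lap (ν - 1 / 2) (u (n + 1)) + (ofReal ν ^ m *
          ofReal (exp (-(1 / 2))) * ofReal (1 / (ν - 1 / 2)) ^ m) *
          (w n * lap (ν - 1 / 2) (rest n)) := by
          have e1 : ofReal (exp (-(1 / 2) * (n + 1 : ℕ))) =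
              ofReal (exp (-(1 / 2))) * ofReal (exp (-(1 / 2) * n)) := by
            rw [← ofReal_mul (exp_nonneg _), ← exp_add]
            push_cast; ring_nf
          have e2 : ofReal ν ^ (m * (n + 1)) =
              ofReal ν ^ m * ofReal ν ^ (m * n) := by rw [← pow_add]; ring_nf
          rw [mul_add]
          congr 1
          simp only [hw]
          rw [e1, e2]; ring
      _ ≤ _ := by
          exact add_le_add le_rfl (mul_le_of_le_one_left zero_le (weight_step hν))
  have tele : ∀ N, ∑ n ∈ Finset.range (N + 1), ofReal ν ^ (m * n) * lap ν (restair m u n)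
      + w N * lap (ν - 1 / 2) (rest N) ≤
      ∑ n ∈ Finset.range (N + 1), w n * lap (ν - 1 / 2) (u n) := by
    intro N
    induction N with
    | zero =>
      have h0 := hsplit 0
      simp only [zero_add, Finset.range_one, sum_singleton]
      exact h0
    | succ N ih =>
      rw [sum_range_succ, sum_range_succ _ (N + 1), add_assoc]
      calc _ ≤ ∑ n ∈ Finset.range (N + 1), ofReal ν ^ (m * n) * lap ν (restair m u n) +
            (w (N + 1) * lap (ν - 1 / 2) (u (N + 1)) + w N * lap (ν - 1 / 2) (rest N)) := by
            exact add_le_add le_rfl ((hsplit (N + 1)).trans (hstep N))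
        _ ≤ _ := by
            rw [add_left_comm, add_comm (∑ n ∈ Finset.range (N + 1), w n * _)]
            gcongr
  refine ENNReal.tsum_le_of_sum_range_le fun N => ?_
  calc _ ≤ ∑ n ∈ Finset.range (N + 1), ofReal ν ^ (m * n) * lap ν (restair m u n) :=
        Finset.sum_le_sum_of_subset (Finset.range_mono (Nat.le_succ N))
    _ ≤ _ := le_trans le_self_add (tele N)
    _ ≤ looseSum m ν u := sum_le_tsum _

lemma IsLoose.stairNorm_le (h : IsLoose m u T) (hν : m + 1 ≤ ν) :
    stairNorm c m ν T ≤ c * looseSum m ν u := by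
  rw [stairNorm_eq h.isStairDecomp_restair ν]
  gcongr
  exact stairSum_restair_le h.toLoose hν

lemma IsStairDecomp.add {S : Dist} {Δ' : ℕ → ℝ → ℂ} (h : IsStairDecomp m T Δ)
    (h' : IsStairDecomp m S Δ') : IsStairDecomp m (T + S) (fun n t => Δ n t + Δ' n t) :=
  (h.isLoose.add h'.isLoose).isStairDecomp (fun i => (h.1 i).add (h'.1 i))
    (fun i t ht => by simp [h.2.1 i t ht, h'.2.1 i t ht])

lemma IsStairDecomp.smul (h : IsStairDecomp m T Δ) (a : ℂ) :
    IsStairDecomp m (a • T) (fun n t => a * Δ n t) :=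
  (h.isLoose.smul a).isStairDecomp (fun i => (h.1 i).const_mul a)
    (fun i t ht => by simp [h.2.1 i t ht])

lemma isStairDecomp_zero (m : ℕ) : IsStairDecomp m 0 (fun _ _ => 0) :=
  (isLoose_zero m).isStairDecomp (fun _ => integrable_zero _ _ _) (fun _ _ _ => rfl)

@[simp] lemma stairNorm_zero (c : ℝ≥0) (m : ℕ) (ν : ℝ) : stairNorm c m ν 0 = 0 := by
  rw [stairNorm_eq (isStairDecomp_zero m)]; simp [stairSum, lap_zero]

lemma stairNorm_add_le (c : ℝ≥0) (m : ℕ) (ν : ℝ) (T S : Dist) :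
    stairNorm c m ν (T + S) ≤ stairNorm c m ν T + stairNorm c m ν S := by
  by_cases hT : stairNorm c m ν T < ⊤
  swap; · simp [not_lt_top_iff.1 hT]
  by_cases hS : stairNorm c m ν S < ⊤
  swap; · simp [not_lt_top_iff.1 hS]
  obtain ⟨Δ, h⟩ := exists_isStairDecomp hT
  obtain ⟨Δ', h'⟩ := exists_isStairDecomp hS
  rw [stairNorm_eq h, stairNorm_eq h', stairNorm_eq (h.add h'), ← mul_add]
  gcongr
  rw [stairSum, stairSum, stairSum, ← ENNReal.tsum_add]
  refine tsum_le_tsum fun i => ?_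
  rw [← mul_add]
  gcongr
  exact lap_add_le (h.1 i).1 ν

lemma stairNorm_smul_le (c : ℝ≥0) (m : ℕ) (ν : ℝ) (a : ℂ) (T : Dist) :
    stairNorm c m ν (a • T) ≤ ‖a‖ₑ * stairNorm c m ν T := by
  by_cases hT : stairNorm c m ν T < ⊤
  · obtain ⟨Δ, h⟩ := exists_isStairDecomp hT
    rw [stairNorm_eq h, stairNorm_eq (h.smul a), ← mul_assoc, mul_comm _ (c : ℝ≥0∞), mul_assoc]
    gcongr
    rw [stairSum, stairSum, ← ENNReal.tsum_mul_left]
    refine tsum_le_tsum fun i => ?_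
    rw [lap_const_mul]
    exact le_of_eq (by ring)
  · by_cases ha : a = 0
    · simp [ha]
    · rw [not_lt_top_iff.1 hT, mul_top (by simpa using ha)]; exact le_top

lemma stairNorm_neg (c : ℝ≥0) (m : ℕ) (ν : ℝ) (T : Dist) :
    stairNorm c m ν (-T) = stairNorm c m ν T := by
  have h : ∀ T : Dist, stairNorm c m ν (-T) ≤ stairNorm c m ν T := fun T => by
    rw [← Dist.neg_one_smul]
    simpa using stairNorm_smul_le c m ν (-1) T
  exact le_antisymm (h T) (by simpa using h (-T))

lemma stairNorm_sub_le (c : ℝ≥0) (m : ℕ) (ν : ℝ) (T S : Dist) :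
    stairNorm c m ν (T - S) ≤ stairNorm c m ν T + stairNorm c m ν S := by
  rw [sub_eq_add_neg, ← stairNorm_neg c m ν S]
  exact stairNorm_add_le _ _ _ _ _

lemma stairNorm_le_sub_add (c : ℝ≥0) (m : ℕ) (ν : ℝ) (T S : Dist) :
    stairNorm c m ν T ≤ stairNorm c m ν (T - S) + stairNorm c m ν S := by
  simpa using stairNorm_add_le c m ν (T - S) S

lemma stairNorm_sum_le (c : ℝ≥0) (m : ℕ) (ν : ℝ) {ι : Type*} (s : Finset ι) (T : ι → Dist) :
    stairNorm c m ν (∑ i ∈ s, T i) ≤ ∑ i ∈ s, stairNorm c m ν (T i) :=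
  Finset.le_sum_of_subadditive _ (by simp) (stairNorm_add_le c m ν) s T

end

section

/-! ### Weak continuity, completeness, and dependence on the weight -/

variable {ψ F : ℝ → ℂ} {B ν ν₀ : ℝ} {c : ℝ≥0} {m : ℕ} {T S : Dist}

lemma IsTest.exists_bound (h : IsTest ψ) (K : ℕ) :
    ∃ B : ℝ, 0 ≤ B ∧ ∀ k ≤ K, ∀ t, ‖_root_.iteratedDeriv k ψ t‖ ≤ B := by
  choose B hB using fun k => (h.iteratedDeriv k).compact.exists_bound_of_continuous
    (h.iteratedDeriv k).smooth.continuous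
  exact ⟨∑ k ∈ Finset.range (K + 1), |B k|, by positivity, fun k hk t => (hB k t).trans
    ((le_abs_self _).trans (Finset.single_le_sum (f := fun k => |B k|) (fun _ _ => abs_nonneg _)
      (mem_range_succ_iff.2 hk)))⟩

lemma enorm_integral_mul_le {N : ℝ} (hν : 0 ≤ ν) (hB : ∀ t, ‖ψ t‖ ≤ B) (hs : tsupport ψ ⊆ Iio N) :
    ‖∫ t, ψ t * F t‖ₑ ≤ ofReal (B * exp (ν * N)) * lap ν F := by
  refine (enorm_integral_le_lintegral_enorm _).trans ?_
  rw [lap, ← lintegral_const_mul' _ _ ofReal_ne_top]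
  refine lintegral_mono fun t => ?_
  have hB0 : 0 ≤ B := (norm_nonneg _).trans (hB t)
  by_cases ht : t < N
  · rw [enorm_mul, ← mul_assoc, ← ofReal_mul (by positivity), mul_assoc, ← exp_add]
    gcongr
    rw [← ofReal_norm]
    refine ofReal_le_ofReal ((hB t).trans (le_mul_of_one_le_right hB0 ?_))
    rw [Real.one_le_exp_iff]; nlinarith
  · simp [image_eq_zero_of_notMem_tsupport fun h => ht (hs h)]

lemma enorm_cval_le (hc : 1 ≤ c) (hν : 1 ≤ ν) {N : ℕ} (hψ : IsTest ψ)
    (hs : tsupport ψ ⊆ Iio (N : ℝ)) (hB : ∀ k ≤ m * N, ∀ t, ‖iteratedDeriv k ψ t‖ ≤ B)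
    (hT : stairNorm c m ν T < ⊤) :
    ‖T.cval ψ‖ₑ ≤ ofReal (B * exp (ν * N)) * stairNorm c m ν T := by
  obtain ⟨Δ, h⟩ := exists_isStairDecomp hT
  have hν1 : 1 ≤ ofReal ν := by simpa using hν
  rw [stairNorm_eq h, h.isLoose.pair ψ hψ N hs, loosePair]
  calc ‖∑ n ∈ Finset.range N, (-1 : ℂ) ^ (m * n) * ∫ t, iteratedDeriv (m * n) ψ t * Δ n t‖ₑ
      ≤ ∑ n ∈ Finset.range N, ‖(-1 : ℂ) ^ (m * n) * ∫ t, iteratedDeriv (m * n) ψ t * Δ n t‖ₑ :=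
        enorm_sum_le _ _
    _ ≤ ∑ n ∈ Finset.range N, ofReal (B * exp (ν * N)) *
          (ofReal ν ^ (m * n) * lap ν (Δ n)) := by
        refine sum_le_sum fun n hn => ?_
        have h1 : ‖(-1 : ℂ) ^ (m * n)‖ₑ = 1 := by rw [enorm_pow]; simp
        rw [enorm_mul, h1, one_mul]
        refine (enorm_integral_mul_le (by linarith)
          (hB _ (Nat.mul_le_mul_left m (Finset.mem_range.1 hn).le))
          ((tsupport_iteratedDeriv_subset _).trans hs)).trans ?_
        gcongr
        exact le_mul_of_one_le_left zero_le (one_le_pow₀ hν1)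
    _ ≤ ofReal (B * exp (ν * N)) * stairSum m ν Δ := by
        rw [← mul_sum]
        gcongr
        exact sum_le_tsum _
    _ ≤ _ := by
        gcongr
        exact le_mul_of_one_le_left zero_le (by exact_mod_cast hc)

lemma tendsto_cval (hc : 1 ≤ c) (hν : 1 ≤ ν) {ι : Type*} {l : Filter ι} {T : ι → Dist}
    (h : Tendsto (fun i => stairNorm c m ν (T i - S)) l (𝓝 0)) (hψ : IsTest ψ) :
    Tendsto (fun i => (T i).cval ψ) l (𝓝 (S.cval ψ)) := by
  obtain ⟨N, hN⟩ := hψ.exists_nat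
  obtain ⟨B, -, hB⟩ := hψ.exists_bound (m * N)
  rw [tendsto_iff_edist_tendsto_0]
  have h1 : Tendsto (fun i => ofReal (B * exp (ν * N)) * stairNorm c m ν (T i - S)) l
      (𝓝 0) := by
    simpa using ENNReal.Tendsto.const_mul h (Or.inr ofReal_ne_top)
  refine tendsto_zero_of_le h1 ?_
  filter_upwards [h.eventually (gt_mem_nhds ENNReal.zero_lt_top)] with i hi
  rw [edist_eq_enorm_sub, ← cval_sub]
  exact enorm_cval_le hc hν hψ hN hB hi

lemma eq_zero_of_stairNorm_eq_zero (hc : 1 ≤ c) (hν : 1 ≤ ν) (h : stairNorm c m ν T = 0) :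
    T = 0 := by
  refine Dist.ext_cval fun ψ hψ => ?_
  exact tendsto_nhds_unique tendsto_const_nhds (tendsto_cval hc hν (m := m)
    (l := (atTop : Filter ℕ)) (T := fun _ => T) (S := 0) (by simp [h]) hψ)

lemma stairNorm_limit_unique (hc : 1 ≤ c) (hν : 1 ≤ ν) {ι : Type*} {l : Filter ι} [l.NeBot]
    {T : ι → Dist} {S' : Dist} (h : Tendsto (fun i => stairNorm c m ν (T i - S)) l (𝓝 0))
    (h' : Tendsto (fun i => stairNorm c m ν (T i - S')) l (𝓝 0)) : S = S' :=
  Dist.ext_cval fun _ hψ => tendsto_nhds_unique (tendsto_cval hc hν h hψ) (tendsto_cval hc hν h' hψ)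

lemma StairHasSum.hasSum_cval (hc : 1 ≤ c) (hν : 1 ≤ ν) {ι : Type} {T : ι → Dist}
    (h : StairHasSum c m ν T S) (hψ : IsTest ψ) : HasSum (fun i => (T i).cval ψ) (S.cval ψ) := by
  have h1 : Tendsto (fun s : Finset ι => stairNorm c m ν (∑ i ∈ s, T i - S)) atTop (𝓝 0) := by
    refine h.congr fun s => ?_
    rw [← stairNorm_neg, neg_sub]
  have := tendsto_cval hc hν h1 hψ
  simp_rw [cval_sum] at this
  exact this

lemma IsStairDecomp.sum {ι : Type*} (s : Finset ι) {T : ι → Dist} {Δ : ι → ℕ → ℝ → ℂ}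
    (h : ∀ i, IsStairDecomp m (T i) (Δ i)) :
    IsStairDecomp m (∑ i ∈ s, T i) (fun n t => ∑ i ∈ s, Δ i n t) := by
  induction s using cons_induction with
  | empty => simpa using isStairDecomp_zero m
  | cons i s hi ih => simp_rw [sum_cons hi]; exact (h i).add ih

lemma integrable_of_lap {a : ℝ} (hν : 0 ≤ ν) (hF : AEStronglyMeasurable F) (hs : ∀ t > a, F t = 0)
    (h : lap ν F < ⊤) : Integrable F := by
  refine ⟨hF, ?_⟩
  simpa [lap, HasFiniteIntegral] using
    (lap_le_of_support_le (μ := 0) hν hs).trans_lt (mul_lt_top ofReal_lt_top h)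

/-- Completeness: an absolutely convergent series converges. -/
theorem exists_stair_sum (hc : 1 ≤ c) (hν : 1 ≤ ν) {ι : Type*} [Countable ι] {T : ι → Dist}
    (hT : ∑' i, stairNorm c m ν (T i) < ⊤) :
    ∃ S, ∀ s : Finset ι, stairNorm c m ν (S - ∑ i ∈ s, T i) ≤ ∑' i : {i // i ∉ s}, stairNorm c m ν
      (T i) := by
  have hTi : ∀ i, stairNorm c m ν (T i) < ⊤ := fun i => (le_tsum i).trans_lt hT
  choose Δ hΔ using fun i => exists_isStairDecomp (hTi i)
  have hν1 : 1 ≤ ofReal ν := by simpa using hν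
  have hfin : ∀ n, ∑' i, lap ν (Δ i n) < ⊤ := by
    intro n
    refine lt_of_le_of_lt (tsum_le_tsum fun i => ?_) hT
    rw [stairNorm_eq (hΔ i), stairSum]
    calc lap ν (Δ i n) ≤ ofReal ν ^ (m * n) * lap ν (Δ i n) :=
          le_mul_of_one_le_left zero_le (one_le_pow₀ hν1)
      _ ≤ ∑' n, ofReal ν ^ (m * n) * lap ν (Δ i n) :=
          le_tsum (f := fun n => ofReal ν ^ (m * n) * lap ν (Δ i n)) n
      _ ≤ _ := le_mul_of_one_le_left zero_le (by exact_mod_cast hc)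
  have hsum : ∀ n, ∀ᵐ t, Summable fun i => Δ i n t := by
    intro n
    have h1 : ∫⁻ t, ∑' i, ofReal (exp (-ν * t)) * ‖Δ i n t‖ₑ ≠ ⊤ := by
      rw [lintegral_tsum fun i => aemeasurable_lap ((hΔ i).1 n).1 ν]
      exact (hfin n).ne
    filter_upwards [ae_lt_top' (AEMeasurable.tsum
      fun i => aemeasurable_lap ((hΔ i).1 n).1 ν) h1] with t ht
    rw [ENNReal.tsum_mul_left] at ht
    have h2 : ∑' i, ‖Δ i n t‖ₑ < ⊤ := by
      by_contra hcon
      rw [not_lt_top_iff.1 hcon, mul_top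
        (by simpa using Real.exp_pos _)] at ht
      exact lt_irrefl _ ht
    exact Summable.of_enorm h2.ne
  set f : ℕ → ℝ → ℂ := fun n t => ∑' i, Δ i n t with hf
  have hmeas : ∀ n, AEStronglyMeasurable (f n) := by
    intro n
    refine aestronglyMeasurable_of_tendsto_ae (atTop : Filter (Finset ι))
      (f := fun s t => ∑ i ∈ s, Δ i n t)
      (fun s => Finset.aestronglyMeasurable_fun_sum s fun i _ => ((hΔ i).1 n).1) ?_
    filter_upwards [hsum n] with t ht
    exact ht.hasSum
  have hrem : ∀ n (s : Finset ι), lap ν (fun t => f n t + -1 * ∑ i ∈ s, Δ i n t) ≤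
      ∑' i : {i // i ∉ s}, lap ν (Δ i n) := by
    intro n s
    simp only [lap]
    rw [← lintegral_tsum fun i : {i // i ∉ s} => aemeasurable_lap ((hΔ i).1 n).1 ν]
    refine lintegral_mono_ae ?_
    filter_upwards [hsum n] with t ht
    rw [ENNReal.tsum_mul_left]
    gcongr
    have h1 : f n t + -1 * ∑ i ∈ s, Δ i n t = ∑' i : {i // i ∉ s}, Δ i n t := by
      have := ht.sum_add_tsum_subtype_compl s
      rw [hf]; simp only
      rw [← this]; ring
    rw [h1]
    exact enorm_tsum_le_tsum_enorm
  have hzero : ∀ (i : ℕ) (t : ℝ), t ∉ Icc (i : ℝ) (i + 1) → f i t = 0 := fun n t ht => by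
    simp [hf, fun i => (hΔ i).2.1 n t ht]
  have hint : ∀ n, Integrable (f n) := fun n => by
    refine integrable_of_lap (ν := ν) (a := n + 1) (by linarith) (hmeas n)
      (fun t ht => hzero n t fun h => absurd h.2 (not_le.2 ht)) ?_
    have := hrem n ∅
    simp only [sum_empty, mul_zero, add_zero] at this
    refine this.trans_lt (lt_of_le_of_lt ?_ (hfin n))
    exact ENNReal.tsum_comp_le_tsum_of_injective Subtype.val_injective _
  have hloose : Loose f := ⟨fun n => (hint n).locallyIntegrable,
    fun n t ht => hzero n t fun h => absurd h.1 (not_le.2 ht)⟩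
  obtain ⟨S, hS⟩ := hloose.exists_isLoose m
  have hSd := hS.isStairDecomp hint hzero
  refine ⟨S, fun s => ?_⟩
  have hd : IsStairDecomp m (S - ∑ i ∈ s, T i) (fun n t => f n t + -1 * ∑ i ∈ s, Δ i n t) := by
    have := hSd.add ((IsStairDecomp.sum s hΔ).smul (-1))
    rwa [Dist.neg_one_smul, ← sub_eq_add_neg] at this
  rw [stairNorm_eq hd]
  simp_rw [fun i : {i // i ∉ s} => stairNorm_eq (c := c) (hΔ i) ν, stairSum]
  rw [ENNReal.tsum_mul_left, ENNReal.tsum_comm]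
  gcongr with n
  rw [ENNReal.tsum_mul_left]
  gcongr
  exact hrem n s

lemma stairHasSum_of_bound {ι : Type} {T : ι → Dist} (hT : ∑' i, stairNorm c m ν (T i) < ⊤)
    (h : ∀ s : Finset ι, stairNorm c m ν (S - ∑ i ∈ s, T i) ≤ ∑' i : {i // i ∉ s}, stairNorm c m ν
    (T i)) : StairHasSum c m ν T S :=
  tendsto_of_tendsto_of_tendsto_of_le_of_le tendsto_const_nhds
    (ENNReal.tendsto_tsum_compl_atTop_zero hT.ne) (fun _ => zero_le) h

/-- An absolutely convergent series that converges weakly to `S` converges in norm to `S`. -/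
lemma stair_sum_of_hasSum_cval (hc : 1 ≤ c) (hν : 1 ≤ ν) {ι : Type} [Countable ι] {T : ι → Dist}
    (hT : ∑' i, stairNorm c m ν (T i) < ⊤) (h : ∀ ψ, IsTest ψ → HasSum (fun i => (T i).cval ψ)
    (S.cval ψ)) : StairHasSum c m ν T S ∧ stairNorm c m ν S ≤ ∑' i, stairNorm c m ν (T i) := by
  obtain ⟨S', hS'⟩ := exists_stair_sum hc hν hT
  have h1 := stairHasSum_of_bound hT hS'
  have h2 : S' = S := Dist.ext_cval fun ψ hψ => (h1.hasSum_cval hc hν hψ).unique (h ψ hψ)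
  subst h2
  refine ⟨h1, ?_⟩
  have := hS' ∅
  simp only [sum_empty, sub_zero] at this
  exact this.trans (ENNReal.tsum_comp_le_tsum_of_injective Subtype.val_injective _)

/-- The factor by which the contribution of level `1` shrinks when `ν₀` is replaced by `ν`. -/
def weightRatio (m : ℕ) (ν₀ ν : ℝ) : ℝ := (ν / ν₀) ^ m * exp (-(ν - ν₀))

lemma weightRatio_nonneg (h0 : 0 < ν₀) (h : ν₀ ≤ ν) : 0 ≤ weightRatio m ν₀ ν := by
  have : 0 ≤ ν := h0.le.trans h
  unfold weightRatio; positivity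

lemma weightRatio_le_one (h0 : m + 1 ≤ ν₀) (h : ν₀ ≤ ν) : weightRatio m ν₀ ν ≤ 1 := by
  have hm : (0 : ℝ) ≤ m := by positivity
  have h0' : 0 < ν₀ := by linarith
  have h1 : ν / ν₀ ≤ exp ((ν - ν₀) / ν₀) := by
    refine le_trans (le_of_eq ?_) (Real.add_one_le_exp _)
    field_simp; ring
  calc weightRatio m ν₀ ν ≤ exp ((ν - ν₀) / ν₀) ^ m * exp (-(ν - ν₀)) := by
        unfold weightRatio
        gcongr
        exact div_nonneg (by linarith) h0'.le
    _ = exp (m * ((ν - ν₀) / ν₀) + -(ν - ν₀)) := by rw [← Real.exp_nat_mul, ← exp_add]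
    _ ≤ 1 := by
        rw [Real.exp_le_one_iff]
        have : m * ((ν - ν₀) / ν₀) ≤ ν - ν₀ := by
          rw [mul_div_assoc', div_le_iff₀ h0']; nlinarith
        linarith

lemma tendsto_weightRatio (m : ℕ) (ν₀ : ℝ) :
    Tendsto (weightRatio m ν₀) atTop (𝓝 0) := by
  have h := (Real.tendsto_pow_mul_exp_neg_atTop_nhds_zero m).const_mul (exp ν₀ / ν₀ ^ m)
  rw [mul_zero] at h
  refine h.congr fun ν => ?_
  rw [weightRatio, neg_sub, sub_eq_add_neg, exp_add, div_pow]; ring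

lemma level_le (h0 : 0 < ν₀) (h : ν₀ ≤ ν) {i : ℕ} (hF : ∀ t < (i : ℝ), F t = 0) :
    ofReal ν ^ (m * i) * lap ν F ≤ ofReal (weightRatio m ν₀ ν) ^ i *
      (ofReal ν₀ ^ (m * i) * lap ν₀ F) := by
  calc _ ≤ ofReal ν ^ (m * i) * (ofReal (exp (-(ν - ν₀) * i)) * lap ν₀ F) := by
        gcongr
        exact lap_le_of_support_ge h hF
    _ = _ := by
        rw [← mul_assoc, ← mul_assoc]
        congr 1
        have hν : 0 ≤ ν := h0.le.trans h
        rw [← ofReal_pow hν, ← ofReal_pow h0.le,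
          ← ofReal_pow (weightRatio_nonneg h0 h), ← ofReal_mul (by positivity),
          ← ofReal_mul (by have := weightRatio_nonneg (m := m) h0 h; positivity)]
        congr 1
        rw [weightRatio, mul_pow, ← pow_mul, ← Real.exp_nat_mul, div_pow, mul_comm (i : ℝ)]
        field_simp

lemma tendsto_lap_atTop (hF : Integrable F) (h0 : ∀ t < 0, F t = 0) :
    Tendsto (fun ν => lap ν F) atTop (𝓝 0) := by
  have h : Tendsto (fun ν => lap ν F) atTop (𝓝 (∫⁻ _ : ℝ, 0)) := by
    refine tendsto_lintegral_filter_of_dominated_convergence' (fun t => ‖F t‖ₑ)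
      (.of_forall fun ν => aemeasurable_lap hF.1 ν) ?_ hF.2.ne ?_
    · filter_upwards [eventually_ge_atTop 0] with ν hν
      refine .of_forall fun t => ?_
      rcases lt_or_ge t 0 with h1 | h1
      · simp [h0 t h1]
      · refine mul_le_of_le_one_left zero_le ?_
        rw [ofReal_le_one, Real.exp_le_one_iff]; nlinarith
    · filter_upwards [ae_ne 0] with t ht
      rcases lt_or_gt_of_ne (show t ≠ 0 from ht) with h1 | h1
      · simp [h0 t h1]
      · have h2 : Tendsto (fun ν : ℝ => exp (-ν * t)) atTop (𝓝 0) := by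
          refine Real.tendsto_exp_atBot.comp ?_
          exact (tendsto_neg_atTop_atBot.atBot_mul_const h1)
        have h3 := tendsto_ofReal h2
        rw [ENNReal.ofReal_zero] at h3
        simpa using ENNReal.Tendsto.mul_const h3 (Or.inr (enorm_ne_top (x := F t)))
  simpa using h

lemma tendsto_stairNorm_atTop (h : stairNorm c m ν₀ T < ⊤) (hc : c ≠ 0) (h0 : m + 1 ≤ ν₀) :
    Tendsto (fun ν => stairNorm c m ν T) atTop (𝓝 0) := by
  have h0' : 0 < ν₀ := lt_of_lt_of_le (by positivity) h0
  obtain ⟨Δ, hΔ⟩ := exists_isStairDecomp h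
  have hfin : stairSum m ν₀ Δ ≠ ⊤ := by
    intro hcon
    rw [stairNorm_eq hΔ, hcon, mul_top (by simpa using hc)] at h
    exact lt_irrefl _ h
  have hz : ∀ (i : ℕ) (t : ℝ), t < i → Δ i t = 0 := hΔ.loose.zero
  have hlim : Tendsto (fun ν => c * (lap ν (Δ 0) + ofReal (weightRatio m ν₀ ν) *
      stairSum m ν₀ Δ)) atTop (𝓝 0) := by
    have h1 := tendsto_lap_atTop (hΔ.1 0) (fun t ht => hz 0 t (by simpa using ht))
    have h2 := ENNReal.Tendsto.mul_const (tendsto_ofReal (tendsto_weightRatio m ν₀))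
      (Or.inr hfin)
    simpa using ENNReal.Tendsto.const_mul (h1.add h2) (Or.inr (ENNReal.coe_ne_top (r := c)))
  refine tendsto_zero_of_le hlim ?_
  filter_upwards [eventually_ge_atTop ν₀] with ν hν
  rw [stairNorm_eq hΔ]
  gcongr
  rw [stairSum, tsum_eq_zero_add' ENNReal.summable]
  refine add_le_add (by simp) ?_
  rw [stairSum, tsum_eq_zero_add' (f := fun i => ofReal ν₀ ^ (m * i) * lap ν₀ (Δ i))
    ENNReal.summable, mul_add]
  refine le_trans ?_ le_add_self
  rw [← ENNReal.tsum_mul_left]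
  refine tsum_le_tsum fun i => (level_le h0' hν (hz (i + 1))).trans ?_
  gcongr
  rw [pow_succ]
  exact mul_le_of_le_one_left zero_le
    (pow_le_one₀ zero_le (by simpa using weightRatio_le_one h0 hν))

/-! ### Pointwise estimates for the primitives -/

lemma Loose.lap_SP_le {u : ℕ → ℝ → ℂ} (h : Loose u) (hν : 0 < ν) (k : ℕ) :
    ofReal ν ^ (m * k) * lap ν (SP m u k) ≤ stairSum m ν u := by
  have key : ofReal ν ^ (m * k) * lap ν (SP m u k) ≤
      ∑ i ∈ Finset.range (k + 1), ofReal ν ^ (m * i) * lap ν (u i) := by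
    induction k with
    | zero => simp [SP]
    | succ k ih =>
      rw [sum_range_succ]
      have h1 : ofReal ν * ofReal (1 / ν) = 1 := by
        rw [← ofReal_mul hν.le, mul_one_div_cancel hν.ne', ofReal_one]
      calc ofReal ν ^ (m * (k + 1)) * lap ν (SP m u (k + 1))
          ≤ ofReal ν ^ (m * (k + 1)) * (ofReal (1 / ν) ^ m * lap ν (SP m u k) +
            lap ν (u (k + 1))) := by
            gcongr
            refine (lap_add_le ((h.causal_SP m k).primitive_iterate m).aesm ν).trans ?_
            gcongr
            exact (h.causal_SP m k).lap_primitive_iterate_le hν m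
        _ = (ofReal ν * ofReal (1 / ν)) ^ m *
            (ofReal ν ^ (m * k) * lap ν (SP m u k)) +
            ofReal ν ^ (m * (k + 1)) * lap ν (u (k + 1)) := by
            rw [mul_add, mul_pow, Nat.mul_succ, pow_add]; ring
        _ ≤ _ := by
            rw [h1, one_pow, one_mul]
            gcongr
  exact key.trans (sum_le_tsum _)

lemma Causal.enorm_primitive_le (hF : Causal F) (hν : 0 ≤ ν) (t : ℝ) :
    ‖Staircase.primitive F t‖ₑ ≤ ofReal (exp (ν * t)) * lap ν F := by
  rcases lt_or_ge t 0 with h1 | h1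
  · simp [hF.primitive.zero t h1]
  rw [Staircase.primitive, integral_of_le h1]
  refine (enorm_integral_le_lintegral_enorm _).trans ?_
  rw [lap, ← lintegral_const_mul' _ _ ofReal_ne_top]
  refine (setLIntegral_mono_ae' measurableSet_Ioc (.of_forall fun s hs => ?_)).trans
    (setLIntegral_le_lintegral _ _)
  rw [← mul_assoc, ← ofReal_mul (by positivity), ← exp_add]
  refine le_mul_of_one_le_left zero_le ?_
  rw [ENNReal.one_le_ofReal, Real.one_le_exp_iff]
  nlinarith [hs.2]

/-! ### Distributions given by functions -/

/-- The family that represents a causal function. -/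
def level0 (F : ℝ → ℂ) : ℕ → ℝ → ℂ := fun n t => if n = 0 then F t else 0

@[simp]
lemma level0_zero (F : ℝ → ℂ) : level0 F 0 = F := funext fun _ => if_pos rfl

lemma level0_of_ne {n : ℕ} (hn : n ≠ 0) (F : ℝ → ℂ) : level0 F n = fun _ => 0 :=
  funext fun _ => if_neg hn

lemma Causal.isLoose_level0 (hF : Causal F) (m : ℕ) : IsLoose m (level0 F) (Dist.ofFun F) := by
  refine ⟨⟨fun n => ?_, fun n t ht => ?_⟩, fun ψ hψ N hN => ?_⟩
  · by_cases h : n = 0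
    · subst h; exact hF.locInt
    · rw [level0_of_ne h]; exact causal_zero.locInt
  · by_cases h : n = 0
    · subst h; simp [hF.zero t (by simpa using ht)]
    · simp [level0_of_ne h]
  · rw [cval_ofFun hF.locOn hψ, loosePair]
    rcases Nat.eq_zero_or_pos N with rfl | hN0
    · have : ∀ t, ψ t = 0 := fun t => image_eq_zero_of_notMem_tsupport fun h =>
        lt_asymm (hψ.supp h) (by simpa using hN h)
      simp [this]
    · rw [Finset.sum_eq_single_of_mem 0 (Finset.mem_range.2 hN0)
        fun n _ hn => by simp [level0_of_ne hn]]
      simp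

lemma looseSum_level0 (m : ℕ) (ν : ℝ) (F : ℝ → ℂ) :
    looseSum m ν (level0 F) = lap (ν - 1 / 2) F := by
  rw [looseSum, tsum_eq_single 0 fun n hn => by rw [level0_of_ne hn, lap_zero, mul_zero]]
  simp

lemma Causal.stairNorm_ofFun_le (hF : Causal F) (c : ℝ≥0) (hν : m + 1 ≤ ν) :
    stairNorm c m ν (Dist.ofFun F) ≤ c * lap (ν - 1 / 2) F :=
  ((hF.isLoose_level0 m).stairNorm_le hν).trans (by rw [looseSum_level0])

end

section

/-! ### Convolution of staircase distributions -/

variable {F G F' ψ : ℝ → ℂ} {t R ν : ℝ} {u v : ℕ → ℝ → ℂ} {k m : ℕ} {T S T' S' : Dist} {c : ℝ≥0}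

/-- The family that represents a convolution. -/
def convFam (u v : ℕ → ℝ → ℂ) : ℕ → ℝ → ℂ :=
  fun n t => ∑ i ∈ Finset.range (n + 1), convFun (u i) (v (n - i)) t

lemma conv_eq_zero_of_support {a b : ℝ} (hF : ∀ t < a, F t = 0) (hG : ∀ t < b, G t = 0)
    (ht : t < a + b) : convFun F G t = 0 := by
  have : ∀ s, F s * G (t - s) = 0 := fun s => by
    rcases lt_or_ge s a with h | h
    · simp [hF s h]
    · simp [hG (t - s) (by linarith)]
  simp [convFun, this]

lemma Loose.convFam (hu : Loose u) (hv : Loose v) : Loose (convFam u v) := by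
  refine ⟨fun n => ?_, fun n t ht => sum_eq_zero fun i hi => ?_⟩
  · exact (Causal.finset_sum _ fun i _ => (hu.causal i).conv (hv.causal (n - i))).locInt
  · have hi' : i ≤ n := mem_range_succ_iff.1 hi
    refine conv_eq_zero_of_support (a := i) (b := (n - i : ℕ))
      (hu.zero i) (hv.zero _) ?_
    rw [Nat.cast_sub hi']; linarith

lemma conv_add_left (hF : Causal F) (hF' : Causal F') (hG : Causal G) :
    (convFun (fun t => F t + F' t) G) =ᵐ[volume] fun t => convFun F G t + convFun F' G t := by
  have key : ∀ R : ℕ, ∀ᵐ t, t < (R : ℝ) →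
      convFun (fun t => F t + F' t) G t = convFun F G t + convFun F' G t := by
    intro R
    filter_upwards [(hF.integrable_prod hG R).prod_right_ae, (hF'.integrable_prod hG R).prod_right_ae]
      with t h1 h2 ht
    rw [(hF.add hF').conv_cut hG ht, hF.conv_cut hG ht, hF'.conv_cut hG ht, ← integral_add h1 h2]
    refine integral_congr_ae (.of_forall fun s => ?_)
    simp only [Set.indicator]
    split_ifs <;> ring
  filter_upwards [ae_all_iff.2 key] with t ht
  obtain ⟨R, hR⟩ := exists_nat_gt t
  exact ht R hR

lemma conv_const_mul_left (a : ℂ) (F G : ℝ → ℂ) :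
    convFun (fun t => a * F t) G = fun t => a * convFun F G t := by
  funext t
  rw [convFun, convFun, ← intervalIntegral.integral_const_mul]
  congr 1; funext s; ring

lemma conv_sum_left {ι : Type*} (s : Finset ι) {F : ι → ℝ → ℂ} (hF : ∀ i, Causal (F i))
    (hG : Causal G) :
    (convFun (fun t => ∑ i ∈ s, F i t) G) =ᵐ[volume] fun t => ∑ i ∈ s, convFun (F i) G t := by
  induction s using cons_induction with
  | empty => exact .of_forall fun t => by simp [convFun]
  | cons i s hi ih =>
    simp_rw [sum_cons hi]
    filter_upwards [conv_add_left (hF i) (Causal.finset_sum s fun i _ => hF i) hG, ih] with t h1 h2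
    rw [h1, h2]

lemma conv_sum_sum {ι κ : Type*} (s : Finset ι) (s' : Finset κ) {F : ι → ℝ → ℂ} {G : κ → ℝ → ℂ}
    (hF : ∀ i, Causal (F i)) (hG : ∀ i, Causal (G i)) :
    (convFun (fun t => ∑ i ∈ s, F i t) (fun t => ∑ j ∈ s', G j t)) =ᵐ[volume]
      fun t => ∑ i ∈ s, ∑ j ∈ s', convFun (F i) (G j) t := by
  have hG' : Causal fun t => ∑ j ∈ s', G j t := Causal.finset_sum s' fun i _ => hG i
  have h2 : ∀ i, ∀ᵐ t, convFun (F i) (fun t => ∑ j ∈ s', G j t) t =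
      ∑ j ∈ s', convFun (F i) (G j) t := fun i => by
    have := conv_sum_left s' hG (hF i)
    filter_upwards [this] with t ht
    rw [(hF i).conv_comm hG', ht]
    exact sum_congr rfl fun j _ => by rw [(hG j).conv_comm (hF i)]
  have h3 : ∀ᵐ t, ∀ i ∈ s, convFun (F i) (fun t => ∑ j ∈ s', G j t) t =
      ∑ j ∈ s', convFun (F i) (G j) t :=
    (Finset.eventually_all s).2 fun i _ => h2 i
  filter_upwards [conv_sum_left s hF hG', h3] with t h1 h3
  rw [h1]
  exact sum_congr rfl h3

lemma conv_congr_ae {G' : ℝ → ℂ} (hF : ∀ᵐ t, t < R → F t = F' t) (hG : ∀ᵐ t, t < R → G t = G' t)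
    (hFc : Causal F) (hF'c : Causal F') (hGc : Causal G) (hG'c : Causal G') (ht : t < R) :
    convFun F G t = convFun F' G' t := by
  rw [hFc.conv_cut hGc ht, hF'c.conv_cut hG'c ht]
  have h1 : ∀ {A B : ℝ → ℂ}, (∀ᵐ t, t < R → A t = B t) →
      (Iio R).indicator A =ᵐ[volume] (Iio R).indicator B := by
    intro A B h
    filter_upwards [h] with s hs
    by_cases h2 : s < R
    · simp [h2, hs h2]
    · simp [h2]
  have h2 := (quasiMeasurePreserving_sub_left (μ := volume) t).ae_eq_comp (h1 hG)
  refine integral_congr_ae ?_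
  filter_upwards [h1 hF, h2] with s hs hs'
  simp only [Function.comp_apply] at hs'
  rw [hs, hs']

lemma Loose.SP_eq_sum (h : Loose u) (m k : ℕ) :
    SP m u k = fun t => ∑ j ∈ Finset.range (k + 1), (primitive^[m * (k - j)] (u j)) t := by
  rw [← stairPrimitive_eq_SP h]; rfl

lemma sum_triangle {M : Type*} [AddCommMonoid M] {I : ℕ → ℕ → M} (h : ∀ i j, k + 1 ≤ i + j → I i j =
    0) :
    ∑ n ∈ Finset.range (k + 1), ∑ i ∈ Finset.range (n + 1), I i (n - i) = ∑ i ∈ Finset.range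
      (k + 1), ∑ j ∈ Finset.range (k + 1), I i j := by
  rw [Finset.sum_range_diag_flip]
  refine sum_congr rfl fun i _ => ?_
  refine Finset.sum_subset (Finset.range_mono (Nat.sub_le _ _)) fun j _ hj => h i j ?_
  rw [Finset.mem_range] at hj; omega

lemma loosePair_convFam (hu : Loose u) (hv : Loose v) (m k : ℕ) (hψ : IsTest ψ)
    (hs : tsupport ψ ⊆ Iio ((k : ℝ) + 1)) :
    loosePair m (convFam u v) (k + 1) ψ = ∫ t, iteratedDeriv (2 * m * k) ψ t * convFun (SP m u k)
      (SP m v k) t := by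
  set I : ℕ → ℕ → ℂ := fun i j =>
    (-1) ^ (m * (i + j)) * ∫ t, iteratedDeriv (m * (i + j)) ψ t * convFun (u i) (v j) t with hI
  have hint : ∀ (l : ℕ) {F : ℝ → ℂ}, Causal F → Integrable fun t => iteratedDeriv l ψ t * F t :=
    fun l F hF => hF.integrable_test hψ l
  have h1 : ∫ t, iteratedDeriv (2 * m * k) ψ t * convFun (SP m u k) (SP m v k) t =
      ∑ i ∈ Finset.range (k + 1), ∑ j ∈ Finset.range (k + 1), I i j := by
    rw [hu.SP_eq_sum, hv.SP_eq_sum]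
    have h2 := conv_sum_sum (Finset.range (k + 1)) (Finset.range (k + 1))
      (F := fun j => primitive^[m * (k - j)] (u j)) (G := fun j => primitive^[m * (k - j)] (v j))
      (fun i => (hu.causal i).primitive_iterate _) (fun i => (hv.causal i).primitive_iterate _)
    have h3 : ∀ᵐ t, iteratedDeriv (2 * m * k) ψ t * convFun
        (fun t => ∑ j ∈ Finset.range (k + 1), (primitive^[m * (k - j)] (u j)) t)
        (fun t => ∑ j ∈ Finset.range (k + 1), (primitive^[m * (k - j)] (v j)) t) t =
        ∑ i ∈ Finset.range (k + 1), ∑ j ∈ Finset.range (k + 1), iteratedDeriv (2 * m * k) ψ t *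
          convFun (primitive^[m * (k - i)] (u i)) (primitive^[m * (k - j)] (v j)) t := by
      filter_upwards [h2] with t ht
      rw [ht, mul_sum]
      exact sum_congr rfl fun i _ => mul_sum _ _ _
    rw [integral_congr_ae h3]
    have hc : ∀ i j, Causal (convFun (primitive^[m * (k - i)] (u i))
        (primitive^[m * (k - j)] (v j))) := fun i j =>
      ((hu.causal i).primitive_iterate _).conv ((hv.causal j).primitive_iterate _)
    rw [integral_finsetSum _ fun i _ => integrable_finsetSum _ fun j _ => hint _ (hc i j)]
    refine sum_congr rfl fun i hi => ?_
    rw [integral_finsetSum _ fun j _ => hint _ (hc i j)]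
    refine sum_congr rfl fun j hj => ?_
    have hi' : i ≤ k := mem_range_succ_iff.1 hi
    have hj' : j ≤ k := mem_range_succ_iff.1 hj
    obtain ⟨a, rfl⟩ := Nat.exists_eq_add_of_le hi'
    obtain ⟨b, hb⟩ := Nat.exists_eq_add_of_le hj'
    have e0 : i + a - j = b := by omega
    have e1 : 2 * m * (i + a) = (m * a + m * b) + m * (i + j) := by grind
    rw [e0, Nat.add_sub_cancel_left, e1, ← iteratedDeriv_add_index (m * a + m * b) (m * (i + j)),
      (hu.causal i).integral_conv_primitive (hv.causal j) (hψ.iteratedDeriv _).smooth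
        (hψ.iteratedDeriv _).compact, hI]
    simp only
    congr 1
    refine neg_one_pow_congr ?_
    rw [Nat.even_iff, Nat.even_iff]
    lia
  have hzero : ∀ i j, k + 1 ≤ i + j → I i j = 0 := by
    intro i j hij
    simp only [hI]
    rw [integral_eq_zero_of_disjoint (a := k + 1) (fun t ht => ?_) hs _, mul_zero]
    exact conv_eq_zero_of_support (hu.zero i) (hv.zero j) (ht.trans_le (by exact_mod_cast hij))
  rw [h1, loosePair]
  have h4 : ∀ n ∈ Finset.range (k + 1), (-1 : ℂ) ^ (m * n) *
      ∫ t, iteratedDeriv (m * n) ψ t * convFam u v n t =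
        ∑ i ∈ Finset.range (n + 1), I i (n - i) := by
    intro n _
    simp only [convFam, mul_sum]
    rw [integral_finsetSum _ fun i _ => hint _ ((hu.causal i).conv (hv.causal _)), mul_sum]
    refine sum_congr rfl fun i hi => ?_
    simp only [hI]
    rw [Nat.add_sub_cancel' (mem_range_succ_iff.1 hi)]
  rw [sum_congr rfl h4]
  exact sum_triangle hzero

lemma integral_congr_below (hs : tsupport ψ ⊆ Iio R) (h : ∀ᵐ t, t < R → F t = G t) (k : ℕ) :
    ∫ t, iteratedDeriv k ψ t * F t = ∫ t, iteratedDeriv k ψ t * G t := by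
  refine integral_congr_ae ?_
  filter_upwards [h] with t ht
  rcases lt_or_ge t R with h1 | h1
  · show _ * F t = _ * G t
    rw [ht h1]
  · simp [image_eq_zero_of_notMem_tsupport fun ht =>
      not_lt.2 h1 (hs (tsupport_iteratedDeriv_subset k ht))]

lemma IsLoose.congr_ae (hu : IsLoose m u T) (hv : Loose v) (h : ∀ n, u n =ᵐ[volume] v n) :
    IsLoose m v T := by
  refine ⟨hv, fun ψ hψ N hN => ?_⟩
  rw [hu.pair ψ hψ N hN, loosePair, loosePair]
  refine sum_congr rfl fun n _ => ?_
  congr 1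
  refine integral_congr_ae ?_
  filter_upwards [h n] with t ht
  rw [ht]

/-- `T ∈ 𝓓'_m`. -/
def IsStair (m : ℕ) (T : Dist) : Prop := ∃ u, IsLoose m u T

lemma IsStair.exists_decomp (h : IsStair m T) : ∃ Δ, IsStairDecomp m T Δ :=
  h.elim fun _ hu => ⟨_, hu.isStairDecomp_restair⟩

lemma isStair_of_stairNorm (h : stairNorm c m ν T < ⊤) : IsStair m T := (exists_isStairDecomp h).elim fun _ h => ⟨_, h.isLoose⟩

lemma isStair_zero (m : ℕ) : IsStair m 0 := ⟨_, isLoose_zero m⟩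

lemma IsStair.add (hT : IsStair m T) (hS : IsStair m S) : IsStair m (T + S) :=
  hT.elim fun _ hu => hS.elim fun _ hv => ⟨_, hu.add hv⟩

lemma IsStair.sub (hT : IsStair m T) (hS : IsStair m S) : IsStair m (T - S) :=
  hT.elim fun _ hu => hS.elim fun _ hv => ⟨_, hu.sub hv⟩

lemma IsStair.smul (hT : IsStair m T) (a : ℂ) : IsStair m (a • T) :=
  hT.elim fun _ hu => ⟨_, hu.smul a⟩

lemma IsStair.sum {ι : Type*} (s : Finset ι) {T : ι → Dist} (h : ∀ i ∈ s, IsStair m (T i)) :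
    IsStair m (∑ i ∈ s, T i) :=
  Finset.sum_induction T _ (fun _ _ h h' => h.add h') (isStair_zero m) h

lemma Causal.isStair (hF : Causal F) (m : ℕ) : IsStair m (Dist.ofFun F) :=
  ⟨_, hF.isLoose_level0 m⟩

lemma loosePair_convFam_decomp {Δ Δ' : ℕ → ℝ → ℂ} (h1 : IsStairDecomp m T Δ)
    (h2 : IsStairDecomp m S Δ') (hψ : IsTest ψ) (hs : tsupport ψ ⊆ Iio ((k : ℝ) + 1)) :
    loosePair m (convFam Δ Δ') (k + 1) ψ = (Dist.deriv^[2 * m * k]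
      (Dist.ofFun (convFun (stairPrimitive m Δ k) (stairPrimitive m Δ' k)))).cval ψ := by
  rw [loosePair_convFam h1.loose h2.loose m k hψ hs, stairPrimitive_eq_SP h1.loose,
    stairPrimitive_eq_SP h2.loose, cval_deriv_ofFun ((h1.loose.causal_SP m k).conv
      (h2.loose.causal_SP m k)).locOn hψ, mul_assoc 2, (even_two_mul _).neg_one_pow, one_mul]

lemma isLoose_of_isStairConv {U : Dist} (h : IsStairConv m T S U) (hu : IsLoose m u T)
    (hv : IsLoose m v S) : IsLoose m (convFam u v) U := by
  obtain ⟨Δ, Δ', h1, h2, hU⟩ := h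
  refine (hu.toLoose.convFam hv.toLoose).isLoose fun ψ hψ k hs => ?_
  rw [loosePair_convFam hu.toLoose hv.toLoose m k hψ hs, eqBelow_iff.1 (hU k) ψ hψ hs,
    ← loosePair_convFam_decomp h1 h2 hψ hs, loosePair_convFam h1.loose h2.loose m k hψ hs]
  refine integral_congr_below hs (.of_forall fun t ht => ?_) _
  exact conv_congr_ae (h1.isLoose.SP_ae_eq' hu k) (h2.isLoose.SP_ae_eq' hv k)
    (h1.loose.causal_SP m k) (hu.toLoose.causal_SP m k) (h2.loose.causal_SP m k)
    (hv.toLoose.causal_SP m k) ht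

lemma IsStair.isStairConv (hT : IsStair m T) (hS : IsStair m S) :
    IsStairConv m T S (stairConv m T S) := by
  obtain ⟨Δ, h1⟩ := hT.exists_decomp
  obtain ⟨Δ', h2⟩ := hS.exists_decomp
  obtain ⟨U, hU⟩ := (h1.loose.convFam h2.loose).exists_isLoose m
  refine Classical.epsilon_spec (p := IsStairConv m T S) ⟨U, Δ, Δ', h1, h2, fun k => ?_⟩
  refine eqBelow_iff.2 fun ψ hψ hs => ?_
  rw [hU.pair ψ hψ (k + 1) (by exact_mod_cast hs), loosePair_convFam_decomp h1 h2 hψ hs]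

lemma IsLoose.conv (hu : IsLoose m u T) (hv : IsLoose m v S) :
    IsLoose m (Staircase.convFam u v) (stairConv m T S) :=
  isLoose_of_isStairConv (IsStair.isStairConv ⟨u, hu⟩ ⟨v, hv⟩) hu hv

lemma IsStair.conv (hT : IsStair m T) (hS : IsStair m S) : IsStair m (stairConv m T S) :=
  hT.elim fun _ hu => hS.elim fun _ hv => ⟨_, hu.conv hv⟩

lemma EqBelow.conv (hT : IsStair m T) (hT' : IsStair m T') (hS : IsStair m S) (hS' : IsStair m S')
    (h : EqBelow (k + 1) T T') (h' : EqBelow (k + 1) S S') :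
    EqBelow (k + 1) (stairConv m T S) (stairConv m T' S') := by
  obtain ⟨u, hu⟩ := hT
  obtain ⟨u', hu'⟩ := hT'
  obtain ⟨v, hv⟩ := hS
  obtain ⟨v', hv'⟩ := hS'
  refine eqBelow_iff.2 fun ψ hψ hs => ?_
  have hs' : tsupport ψ ⊆ Iio (((k + 1 : ℕ)) : ℝ) := by exact_mod_cast hs
  rw [(hu.conv hv).pair ψ hψ (k + 1) hs', (hu'.conv hv').pair ψ hψ (k + 1) hs',
    loosePair_convFam hu.toLoose hv.toLoose m k hψ hs,
    loosePair_convFam hu'.toLoose hv'.toLoose m k hψ hs]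
  refine integral_congr_below hs (.of_forall fun t ht => ?_) _
  exact conv_congr_ae (hu.SP_ae_eq hu' (N := k + 1) (by exact_mod_cast h) k (Nat.lt_succ_self k))
    (hv.SP_ae_eq hv' (N := k + 1) (by exact_mod_cast h') k (Nat.lt_succ_self k))
    (hu.toLoose.causal_SP m k) (hu'.toLoose.causal_SP m k) (hv.toLoose.causal_SP m k)
    (hv'.toLoose.causal_SP m k) ht

lemma stairConv_comm (hT : IsStair m T) (hS : IsStair m S) : stairConv m T S = stairConv m S T := by
  obtain ⟨u, hu⟩ := hT
  obtain ⟨v, hv⟩ := hS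
  have h : convFam u v = convFam v u := by
    funext n t
    rw [convFam, convFam, ← Finset.sum_range_reflect]
    refine sum_congr rfl fun i hi => ?_
    have : i ≤ n := mem_range_succ_iff.1 hi
    rw [(hu.causal _).conv_comm (hv.causal _), show n + 1 - 1 - i = n - i by omega,
      Nat.sub_sub_self this]
  exact (hu.conv hv).unique (h ▸ hv.conv hu)

lemma stairConv_add_left (hT : IsStair m T) (hT' : IsStair m T') (hS : IsStair m S) :
    stairConv m (T + T') S = stairConv m T S + stairConv m T' S := by
  obtain ⟨u, hu⟩ := hT
  obtain ⟨u', hu'⟩ := hT'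
  obtain ⟨v, hv⟩ := hS
  refine IsLoose.unique (((hu.add hu').conv hv).congr_ae
    ((hu.conv hv).add (hu'.conv hv)).toLoose fun n => ?_) ((hu.conv hv).add (hu'.conv hv))
  have h : ∀ᵐ t, ∀ i ∈ Finset.range (n + 1), convFun (fun t => u i t + u' i t) (v (n - i)) t =
      convFun (u i) (v (n - i)) t + convFun (u' i) (v (n - i)) t :=
    (Finset.eventually_all _).2 fun i _ =>
      conv_add_left (hu.causal i) (hu'.causal i) (hv.causal (n - i))
  filter_upwards [h] with t ht
  rw [convFam, convFam, convFam, ← sum_add_distrib]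
  exact sum_congr rfl ht

lemma stairConv_smul_left (hT : IsStair m T) (hS : IsStair m S) (a : ℂ) :
    stairConv m (a • T) S = a • stairConv m T S := by
  obtain ⟨u, hu⟩ := hT
  obtain ⟨v, hv⟩ := hS
  refine IsLoose.unique ((hu.smul a).conv hv) ?_
  have h : convFam (fun n t => a * u n t) v = fun n t => a * convFam u v n t := by
    funext n t
    simp only [convFam, mul_sum]
    exact sum_congr rfl fun i _ => by rw [conv_const_mul_left]
  rw [h]
  exact (hu.conv hv).smul a

lemma stairConv_zero_left (hS : IsStair m S) : stairConv m 0 S = 0 := by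
  simpa using stairConv_smul_left (isStair_zero m) hS 0

lemma stairConv_add_right (hT : IsStair m T) (hS : IsStair m S) (hS' : IsStair m S') :
    stairConv m T (S + S') = stairConv m T S + stairConv m T S' := by
  rw [stairConv_comm hT (hS.add hS'), stairConv_add_left hS hS' hT, stairConv_comm hS hT,
    stairConv_comm hS' hT]

lemma stairConv_smul_right (hT : IsStair m T) (hS : IsStair m S) (a : ℂ) :
    stairConv m T (a • S) = a • stairConv m T S := by
  rw [stairConv_comm hT (hS.smul a), stairConv_smul_left hS hT, stairConv_comm hS hT]

lemma stairConv_sum_sum {ι κ : Type*} (s : Finset ι) (s' : Finset κ) {T : ι → Dist} {S : κ → Dist}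
    (hT : ∀ i, IsStair m (T i)) (hS : ∀ i, IsStair m (S i)) :
    stairConv m (∑ i ∈ s, T i) (∑ j ∈ s', S j) = ∑ i ∈ s, ∑ j ∈ s', stairConv m (T i) (S j) := by
  classical
  have h1 : ∀ i, stairConv m (T i) (∑ j ∈ s', S j) = ∑ j ∈ s', stairConv m (T i) (S j) := by
    intro i
    induction s' using cons_induction with
    | empty => simp [stairConv_comm (hT i) (isStair_zero m), stairConv_zero_left (hT i)]
    | cons j s' hj ih =>
      rw [sum_cons hj, stairConv_add_right (hT i) (hS j) (IsStair.sum _ fun i _ => hS i),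
        sum_cons hj, ih]
  have hS' : IsStair m (∑ j ∈ s', S j) := IsStair.sum _ fun i _ => hS i
  induction s using cons_induction with
  | empty => simp [stairConv_zero_left hS']
  | cons i s hi ih =>
    rw [sum_cons hi, stairConv_add_left (hT i) (IsStair.sum _ fun i _ => hT i) hS',
      sum_cons hi, ih, h1]

lemma ennreal_tsum_mul_tsum (A B : ℕ → ℝ≥0∞) : (∑' i, A i) * ∑' j, B j =
    ∑' n, ∑ i ∈ Finset.range (n + 1), A i * B (n - i) := by
  simp_rw [← Finset.Nat.sum_antidiagonal_eq_sum_range_succ fun i j => A i * B j]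
  rw [← ENNReal.tsum_mul_right]
  simp_rw [← ENNReal.tsum_mul_left]
  rw [← ENNReal.tsum_prod (f := fun i j => A i * B j),
    ← Finset.HasAntidiagonal.sigmaAntidiagonalEquivProd.tsum_eq, ENNReal.tsum_sigma']
  refine tsum_congr fun n => ?_
  exact Finset.tsum_subtype (Finset.HasAntidiagonal.antidiagonal n) fun p : ℕ × ℕ => A p.1 * B p.2

/-- The norm is submultiplicative. The weights of `looseSum` cost a factor `e^{1/2}` for each of the
two decompositions, which is compensated by `e < 3 < c`. -/
lemma stairNorm_conv_le (hc : 3 < c) (hν : m + 1 ≤ ν) (hT : IsStair m T) (hS : IsStair m S) :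
    stairNorm c m ν (stairConv m T S) ≤ stairNorm c m ν T * stairNorm c m ν S := by
  obtain ⟨Δ, h1⟩ := hT.exists_decomp
  obtain ⟨Δ', h2⟩ := hS.exists_decomp
  have hlow : ∀ {X : Dist} {Δ : ℕ → ℝ → ℂ}, IsStairDecomp m X Δ → ∀ i : ℕ,
      lap (ν - 1 / 2) (Δ i) ≤ ofReal (exp (1 / 2 * (i + 1))) * lap ν (Δ i) := by
    intro X Δ h i
    have := lap_le_of_support_le (F := Δ i) (μ := ν - 1 / 2) (ν := ν) (a := i + 1) (by linarith)
      (fun t ht => h.2.1 i t fun h' => absurd h'.2 (not_le.2 ht))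
    simpa using this
  set A : ℕ → ℝ≥0∞ := fun i => ofReal ν ^ (m * i) * lap ν (Δ i)
  set A' : ℕ → ℝ≥0∞ := fun i => ofReal ν ^ (m * i) * lap ν (Δ' i)
  have hterm : ∀ n : ℕ, ofReal ν ^ (m * n) * ofReal (exp (-(1 / 2) * n)) *
      lap (ν - 1 / 2) (convFam Δ Δ' n) ≤
      ofReal (exp 1) * ∑ i ∈ Finset.range (n + 1), A i * A' (n - i) := by
    intro n
    have h3 : lap (ν - 1 / 2) (convFam Δ Δ' n) ≤
        ∑ i ∈ Finset.range (n + 1), lap (ν - 1 / 2) (Δ i) * lap (ν - 1 / 2) (Δ' (n - i)) :=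
      (lap_finset_sum_le _ (fun i _ => ((h1.loose.causal i).conv (h2.loose.causal _)).aesm) _).trans
        (sum_le_sum fun i _ => (h1.loose.causal i).lap_conv_le (h2.loose.causal _) _)
    refine (mul_le_mul_right h3 _).trans ?_
    rw [mul_sum, mul_sum]
    refine sum_le_sum fun i hi => ?_
    have hi' : i ≤ n := mem_range_succ_iff.1 hi
    obtain ⟨j, rfl⟩ := Nat.exists_eq_add_of_le hi'
    rw [Nat.add_sub_cancel_left]
    refine (mul_le_mul_right (mul_le_mul' (hlow h1 i) (hlow h2 j)) _).trans (le_of_eq ?_)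
    have e1 : ofReal (exp (-(1 / 2) * (i + j : ℕ))) *
        (ofReal (exp (1 / 2 * (i + 1))) * ofReal (exp (1 / 2 * (j + 1))))
        = ofReal (exp 1) := by
      rw [← ofReal_mul (exp_nonneg _), ← ofReal_mul (exp_nonneg _),
        ← exp_add, ← exp_add]
      congr 2; push_cast; ring
    rw [← e1]
    simp only [A, A']
    rw [Nat.mul_add, pow_add]; ring
  calc stairNorm c m ν (stairConv m T S) ≤ c * looseSum m ν (convFam Δ Δ') :=
        (h1.isLoose.conv h2.isLoose).stairNorm_le hν
    _ ≤ c * (ofReal (exp 1) * ((∑' i, A i) * ∑' i, A' i)) := by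
        rw [ennreal_tsum_mul_tsum, ← ENNReal.tsum_mul_left]
        gcongr
        exact tsum_le_tsum hterm
    _ ≤ c * (c * ((∑' i, A i) * ∑' i, A' i)) := by
        gcongr
        refine ENNReal.ofReal_le_of_le_toReal ?_
        have h3 : (3 : ℝ) < c := by exact_mod_cast hc
        rw [ENNReal.coe_toReal]
        linarith [Real.exp_one_lt_d9]
    _ = _ := by rw [stairNorm_eq h1, stairNorm_eq h2]; simp only [stairSum, A, A']; ring

end

section

/-! ### Translation -/

variable {u Δ : ℕ → ℝ → ℂ} {j k m : ℕ} {T S : Dist}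

/-- The family that represents `[T(p - j)]^(mj)`. -/
def shiftFam (j : ℕ) (u : ℕ → ℝ → ℂ) : ℕ → ℝ → ℂ :=
  fun n t => if j ≤ n then u (n - j) (t - j) else 0

lemma Loose.shiftFam (h : Loose u) (j : ℕ) : Loose (shiftFam j u) := by
  refine ⟨fun n => ?_, fun n t ht => ?_⟩
  · by_cases hn : j ≤ n
    · have : Staircase.shiftFam j u n = fun t => u (n - j) (t - j) :=
        funext fun t => by simp [Staircase.shiftFam, hn]
      rw [this]
      exact ((h.causal (n - j)).translate (by positivity)).locInt
    · have : Staircase.shiftFam j u n = fun t => 0 :=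
        funext fun t => by simp [Staircase.shiftFam, hn]
      rw [this]
      exact causal_zero.locInt
  · simp only [Staircase.shiftFam]
    split_ifs with hn
    · refine h.zero _ _ ?_
      rw [Nat.cast_sub hn]; linarith
    · rfl

lemma SP_shiftFam_lt (m : ℕ) (hk : k < j) : SP m (shiftFam j u) k = fun _ => 0 := by
  induction k with
  | zero => funext t; simp [SP, shiftFam, hk.ne']
  | succ k ih =>
    funext t
    simp only [SP]
    rw [ih (by omega), primitive_iterate_zero]
    simp [shiftFam, hk]

lemma Loose.SP_shiftFam (h : Loose u) (m j k : ℕ) :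
    SP m (Staircase.shiftFam j u) (j + k) = fun t => SP m u k (t - j) := by
  induction k with
  | zero =>
    rcases Nat.eq_zero_or_pos j with rfl | hj
    · funext t; simp [SP, Staircase.shiftFam]
    · obtain ⟨i, rfl⟩ := Nat.exists_eq_succ_of_ne_zero hj.ne'
      funext t
      simp only [Nat.succ_eq_add_one, SP]
      rw [SP_shiftFam_lt m (Nat.lt_succ_self i), primitive_iterate_zero]
      simp [Staircase.shiftFam]
  | succ k ih =>
    funext t
    rw [← add_assoc]
    simp only [SP]
    rw [ih, primitive_iterate_translate (h.causal_SP m k) (by positivity)]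
    have : j ≤ j + k + 1 := by omega
    simp only [Staircase.shiftFam, this, if_true]
    rw [show j + k + 1 - j = k + 1 by omega]

/-- Translates of families which represent the same distribution represent the same
distribution. -/
lemma IsLoose.shiftFam_congr {v : ℕ → ℝ → ℂ} {U : Dist} (hu : IsLoose m u T) (hv : IsLoose m v T)
    (j : ℕ) (hU : IsLoose m (shiftFam j u) U) : IsLoose m (shiftFam j v) U := by
  refine hU.of_SP (hv.toLoose.shiftFam j) fun k => ?_
  rcases lt_or_ge k j with hk | hk
  · rw [SP_shiftFam_lt m hk, SP_shiftFam_lt m hk]; simp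
  · obtain ⟨i, rfl⟩ := Nat.exists_eq_add_of_le hk
    rw [hu.toLoose.SP_shiftFam, hv.toLoose.SP_shiftFam]
    have := (measurePreserving_sub_right volume (j : ℝ)).quasiMeasurePreserving.ae
      (hu.SP_ae_eq' hv i)
    filter_upwards [this] with t ht h1
    exact ht (by push_cast at h1; linarith)

lemma sum_shift_eq (h : Loose Δ) {ψ : ℝ → ℂ} (hψ : IsTest ψ) (hs : tsupport ψ ⊆ Iio ((k : ℝ) + 1)) :
    (∑ i ∈ Finset.range (k + 1), Dist.deriv^[m * (i + j)] (Dist.ofFun fun t => Δ i (t - j))).cval ψ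
      = loosePair m (shiftFam j Δ) (k + 1) ψ := by
  have h1 : loosePair m (shiftFam j Δ) (k + 1) ψ = loosePair m (shiftFam j Δ) (j + (k + 1)) ψ :=
    ((h.shiftFam j).pair_le m (by omega) (by exact_mod_cast hs)).symm
  rw [h1, loosePair, Finset.sum_range_add _ j, cval_sum]
  have h2 : ∑ n ∈ Finset.range j, (-1 : ℂ) ^ (m * n) *
      ∫ t, iteratedDeriv (m * n) ψ t * shiftFam j Δ n t = 0 := by
    refine sum_eq_zero fun n hn => ?_
    have : ¬ j ≤ n := not_le.2 (Finset.mem_range.1 hn)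
    simp [shiftFam, this]
  rw [h2, zero_add]
  refine sum_congr rfl fun i _ => ?_
  rw [cval_deriv_ofFun ((h.causal i).translate (by positivity)).locOn hψ, add_comm j i]
  simp [shiftFam]

lemma IsStair.isShiftDeriv (hT : IsStair m T) (j : ℕ) : IsShiftDeriv m j T (shiftDeriv m j T) := by
  obtain ⟨Δ, h⟩ := hT.exists_decomp
  obtain ⟨U, hU⟩ := (h.loose.shiftFam j).exists_isLoose m
  refine Classical.epsilon_spec (p := IsShiftDeriv m j T) ⟨U, Δ, h, fun k => ?_⟩
  refine eqBelow_iff.2 fun ψ hψ hs => ?_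
  rw [sum_shift_eq h.loose hψ hs, hU.pair ψ hψ (k + 1) (by exact_mod_cast hs)]

lemma IsLoose.shift (hu : IsLoose m u T) (j : ℕ) : IsLoose m (shiftFam j u) (shiftDeriv m j T) := by
  obtain ⟨Δ, h, hU⟩ := IsStair.isShiftDeriv ⟨u, hu⟩ j
  refine h.isLoose.shiftFam_congr hu j ((h.loose.shiftFam j).isLoose fun ψ hψ k hs => ?_)
  rw [eqBelow_iff.1 (hU k) ψ hψ hs, sum_shift_eq h.loose hψ hs]

lemma IsStair.shift (hT : IsStair m T) (j : ℕ) : IsStair m (shiftDeriv m j T) := hT.elim fun _ hu => ⟨_, hu.shift j⟩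

lemma shiftDeriv_zero_index (hT : IsStair m T) : shiftDeriv m 0 T = T := by
  obtain ⟨u, hu⟩ := hT
  have : shiftFam 0 u = u := by funext n t; simp [shiftFam]
  exact (hu.shift 0).unique (this.symm ▸ hu)

lemma shiftDeriv_add (hT : IsStair m T) (hS : IsStair m S) (j : ℕ) :
    shiftDeriv m j (T + S) = shiftDeriv m j T + shiftDeriv m j S := by
  obtain ⟨u, hu⟩ := hT
  obtain ⟨v, hv⟩ := hS
  refine ((hu.add hv).shift j).unique ?_
  convert (hu.shift j).add (hv.shift j) using 3 with n t
  simp only [shiftFam]; split_ifs <;> simp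

lemma shiftDeriv_smul (hT : IsStair m T) (a : ℂ) (j : ℕ) :
    shiftDeriv m j (a • T) = a • shiftDeriv m j T := by
  obtain ⟨u, hu⟩ := hT
  refine ((hu.smul a).shift j).unique ?_
  convert (hu.shift j).smul a using 3 with n t
  simp only [shiftFam]; split_ifs <;> simp

lemma shiftDeriv_zero (m j : ℕ) : shiftDeriv m j 0 = 0 := by
  refine ((isLoose_zero m).shift j).unique ?_
  convert isLoose_zero m using 3 with n t
  simp [shiftFam]

lemma shiftDeriv_sub (hT : IsStair m T) (hS : IsStair m S) (j : ℕ) :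
    shiftDeriv m j (T - S) = shiftDeriv m j T - shiftDeriv m j S := by
  rw [sub_eq_add_neg, ← Dist.neg_one_smul, shiftDeriv_add hT (hS.smul _), shiftDeriv_smul hS,
    Dist.neg_one_smul, ← sub_eq_add_neg]

lemma shiftDeriv_sum {ι : Type*} (s : Finset ι) {T : ι → Dist} (hT : ∀ i, IsStair m (T i)) (j : ℕ) :
    shiftDeriv m j (∑ i ∈ s, T i) = ∑ i ∈ s, shiftDeriv m j (T i) := by
  induction s using cons_induction with
  | empty => simp [shiftDeriv_zero]
  | cons i s hi ih =>
    rw [sum_cons hi, shiftDeriv_add (hT i) (IsStair.sum _ fun i _ => hT i), ih,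
      sum_cons hi]

lemma stairConv_shift (hT : IsStair m T) (hS : IsStair m S) (i j : ℕ) :
    stairConv m (shiftDeriv m i T) (shiftDeriv m j S) = shiftDeriv m (i + j) (stairConv m T S) := by
  obtain ⟨u, hu⟩ := hT
  obtain ⟨v, hv⟩ := hS
  refine ((hu.shift i).conv (hv.shift j)).unique ?_
  convert (hu.conv hv).shift (i + j) using 1
  have hconv : ∀ {F G : ℝ → ℂ}, Causal F → Causal G → ∀ t,
      convFun (fun t => F (t - i)) (fun t => G (t - j)) t = convFun F G (t - (i + j : ℕ)) := by
    intro F G hF hG t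
    rw [(hF.translate (by positivity)).conv_eq (hG.translate (by positivity)), hF.conv_eq hG,
      ← integral_sub_right_eq_self (fun s => F s * G (t - (i + j : ℕ) - s)) (i : ℝ)]
    congr 1; funext s; congr 2; push_cast; ring
  have hcz : ∀ (G : ℝ → ℂ) t, convFun (fun _ => 0) G t = 0 := fun G t => by simp [convFun]
  have hcz' : ∀ (F : ℝ → ℂ) t, convFun F (fun _ => 0) t = 0 := fun G t => by simp [convFun]
  have hlo : ∀ {w : ℕ → ℝ → ℂ} {a n : ℕ}, n < a → shiftFam a w n = fun _ => 0 :=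
    fun h => funext fun t => by simp [shiftFam, h]
  have hhi : ∀ {w : ℕ → ℝ → ℂ} {a n : ℕ}, shiftFam a w (a + n) = fun t => w n (t - a) :=
    funext fun t => by simp [shiftFam]
  funext n t
  simp only [convFam]
  rcases lt_or_ge n (i + j) with hn | hn
  · rw [show shiftFam (i + j) (convFam u v) n t = 0 by rw [hlo hn]]
    refine sum_eq_zero fun l hl => ?_
    have hl' := Finset.mem_range.1 hl
    rcases lt_or_ge l i with h1 | h1
    · rw [hlo h1, hcz]
    · rw [hlo (show n - l < j by omega), hcz']
  · obtain ⟨k, rfl⟩ := Nat.exists_eq_add_of_le hn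
    rw [hhi]
    simp only [convFam]
    rw [show i + j + k + 1 = i + ((k + 1) + j) by ring, Finset.sum_range_add,
      sum_eq_zero (s := Finset.range i) fun l hl => by
        rw [hlo (Finset.mem_range.1 hl), hcz], zero_add, Finset.sum_range_add,
      sum_eq_zero (s := Finset.range j) fun l hl => by
        have hl' := Finset.mem_range.1 hl
        rw [hlo (w := v) (show i + j + k - (i + (k + 1 + l)) < j by omega), hcz'], add_zero]
    refine sum_congr rfl fun l hl => ?_
    have hl' : l ≤ k := mem_range_succ_iff.1 hl
    rw [hhi, show i + j + k - (i + l) = j + (k - l) by omega, hhi,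
      hconv (hu.causal l) (hv.causal _)]

lemma EqBelow.shift (hT : IsStair m T) (hS : IsStair m S) (h : EqBelow (k + 1) T S) (j : ℕ) :
    EqBelow ((j + k : ℕ) + 1) (shiftDeriv m j T) (shiftDeriv m j S) := by
  obtain ⟨u, hu⟩ := hT
  obtain ⟨v, hv⟩ := hS
  refine eqBelow_iff.2 fun ψ hψ hs => ?_
  have hs' : tsupport ψ ⊆ Iio (((j + k + 1 : ℕ)) : ℝ) := by exact_mod_cast hs
  rw [(hu.shift j).pair ψ hψ _ hs', (hv.shift j).pair ψ hψ _ hs',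
    (hu.toLoose.shiftFam j).pair_SP m _ hψ, (hv.toLoose.shiftFam j).pair_SP m _ hψ,
    hu.toLoose.SP_shiftFam, hv.toLoose.SP_shiftFam]
  congr 1
  refine integral_congr_below hs ?_ _
  have := (measurePreserving_sub_right volume (j : ℝ)).quasiMeasurePreserving.ae
    (hu.SP_ae_eq hv (N := k + 1) (by exact_mod_cast h) k (Nat.lt_succ_self k))
  filter_upwards [this] with t ht h1
  exact ht (by push_cast at h1; linarith)

lemma shiftDeriv_eqBelow_zero (hT : IsStair m T) (j : ℕ) : EqBelow j (shiftDeriv m j T) 0 := by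
  obtain ⟨u, hu⟩ := hT
  refine eqBelow_iff.2 fun ψ hψ hs => ?_
  rw [(hu.shift j).pair ψ hψ j hs, cval_zero, loosePair]
  refine sum_eq_zero fun n hn => ?_
  have : ¬ j ≤ n := not_le.2 (Finset.mem_range.1 hn)
  simp [shiftFam, this]

lemma eqBelow_one_of_shift (hT : IsStair m T) (hS : IsStair m S)
    (h : EqBelow (j + 1) (shiftDeriv m j T) (shiftDeriv m j S)) : EqBelow 1 T S := by
  obtain ⟨u, hu⟩ := hT
  obtain ⟨v, hv⟩ := hS
  refine eqBelow_iff.2 fun ψ hψ hs => ?_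
  have hs' : tsupport ψ ⊆ Iio ((0 + 1 : ℕ) : ℝ) := by simpa using hs
  rw [hu.pair ψ hψ (0 + 1) hs', hv.pair ψ hψ (0 + 1) hs', hu.toLoose.pair_SP m 0 hψ,
    hv.toLoose.pair_SP m 0 hψ]
  congr 1
  refine integral_congr_below (R := 1) hs ?_ (m * 0)
  have h1 := (hu.shift j).SP_ae_eq (hv.shift j) (N := j + 1) (by exact_mod_cast h) j
    (Nat.lt_succ_self j)
  have h2 := hu.toLoose.SP_shiftFam m j 0
  have h3 := hv.toLoose.SP_shiftFam m j 0
  rw [add_zero] at h2 h3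
  rw [h2, h3] at h1
  have := (measurePreserving_add_right volume (j : ℝ)).quasiMeasurePreserving.ae h1
  filter_upwards [this] with t ht h1
  simpa using ht (by linarith)

lemma IsStairDecomp.shift (h : IsStairDecomp m T Δ) (j : ℕ) :
    IsStairDecomp m (shiftDeriv m j T) (shiftFam j Δ) := by
  refine (h.isLoose.shift j).isStairDecomp (fun i => ?_) (fun i t ht => ?_)
  · by_cases hn : j ≤ i
    · have : shiftFam j Δ i = fun t => Δ (i - j) (t - j) := funext fun t => by simp [shiftFam, hn]
      rw [this]
      exact (h.1 _).comp_sub_right _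
    · have : shiftFam j Δ i = fun t => 0 := funext fun t => by simp [shiftFam, hn]
      rw [this]; exact integrable_zero _ _ _
  · simp only [shiftFam]
    split_ifs with hn
    · refine h.2.1 _ _ fun h' => ht ?_
      rw [Nat.cast_sub hn] at h'
      exact ⟨by linarith [h'.1], by linarith [h'.2]⟩
    · rfl

lemma stairNorm_shift {c : ℝ≥0} {ν : ℝ} (hT : IsStair m T) (j : ℕ) :
    stairNorm c m ν (shiftDeriv m j T) = (ofReal ν ^ m * ofReal (exp (-ν))) ^ j
      * stairNorm c m ν T := by
  obtain ⟨Δ, h⟩ := hT.exists_decomp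
  have h1 : stairSum m ν (shiftFam j Δ) =
      (ofReal ν ^ m * ofReal (exp (-ν))) ^ j * stairSum m ν Δ := by
    have hsplit : stairSum m ν (shiftFam j Δ) = _ := (ENNReal.summable.sum_add_tsum_nat_add' (k := j)
      (f := fun i => ofReal ν ^ (m * i) * lap ν (shiftFam j Δ i))).symm
    rw [hsplit, sum_eq_zero, zero_add, stairSum, ← ENNReal.tsum_mul_left]
    · refine tsum_congr fun i => ?_
      have : shiftFam j Δ (i + j) = fun t => Δ i (t - j) := funext fun t => by simp [shiftFam]
      rw [this, lap_translate, mul_pow, ← ofReal_pow (exp_nonneg _),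
        ← Real.exp_nat_mul, mul_comm (j : ℝ), ← pow_mul, Nat.mul_add, pow_add]
      ring
    · intro i hi
      have : shiftFam j Δ i = fun t => 0 := funext fun t => by
        simp [shiftFam, not_le.2 (Finset.mem_range.1 hi)]
      rw [this, lap_zero, mul_zero]
  rw [stairNorm_eq h, stairNorm_eq (h.shift j), h1]; ring

end

section

/-! ### Sectors and rays -/

variable {z w : ℂ} {a t : ℝ}

/-- The sector between the real half line and the ray of argument `s * ψ`; the sign `s = ±1` tells
on which side of the real axis it lies. -/
def side (s ψ : ℝ) : Set ℂ := {z | 0 < s * z.arg ∧ s * z.arg < ψ}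

/-- The direction of argument `s * θ`. -/
abbrev dir (s θ : ℝ) : ℂ := Complex.exp ((s * θ : ℝ) * I)

/-- The point at distance `t` on the ray of argument `s * θ`. -/
def rayPt (s θ t : ℝ) : ℂ := t * dir s θ

/-- `s` is a sign, `1` or `-1`. -/
class IsSign (s : ℝ) : Prop where
  out : s = 1 ∨ s = -1

/-- `ψ` is the opening of a sector in a quadrant. -/
class IsAngle (ψ : ℝ) : Prop where
  pos : 0 < ψ
  le : ψ ≤ Real.pi / 2

instance : IsSign 1 := ⟨Or.inl rfl⟩

instance : IsSign (-1) := ⟨Or.inr rfl⟩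

instance {s : ℝ} [h : IsSign s] : IsSign (-s) := ⟨by rcases h.out with rfl | rfl <;> simp⟩

lemma upperSector_eq (ψ : ℝ) : upperSector ψ = side 1 ψ := by simp [upperSector, side]

lemma lowerSector_eq (ψ : ℝ) : lowerSector ψ = side (-1) (-ψ) := by
  ext z
  simp only [lowerSector, side, mem_ofPred_eq]
  constructor <;> rintro ⟨h1, h2⟩ <;> constructor <;> linarith

lemma mul_sin_of_sign {s : ℝ} [IsSign s] (x : ℝ) : s * sin x = sin (s * x) := by
  have hs : s = 1 ∨ s = -1 := IsSign.out
  rcases hs with rfl | rfl <;> simp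

lemma sign_mul_self {s : ℝ} [IsSign s] : s * s = 1 := by
  have hs : s = 1 ∨ s = -1 := IsSign.out
  rcases hs with rfl | rfl <;> norm_num

lemma mem_side_iff {s ψ : ℝ} [IsSign s] [IsAngle ψ] :
    z ∈ side s ψ ↔ 0 < s * z.im ∧ s * (z * Complex.exp ((-(s * ψ) : ℝ) * I)).im < 0 := by
  have hψ : 0 < ψ := IsAngle.pos
  have hψ' : ψ ≤ Real.pi / 2 := IsAngle.le
  have hs : s = 1 ∨ s = -1 := IsSign.out
  have hpi := Real.pi_pos
  rcases eq_or_ne z 0 with rfl | hz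
  · simp [side]
  have hr : 0 < ‖z‖ := norm_pos_iff.2 hz
  have him : s * z.im = ‖z‖ * sin (s * z.arg) := by
    rw [← mul_sin_of_sign, ← Complex.norm_mul_sin_arg z]; ring
  have him2 : s * (z * Complex.exp ((-(s * ψ) : ℝ) * I)).im =
      ‖z‖ * sin (s * z.arg - ψ) := by
    have h1 : (z * Complex.exp ((-(s * ψ) : ℝ) * I)).im =
        ‖z‖ * sin (z.arg + -(s * ψ)) := by
      conv_lhs => rw [← Complex.norm_mul_exp_arg_mul_I z]
      rw [mul_assoc, ← Complex.exp_add, ← add_mul, ← Complex.ofReal_add,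
        Complex.im_ofReal_mul, Complex.exp_ofReal_mul_I_im]
    rw [h1, show s * (‖z‖ * sin (z.arg + -(s * ψ))) =
      ‖z‖ * (s * sin (z.arg + -(s * ψ))) by ring, mul_sin_of_sign]
    congr 2
    rw [mul_add, mul_neg, ← mul_assoc, sign_mul_self]; ring
  rw [him, him2]
  have hmem := Complex.arg_mem_Ioc z
  have hub : s * z.arg ≤ Real.pi ∧ -Real.pi ≤ s * z.arg := by
    rcases hs with rfl | rfl
    · constructor <;> linarith [hmem.1, hmem.2]
    · constructor <;> linarith [hmem.1, hmem.2]
  simp only [side, mem_ofPred_eq]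
  constructor
  · rintro ⟨h1, h2⟩
    refine ⟨mul_pos hr (Real.sin_pos_of_pos_of_lt_pi h1 (by linarith)), ?_⟩
    exact mul_neg_of_pos_of_neg hr (Real.sin_neg_of_neg_of_neg_pi_lt (by linarith) (by linarith))
  · rintro ⟨h1, h2⟩
    have h3 : 0 < sin (s * z.arg) := (mul_pos_iff_of_pos_left hr).1 h1
    have h4 : sin (s * z.arg - ψ) < 0 := by nlinarith
    have h5 : 0 < s * z.arg := by
      by_contra hcon
      exact absurd h3 (not_lt.2 (Real.sin_nonpos_of_nonpos_of_neg_pi_le (not_lt.1 hcon) hub.2))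
    refine ⟨h5, ?_⟩
    by_contra hcon
    exact absurd h4 (not_lt.2 (Real.sin_nonneg_of_nonneg_of_le_pi (by linarith) (by linarith)))

variable {s ψ : ℝ} [IsSign s] [IsAngle ψ]

lemma isOpen_side : IsOpen (side s ψ) := by
  have : side s ψ = {z : ℂ | 0 < s * z.im} ∩
      {z : ℂ | s * (z * Complex.exp ((-(s * ψ) : ℝ) * I)).im < 0} := by
    ext z; exact mem_side_iff
  rw [this]
  refine (isOpen_lt continuous_const ?_).inter (isOpen_lt ?_ continuous_const) <;> fun_prop

lemma smul_add_smul_mem_side (hz : z ∈ side s ψ) (hw : w ∈ side s ψ) {b : ℝ} (ha : 0 ≤ a)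
    (hb : 0 ≤ b) (hab : 0 < a + b) : (a : ℂ) * z + b * w ∈ side s ψ := by
  rw [mem_side_iff] at *
  set e := Complex.exp ((-(s * ψ) : ℝ) * I)
  have e1 : s * ((a : ℂ) * z + b * w).im = a * (s * z.im) + b * (s * w.im) := by
    simp only [Complex.add_im, Complex.im_ofReal_mul]; ring
  have e2 : s * (((a : ℂ) * z + b * w) * e).im = a * (s * (z * e).im) + b * (s * (w * e).im) := by
    rw [add_mul, mul_assoc, mul_assoc, Complex.add_im, Complex.im_ofReal_mul, Complex.im_ofReal_mul]
    ring
  rw [e1, e2]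
  rcases ha.eq_or_lt with rfl | ha'
  · have hb' : 0 < b := by linarith
    constructor <;> nlinarith [mul_pos hb' hw.1, mul_pos_of_neg_of_neg (neg_lt_zero.2 hb') hw.2]
  · constructor <;>
      nlinarith [mul_pos ha' hz.1, mul_pos_of_neg_of_neg (neg_lt_zero.2 ha') hz.2,
        mul_nonneg hb hw.1.le, mul_nonneg hb (neg_nonneg.2 hw.2.le)]

lemma convex_side : Convex ℝ (side s ψ) := by
  intro z hz w hw a b ha hb hab
  simpa using smul_add_smul_mem_side hz hw ha hb (by linarith)

lemma add_mem_side (hz : z ∈ side s ψ) (hw : w ∈ side s ψ) : z + w ∈ side s ψ := by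
  simpa using smul_add_smul_mem_side hz hw zero_le_one zero_le_one (by norm_num)

lemma mul_mem_side (hz : z ∈ side s ψ) (ha : 0 < a) : (a : ℂ) * z ∈ side s ψ := by
  simpa using smul_add_smul_mem_side hz hz ha.le le_rfl (by linarith)

/-- The sectors are stable under translation to the right. -/
lemma add_ofReal_mem_side (hz : z ∈ side s ψ) (ha : 0 ≤ a) : z + a ∈ side s ψ := by
  have hψ' : ψ ≤ Real.pi / 2 := IsAngle.le
  have hψ : 0 < ψ := IsAngle.pos
  rw [mem_side_iff] at *
  have h1 : (a * Complex.exp ((-(s * ψ) : ℝ) * I)).im = -(a * sin (s * ψ)) := by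
    rw [Complex.im_ofReal_mul, Complex.exp_ofReal_mul_I_im, Real.sin_neg]; ring
  refine ⟨by simpa using hz.1, ?_⟩
  rw [add_mul, Complex.add_im, h1, mul_add]
  have h2 : s * -(a * sin (s * ψ)) = -(a * sin ψ) := by
    rw [show s * -(a * sin (s * ψ)) = -(a * (s * sin (s * ψ))) by ring,
      mul_sin_of_sign, ← mul_assoc, sign_mul_self, one_mul]
  have h3 : 0 ≤ sin ψ := Real.sin_nonneg_of_nonneg_of_le_pi hψ.le (by linarith [Real.pi_pos])
  rw [h2]
  nlinarith [mul_nonneg ha h3, hz.2]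

lemma rayPt_mem_side {θ : ℝ} (hθ : 0 < θ) (hθ' : θ < ψ) (ht : 0 < t) : rayPt s θ t ∈ side s ψ := by
  have hψ' : ψ ≤ Real.pi / 2 := IsAngle.le
  have hs : s = 1 ∨ s = -1 := IsSign.out
  have hpi := Real.pi_pos
  have h : (rayPt s θ t).arg = s * θ := by
    rw [rayPt, dir, Complex.arg_real_mul _ ht, Complex.arg_exp_mul_I, toIocMod_eq_self]
    rcases hs with rfl | rfl <;> constructor <;> linarith
  simp only [side, mem_ofPred_eq, h, ← mul_assoc, sign_mul_self, one_mul]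
  exact ⟨hθ, hθ'⟩

lemma exists_rayPt (hz : z ∈ side s ψ) : 0 < ‖z‖ ∧ z = rayPt s (s * z.arg) ‖z‖ := by
  have h0 : z ≠ 0 := by rintro rfl; simp [side] at hz
  refine ⟨norm_pos_iff.2 h0, ?_⟩
  rw [rayPt, dir, ← mul_assoc, sign_mul_self, one_mul, Complex.norm_mul_exp_arg_mul_I]

@[simp]
lemma norm_dir (s θ : ℝ) : ‖dir s θ‖ = 1 := norm_exp_ofReal_mul_I _

@[simp]
lemma enorm_dir (s θ : ℝ) : ‖dir s θ‖ₑ = 1 := by rw [← ofReal_norm, norm_dir, ofReal_one]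

lemma norm_rayPt (s θ : ℝ) (ht : 0 ≤ t) : ‖rayPt s θ t‖ = t := by
  rw [rayPt, norm_mul, norm_dir, mul_one, Complex.norm_real, Real.norm_of_nonneg ht]

lemma hasDerivAt_rayPt (s θ t : ℝ) :
    HasDerivAt (rayPt s θ) (dir s θ) t := by
  have := (Complex.ofRealCLM.hasDerivAt (x := t)).mul_const
    (dir s θ)
  rw [Complex.ofRealCLM_apply, Complex.ofReal_one, one_mul] at this
  exact this

lemma continuous_rayPt (s : ℝ) : Continuous fun p : ℝ × ℝ => rayPt s p.1 p.2 := by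
  unfold rayPt; fun_prop

lemma continuous_rayPt_right (s θ : ℝ) : Continuous (rayPt s θ) :=
  (continuous_rayPt s).comp (by fun_prop : Continuous fun t : ℝ => (θ, t))

lemma continuous_rayPt_left (s t : ℝ) : Continuous fun θ => rayPt s θ t :=
  (continuous_rayPt s).comp (by fun_prop : Continuous fun θ : ℝ => (θ, t))

@[simp]
lemma dir_zero (s : ℝ) : dir s 0 = 1 := by simp [dir]

@[simp]
lemma rayPt_zero (s t : ℝ) : rayPt s 0 t = t := by simp [rayPt]

lemma tendsto_rayPt_zero (s t : ℝ) : Tendsto (fun θ => rayPt s θ t) (𝓝[>] 0) (𝓝 t) := by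
  simpa using ((continuous_rayPt_left s t).tendsto 0).mono_left nhdsWithin_le_nhds

/-- The limits at the origin, along rays, of a primitive of `q` agree: otherwise the integral of
`|q|` over the sector between the rays would be at least that of a multiple of `1/t`. -/
lemma ray_limit_unique {q Q : ℂ → ℂ} {U : Set ℂ} {s r θ₁ θ₂ : ℝ} {C : ℝ≥0∞} (hr : 0 < r)
    (hθ : θ₁ ≤ θ₂) (hC : C < ⊤) (hU : ∀ t ∈ Ioo 0 r, ∀ θ ∈ Icc θ₁ θ₂, rayPt s θ t ∈ U)
    (hQ : ∀ z ∈ U, HasDerivAt Q (q z) z) (hq : ContinuousOn q U) [IsSign s] (hint : ∀ θ ∈ Icc θ₁ θ₂,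
    ∫⁻ t in Ioo 0 r, ‖q (rayPt s θ t)‖ₑ ≤ C) {L₁ L₂ : ℂ} (h1 : Tendsto (fun t => Q (rayPt s θ₁ t))
    (𝓝[>] 0) (𝓝 L₁)) (h2 : Tendsto (fun t => Q (rayPt s θ₂ t)) (𝓝[>] 0) (𝓝 L₂)) : L₁ = L₂ := by
  have hs : s = 1 ∨ s = -1 := IsSign.out
  by_contra hne
  set δ : ℝ := ‖L₂ - L₁‖ / 2 with hδ
  have hδ0 : 0 < δ := half_pos (norm_pos_iff.2 (sub_ne_zero.2 (Ne.symm hne)))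
  have hev : ∀ᶠ t in 𝓝[>] (0 : ℝ), δ < ‖Q (rayPt s θ₂ t) - Q (rayPt s θ₁ t)‖ :=
    ((h2.sub h1).norm).eventually (lt_mem_nhds (by rw [hδ]; linarith))
  obtain ⟨r', hr'0, hr'⟩ := (mem_nhdsGT_iff_exists_Ioo_subset).1 hev
  set ρ := min r r' with hρ
  have hρ0 : 0 < ρ := lt_min hr hr'0
  -- the increment of `Q` along the arc of radius `t` is at most `t ∫ |q| dθ`
  have harc : ∀ t ∈ Ioo 0 ρ, ofReal (δ * t⁻¹) ≤
      ∫⁻ θ in Icc θ₁ θ₂, ‖q (rayPt s θ t)‖ₑ := by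
    intro t ht
    have htr : t ∈ Ioo 0 r := ⟨ht.1, ht.2.trans_le (min_le_left _ _)⟩
    have hcont : ContinuousOn (fun θ => q (rayPt s θ t)) (Icc θ₁ θ₂) :=
      hq.comp (continuous_rayPt_left s t).continuousOn fun θ hθ => hU t htr θ hθ
    have hderiv : ∀ θ ∈ uIcc θ₁ θ₂, HasDerivAt (fun θ => Q (rayPt s θ t))
        (q (rayPt s θ t) * (rayPt s θ t * (s * I))) θ := by
      intro θ hθ'
      rw [uIcc_of_le hθ] at hθ'
      have h3 : HasDerivAt (fun θ : ℝ => rayPt s θ t) (rayPt s θ t * (s * I)) θ := by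
        have h4 : HasDerivAt (fun θ : ℝ => ((s * θ : ℝ) : ℂ) * I) (s * I) θ := by
          have := ((hasDerivAt_id θ).const_mul s).ofReal_comp.mul_const I
          simpa using this
        have := (h4.cexp).const_mul (t : ℂ)
        simpa [rayPt, dir, mul_assoc] using this
      exact (hQ _ (hU t htr θ hθ')).comp θ h3
    have hci : ContinuousOn (fun θ => q (rayPt s θ t) * (rayPt s θ t * (s * I)))
        (uIcc θ₁ θ₂) := by
      rw [uIcc_of_le hθ]
      exact hcont.mul ((continuous_rayPt_left s t).mul continuous_const).continuousOn
    have hftc := intervalIntegral.integral_eq_sub_of_hasDerivAt hderiv hci.intervalIntegrable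
    have h5 : δ < ‖∫ θ in θ₁..θ₂, q (rayPt s θ t) * (rayPt s θ t * (s * I))‖ := by
      rw [hftc]
      exact hr' ⟨ht.1, ht.2.trans_le (min_le_right _ _)⟩
    have h6 : ‖∫ θ in θ₁..θ₂, q (rayPt s θ t) * (rayPt s θ t * (s * I))‖ₑ ≤
        ofReal t * ∫⁻ θ in Icc θ₁ θ₂, ‖q (rayPt s θ t)‖ₑ := by
      rw [integral_of_le hθ, ← lintegral_const_mul' _ _ ofReal_ne_top,
        ← restrict_Ioc_eq_restrict_Icc]
      refine (enorm_integral_le_lintegral_enorm _).trans (lintegral_mono fun θ => le_of_eq ?_)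
      rw [enorm_mul, mul_comm, ← ofReal_norm (rayPt s θ t * _), norm_mul, norm_rayPt _ _ ht.1.le]
      congr 2
      rcases hs with rfl | rfl <;> simp
    have h7 : ofReal δ ≤ ofReal t * ∫⁻ θ in Icc θ₁ θ₂, ‖q (rayPt s θ t)‖ₑ := by
      refine le_trans ?_ h6
      rw [← ofReal_norm]
      exact ofReal_le_ofReal h5.le
    rw [ofReal_mul hδ0.le, ENNReal.ofReal_inv_of_pos ht.1, ← div_eq_mul_inv]
    exact ENNReal.div_le_of_le_mul' h7
  have hfin : ∫⁻ t in Ioo 0 ρ, ofReal (δ * t⁻¹) < ⊤ := by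
    calc ∫⁻ t in Ioo 0 ρ, ofReal (δ * t⁻¹)
        ≤ ∫⁻ t in Ioo 0 ρ, ∫⁻ θ in Icc θ₁ θ₂, ‖q (rayPt s θ t)‖ₑ :=
          setLIntegral_mono_ae' measurableSet_Ioo (.of_forall harc)
      _ = ∫⁻ θ in Icc θ₁ θ₂, ∫⁻ t in Ioo 0 ρ, ‖q (rayPt s θ t)‖ₑ := by
          refine lintegral_lintegral_swap ?_
          rw [Measure.prod_restrict]
          refine (ContinuousOn.aemeasurable ?_ (measurableSet_Ioo.prod measurableSet_Icc)).enorm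
          exact hq.comp ((continuous_rayPt s).comp
            (by fun_prop : Continuous fun p : ℝ × ℝ => (p.2, p.1))).continuousOn
            fun p hp => hU p.1 ⟨hp.1.1, hp.1.2.trans_le (min_le_left _ _)⟩ p.2 hp.2
      _ ≤ ∫⁻ _ in Icc θ₁ θ₂, C := by
          refine setLIntegral_mono_ae' measurableSet_Icc (.of_forall fun θ hθ => ?_)
          refine (lintegral_mono_set ?_).trans (hint θ hθ)
          exact Ioo_subset_Ioo_right (min_le_left _ _)
      _ < ⊤ := by
          rw [setLIntegral_const]
          exact mul_lt_top hC (by simp)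
  have hii : IntervalIntegrable (fun t : ℝ => t⁻¹) volume 0 ρ := by
    rw [intervalIntegrable_iff_integrableOn_Ioo_of_le hρ0.le]
    have h3 : IntegrableOn (fun t : ℝ => δ * t⁻¹) (Ioo 0 ρ) := by
      refine ⟨by fun_prop, ?_⟩
      rw [hasFiniteIntegral_iff_enorm]
      refine lt_of_le_of_lt (setLIntegral_mono_ae' measurableSet_Ioo
        (.of_forall fun t ht => ?_)) hfin
      rw [← ofReal_norm, Real.norm_of_nonneg (by have := ht.1; positivity)]
    have h4 := h3.const_mul δ⁻¹
    refine h4.congr (.of_forall fun t => ?_)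
    field_simp
  rw [intervalIntegrable_inv_iff] at hii
  rcases hii with h | h
  · exact hρ0.ne h
  · exact h left_mem_uIcc

end

section

/-! ### Boundary values and primitives along rays -/

variable {g : ℂ → ℂ} {F : ℝ → ℂ} {c : ℝ≥0} {m : ℕ} {ν θ₀ : ℝ} {D : Dist} {C : ℝ≥0∞} {u : ℕ → ℝ →
  ℂ}

/-- The restriction of `g` to the ray of argument `s * θ`, extended by zero. -/
def rayFun (g : ℂ → ℂ) (s θ : ℝ) : ℝ → ℂ := (Ioi (0 : ℝ)).indicator fun t => g (rayPt s θ t)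

lemma rayFun_of_pos (g : ℂ → ℂ) (s θ : ℝ) {t : ℝ} (ht : 0 < t) :
    rayFun g s θ t = g (rayPt s θ t) := by simp [rayFun, ht]

/-- The functions `rayFun g s θ` converge to `D` as `θ → 0+`. -/
structure RayLim (c : ℝ≥0) (m : ℕ) (ν s : ℝ) (g : ℂ → ℂ) (D : Dist) : Prop where
  fin : stairNorm c m ν D < ⊤
  lim : Tendsto (fun θ => stairNorm c m ν (Dist.ofFun (rayFun g s θ) - D)) (𝓝[>] 0) (𝓝 0)

variable {s ψ : ℝ} [IsSign s] [IsAngle ψ]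

lemma continuousOn_ray (hg : ContinuousOn g (side s ψ)) {θ : ℝ} (hθ : θ ∈ Ioo 0 ψ) :
    ContinuousOn (fun t => g (rayPt s θ t)) (Ioi 0) :=
  hg.comp (continuous_rayPt_right s θ).continuousOn
    fun _ ht => rayPt_mem_side hθ.1 hθ.2 ht

lemma locallyIntegrableOn_indicator (hF : ContinuousOn F (Ioi 0)) :
    LocallyIntegrableOn ((Ioi (0 : ℝ)).indicator F) (Ioi 0) :=
  (hF.congr fun t ht => by simp [mem_Ioi.1 ht]).locallyIntegrableOn measurableSet_Ioi

lemma ofFun_indicator (hF : ContinuousOn F (Ioi 0)) :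
    Dist.ofFun ((Ioi (0 : ℝ)).indicator F) = Dist.ofFun F := by
  simpa using ofFun_smul_congr (a := 1) (hF.locallyIntegrableOn measurableSet_Ioi)
    (G := (Ioi (0 : ℝ)).indicator F) fun t ht => by simp [show 0 < t from ht]

lemma rayFun_zero (s θ : ℝ) : rayFun (fun _ => 0) s θ = fun _ => 0 := by simp [rayFun]

lemma ofFun_zero : Dist.ofFun (fun _ => 0) = 0 := Dist.ext_cval fun φ hφ => by
  rw [cval_ofFun causal_zero.locOn hφ]; simp

lemma RayLim.zero (c : ℝ≥0) (m : ℕ) (ν s : ℝ) : RayLim c m ν s (fun _ => 0) 0 := by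
  refine ⟨by simp, ?_⟩
  simp_rw [rayFun_zero, ofFun_zero]
  simp

lemma hasRayLimit_iff {l : Filter ℝ} (hl : map (s * ·) (𝓝[>] 0) = l)
    (hg : ContinuousOn g (side s ψ)) : HasRayLimit c m ν l g D ↔ RayLim c m ν s g D := by
  subst hl
  have key : (fun θ => stairNorm c m ν (Dist.ofFun (rayFun g s θ) - D)) =ᶠ[𝓝[>] 0] fun θ =>
      stairNorm c m ν (Dist.ofFun (fun t => g (rayPt s θ t)) - D) := by
    filter_upwards [Ioo_mem_nhdsGT (IsAngle.pos (ψ := ψ))] with θ hθ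
    rw [rayFun, ofFun_indicator (continuousOn_ray hg hθ)]
  exact ⟨fun h => ⟨h.1, (tendsto_congr' key).2 (tendsto_map'_iff.1 h.2)⟩,
    fun h => ⟨h.1, tendsto_map'_iff.2 ((tendsto_congr' key).1 h.2)⟩⟩

lemma hasRayLimit_upper (hg : ContinuousOn g (side 1 ψ)) :
    HasRayLimit c m ν (𝓝[>] 0) g D ↔ RayLim c m ν 1 g D :=
  hasRayLimit_iff (by simp) hg

lemma hasRayLimit_lower (hg : ContinuousOn g (side (-1) ψ)) :
    HasRayLimit c m ν (𝓝[<] 0) g D ↔ RayLim c m ν (-1) g D :=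
  hasRayLimit_iff (by simp) hg

lemma causal_indicator (hF : LocallyIntegrableOn F (Ioi 0)) (h1 : IntegrableOn F (Ioo 0 1)) :
    Causal ((Ioi (0 : ℝ)).indicator F) := by
  refine ⟨locallyIntegrable_of_Iio fun R => ?_, fun t ht => by simp [not_lt.2 ht.le]⟩
  have h2 : IntegrableOn F (Icc (1 / 2) R) :=
    hF.integrableOn_compact_subset (fun t ht => lt_of_lt_of_le (by norm_num) ht.1) isCompact_Icc
  have h3 : IntegrableOn F (Iio R ∩ Ioi 0) := by
    refine (h1.union h2).mono_set fun t ht => ?_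
    rcases lt_or_ge t 1 with h | h
    · exact Or.inl ⟨ht.2, h⟩
    · exact Or.inr ⟨by linarith, ht.1.le⟩
  rw [IntegrableOn, integrable_indicator_iff measurableSet_Ioi, IntegrableOn,
    Measure.restrict_restrict measurableSet_Ioi, inter_comm]
  exact h3

/-- A function on the half line which defines a distribution in `𝓓'_m` is integrable at `0`; there
it is the first member of the staircase decomposition. -/
lemma IsStair.causal_indicator (hF : ContinuousOn F (Ioi 0)) {Δ : ℕ → ℝ → ℂ}
    (h : IsStairDecomp m (Dist.ofFun ((Ioi (0 : ℝ)).indicator F)) Δ) :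
    Causal ((Ioi (0 : ℝ)).indicator F) ∧ ∀ᵐ t, t ∈ Ioo (0 : ℝ) 1 → F t = Δ 0 t := by
  have hFl : LocallyIntegrableOn F (Ioi 0) := hF.locallyIntegrableOn measurableSet_Ioi
  have h1 : ∀ᵐ t, t ∈ Ioo (0 : ℝ) 1 → F t - Δ 0 t = 0 := by
    refine ae_eq_zero_of_integral_isTest
      ((hFl.mono_set Ioo_subset_Ioi_self).sub ((h.1 0).locallyIntegrable.locallyIntegrableOn _))
      fun ψ hψ hs => ?_
    have h2 := h.isLoose.pair ψ hψ 1 (by simpa using hs)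
    rw [ofFun_indicator hF, cval_ofFun hFl hψ] at h2
    simp only [loosePair, Finset.range_one, sum_singleton, mul_zero, pow_zero, one_mul,
      iteratedDeriv_zero] at h2
    simp_rw [mul_sub]
    rw [integral_sub (hψ.integrable_mul hFl) ((h.loose.causal 0).integrable_mul hψ.smooth.continuous hψ.compact), h2,
      sub_self]
  refine ⟨Staircase.causal_indicator hFl ?_, h1.mono fun t ht ht' => sub_eq_zero.1 (ht ht')⟩
  refine (h.1 0).integrableOn.congr_fun_ae ?_
  rw [EventuallyEq, ae_restrict_iff' measurableSet_Ioo]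
  exact h1.mono fun t ht ht' => (sub_eq_zero.1 (ht ht')).symm

/-- The norm controls the first member of a staircase decomposition. -/
lemma IsStairDecomp.lintegral_unit_le {T : Dist} {Δ : ℕ → ℝ → ℂ} (h : IsStairDecomp m T Δ)
    (hc : 1 ≤ c) (hν : 0 ≤ ν) :
    ∫⁻ t in Ioo 0 1, ‖Δ 0 t‖ₑ ≤ ofReal (exp ν) * stairNorm c m ν T := by
  calc _ ≤ ∫⁻ t in Ioo 0 1, ofReal (exp ν) * (ofReal (exp (-ν * t)) * ‖Δ 0 t‖ₑ) := by
        refine setLIntegral_mono_ae' measurableSet_Ioo (.of_forall fun t ht => ?_)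
        rw [← mul_assoc, ← ofReal_mul (exp_nonneg _), ← exp_add]
        refine le_mul_of_one_le_left zero_le ?_
        rw [ENNReal.one_le_ofReal, Real.one_le_exp_iff]
        nlinarith [ht.1, ht.2]
    _ ≤ ofReal (exp ν) * lap ν (Δ 0) := by
        rw [lintegral_const_mul' _ _ ofReal_ne_top]
        gcongr
        exact setLIntegral_le_lintegral _ _
    _ ≤ _ := by
        gcongr
        rw [stairNorm_eq h]
        refine le_trans ?_ (le_mul_of_one_le_left zero_le (by exact_mod_cast hc))
        refine le_trans ?_ (le_tsum 0)
        simp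

/-- The norm controls a function near the origin. -/
lemma causal_of_stairNorm_le (hc : 1 ≤ c) (hν : 1 ≤ ν) (hF : ContinuousOn F (Ioi 0)) (hC : C < ⊤)
    (h : stairNorm c m ν (Dist.ofFun ((Ioi (0 : ℝ)).indicator F)) ≤ C) :
    Causal ((Ioi (0 : ℝ)).indicator F) ∧ ∫⁻ t in Ioo 0 1, ‖F t‖ₑ ≤ ofReal (exp ν) *
      C := by
  obtain ⟨Δ, hΔ⟩ := exists_isStairDecomp (h.trans_lt hC)
  obtain ⟨h6, h7⟩ := IsStair.causal_indicator hF hΔ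
  refine ⟨h6, ?_⟩
  calc ∫⁻ t in Ioo 0 1, ‖F t‖ₑ = ∫⁻ t in Ioo 0 1, ‖Δ 0 t‖ₑ := by
        refine setLIntegral_congr_fun_ae measurableSet_Ioo (h7.mono fun t ht ht' => ?_)
        rw [ht ht']
    _ ≤ _ := (hΔ.lintegral_unit_le hc (zero_le_one.trans hν)).trans (by gcongr)

/-- On the rays close to the real axis, `g` is integrable at the origin, with a uniform bound. -/
def RayInt (s θ₀ : ℝ) (C : ℝ≥0∞) (g : ℂ → ℂ) : Prop :=
  ∀ θ ∈ Ioo 0 θ₀, Causal (rayFun g s θ) ∧ ∫⁻ t in Ioo 0 1, ‖g (rayPt s θ t)‖ₑ ≤ C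

lemma RayInt.mono {θ₁ : ℝ} {C' : ℝ≥0∞} (h : RayInt s θ₀ C g) (hθ : θ₁ ≤ θ₀) (hC : C ≤ C') :
    RayInt s θ₁ C' g :=
  fun θ h' => (h θ ⟨h'.1, h'.2.trans_le hθ⟩).imp_right hC.trans'

lemma RayLim.near_zero (hc : 1 ≤ c) (hν : 1 ≤ ν) (hg : ContinuousOn g (side s ψ))
    (h : RayLim c m ν s g D) :
    ∃ θ₀ ∈ Ioc 0 ψ, ∃ C < (⊤ : ℝ≥0∞), RayInt s θ₀ C g := by
  have hψ : 0 < ψ := IsAngle.pos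
  have hev := (h.lim.eventually (gt_mem_nhds one_pos)).and (Ioo_mem_nhdsGT hψ)
  obtain ⟨θ₁, h1, h2⟩ := (mem_nhdsGT_iff_exists_Ioo_subset).1 hev
  have hC : 1 + stairNorm c m ν D < ⊤ := ENNReal.add_lt_top.2 ⟨one_lt_top, h.fin⟩
  refine ⟨min θ₁ ψ, ⟨lt_min h1 hψ, min_le_right _ _⟩, ofReal (exp ν) * _,
    mul_lt_top ofReal_lt_top hC, fun θ hθ => ?_⟩
  obtain ⟨h3, h4⟩ := h2 ⟨hθ.1, hθ.2.trans_le (min_le_left _ _)⟩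
  exact causal_of_stairNorm_le hc hν (continuousOn_ray hg h4) hC
    ((stairNorm_le_sub_add _ _ _ _ D).trans (add_le_add h3.le le_rfl))

/-- A primitive of a function which is uniformly integrable near the origin along rays has a limit
at the origin, the same on all of them. -/
lemma exists_ray_limit {q Q : ℂ → ℂ} {U : Set ℂ} {r : ℝ} (hr : 0 < r) (hC : C < ⊤)
    (hU : ∀ θ ∈ Ioo 0 θ₀, ∀ t ∈ Ioo 0 r, rayPt s θ t ∈ U) (hQ : ∀ z ∈ U, HasDerivAt Q (q z) z)
    (hq : ContinuousOn q U) (hint : ∀ θ ∈ Ioo 0 θ₀, ∫⁻ t in Ioo 0 r, ‖q (rayPt s θ t)‖ₑ ≤ C) :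
    ∃ L, ∀ θ ∈ Ioo 0 θ₀, ∀ t > 0, (∀ x ∈ Ioc 0 t, rayPt s θ x ∈ U) →
      IntervalIntegrable (rayFun q s θ) volume 0 t →
      Q (rayPt s θ t) = L + dir s θ * primitive (rayFun q s θ) t := by
  have hlim : ∀ θ ∈ Ioo 0 θ₀, ∀ t > 0, (∀ x ∈ Ioc 0 t, rayPt s θ x ∈ U) →
      IntervalIntegrable (rayFun q s θ) volume 0 t → Tendsto (fun t => Q (rayPt s θ t)) (𝓝[>] 0)
      (𝓝 (Q (rayPt s θ t) - dir s θ * primitive (rayFun q s θ) t)) := by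
    intro θ hθ t ht hm hi
    have h1 : Tendsto (fun x => Q (rayPt s θ t) + dir s θ * ∫ u in t..x, rayFun q s θ u) (𝓝[>] 0)
        (𝓝 (Q (rayPt s θ t) + dir s θ * ∫ u in t..0, rayFun q s θ u)) := by
      refine .const_add _ (.const_mul _ (((intervalIntegral.continuousOn_primitive_interval' hi
        right_mem_uIcc) 0 left_mem_uIcc).mono_left ?_))
      rw [uIcc_of_le ht.le, ← nhdsWithin_Ioc_eq_nhdsGT ht]
      exact nhdsWithin_mono _ Ioc_subset_Icc_self
    rw [intervalIntegral.integral_symm, mul_neg, ← sub_eq_add_neg] at h1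
    refine h1.congr' ?_
    filter_upwards [Ioo_mem_nhdsGT ht] with x hx
    have hp : ∀ u ∈ uIcc t x, u ∈ Ioc 0 t := fun u hu => by
      rw [uIcc_of_ge hx.2.le] at hu; exact ⟨hx.1.trans_le hu.1, hu.2⟩
    have h2 : ∀ u ∈ uIcc t x, HasDerivAt (fun u => Q (rayPt s θ u)) (rayFun q s θ u * dir s θ) u := by
      intro u hu
      rw [rayFun_of_pos _ _ _ (hp u hu).1]
      exact (hQ _ (hm u (hp u hu))).comp u (hasDerivAt_rayPt s θ u)
    rw [mul_comm, ← intervalIntegral.integral_mul_const,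
      intervalIntegral.integral_eq_sub_of_hasDerivAt h2 ((hi.mono_set ?_).mul_const _)]
    · ring
    · rw [uIcc_of_le ht.le]; exact fun u hu => Ioc_subset_Icc_self (hp u hu)
  have huniq : ∀ θ ∈ Ioo 0 θ₀, ∀ θ' ∈ Ioo 0 θ₀, θ ≤ θ' → ∀ {L L' : ℂ},
      Tendsto (fun t => Q (rayPt s θ t)) (𝓝[>] 0) (𝓝 L) →
      Tendsto (fun t => Q (rayPt s θ' t)) (𝓝[>] 0) (𝓝 L') → L = L' := fun θ h θ' h' hle _ _ =>
    ray_limit_unique hr hle hC (fun t ht x hx => hU x ⟨h.1.trans_le hx.1, hx.2.trans_lt h'.2⟩ t ht)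
      hQ hq fun x hx => hint x ⟨h.1.trans_le hx.1, hx.2.trans_lt h'.2⟩
  by_cases h : ∃ θ ∈ Ioo 0 θ₀, ∃ L, Tendsto (fun t => Q (rayPt s θ t)) (𝓝[>] 0) (𝓝 L)
  · obtain ⟨θ', hθ', L, hL⟩ := h
    refine ⟨L, fun θ hθ t ht hm hi => ?_⟩
    rw [← sub_eq_iff_eq_add]
    rcases le_total θ θ' with h | h
    · exact huniq θ hθ θ' hθ' h (hlim θ hθ t ht hm hi) hL
    · exact (huniq θ' hθ' θ hθ h hL (hlim θ hθ t ht hm hi)).symm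
  · exact ⟨0, fun θ hθ t ht hm hi => (h ⟨θ, hθ, _, hlim θ hθ t ht hm hi⟩).elim⟩

lemma exists_ray_primitive (hg : DifferentiableOn ℂ g (side s ψ)) (hθ₀ : θ₀ ∈ Ioc 0 ψ) (hC : C < ⊤)
    (hF : RayInt s θ₀ C g) :
    ∃ Φ : ℂ → ℂ, (∀ z ∈ side s ψ, HasDerivAt Φ (g z) z) ∧ ∀ θ ∈ Ioo 0 θ₀, ∀ t > 0, Φ (rayPt s θ t) =
      dir s θ * primitive (rayFun g s θ) t := by
  obtain ⟨Φ, hΦ⟩ := convex_side.exists_forall_hasDerivWithinAt hg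
  have hΦ' : ∀ z ∈ side s ψ, HasDerivAt Φ (g z) z := fun z hz =>
    (hΦ z hz).hasDerivAt (isOpen_side.mem_nhds hz)
  have hmem : ∀ θ ∈ Ioo 0 θ₀, ∀ t > 0, rayPt s θ t ∈ side s ψ := fun θ hθ t ht =>
    rayPt_mem_side hθ.1 (hθ.2.trans_le hθ₀.2) ht
  obtain ⟨L, hL⟩ := exists_ray_limit one_pos hC (fun θ hθ t ht => hmem θ hθ t ht.1) hΦ'
    hg.continuousOn fun θ hθ => (hF θ hθ).2
  refine ⟨fun z => Φ z - L, fun z hz => (hΦ' z hz).sub_const _, fun θ hθ t ht => ?_⟩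
  rw [sub_eq_iff_eq_add', hL θ hθ t ht (fun x hx => hmem θ hθ x hx.1)
    ((hF θ hθ).1.intervalIntegrable _ _)]

lemma lintegral_primitive_le :
    ∫⁻ t in Ioo (0 : ℝ) 1, ‖primitive F t‖ₑ ≤ ∫⁻ t in Ioo (0 : ℝ) 1, ‖F t‖ₑ := by
  have h : ∀ t ∈ Ioo (0 : ℝ) 1, ‖primitive F t‖ₑ ≤ ∫⁻ t in Ioo (0 : ℝ) 1, ‖F t‖ₑ := by
    intro t ht
    rw [primitive, integral_of_le ht.1.le]
    refine (enorm_integral_le_lintegral_enorm _).trans (lintegral_mono_set fun x hx => ?_)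
    exact ⟨hx.1, hx.2.trans_lt ht.2⟩
  refine (setLIntegral_mono_ae' measurableSet_Ioo (.of_forall h)).trans ?_
  simp

/-- Iterated primitives which vanish at the origin. -/
lemma exists_ray_primitive_iterate (hg : DifferentiableOn ℂ g (side s ψ)) (hθ₀ : θ₀ ∈ Ioc 0 ψ)
    (hC : C < ⊤) (hF : RayInt s θ₀ C g) (M : ℕ) :
    ∃ Φ : ℂ → ℂ, DifferentiableOn ℂ Φ (side s ψ) ∧ (∀ z ∈ side s ψ, iteratedDeriv M Φ z = g z) ∧
      RayInt s θ₀ C Φ ∧ ∀ θ ∈ Ioo 0 θ₀, rayFun Φ s θ =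
        fun t => dir s θ ^ M * (primitive^[M] (rayFun g s θ)) t := by
  induction M with
  | zero => exact ⟨g, hg, fun z _ => by simp, hF, fun θ _ => by simp⟩
  | succ M ih =>
    obtain ⟨Φ, h1, h2, h3, h4⟩ := ih
    obtain ⟨Φ', h5, h6⟩ := exists_ray_primitive h1 hθ₀ hC h3
    have h7 : ∀ θ ∈ Ioo 0 θ₀, rayFun Φ' s θ = fun t => dir s θ * primitive (rayFun Φ s θ) t :=
      fun θ hθ => funext fun t => by
        by_cases ht : 0 < t
        · rw [rayFun_of_pos _ _ _ ht, h6 θ hθ t ht]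
        · rw [primitive_eq_zero le_rfl (h3 θ hθ).1.zero (not_lt.1 ht)]
          simp [rayFun, ht]
    refine ⟨Φ', fun z hz => (h5 z hz).differentiableAt.differentiableWithinAt, fun z hz => ?_,
      fun θ hθ => ⟨by rw [h7 θ hθ]; exact (h3 θ hθ).1.primitive.const_mul _, ?_⟩, fun θ hθ => ?_⟩
    · rw [iteratedDeriv_succ', ← h2 z hz]
      refine Filter.EventuallyEq.iteratedDeriv_eq M ?_
      filter_upwards [isOpen_side.mem_nhds hz] with w hw
      exact (h5 w hw).deriv
    · refine (le_of_eq ?_).trans ((lintegral_primitive_le (F := rayFun Φ s θ)).trans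
        ((le_of_eq ?_).trans (h3 θ hθ).2))
      · refine setLIntegral_congr_fun measurableSet_Ioo fun t ht => ?_
        rw [h6 θ hθ t ht.1, enorm_mul, enorm_dir, one_mul]
      · exact setLIntegral_congr_fun measurableSet_Ioo fun t ht => by rw [rayFun_of_pos _ _ _ ht.1]
    · rw [h7 θ hθ, h4 θ hθ, primitive_const_mul, iterate_succ_apply']
      funext t
      ring

lemma SP_level0 (m k : ℕ) (F : ℝ → ℂ) : SP m (level0 F) k = primitive^[m * k] F := by
  induction k with
  | zero => funext t; simp [SP, level0]
  | succ k ih =>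
    funext t
    simp only [SP]
    rw [ih, ← iterate_add_apply, Nat.mul_succ, add_comm (m * k)]
    simp [level0]

/-- The norm of `T` controls the primitive of order `mk + 1` on `(0, k+1)`. -/
lemma IsLoose.enorm_primitive_SP_le (hc : 1 ≤ c) (hν : 1 ≤ ν) {T : Dist} (hu : IsLoose m u T)
    (k : ℕ) {t : ℝ} (ht : t ≤ k + 1) :
    ‖primitive (SP m u k) t‖ₑ ≤ ofReal (exp (ν * (k + 1))) * stairNorm c m ν
      T := by
  have hΔ := hu.isStairDecomp_restair
  set Δ := restair m u
  have hν1 : 1 ≤ ofReal ν := by simpa using hν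
  have hcΔ := hΔ.loose.causal_SP m k
  rw [primitive_congr_ae (by positivity) (hu.SP_ae_eq' hΔ.isLoose k) ht]
  refine (hcΔ.enorm_primitive_le (ν := ν) (by linarith) t).trans ?_
  gcongr
  calc lap ν (SP m Δ k) ≤ ofReal ν ^ (m * k) * lap ν (SP m Δ k) :=
        le_mul_of_one_le_left zero_le (one_le_pow₀ hν1)
    _ ≤ stairSum m ν Δ := hΔ.loose.lap_SP_le (by linarith) k
    _ ≤ c * stairSum m ν Δ := le_mul_of_one_le_left zero_le (by exact_mod_cast hc)
    _ = _ := (stairNorm_eq hΔ ν).symm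

/-- A function with a boundary value has iterated primitives which extend continuously to the real
axis. -/
lemma RayLim.exists_boundary_primitive (hc : 1 ≤ c) (hν : 1 ≤ ν) (hg : DifferentiableOn ℂ g
    (side s ψ)) (h : RayLim c m ν s g D) (hu : IsLoose m u D) (k : ℕ) :
    ∃ Φ : ℂ → ℂ, DifferentiableOn ℂ Φ (side s ψ) ∧ (∀ z ∈ side s ψ, iteratedDeriv (m * k + 1) Φ
      z = g z) ∧ ∀ t ∈ Ioo (0 : ℝ) (k + 1), Tendsto Φ (𝓝[side s ψ] t)
      (𝓝 (primitive (SP m u k) t)) := by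
  obtain ⟨θ₀, hθ₀, C, hC, hθ⟩ := h.near_zero hc hν hg.continuousOn
  obtain ⟨Φ, h1, h2, -, h3⟩ := exists_ray_primitive_iterate hg hθ₀ hC hθ (m * k + 1)
  refine ⟨Φ, h1, h2, fun t₀ ht₀ => ?_⟩
  have hW := hu.toLoose.causal_SP m k
  set W := primitive (SP m u k)
  have harg : ContinuousAt Complex.arg (t₀ : ℂ) :=
    Complex.continuousAt_arg (Complex.mem_slitPlane_iff.2 (Or.inl (by simpa using ht₀.1)))
  have harg0 : Complex.arg (t₀ : ℂ) = 0 := Complex.arg_ofReal_of_nonneg ht₀.1.le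
  have hth : Tendsto (fun z : ℂ => s * z.arg) (𝓝[side s ψ] t₀) (𝓝[>] 0) := by
    refine tendsto_nhdsWithin_iff.2 ⟨?_, ?_⟩
    · have := (harg.tendsto.const_mul s).mono_left (nhdsWithin_le_nhds (s := side s ψ))
      rwa [harg0, mul_zero] at this
    · filter_upwards [self_mem_nhdsWithin] with z hz using hz.1
  have hnorm : Tendsto (fun z : ℂ => ‖z‖) (𝓝[side s ψ] t₀) (𝓝 t₀) := by
    simpa [abs_of_pos ht₀.1] using
      (continuous_norm.tendsto (t₀ : ℂ)).mono_left (nhdsWithin_le_nhds (s := side s ψ))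
  have hmain : Tendsto (fun z : ℂ => dir s (s * z.arg) ^ (m * k + 1) * W ‖z‖) (𝓝[side s ψ] t₀)
      (𝓝 (W t₀)) := by
    have h4 := (((by fun_prop : Continuous (dir s)).tendsto' 0 1 (dir_zero s)).comp
      (hth.mono_right nhdsWithin_le_nhds)).pow (m * k + 1)
    simpa using h4.mul ((hW.continuous_primitive.tendsto t₀).comp hnorm)
  -- the remainder is controlled by the distance of `g` from its boundary value
  have hrem : Tendsto (fun z : ℂ => ofReal (exp (ν * (k + 1))) *
      stairNorm c m ν (Dist.ofFun (rayFun g s (s * z.arg)) - D)) (𝓝[side s ψ] t₀) (𝓝 0) := by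
    simpa using ENNReal.Tendsto.const_mul (h.lim.comp hth) (Or.inr ofReal_ne_top)
  have hdiff : Tendsto (fun z : ℂ => Φ z - dir s (s * z.arg) ^ (m * k + 1) * W ‖z‖)
      (𝓝[side s ψ] t₀) (𝓝 0) := by
    rw [tendsto_zero_iff_enorm_tendsto_zero]
    refine tendsto_zero_of_le hrem ?_
    filter_upwards [self_mem_nhdsWithin, hnorm.eventually (gt_mem_nhds ht₀.2),
      hth (Ioo_mem_nhdsGT hθ₀.1)] with z hz hzn hzθ
    obtain ⟨hz0, hzr⟩ := exists_rayPt hz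
    set θ := s * z.arg
    have hF := (hθ θ hzθ).1
    rw [hzr, ← rayFun_of_pos Φ _ _ hz0, h3 θ hzθ, norm_rayPt _ _ (norm_nonneg z), ← mul_sub, enorm_mul, enorm_pow,
      enorm_dir, one_pow, one_mul, iterate_succ_apply']
    have h9 := ((hF.isLoose_level0 m).sub hu).enorm_primitive_SP_le hc hν k hzn.le
    rw [SP_add (hF.isLoose_level0 m).toLoose (hu.toLoose.const_mul (-1)), SP_const_mul, SP_level0,
      primitive_add (hF.primitive_iterate _) (hW.const_mul (-1)), primitive_const_mul] at h9
    simpa only [neg_one_mul, ← sub_eq_add_neg] using h9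
  simpa using hdiff.add hmain

end

section

/-! ### Continuation across the real axis -/

variable {f g g' : ℂ → ℂ} {z : ℂ} {j m : ℕ} {t ν : ℝ} {T D D' : Dist} {c : ℝ≥0}

lemma rectangle_integral_eq_zero {w : ℂ} (hc : ContinuousOn f (Complex.Rectangle z w))
    (hd : ∀ x ∈ Complex.Rectangle z w, x.im ≠ 0 → DifferentiableAt ℂ f x)
    (h0 : (0 : ℝ) ∉ Ioo (min z.im w.im) (max z.im w.im)) :
    (∫ x : ℝ in z.re..w.re, f (x + z.im * I)) - (∫ x : ℝ in z.re..w.re,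
      f (x + w.im * I)) + I • (∫ y : ℝ in z.im..w.im, f (w.re + y * I)) -
      I • (∫ y : ℝ in z.im..w.im, f (z.re + y * I)) = 0 := by
  refine Complex.integral_boundary_rect_eq_zero_of_continuousOn_of_differentiableOn f z w hc
    fun x hx => (hd x ?_ ?_).differentiableWithinAt
  · exact ⟨Ioo_subset_Icc_self hx.1, Ioo_subset_Icc_self hx.2⟩
  · intro h
    exact h0 (h ▸ hx.2)

/-- A continuous function which is holomorphic off the real axis is holomorphic. -/
lemma differentiableOn_of_off_real {V : Set ℂ} (hV : IsOpen V) (hc : ContinuousOn f V)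
    (hd : ∀ z ∈ V, z.im ≠ 0 → DifferentiableAt ℂ f z) : DifferentiableOn ℂ f V := by
  refine (Complex.isConservativeOn_and_continuousOn_iff_isDifferentiableOn hV).1 ⟨?_, hc⟩
  intro z w hzw
  rw [← add_eq_zero_iff_eq_neg, Complex.wedgeIntegral_add_wedgeIntegral_eq]
  have hc' := hc.mono hzw
  have hd' : ∀ x ∈ Complex.Rectangle z w, x.im ≠ 0 → DifferentiableAt ℂ f x :=
    fun x hx => hd x (hzw hx)
  by_cases h0 : (0 : ℝ) ∈ Ioo (min z.im w.im) (max z.im w.im)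
  swap; · exact rectangle_integral_eq_zero hc' hd' h0
  -- a rectangle that meets the real axis is cut along it
  have h0' : (0 : ℝ) ∈ uIcc z.im w.im := ⟨h0.1.le, h0.2.le⟩
  have hs1 : Complex.Rectangle z (w.re : ℂ) ⊆ Complex.Rectangle z w := fun x hx =>
    ⟨by simpa using hx.1, uIcc_subset_uIcc left_mem_uIcc h0' (by simpa using hx.2)⟩
  have hs2 : Complex.Rectangle (z.re : ℂ) w ⊆ Complex.Rectangle z w := fun x hx =>
    ⟨by simpa using hx.1, uIcc_subset_uIcc h0' right_mem_uIcc (by simpa using hx.2)⟩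
  have e1 := rectangle_integral_eq_zero (hc'.mono hs1) (fun x hx => hd' x (hs1 hx))
    (by rcases le_total z.im 0 with h | h <;> simp [h])
  have e2 := rectangle_integral_eq_zero (hc'.mono hs2) (fun x hx => hd' x (hs2 hx))
    (by rcases le_total w.im 0 with h | h <;> simp [h])
  simp only [Complex.ofReal_im, Complex.ofReal_re] at e1 e2
  have hvert : ∀ a ∈ uIcc z.re w.re, (∫ y : ℝ in z.im..0, f (a + y * I)) +
      (∫ y : ℝ in (0 : ℝ)..w.im, f (a + y * I)) =
      ∫ y : ℝ in z.im..w.im, f (a + y * I) := by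
    intro a ha
    have hcont : ContinuousOn (fun y : ℝ => f (a + y * I)) (uIcc z.im w.im) :=
      hc'.comp (by fun_prop) fun y hy => ⟨by simpa using ha, by simpa using hy⟩
    exact integral_add_adjacent_intervals
      (hcont.mono (uIcc_subset_uIcc left_mem_uIcc h0')).intervalIntegrable
      (hcont.mono (uIcc_subset_uIcc h0' right_mem_uIcc)).intervalIntegrable
  rw [← hvert _ left_mem_uIcc, ← hvert _ right_mem_uIcc, smul_add, smul_add]
  linear_combination e1 + e2

variable {s ψA ψB : ℝ} [IsSign s] [IsAngle ψA] [IsAngle ψB]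

lemma sign_arg_pos (h : 0 < s * z.im) : 0 < s * z.arg := by
  have hs : s = 1 ∨ s = -1 := IsSign.out
  rcases hs with rfl | rfl
  · simp only [one_mul] at *
    refine lt_of_le_of_ne (Complex.arg_nonneg_iff.2 h.le) fun h0 => ?_
    exact h.ne' (Complex.arg_eq_zero_iff.1 h0.symm).2
  · have : z.arg < 0 := Complex.arg_neg_iff.2 (by linarith)
    linarith

lemma eventually_mem_side (ht : 0 < t) : ∀ᶠ w in 𝓝 (t : ℂ), 0 < s * w.im → w ∈ side s ψB := by
  have hc : ContinuousAt (fun w : ℂ => s * w.arg) t :=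
    continuousAt_const.mul (Complex.continuousAt_arg (Complex.ofReal_mem_slitPlane.2 ht))
  filter_upwards [hc.eventually (gt_mem_nhds (by
    simpa [Complex.arg_ofReal_of_nonneg ht.le] using IsAngle.pos (ψ := ψB)))] with w hw h0
  exact ⟨sign_arg_pos h0, hw⟩

lemma isOpen_side_sub (j : ℕ) : IsOpen {z : ℂ | z - j ∈ side s ψB} :=
  isOpen_side.preimage (by fun_prop : Continuous fun z : ℂ => z - j)

lemma isOpen_crossing (j : ℕ) : IsOpen (crossing (side (-s) ψA) (side s ψB) j) := by
  rw [isOpen_iff_mem_nhds]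
  rintro z ((h | ⟨t, ht, rfl⟩) | h)
  · exact mem_of_superset (isOpen_side.mem_nhds h) fun w hw => Or.inl (Or.inl hw)
  · have h2 : Tendsto (fun w : ℂ => w - j) (𝓝 t) (𝓝 ((t - j : ℝ) : ℂ)) := by
      push_cast; exact (continuous_id.sub continuous_const).tendsto _
    filter_upwards [eventually_mem_side (s := -s) (ψB := ψA) ((Nat.cast_nonneg j).trans_lt ht.1),
      h2.eventually (eventually_mem_side (s := s) (ψB := ψB) (sub_pos.2 ht.1)),
      (isOpen_Ioo.preimage continuous_re).mem_nhds ht] with w h3 h4 h5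
    rcases lt_trichotomy (s * w.im) 0 with h | h | h
    · exact Or.inl (Or.inl (h3 (by linarith)))
    · refine Or.inl (Or.inr ⟨w.re, h5, Complex.ext rfl ?_⟩)
      rcases IsSign.out (s := s) with rfl | rfl <;> simp at h <;> simp [h]
    · exact Or.inr (h4 (by simpa using h))
  · exact mem_of_superset ((isOpen_side_sub j).mem_nhds h) fun w hw => Or.inr hw

lemma ofReal_mem_closure_side (ht : 0 < t) : (t : ℂ) ∈ closure (side s ψB) := by
  have hB : 0 < ψB := IsAngle.pos
  refine mem_closure_of_tendsto (tendsto_rayPt_zero s t) ?_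
  filter_upwards [Ioo_mem_nhdsGT hB] with θ hθ
  exact rayPt_mem_side hθ.1 hθ.2 ht

lemma isPreconnected_crossing (j : ℕ) : IsPreconnected (crossing (side (-s) ψA) (side s ψB) j) := by
  set seg := Complex.ofReal '' Ioo (j : ℝ) (j + 1) with hseg
  have hj : (0 : ℝ) ≤ j := Nat.cast_nonneg j
  have h1 : IsPreconnected (side (-s) ψA ∪ seg) := by
    refine convex_side.isPreconnected.subset_closure subset_union_left
      (union_subset subset_closure ?_)
    rintro _ ⟨t, ht, rfl⟩
    exact ofReal_mem_closure_side (hj.trans_lt ht.1)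
  have h2 : IsPreconnected (seg ∪ {z : ℂ | z - j ∈ side s ψB}) := by
    have h3 : IsPreconnected {z : ℂ | z - j ∈ side s ψB} := by
      have := ((convex_side (s := s) (ψ := ψB)).translate_preimage_right (-j)).isPreconnected
      simp only [neg_add_eq_sub] at this
      exact this
    rw [union_comm]
    refine h3.subset_closure subset_union_left (union_subset subset_closure ?_)
    rintro _ ⟨t, ht, rfl⟩
    have h4 := ofReal_mem_closure_side (s := s) (ψB := ψB) (sub_pos.2 ht.1)
    have h5 : MapsTo (fun z => z + (j : ℂ)) (side s ψB) {z : ℂ | z - j ∈ side s ψB} :=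
      fun z hz => by simpa using hz
    have h6 := h5.closure (by fun_prop : Continuous fun z => z + (j : ℂ)) h4
    simpa using h6
  have hmid : (((j : ℝ) + 1 / 2 : ℝ) : ℂ) ∈ seg := ⟨_, ⟨by linarith, by linarith⟩, rfl⟩
  have := IsPreconnected.union (((j : ℝ) + 1 / 2 : ℝ) : ℂ) (mem_union_right _ hmid)
    (mem_union_left _ hmid) h1 h2
  convert this using 1
  ext z
  simp only [crossing, mem_union, mem_ofPred_eq]
  tauto

lemma IsLoose.sum {ι : Type*} (S : Finset ι) {T : ι → Dist} {u : ι → ℕ → ℝ → ℂ}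
    (h : ∀ i, IsLoose m (u i) (T i)) : IsLoose m (fun n t => ∑ i ∈ S, u i n t) (∑ i ∈ S, T i) := by
  induction S using cons_induction with
  | empty => simpa using isLoose_zero m
  | cons i S hi ih => simp_rw [sum_cons hi]; exact (h i).add ih

lemma SP_zero (m k : ℕ) : SP m (fun _ _ => 0) k = fun _ => 0 := by
  have := SP_const_mul 0 (fun _ _ => 0) m k
  simpa using this

lemma SP_sum {ι : Type*} (S : Finset ι) {u : ι → ℕ → ℝ → ℂ} (h : ∀ i, Loose (u i)) (m k : ℕ) :
    SP m (fun n t => ∑ i ∈ S, u i n t) k = fun t => ∑ i ∈ S, SP m (u i) k t := by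
  induction S using cons_induction with
  | empty => simpa using SP_zero m k
  | cons i S hi ih =>
    simp_rw [sum_cons hi]
    have hl : Loose (fun n t => ∑ i ∈ S, u i n t) :=
      ⟨fun n => (Causal.finset_sum S fun i _ => (h i).causal n).locInt,
        fun n t ht => sum_eq_zero fun i _ => (h i).zero n t ht⟩
    rw [SP_add (h i) hl, ih]

/-- The boundary values of the iterated primitives of the two sides agree. -/
lemma boundary_primitive_eq {D : ℕ → Dist} {uT : ℕ → ℝ → ℂ} {u : ℕ → ℕ → ℝ → ℂ}
    (hT : IsLoose m uT T) (hD : ∀ i, IsLoose m (u i) (D i)) (hE : EqBelow (j + 1) T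
    (∑ i ∈ Finset.range (j + 1), shiftDeriv m i (D i))) (ht : t ≤ j + 1) :
    ∑ i ∈ Finset.range (j + 1), primitive (SP m (u i) (j - i)) (t - i) = primitive (SP m uT j) t := by
  have hv := IsLoose.sum (Finset.range (j + 1)) fun i => (hD i).shift i
  have h1 : SP m (fun n t => ∑ i ∈ Finset.range (j + 1), shiftFam i (u i) n t) j =
      fun t => ∑ i ∈ Finset.range (j + 1), SP m (u i) (j - i) (t - i) := by
    rw [SP_sum _ fun i => ((hD i).shift i).toLoose]
    funext t
    refine sum_congr rfl fun i hi => ?_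
    rw [← congrFun ((hD i).toLoose.SP_shiftFam m i (j - i)) t, Nat.add_sub_cancel' (mem_range_succ_iff.1 hi)]
  have h2 := hT.SP_ae_eq hv (N := j + 1) (by exact_mod_cast hE) j (Nat.lt_succ_self j)
  rw [primitive_congr_ae (by positivity) h2 ht, h1]
  have hc : ∀ i, Causal (fun t => SP m (u i) (j - i) (t - i)) := fun i =>
    ((hD i).toLoose.causal_SP m _).translate (Nat.cast_nonneg i)
  have h3 := primitive_iterate_sum (Finset.range (j + 1)) hc 1
  simp only [Function.iterate_one] at h3
  rw [h3]
  refine sum_congr rfl fun i _ => ?_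
  rw [primitive_translate ((hD i).toLoose.causal_SP m _) (Nat.cast_nonneg i)]

lemma iteratedDeriv_add_eq (a b : ℕ) :
    iteratedDeriv (a + b) f = iteratedDeriv a (iteratedDeriv b f) := by
  rw [iteratedDeriv_eq_iterate, iteratedDeriv_eq_iterate, iteratedDeriv_eq_iterate,
    iterate_add_apply]

/-- If the boundary value `T` of `f` from one side agrees on `(0, j+1)` with the sum of the
translates of the boundary values of the `g i` from the other side, then `f` continues across
`(j, j+1)`, and its continuation is the sum of the translates of the derivatives of the `g i`. The
iterated primitives of both sides fit together continuously. -/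
theorem exists_continuation (hc : 1 ≤ c) (hν : 1 ≤ ν) (hf : DifferentiableOn ℂ f (side (-s) ψA))
    (hT : RayLim c m ν (-s) f T) {g : ℕ → ℂ → ℂ} {D : ℕ → Dist} (hg : ∀ i, DifferentiableOn ℂ (g i)
    (side s ψB)) (hD : ∀ i, RayLim c m ν s (g i) (D i)) (j : ℕ) (hE : EqBelow (j + 1) T
    (∑ i ∈ Finset.range (j + 1), shiftDeriv m i (D i))) :
    ∃ b : ℂ → ℂ, AnalyticOnNhd ℂ b (crossing (side (-s) ψA) (side s ψB) j) ∧ EqOn b f (side (-s) ψA)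
      ∧ ∀ z : ℂ, z - j ∈ side s ψB → b z = ∑ i ∈ Finset.range (j + 1), iteratedDeriv (m * i) (g i)
      (z - i) := by
  obtain ⟨uT, huT⟩ := isStair_of_stairNorm hT.fin
  choose u hu using fun i => isStair_of_stairNorm (hD i).fin
  obtain ⟨ΦA, a1, a2, a3⟩ := hT.exists_boundary_primitive hc hν hf huT j
  choose Φ b1 b2 b3 using fun i => (hD i).exists_boundary_primitive hc hν (hg i) (hu i)
    (j - i)
  set A : Set ℂ := side (-s) ψA ∪ {z | z - j ∈ side s ψB} with hA
  have hAo : IsOpen A := isOpen_side.union (isOpen_side_sub j)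
  set ΘB : ℂ → ℂ := fun z => ∑ i ∈ Finset.range (j + 1), Φ i (z - i) with hΘB
  set Θ₀ : ℂ → ℂ := fun z => if 0 < s * z.im then ΘB z else ΦA z
  have eqB : EqOn Θ₀ ΘB {z | z - j ∈ side s ψB} := fun z hz =>
    if_pos (by simpa using (mem_side_iff.1 hz).1)
  have eqA : EqOn Θ₀ ΦA (side (-s) ψA) := fun z hz => if_neg (by linarith [(mem_side_iff.1 hz).1])
  -- translation by `j - i` keeps `z - i` in the sector
  have hmove : ∀ {z : ℂ}, z - j ∈ side s ψB → ∀ i ∈ Finset.range (j + 1), z - i ∈ side s ψB := by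
    intro z hz i hi
    have := add_ofReal_mem_side hz (a := (j - i : ℕ)) (Nat.cast_nonneg _)
    convert this using 1
    push_cast [Nat.cast_sub (mem_range_succ_iff.1 hi)]; ring
  have evA : ∀ z ∈ side (-s) ψA, Θ₀ =ᶠ[𝓝 z] ΦA := fun z hz =>
    eqA.eventuallyEq_of_mem (isOpen_side.mem_nhds hz)
  have evB : ∀ z : ℂ, z - j ∈ side s ψB → Θ₀ =ᶠ[𝓝 z] ΘB := fun z hz =>
    eqB.eventuallyEq_of_mem ((isOpen_side_sub j).mem_nhds hz)
  have hd : ∀ z ∈ A, DifferentiableAt ℂ Θ₀ z := by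
    rintro z (hz | hz)
    · exact (a1.differentiableAt (isOpen_side.mem_nhds hz)).congr_of_eventuallyEq (evA z hz)
    · refine DifferentiableAt.congr_of_eventuallyEq (DifferentiableAt.fun_sum fun i hi => ?_) (evB z hz)
      exact ((b1 i).differentiableAt (isOpen_side.mem_nhds (hmove hz i hi))).comp z
        (by fun_prop : DifferentiableAt ℂ (fun z : ℂ => z - i) z)
  have hl : ∀ z ∈ A, Tendsto Θ₀ (𝓝[A] z) (𝓝 (Θ₀ z)) := fun z hz =>
    (hd z hz).continuousAt.mono_left nhdsWithin_le_nhds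
  have hev : ∀ z ∈ A, extendFrom A Θ₀ =ᶠ[𝓝 z] Θ₀ := fun z hz => EqOn.eventuallyEq_of_mem
    (fun w hw => extendFrom_eq (subset_closure hw) (hl w hw)) (hAo.mem_nhds hz)
  have hdoff : ∀ z ∈ crossing (side (-s) ψA) (side s ψB) j, z.im ≠ 0 →
      DifferentiableAt ℂ (extendFrom A Θ₀) z := by
    intro z hz h0
    have hz : z ∈ A := by
      rcases hz with (hz | ⟨t, -, rfl⟩) | hz
      exacts [Or.inl hz, absurd (Complex.ofReal_im t) h0, Or.inr hz]
    exact (hd z hz).congr_of_eventuallyEq (hev z hz)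
  have hcont : ContinuousOn (extendFrom A Θ₀) (crossing (side (-s) ψA) (side s ψB) j) := by
    have h0 : ∀ t ∈ Ioo (j : ℝ) (j + 1), 0 < t := fun t ht => (Nat.cast_nonneg j).trans_lt ht.1
    refine continuousOn_extendFrom ?_ ?_
    · rintro z ((hz | ⟨t, ht, rfl⟩) | hz)
      exacts [subset_closure (Or.inl hz),
        closure_mono subset_union_left (ofReal_mem_closure_side (h0 t ht)),
        subset_closure (Or.inr hz)]
    rintro z ((hz | ⟨t, ht, rfl⟩) | hz)
    · exact ⟨_, hl z (Or.inl hz)⟩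
    · refine ⟨primitive (SP m uT j) t, ?_⟩
      rw [hA, nhdsWithin_union]
      refine Tendsto.sup ((a3 t ⟨h0 t ht, ht.2⟩).congr' eqA.symm.eventuallyEq_nhdsWithin)
        (Tendsto.congr' eqB.symm.eventuallyEq_nhdsWithin ?_)
      rw [← boundary_primitive_eq huT hu hE ht.2.le]
      refine tendsto_finsetSum _ fun i hi => ?_
      have hi' := mem_range_succ_iff.1 hi
      have hij : (i : ℝ) ≤ j := Nat.cast_le.2 hi'
      refine (b3 i (t - i) ⟨by linarith [ht.1], ?_⟩).comp (tendsto_nhdsWithin_iff.2 ⟨?_, ?_⟩)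
      · rw [Nat.cast_sub hi']; linarith [ht.2]
      · push_cast
        exact ((continuous_id.sub continuous_const).tendsto _).mono_left nhdsWithin_le_nhds
      · filter_upwards [self_mem_nhdsWithin] with w hw using hmove hw i hi
    · exact ⟨_, hl z (Or.inr hz)⟩
  have han := (differentiableOn_of_off_real (isOpen_crossing j) hcont hdoff).analyticOnNhd
    (isOpen_crossing j)
  refine ⟨iteratedDeriv (m * j + 1) (extendFrom A Θ₀), ?_, fun z hz => ?_, fun z hz => ?_⟩
  · rw [iteratedDeriv_eq_iterate]
    exact han.iterated_deriv _
  · rw [((hev z (Or.inl hz)).trans (evA z hz)).iteratedDeriv_eq, a2 z hz]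
  · rw [((hev z (Or.inr hz)).trans (evB z hz)).iteratedDeriv_eq, hΘB, iteratedDeriv_fun_sum]
    · refine sum_congr rfl fun i hi => ?_
      have e : m * j + 1 = m * i + (m * (j - i) + 1) := by
        rw [← add_assoc, ← mul_add, Nat.add_sub_cancel' (mem_range_succ_iff.1 hi)]
      rw [iteratedDeriv_comp_sub_const, e, iteratedDeriv_add_eq]
      refine Filter.EventuallyEq.iteratedDeriv_eq _ ?_
      filter_upwards [isOpen_side.mem_nhds (hmove hz i hi)] with w hw using b2 i w hw
    · exact fun i hi => ((b1 i).analyticOnNhd isOpen_side _ (hmove hz i hi)).contDiffAt.comp z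
        (by fun_prop)

/-- A function whose boundary value vanishes on `(0, 1)` is zero. -/
theorem eq_zero_of_rayLim (hc : 1 ≤ c) (hν : 1 ≤ ν) (hg : DifferentiableOn ℂ g (side s ψB))
    (hD : RayLim c m ν s g D) (h0 : EqBelow 1 D 0) : ∀ z ∈ side s ψB, g z = 0 := by
  obtain ⟨b, h1, h2, h3⟩ := exists_continuation hc hν (ψA := ψB) (T := 0) (f := fun _ => 0)
    (differentiableOn_const 0) (.zero c m ν _) (fun _ => hg) (fun _ => hD) 0 (by
      rw [zero_add, Finset.range_one, sum_singleton,
        shiftDeriv_zero_index (isStair_of_stairNorm hD.fin)]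
      exact fun φ hφ => by simpa using (h0 φ (by simpa using hφ)).symm)
  intro z hzB
  have h4 : z - (0 : ℕ) ∈ side s ψB := by simpa using hzB
  have hmem : rayPt (-s) (ψB / 2) 1 ∈ side (-s) ψB :=
    rayPt_mem_side (half_pos IsAngle.pos) (half_lt_self IsAngle.pos) one_pos
  have h5 := h1.eqOn_of_preconnected_of_eventuallyEq (analyticOnNhd_const (v := 0))
    (isPreconnected_crossing 0) (Or.inl (Or.inl hmem))
    (by filter_upwards [isOpen_side.mem_nhds hmem] with w hw
        exact h2 hw)
  have h6 := h3 z h4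
  simp at h6
  rw [← h6]
  exact h5 (Or.inr h4)

lemma continuousOn_rayFun (hg : ContinuousOn g (side s ψB)) {θ : ℝ} (hθ : θ ∈ Ioo 0 ψB) :
    LocallyIntegrableOn (rayFun g s θ) (Ioi 0) :=
  locallyIntegrableOn_indicator (continuousOn_ray hg hθ)

lemma ofFun_add {F G : ℝ → ℂ} (hF : LocallyIntegrableOn F (Ioi 0))
    (hG : LocallyIntegrableOn G (Ioi 0)) (a b : ℂ) : Dist.ofFun (fun t => a * F t + b * G t) =
      a • Dist.ofFun F + b • Dist.ofFun G := by
  refine Dist.ext_cval fun ψ hψ => ?_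
  have hl : ∀ {F : ℝ → ℂ} (a : ℂ), LocallyIntegrableOn F (Ioi 0) →
      LocallyIntegrableOn (fun t => a * F t) (Ioi 0) := fun a hF => hF.smul a
  have hadd : LocallyIntegrableOn (fun t => a * F t + b * G t) (Ioi 0) := (hl a hF).add (hl b hG)
  rw [cval_ofFun hadd hψ, cval_add, cval_smul, cval_smul, cval_ofFun hF hψ,
    cval_ofFun hG hψ, ← integral_const_mul, ← integral_const_mul,
    ← integral_add ((hψ.integrable_mul hF).const_mul a) ((hψ.integrable_mul hG).const_mul b)]
  congr 1; funext t; ring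

lemma RayLim.lin (hg : ContinuousOn g (side s ψB)) (hD : RayLim c m ν s g D)
    (hg' : ContinuousOn g' (side s ψB)) (hD' : RayLim c m ν s g' D') (a b : ℂ) :
    RayLim c m ν s (fun z => a * g z + b * g' z) (a • D + b • D') := by
  have hB : 0 < ψB := IsAngle.pos
  have hle : ∀ X Y : Dist, stairNorm c m ν (a • X + b • Y) ≤
      ‖a‖ₑ * stairNorm c m ν X + ‖b‖ₑ * stairNorm c m ν Y := fun X Y =>
    (stairNorm_add_le _ _ _ _ _).trans
      (add_le_add (stairNorm_smul_le _ _ _ _ _) (stairNorm_smul_le _ _ _ _ _))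
  refine ⟨(hle D D').trans_lt (ENNReal.add_lt_top.2 ⟨mul_lt_top enorm_lt_top hD.fin,
    mul_lt_top enorm_lt_top hD'.fin⟩), ?_⟩
  have h1 : Tendsto (fun θ => ‖a‖ₑ * stairNorm c m ν (Dist.ofFun (rayFun g s θ) - D) +
      ‖b‖ₑ * stairNorm c m ν (Dist.ofFun (rayFun g' s θ) - D')) (𝓝[>] 0) (𝓝 0) := by
    have h2 := ENNReal.Tendsto.const_mul hD.lim (Or.inr (enorm_ne_top (x := a)))
    have h3 := ENNReal.Tendsto.const_mul hD'.lim (Or.inr (enorm_ne_top (x := b)))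
    simpa using h2.add h3
  refine tendsto_zero_of_le h1 ?_
  filter_upwards [Ioo_mem_nhdsGT hB] with θ hθ
  refine le_trans (le_of_eq ?_) (hle _ _)
  have h4 : rayFun (fun z => a * g z + b * g' z) s θ =
      fun t => a * rayFun g s θ t + b * rayFun g' s θ t := by
    funext t; simp only [rayFun, indicator]; split_ifs <;> simp
  rw [h4, ofFun_add (continuousOn_rayFun hg hθ) (continuousOn_rayFun hg' hθ)]
  congr 1
  simp only [smul_sub]; abel

lemma RayLim.congr (h : RayLim c m ν s g D) (hgg : EqOn g g' (side s ψB)) :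
    RayLim c m ν s g' D := by
  have hB : 0 < ψB := IsAngle.pos
  refine ⟨h.fin, h.lim.congr' ?_⟩
  filter_upwards [Ioo_mem_nhdsGT hB] with θ hθ
  have : rayFun g s θ = rayFun g' s θ := by
    refine indicator_congr fun t ht => hgg (rayPt_mem_side hθ.1 hθ.2 ht)
  rw [this]

lemma RayLim.unique (hc : 1 ≤ c) (hν : 1 ≤ ν) (h : RayLim c m ν s g D) (h' : RayLim c m ν s g D') :
    D = D' :=
  stairNorm_limit_unique hc hν h.lim h'.lim

lemma eqOn_of_rayLim (hc : 1 ≤ c) (hν : 1 ≤ ν) (hg : DifferentiableOn ℂ g (side s ψB))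
    (hD : RayLim c m ν s g D) (hg' : DifferentiableOn ℂ g' (side s ψB)) (hD' : RayLim c m ν s g' D')
    (h0 : EqBelow 1 D D') : EqOn g g' (side s ψB) := by
  have hs : s = 1 ∨ s = -1 := IsSign.out
  have h1 := RayLim.lin hg.continuousOn hD hg'.continuousOn hD' 1 (-1)
  have h2 : DifferentiableOn ℂ (fun z => 1 * g z + -1 * g' z) (side s ψB) :=
    (hg.const_mul 1).add (hg'.const_mul (-1))
  intro z hz
  have h3 := eq_zero_of_rayLim hc hν h2 h1 (eqBelow_iff.2 fun φ hφ hs => by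
    rw [cval_add, cval_smul, cval_smul, eqBelow_iff.1 h0 φ hφ hs, cval_zero]; ring) z hz
  linear_combination h3

lemma eqBelow_sum_left {R : ℝ} {T S : ℕ → Dist} (h : ∀ i < j, T i = S i)
    (hE : EqBelow R (∑ i ∈ Finset.range (j + 1), T i) (∑ i ∈ Finset.range (j + 1), S i)) :
    EqBelow R (T j) (S j) := by
  rw [sum_range_succ, sum_range_succ,
    sum_congr rfl fun i hi => h i (Finset.mem_range.1 hi)] at hE
  refine eqBelow_iff.2 fun φ hφ hs => ?_
  have := eqBelow_iff.1 hE φ hφ hs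
  rwa [cval_add, cval_add, add_right_inj] at this

/-- The components are unique: if the first `j` of them are known then the relation on `(0, j+1)`
determines `D j` on `(0, 1)`, and hence the function of which it is the boundary value. -/
theorem components_unique (hc : 1 ≤ c) (hν : 1 ≤ ν) {g g' : ℕ → ℂ → ℂ} {D D' : ℕ → Dist} {k : ℕ}
    (hg : ∀ i ≤ k, DifferentiableOn ℂ (g i) (side s ψB)) (hD : ∀ i ≤ k, RayLim c m ν s (g i) (D i))
    (hg' : ∀ i ≤ k, DifferentiableOn ℂ (g' i) (side s ψB)) (hD' : ∀ i ≤ k, RayLim c m ν s (g' i)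
    (D' i)) (hE : ∀ j ≤ k, EqBelow (j + 1) (∑ i ∈ Finset.range (j + 1), shiftDeriv m i (D i))
    (∑ i ∈ Finset.range (j + 1), shiftDeriv m i (D' i))) : ∀ j ≤ k, D j = D' j := by
  intro j
  induction j using Nat.strong_induction_on with
  | _ j ih =>
    intro hj
    have h1 := eqBelow_sum_left (fun i hi => by rw [ih i hi (hi.le.trans hj)]) (hE j hj)
    have h2 := eqBelow_one_of_shift (isStair_of_stairNorm (hD j hj).fin)
      (isStair_of_stairNorm (hD' j hj).fin) h1
    have h3 := eqOn_of_rayLim hc hν (hg j hj) (hD j hj) (hg' j hj) (hD' j hj) h2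
    exact ((hD j hj).congr h3).unique hc hν (hD' j hj)

end

section

/-! ### Convolution of functions analytic in a sector -/

variable {f g : ℂ → ℂ} {C : ℝ≥0∞} {θ ε θ₀ : ℝ}

/-- An integral of holomorphic functions with an integrable weight is holomorphic. -/
lemma differentiableOn_integral {U : Set ℂ} (hU : IsOpen U) (hε : 0 ≤ ε) {φ : ℝ → ℂ}
    {k k' : ℝ → ℂ → ℂ} (hφ : IntervalIntegrable φ volume 0 ε)
    (hk : ∀ z ∈ U, ContinuousOn (fun x => k x z) (Icc 0 ε))
    (hk' : ContinuousOn (fun p : ℝ × ℂ => k' p.1 p.2) (Icc 0 ε ×ˢ U))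
    (hd : ∀ x ∈ Icc 0 ε, ∀ z ∈ U, HasDerivAt (k x) (k' x z) z) :
    DifferentiableOn ℂ (fun z => ∫ x in 0..ε, φ x * k x z) U := by
  intro z₀ hz₀
  obtain ⟨R, hR, hRU⟩ := nhds_basis_closedBall.mem_iff.1 (hU.mem_nhds hz₀)
  obtain ⟨B, hB⟩ := (isCompact_Icc.prod (isCompact_closedBall z₀ R)).exists_bound_of_continuousOn
    (hk'.mono (prod_mono_right hRU))
  have hI : ∀ {k : ℝ → ℂ}, ContinuousOn k (Icc 0 ε) →
      IntervalIntegrable (fun x => φ x * k x) volume 0 ε :=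
    fun hk => hφ.mul_continuousOn (by rwa [uIcc_of_le hε])
  have hu : ∀ {x}, x ∈ uIoc 0 ε → x ∈ Icc 0 ε := fun hx =>
    Ioc_subset_Icc_self (uIoc_of_le hε ▸ hx)
  refine (intervalIntegral.hasDerivAt_integral_of_dominated_loc_of_deriv_le
    (F' := fun z x => φ x * k' x z) (bound := fun x => ‖φ x‖ * B)
    (Metric.closedBall_mem_nhds z₀ hR) ?_ (hI (hk z₀ hz₀)) ?_ ?_ (hφ.norm.mul_const B)
    ?_).2.differentiableAt.differentiableWithinAt
  · filter_upwards [hU.mem_nhds hz₀] with z hz using (hI (hk z hz)).def'.1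
  · exact (hI (hk'.comp (f := fun x => (x, z₀)) (by fun_prop) fun x hx => ⟨hx, hz₀⟩)).def'.1
  · refine .of_forall fun x hx z hz => ?_
    rw [norm_mul]
    gcongr
    exact hB (x, z) ⟨hu hx, hz⟩
  · exact .of_forall fun x hx z hz => (hd x (hu hx) z (hRU hz)).const_mul _

variable {s ψ : ℝ} [IsSign s] [IsAngle ψ]

lemma rayPt_sub (s θ a b : ℝ) : rayPt s θ a - rayPt s θ b = rayPt s θ (a - b) := by
  simp only [rayPt]; push_cast; ring

lemma sub_rayPt_mem {z : ℂ} (hθ : θ ∈ Ioo 0 ψ) (hz : z - rayPt s θ ε ∈ side s ψ) {x : ℝ}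
    (hx : x ≤ ε) : z - rayPt s θ x ∈ side s ψ := by
  rcases hx.eq_or_lt with rfl | h
  · exact hz
  have h1 := add_mem_side hz (rayPt_mem_side hθ.1 hθ.2 (sub_pos.2 h))
  rw [← rayPt_sub] at h1
  convert h1 using 1; ring

/-- The integral of `f w * g (z - w)` along a segment from the origin, in terms of a primitive. -/
lemma exists_segment_eq (hf : ContinuousOn f (side s ψ)) (hg : ContinuousOn g (side s ψ))
    (hC : C < ⊤) (hθ₀ : θ₀ ∈ Ioc 0 ψ) (hF : RayInt s θ₀ C f) {z : ℂ} (hz : z ∈ side s ψ)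
    {Q : ℂ → ℂ} (hQ : ∀ w ∈ {w | w ∈ side s ψ ∧ z - w ∈ side s ψ},
    HasDerivAt Q (f w * g (z - w)) w) :
    ∃ L, ∀ θ ∈ Ioo 0 θ₀, ∀ ε > 0, z - rayPt s θ ε ∈ side s ψ → Q (rayPt s θ ε) = L +
      dir s θ * ∫ x in 0..ε, rayFun f s θ x * g (z - rayPt s θ x) := by
  obtain ⟨R, hR, hRU⟩ := nhds_basis_closedBall.mem_iff.1 (isOpen_side.mem_nhds hz)
  obtain ⟨B, hB⟩ := (isCompact_closedBall z R).exists_bound_of_continuousOn (hg.mono hRU)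
  have hm : ∀ θ ∈ Ioo 0 θ₀, θ ∈ Ioo 0 ψ := fun θ h => ⟨h.1, h.2.trans_le hθ₀.2⟩
  have hball : ∀ θ, ∀ t ∈ Ioo 0 (min R 1), z - rayPt s θ t ∈ closedBall z R := fun θ t ht => by
    rw [Metric.mem_closedBall, dist_eq_norm, sub_sub_cancel_left, norm_neg, norm_rayPt _ _ ht.1.le]
    exact ht.2.le.trans (min_le_left _ _)
  obtain ⟨L, hL⟩ := exists_ray_limit (s := s) (θ₀ := θ₀) (q := fun w => f w * g (z - w))
    (U := {w | w ∈ side s ψ ∧ z - w ∈ side s ψ}) (lt_min hR one_pos) (mul_lt_top hC (ofReal_lt_top (r := B)))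
    (fun θ hθ t ht => ⟨rayPt_mem_side hθ.1 (hm θ hθ).2 ht.1, hRU (hball θ t ht)⟩) hQ
    ((hf.mono fun w hw => hw.1).mul (hg.comp (f := fun w => z - w) (by fun_prop) fun w hw => hw.2))
    (fun θ hθ => by
      refine le_trans ?_ (mul_le_mul_left (hF θ hθ).2 _)
      rw [← lintegral_mul_const' _ _ ofReal_ne_top]
      refine (setLIntegral_mono' measurableSet_Ioo fun t ht => ?_).trans
        (lintegral_mono_set (Ioo_subset_Ioo_right (min_le_right R 1)))
      rw [enorm_mul]
      gcongr
      rw [← ofReal_norm]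
      exact ofReal_le_ofReal (hB _ (hball θ t ht)))
  have e : ∀ θ, rayFun (fun w => f w * g (z - w)) s θ =
      fun x => rayFun f s θ x * g (z - rayPt s θ x) := fun θ => by
    funext x; simp only [rayFun, indicator]; split_ifs <;> simp
  refine ⟨L, fun θ hθ ε hε hzε => ?_⟩
  rw [hL θ hθ ε hε (fun x hx => ⟨rayPt_mem_side hθ.1 (hm θ hθ).2 hx.1,
    sub_rayPt_mem (hm θ hθ) hzε hx.2⟩), e, primitive]
  rw [e]
  refine ((hF θ hθ).1.intervalIntegrable 0 ε).mul_continuousOn (hg.comp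
    (continuous_const.sub (continuous_rayPt_right s θ)).continuousOn fun x hx => ?_)
  rw [uIcc_of_le hε.le] at hx
  exact sub_rayPt_mem (hm θ hθ) hzε hx.2

/-- The identity theorem along a ray. -/
lemma eqOn_of_ray {U : Set ℂ} (hU : IsOpen U) (hU' : IsPreconnected U) {F G : ℂ → ℂ}
    (hF : DifferentiableOn ℂ F U) (hG : DifferentiableOn ℂ G U) {r : ℝ} (hr : rayPt s θ r ∈ U)
    (h : ∀ᶠ t in 𝓝 r, F (rayPt s θ t) = G (rayPt s θ t)) : EqOn F G U := by
  refine (hF.analyticOnNhd hU).eqOn_of_preconnected_of_frequently_eq (hG.analyticOnNhd hU) hU' hr ?_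
  have h1 : Tendsto (rayPt s θ) (𝓝[≠] r) (𝓝[≠] (rayPt s θ r)) := by
    refine tendsto_nhdsWithin_iff.2 ⟨((continuous_rayPt_right s θ).tendsto r).mono_left
      nhdsWithin_le_nhds, ?_⟩
    filter_upwards [self_mem_nhdsWithin] with t ht
    simp only [mem_compl_iff, mem_singleton_iff, rayPt, mul_eq_mul_right_iff, Complex.exp_ne_zero,
      or_false, Complex.ofReal_inj]
    exact ht
  exact h1.frequently (h.filter_mono nhdsWithin_le_nhds).frequently

lemma Causal.conv_eq_add_half {F G : ℝ → ℂ} (hF : Causal F) (hG : Causal G) {R t : ℝ}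
    (cF : ContinuousOn F (Ioo 0 R)) (cG : ContinuousOn G (Ioo 0 R)) (ht : t ∈ Ioo 0 R) :
    convFun F G t = (∫ x in 0..(t / 2), F x * G (t - x)) + ∫ x in 0..(t / 2), G x * F (t - x) := by
  have hi : ∀ {F G : ℝ → ℂ}, Causal F → ContinuousOn G (Ioo 0 R) →
      IntervalIntegrable (fun x => F x * G (t - x)) volume 0 (t / 2) := fun hF cG => by
    refine (hF.intervalIntegrable _ _).mul_continuousOn (cG.comp (by fun_prop) fun x hx => ?_)
    rw [uIcc_of_le (half_pos ht.1).le] at hx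
    exact ⟨by linarith [hx.2, ht.1], by linarith [hx.1, ht.2]⟩
  have h3 := (hi hG cF).comp_sub_left t
  have h4 := intervalIntegral.integral_comp_sub_left (a := t / 2) (b := t)
    (fun x => G x * F (t - x)) t
  simp only [sub_sub_cancel, sub_zero, sub_self, sub_half, mul_comm (G _)] at h3 h4
  rw [convFun, ← integral_add_adjacent_intervals (hi hF cG) h3.symm, h4]
  simp only [mul_comm (G _)]

/-- The convolution of two functions which are analytic in a sector and uniformly integrable near
the origin along the rays close to the real axis. At `z` it is the integral of `f w * g (z - w)`
over a path which starts and ends with a short segment on such a ray and is straight in between; it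
depends neither on the ray nor on the length of the segments. -/
theorem exists_conv (hf : DifferentiableOn ℂ f (side s ψ)) (hg : DifferentiableOn ℂ g (side s ψ))
    (hC : C < ⊤) (hθ₀ : θ₀ ∈ Ioc 0 ψ) (hF : RayInt s θ₀ C f) (hG : RayInt s θ₀ C g) :
    ∃ h : ℂ → ℂ, DifferentiableOn ℂ h (side s ψ) ∧ ∀ θ ∈ Ioo 0 θ₀, ∀ t > 0, h (rayPt s θ t) =
      dir s θ * convFun (rayFun f s θ) (rayFun g s θ) t := by
  have hm : ∀ θ ∈ Ioo 0 θ₀, θ ∈ Ioo 0 ψ := fun θ h => ⟨h.1, h.2.trans_le hθ₀.2⟩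
  have hfc := hf.continuousOn
  have hgc := hg.continuousOn
  set A : (ℂ → ℂ) → (ℂ → ℂ) → ℝ → ℝ → ℂ → ℂ := fun f g θ ε z =>
    ∫ x in 0..ε, rayFun f s θ x * g (z - rayPt s θ x) with hA
  set p : ℂ → ℝ → ℂ → ℂ := fun a y z => a + y * (z - 2 * a) with hp
  set k : ℂ → ℝ → ℂ → ℂ := fun a y z => f (p a y z) * g (z - p a y z) * (z - 2 * a) with hk
  have hP : ∀ {a z : ℂ} {y : ℝ}, y ∈ Icc (0 : ℝ) 1 → a ∈ side s ψ → z - a ∈ side s ψ →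
      p a y z ∈ side s ψ ∧ z - p a y z ∈ side s ψ := by
    intro a z y hy ha hz
    constructor
    · convert smul_add_smul_mem_side ha hz (sub_nonneg.2 hy.2) hy.1 (by simp) using 1
      push_cast; ring
    · convert smul_add_smul_mem_side ha hz hy.1 (sub_nonneg.2 hy.2) (by simp) using 1
      push_cast; ring
  have key : ∀ z ∈ side s ψ, ∃ L, ∀ θ ∈ Ioo 0 θ₀, ∀ ε > 0, z - rayPt s θ ε ∈ side s ψ →
      dir s θ * A f g θ ε z + (∫ y in (0 : ℝ)..1, k (rayPt s θ ε) y z) + dir s θ * A g f θ ε z = L := by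
    intro z hz
    have ho : IsOpen {w | w ∈ side s ψ ∧ z - w ∈ side s ψ} :=
      isOpen_side.inter (isOpen_side.preimage (by fun_prop : Continuous fun w => z - w))
    have hc : Convex ℝ {w | w ∈ side s ψ ∧ z - w ∈ side s ψ} := by
      intro x hx y hy a b ha hb hab
      refine ⟨convex_side hx.1 hy.1 ha hb hab, ?_⟩
      convert convex_side hx.2 hy.2 ha hb hab using 1
      rw [smul_sub, smul_sub, sub_add_sub_comm, ← add_smul, hab, one_smul]
    obtain ⟨Q, hQ⟩ := hc.exists_forall_hasDerivWithinAt
      (f := fun w => f w * g (z - w)) ((hf.mono fun w hw => hw.1).mul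
        (hg.comp (by fun_prop) fun w hw => hw.2))
    replace hQ := fun w hw => (hQ w hw).hasDerivAt (ho.mem_nhds hw)
    obtain ⟨L, hL⟩ := exists_segment_eq hfc hgc hC hθ₀ hF hz hQ
    obtain ⟨L', hL'⟩ := exists_segment_eq hgc hfc hC hθ₀ hG hz (Q := fun w => -Q (z - w))
      fun w hw => by
        have := (hQ (z - w) ⟨hw.2, by simpa using hw.1⟩).scomp w ((hasDerivAt_id w).const_sub z)
        exact this.neg.congr_deriv (by simp [mul_comm])
    refine ⟨-L - L', fun θ hθ ε hε hzε => ?_⟩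
    have ha := rayPt_mem_side (s := s) hθ.1 (hm θ hθ).2 hε
    have hd : ∀ y ∈ uIcc (0 : ℝ) 1, HasDerivAt (fun y : ℝ => Q (p (rayPt s θ ε) y z))
        (k (rayPt s θ ε) y z) y := by
      intro y hy
      rw [uIcc_of_le zero_le_one] at hy
      have h1 := (Complex.ofRealCLM.hasDerivAt.mul_const (z - 2 * rayPt s θ ε)).const_add
        (rayPt s θ ε) (x := y)
      simpa [hp, hk, Function.comp_def] using (hQ _ (hP hy ha hzε)).comp y h1
    have h1 := intervalIntegral.integral_eq_sub_of_hasDerivAt hd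
      (ContinuousOn.intervalIntegrable (by
        rw [uIcc_of_le zero_le_one]
        exact ((hfc.comp (by fun_prop) fun y hy => (hP hy ha hzε).1).mul
          (hgc.comp (by fun_prop) fun y hy => (hP hy ha hzε).2)).mul continuousOn_const))
    have h2 := hL θ hθ ε hε hzε
    have h3 := hL' θ hθ ε hε hzε
    have e1 : p (rayPt s θ ε) (1 : ℝ) z = z - rayPt s θ ε := by simp only [hp]; push_cast; ring
    have e2 : p (rayPt s θ ε) (0 : ℝ) z = rayPt s θ ε := by simp [hp]
    rw [h1, e1, e2]
    linear_combination -h2 - h3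
  choose! L hL using key
  refine ⟨L, fun z₀ hz₀ => ?_, fun θ hθ t ht => ?_⟩
  · have hθ : θ₀ / 2 ∈ Ioo 0 θ₀ := ⟨half_pos hθ₀.1, half_lt_self hθ₀.1⟩
    set θ := θ₀ / 2
    obtain ⟨ε, hzε, hε⟩ : ∃ ε, z₀ - rayPt s θ ε ∈ side s ψ ∧ 0 < ε := by
      have h1 : Tendsto (fun ε => z₀ - rayPt s θ ε) (𝓝[>] 0) (𝓝 (z₀ - rayPt s θ 0)) :=
        ((continuous_const.sub (continuous_rayPt_right s θ)).tendsto 0).mono_left nhdsWithin_le_nhds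
      rw [(by simp [rayPt] : z₀ - rayPt s θ 0 = z₀)] at h1
      exact ((h1.eventually (isOpen_side.mem_nhds hz₀)).and self_mem_nhdsWithin).exists
    set a := rayPt s θ ε with ha
    have haS : a ∈ side s ψ := rayPt_mem_side hθ.1 (hm θ hθ).2 hε
    have hUo : IsOpen {z | z - a ∈ side s ψ} :=
      isOpen_side.preimage (by fun_prop : Continuous fun z => z - a)
    have hdA : ∀ {f g : ℂ → ℂ}, DifferentiableOn ℂ g (side s ψ) → Causal (rayFun f s θ) →
        DifferentiableOn ℂ (A f g θ ε) {z | z - a ∈ side s ψ} := by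
      intro f g hg hF
      have hr := continuous_rayPt_right s θ
      refine differentiableOn_integral hUo hε.le (hF.intervalIntegrable 0 ε)
        (k' := fun x z => deriv g (z - rayPt s θ x)) (fun z hz => ?_) ?_ fun x hx z hz => ?_
      · exact hg.continuousOn.comp (by fun_prop) fun x hx => sub_rayPt_mem (hm θ hθ) hz hx.2
      · exact (hg.deriv isOpen_side).continuousOn.comp (by fun_prop)
          fun q hq => sub_rayPt_mem (hm θ hθ) hq.2 hq.1.2
      · exact ((hg.hasDerivAt (isOpen_side.mem_nhds
          (sub_rayPt_mem (hm θ hθ) hz hx.2))).comp_sub_const z _)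
    have hM : DifferentiableOn ℂ (fun z => ∫ y in (0 : ℝ)..1, 1 * k a y z)
        {z | z - a ∈ side s ψ} := by
      have c1 : ∀ {f : ℂ → ℂ} {q : ℝ × ℂ → ℂ}, ContinuousOn f (side s ψ) → Continuous q →
          (∀ y ∈ Icc (0 : ℝ) 1, ∀ z, z - a ∈ side s ψ → q (y, z) ∈ side s ψ) →
          ContinuousOn (fun x => f (q x)) (Icc 0 1 ×ˢ {z | z - a ∈ side s ψ}) :=
        fun hf hq h => hf.comp hq.continuousOn fun x hx => h x.1 hx.1 x.2 hx.2
      have q1 : Continuous fun x : ℝ × ℂ => p a x.1 x.2 := by fun_prop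
      have q2 : Continuous fun x : ℝ × ℂ => x.2 - p a x.1 x.2 := by fun_prop
      have p1 := fun (y : ℝ) (hy : y ∈ Icc (0 : ℝ) 1) (z : ℂ) hz => (hP hy haS (z := z) hz).1
      have p2 := fun (y : ℝ) (hy : y ∈ Icc (0 : ℝ) 1) (z : ℂ) hz => (hP hy haS (z := z) hz).2
      refine differentiableOn_integral hUo zero_le_one intervalIntegrable_const
        (k' := fun y z => (deriv f (p a y z) * y * g (z - p a y z) +
          f (p a y z) * (deriv g (z - p a y z) * (1 - y))) * (z - 2 * a) +
          f (p a y z) * g (z - p a y z)) (fun z hz => ?_) ?_ fun y hy z hz => ?_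
      · exact ((hfc.comp (by fun_prop) fun y hy => p1 y hy z hz).mul
          (hgc.comp (by fun_prop) fun y hy => p2 y hy z hz)).mul continuousOn_const
      · have cf := c1 hfc q1 p1
        have cg := c1 hgc q2 p2
        have cf' := c1 (hf.deriv isOpen_side).continuousOn q1 p1
        have cg' := c1 (hg.deriv isOpen_side).continuousOn q2 p2
        have hy : Continuous fun x : ℝ × ℂ => (x.1 : ℂ) := by fun_prop
        have hz : Continuous fun x : ℝ × ℂ => x.2 - 2 * a := by fun_prop
        exact ((((cf'.mul hy.continuousOn).mul cg).add (cf.mul (cg'.mul (continuous_const.sub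
          hy).continuousOn))).mul hz.continuousOn).add (cf.mul cg)
      · have d0 : HasDerivAt (fun z => a + y * (z - 2 * a)) y z := by
          simpa using (((hasDerivAt_id z).sub_const (2 * a)).const_mul (y : ℂ)).const_add a
        have d1 := (hf.hasDerivAt (isOpen_side.mem_nhds (p1 y hy z hz))).comp z d0
        have d2 := (hg.hasDerivAt (isOpen_side.mem_nhds (p2 y hy z hz))).comp z
          ((hasDerivAt_id z).sub d0)
        exact ((d1.mul d2).mul ((hasDerivAt_id z).sub_const (2 * a))).congr_deriv (by simp [p])
    refine (((((hdA hg (hF θ hθ).1).const_mul (dir s θ)).add hM).add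
      ((hdA hf (hG θ hθ).1).const_mul (dir s θ))).congr fun z hz => ?_).differentiableAt
        (hUo.mem_nhds hzε) |>.differentiableWithinAt
    simpa using (hL z (by simpa [ha] using add_mem_side hz haS) θ hθ ε hε hz).symm
  · have h2 : 0 < t / 2 := half_pos ht
    rw [← hL _ (rayPt_mem_side hθ.1 (hm θ hθ).2 ht) θ hθ _ h2 (by
      rw [rayPt_sub]; exact rayPt_mem_side hθ.1 (hm θ hθ).2 (by linarith))]
    have hr : ∀ {f g : ℂ → ℂ}, A f g θ (t / 2) (rayPt s θ t) =
        ∫ x in 0..(t / 2), rayFun f s θ x * rayFun g s θ (t - x) := fun {f g} =>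
      intervalIntegral.integral_congr fun x hx => by
        rw [uIcc_of_le h2.le] at hx
        rw [rayPt_sub, rayFun_of_pos g _ _ (by linarith [hx.2] : 0 < t - x)]
    have hc : ∀ {f : ℂ → ℂ}, ContinuousOn f (side s ψ) →
        ContinuousOn (rayFun f s θ) (Ioo 0 (t + 1)) := fun hf =>
      ((continuousOn_ray hf (hm θ hθ)).mono Ioo_subset_Ioi_self).congr
        fun t ht => rayFun_of_pos _ _ _ ht.1
    have h5 : rayPt s θ t - 2 * rayPt s θ (t / 2) = 0 := by
      simp only [rayPt]; push_cast; ring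
    simp only [hr, hk, h5, mul_zero, intervalIntegral.integral_zero, add_zero]
    rw [(hF θ hθ).1.conv_eq_add_half (hG θ hθ).1 (hc hfc) (hc hgc) ⟨ht, lt_add_one t⟩, mul_add]

lemma stairConv_ofFun {F G : ℝ → ℂ} (hF : Causal F) (hG : Causal G) (m : ℕ) :
    stairConv m (Dist.ofFun F) (Dist.ofFun G) = Dist.ofFun (convFun F G) := by
  have h1 := (hF.isLoose_level0 m).conv (hG.isLoose_level0 m)
  have h2 : convFam (level0 F) (level0 G) = level0 (convFun F G) := by
    funext n t
    rcases eq_or_ne n 0 with rfl | hn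
    · simp [convFam]
    · rw [level0_of_ne hn, convFam]
      refine sum_eq_zero fun i hi => ?_
      rcases eq_or_ne i 0 with rfl | hi0
      · simp [level0_of_ne hn, convFun]
      · simp [level0_of_ne hi0, convFun]
  rw [h2] at h1
  exact h1.unique ((hF.conv hG).isLoose_level0 m)

/-- The boundary value of a convolution is the convolution of the boundary values. -/
theorem RayLim.conv {c : ℝ≥0} (hc : 3 < c) {m : ℕ} {ν : ℝ} (hν : m + 1 ≤ ν) {h : ℂ → ℂ}
    {D D' : Dist} (hf : ContinuousOn f (side s ψ)) (hD : RayLim c m ν s f D)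
    (hg : ContinuousOn g (side s ψ)) (hD' : RayLim c m ν s g D') (hθ₀ : 0 < θ₀)
    (hh : ∀ θ ∈ Ioo 0 θ₀, ∀ t > 0, h (rayPt s θ t) = dir s θ * convFun
    (rayFun f s θ) (rayFun g s θ) t) : RayLim c m ν s h (stairConv m D D') := by
  have hc1 := one_le_of_three_lt hc
  have hν1 := one_le_of_succ_le hν
  have sD := isStair_of_stairNorm hD.fin
  have sD' := isStair_of_stairNorm hD'.fin
  obtain ⟨θ₁, hθ₁, C, -, hfc⟩ := hD.near_zero hc1 hν1 hf
  obtain ⟨θ₂, hθ₂, C', -, hgc⟩ := hD'.near_zero hc1 hν1 hg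
  set N := stairNorm c m ν with hN
  have hfin : N (stairConv m D D') < ⊤ :=
    (stairNorm_conv_le hc hν sD sD').trans_lt (mul_lt_top hD.fin hD'.fin)
  refine ⟨hfin, ?_⟩
  set A : ℝ → Dist := fun θ => Dist.ofFun (rayFun f s θ)
  set B : ℝ → Dist := fun θ => Dist.ofFun (rayFun g s θ)
  have hlim : Tendsto (fun θ => ‖dir s θ - 1‖ₑ * N (stairConv m D D') +
      (N (A θ - D) * (N (B θ - D') + N D') + N D * N (B θ - D'))) (𝓝[>] 0) (𝓝 0) := by
    have h1 : Tendsto (fun θ => ‖dir s θ - 1‖ₑ) (𝓝[>] 0) (𝓝 0) := by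
      have h2 : Continuous fun θ => ‖dir s θ - 1‖ₑ := by fun_prop
      have h3 := (h2.tendsto 0).mono_left (nhdsWithin_le_nhds (s := Ioi 0))
      simpa only [dir_zero, sub_self, enorm_zero] using h3
    have h4 := ENNReal.Tendsto.mul_const h1 (Or.inr hfin.ne)
    have h5 : Tendsto (fun θ => N (B θ - D') + N D') (𝓝[>] 0) (𝓝 (0 + N D')) :=
      hD'.lim.add tendsto_const_nhds
    have h6 := ENNReal.Tendsto.mul hD.lim (Or.inr (by simpa using hD'.fin.ne)) h5
      (Or.inr ENNReal.zero_ne_top)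
    have h7 := ENNReal.Tendsto.const_mul hD'.lim (Or.inr hD.fin.ne)
    simpa using h4.add (h6.add h7)
  refine tendsto_zero_of_le hlim ?_
  filter_upwards [Ioo_mem_nhdsGT hθ₀, Ioo_mem_nhdsGT hθ₁.1, Ioo_mem_nhdsGT hθ₂.1]
    with θ h0 h1 h2
  have cF := (hfc θ h1).1
  have cG := (hgc θ h2).1
  have sA := cF.isStair m
  have sB := cG.isStair m
  have e1 : Dist.ofFun (rayFun h s θ) = dir s θ • stairConv m (A θ) (B θ) := by
    rw [stairConv_ofFun cF cG]
    exact ofFun_smul_congr (cF.conv cG).locOn fun t ht => by rw [rayFun_of_pos _ _ _ ht, hh θ h0 t ht]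
  have e4 : Dist.ofFun (rayFun h s θ) - stairConv m D D' = (dir s θ - 1) • stairConv m D D' +
      dir s θ • (stairConv m (A θ - D) (B θ) + stairConv m D (B θ - D')) := by
    have h5 : A θ = (A θ - D) + D := by abel
    have h6 : B θ = (B θ - D') + D' := by abel
    have h7 : stairConv m (A θ) (B θ) = stairConv m (A θ - D) (B θ) +
        (stairConv m D (B θ - D') + stairConv m D D') := by
      rw [← stairConv_add_right sD (sB.sub sD') sD', ← h6, ← stairConv_add_left (sA.sub sD) sD sB,
        ← h5]
    rw [e1, h7]
    module
  rw [e4]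
  refine (stairNorm_add_le _ _ _ _ _).trans (add_le_add (stairNorm_smul_le _ _ _ _ _) ?_)
  refine (stairNorm_smul_le _ _ _ _ _).trans ?_
  rw [enorm_dir, one_mul]
  refine (stairNorm_add_le _ _ _ _ _).trans (add_le_add ?_ ?_)
  · refine (stairNorm_conv_le hc hν (sA.sub sD) sB).trans ?_
    gcongr
    exact stairNorm_le_sub_add _ _ _ _ _
  · exact stairNorm_conv_le hc hν sD (sB.sub sD')

end

section

/-! ### Decompositions -/

variable {ν R : ℝ} {f f' : ℂ → ℂ} {D D' : ℕ → Dist} {T S T' : Dist} {g : ℕ → ℂ → ℂ}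

/-- The decomposition of `f` relative to the continuations from the side `-s` of the real axis to
the side `s`: `T` is the boundary value of `f` from the side `-s`, and `D j` is that of the component
`g j` from the side `s`. The continuations themselves are not part of the data since they exist by
`exists_continuation`. -/
structure Components (c : ℝ≥0) (m : ℕ) (s ψA ψB : ℝ) (f : ℂ → ℂ) (T : Dist) (g : ℕ → ℂ → ℂ)
    (D : ℕ → Dist) : Prop where
  zero : g 0 = f
  diffA : DifferentiableOn ℂ f (side (-s) ψA)
  diffB : ∀ j, DifferentiableOn ℂ (g j) (side s ψB)
  limA : ∀ᶠ ν in atTop, RayLim c m ν (-s) f T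
  limB : ∀ᶠ ν in atTop, ∀ j, RayLim c m ν s (g j) (D j)
  rel : ∀ j : ℕ, EqBelow (j + 1) T (∑ i ∈ Finset.range (j + 1), shiftDeriv m i (D i))

/-- The distributions `D j` are the boundary values of the components of `f`. -/
def HasDecomp (c : ℝ≥0) (m : ℕ) (s ψA ψB : ℝ) (f : ℂ → ℂ) (D : ℕ → Dist) : Prop :=
  ∃ T g, Components c m s ψA ψB f T g D

variable {c : ℝ≥0} {m : ℕ} {s ψA ψB : ℝ} [IsSign s] [IsAngle ψA] [IsAngle ψB]

lemma isDecomposition_iff (hc : 1 ≤ c) {lA lB : Filter ℝ} (hlA : ∀ ν g D, ContinuousOn g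
    (side (-s) ψA) → (HasRayLimit c m ν lA g D ↔ RayLim c m ν (-s) g D)) (hlB : ∀ ν g D,
    ContinuousOn g (side s ψB) → (HasRayLimit c m ν lB g D ↔ RayLim c m ν s g D)) :
    IsDecomposition c m (side (-s) ψA) (side s ψB) lA lB f D ↔ HasDecomp c m s ψA ψB f D := by
  constructor
  · rintro ⟨g, T, h0, hg, hT, hD, hb, hrel⟩
    obtain ⟨b, hb1, hb2, -⟩ := hb 0
    have hfA : DifferentiableOn ℂ f (side (-s) ψA) :=
      (hb1.differentiableOn.mono fun z hz => Or.inl (Or.inl hz)).congr fun z hz => (hb2 hz).symm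
    refine ⟨T, g, h0, hfA, fun j => (hg j).differentiableOn, ?_, ?_, hrel⟩
    · filter_upwards [hT] with ν hν using (hlA ν f T hfA.continuousOn).1 hν
    · filter_upwards [hD] with ν hν j
      exact (hlB ν _ _ (hg j).differentiableOn.continuousOn).1 (hν j)
  · rintro ⟨T, g, h⟩
    refine ⟨g, T, h.zero, fun j => (h.diffB j).analyticOnNhd isOpen_side, ?_, ?_, ?_,
      h.rel⟩
    · filter_upwards [h.limA] with ν hν using (hlA ν f T h.diffA.continuousOn).2 hν
    · filter_upwards [h.limB] with ν hν j using (hlB ν _ _ (h.diffB j).continuousOn).2 (hν j)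
    · intro j
      obtain ⟨ν, hν, h1, h2⟩ := ((eventually_ge_succ m).and (h.limA.and h.limB)).exists
      exact exists_continuation hc (one_le_of_succ_le hν) h.diffA h1 h.diffB h2 j
        (h.rel j)

lemma isUpperDecomp_iff (hc : 1 ≤ c) :
    IsUpperDecomp c m (-ψA) ψB f D ↔ HasDecomp c m 1 ψA ψB f D := by
  rw [IsUpperDecomp, lowerSector_eq, upperSector_eq, neg_neg]
  exact isDecomposition_iff hc
    (fun ν g D hg => hasRayLimit_lower hg) (fun ν g D hg => hasRayLimit_upper hg)

lemma isLowerDecomp_iff (hc : 1 ≤ c) :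
    IsLowerDecomp c m (-ψB) ψA f D ↔ HasDecomp c m (-1) ψA ψB f D := by
  have := isDecomposition_iff (ψA := ψA) (ψB := ψB) (m := m) (lA := 𝓝[>] 0) (lB := 𝓝[<] 0) (f := f) (D := D) hc
    (s := -1)
    (fun ν g D hg => by rw [neg_neg] at hg ⊢; exact hasRayLimit_upper hg)
    (fun ν g D hg => hasRayLimit_lower hg)
  rw [neg_neg] at this
  rw [IsLowerDecomp, lowerSector_eq, upperSector_eq, neg_neg]
  exact this

lemma Components.isStairA (h : Components c m s ψA ψB f T g D) : IsStair m T := by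
  obtain ⟨ν, hν⟩ := h.limA.exists
  exact isStair_of_stairNorm hν.fin

lemma Components.isStair (h : Components c m s ψA ψB f T g D) (j : ℕ) : IsStair m (D j) := by
  obtain ⟨ν, hν⟩ := h.limB.exists
  exact isStair_of_stairNorm (hν j).fin

lemma HasDecomp.isStair (h : HasDecomp c m s ψA ψB f D) (j : ℕ) : IsStair m (D j) := by
  obtain ⟨T, g, h⟩ := h
  exact h.isStair j

lemma eqBelow_trans {U : Dist} (h : EqBelow R T S) (h' : EqBelow R S U) : EqBelow R T U := fun φ hφ => (h φ hφ).trans (h' φ hφ)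

lemma eqBelow_symm (h : EqBelow R T S) : EqBelow R S T :=
  fun φ hφ => (h φ hφ).symm

lemma HasDecomp.unique (hc : 1 ≤ c) (h : HasDecomp c m s ψA ψB f D) (h' : HasDecomp c m s ψA ψB f
    D') : D = D' := by
  obtain ⟨T, g, h⟩ := h
  obtain ⟨T', g', h'⟩ := h'
  obtain ⟨ν, hν, ⟨h1, h2⟩, h3, h4⟩ := ((eventually_ge_succ m).and ((h.limA.and h.limB).and
    (h'.limA.and h'.limB))).exists
  have hν1 := one_le_of_succ_le hν
  have hT : T = T' := h1.unique hc hν1 h3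
  exact funext fun k => components_unique hc hν1 (fun i _ => h.diffB i)
    (fun i _ => h2 i) (fun i _ => h'.diffB i) (fun i _ => h4 i)
    (fun j _ => eqBelow_trans (eqBelow_symm (h.rel j)) (hT ▸ h'.rel j)) k le_rfl

/-- The first component of a decomposition is the boundary value of `f`. -/
lemma HasDecomp.limB_zero (h : HasDecomp c m s ψA ψB f D) :
    DifferentiableOn ℂ f (side s ψB) ∧ ∀ᶠ ν in atTop, RayLim c m ν s f (D 0) := by
  obtain ⟨T, g, h⟩ := h
  refine ⟨h.zero ▸ h.diffB 0, ?_⟩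
  filter_upwards [h.limB] with ν hν
  exact h.zero ▸ hν 0

lemma HasDecomp.congr (h : HasDecomp c m s ψA ψB f D) (h1 : EqOn f f' (side (-s) ψA))
    (h2 : EqOn f f' (side s ψB)) : HasDecomp c m s ψA ψB f' D := by
  obtain ⟨T, g, h⟩ := h
  have hg : ∀ j, EqOn (g j) (if j = 0 then f' else g j) (side s ψB) := by
    intro j z hz
    split_ifs with hj
    · rw [hj, h.zero]; exact h2 hz
    · rfl
  refine ⟨T, fun j => if j = 0 then f' else g j, by simp, h.diffA.congr fun z hz => (h1 hz).symm,
    fun j => (h.diffB j).congr fun z hz => (hg j hz).symm, ?_, ?_, h.rel⟩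
  · filter_upwards [h.limA] with ν hν using hν.congr h1
  · filter_upwards [h.limB] with ν hν j using (hν j).congr (hg j)

lemma EqBelow.lin {S' : Dist} (h : EqBelow R T T') (h' : EqBelow R S S') (a b : ℂ) :
    EqBelow R (a • T + b • S) (a • T' + b • S') := by
  refine eqBelow_iff.2 fun φ hφ hs => ?_
  simp only [cval_add, cval_smul]
  rw [eqBelow_iff.1 h φ hφ hs, eqBelow_iff.1 h' φ hφ hs]

lemma sum_shift_lin (h : ∀ j, IsStair m (D j)) (h' : ∀ j, IsStair m (D' j)) (a b : ℂ) (j : ℕ) :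
    ∑ i ∈ Finset.range (j + 1), shiftDeriv m i (a • D i + b • D' i) =
      a • (∑ i ∈ Finset.range (j + 1), shiftDeriv m i (D i)) + b • ∑ i ∈ Finset.range (j + 1),
      shiftDeriv m i (D' i) := by
  rw [smul_sum, smul_sum, ← sum_add_distrib]
  refine sum_congr rfl fun i _ => ?_
  rw [shiftDeriv_add ((h i).smul a) ((h' i).smul b), shiftDeriv_smul (h i), shiftDeriv_smul (h' i)]

lemma HasDecomp.lin (h : HasDecomp c m s ψA ψB f D) (h' : HasDecomp c m s ψA ψB f' D') (a b : ℂ) :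
    HasDecomp c m s ψA ψB (fun z => a * f z + b * f' z) (fun j => a • D j + b • D' j) := by
  obtain ⟨T, g, h⟩ := h
  obtain ⟨T', g', h'⟩ := h'
  refine ⟨a • T + b • T', fun j z => a * g j z + b * g' j z, by simp only [h.zero, h'.zero],
    (h.diffA.const_mul a).add (h'.diffA.const_mul b),
    fun j => ((h.diffB j).const_mul a).add ((h'.diffB j).const_mul b), ?_, ?_, fun j => ?_⟩
  · filter_upwards [h.limA, h'.limA] with ν h1 h2
    exact RayLim.lin h.diffA.continuousOn h1 h'.diffA.continuousOn h2 a b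
  · filter_upwards [h.limB, h'.limB] with ν h1 h2 j
    exact RayLim.lin (h.diffB j).continuousOn (h1 j) (h'.diffB j).continuousOn (h2 j) a b
  · rw [sum_shift_lin h.isStair h'.isStair]
    exact (h.rel j).lin (h'.rel j) a b

lemma RayLim.sum {ι : Type*} (S : Finset ι) {g : ι → ℂ → ℂ} {D : ι → Dist}
    (hg : ∀ i, DifferentiableOn ℂ (g i) (side s ψB)) (hD : ∀ i, RayLim c m ν s (g i) (D i)) :
    RayLim c m ν s (fun z => ∑ i ∈ S, g i z) (∑ i ∈ S, D i) := by
  induction S using cons_induction with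
  | empty => simpa using RayLim.zero c m ν s
  | cons i S hi ih =>
    simp_rw [sum_cons hi]
    have h1 : DifferentiableOn ℂ (fun z => ∑ i ∈ S, g i z) (side s ψB) :=
      DifferentiableOn.fun_sum fun i _ => hg i
    simpa using RayLim.lin (hg i).continuousOn (hD i) h1.continuousOn ih 1 1

/-- The convolution of two functions with boundary values. -/
lemma exists_conv_rayLim (hc : 3 < c) {g : ℂ → ℂ} (hf : DifferentiableOn ℂ f (side s ψB))
    (hg : DifferentiableOn ℂ g (side s ψB)) {ν₀ : ℝ} (hν₀ : 1 ≤ ν₀) {D D' : Dist}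
    (hD : RayLim c m ν₀ s f D) (hD' : RayLim c m ν₀ s g D') :
    ∃ h : ℂ → ℂ, DifferentiableOn ℂ h (side s ψB) ∧ ∀ ν : ℝ, m + 1 ≤ ν → ∀ D D', RayLim c m ν s f D
      → RayLim c m ν s g D' → RayLim c m ν s h (stairConv m D D') := by
  have hc1 := one_le_of_three_lt hc
  obtain ⟨θ₁, hθ₁, C, hC, hfc⟩ := hD.near_zero hc1 hν₀ hf.continuousOn
  obtain ⟨θ₂, hθ₂, C', hC', hgc⟩ := hD'.near_zero hc1 hν₀ hg.continuousOn
  obtain ⟨h, h1, h2⟩ := exists_conv hf hg (C := max C C') (max_lt hC hC')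
    (θ₀ := min θ₁ θ₂) ⟨lt_min hθ₁.1 hθ₂.1, (min_le_left _ _).trans hθ₁.2⟩
    (hfc.mono (min_le_left _ _) (le_max_left _ _)) (hgc.mono (min_le_right _ _) (le_max_right _ _))
  exact ⟨h, h1, fun ν hν D D' hD hD' => hD.conv hc hν hf.continuousOn
    hg.continuousOn hD' (lt_min hθ₁.1 hθ₂.1) h2⟩

/-- The relation for the boundary values of a convolution. -/
lemma eqBelow_conv_sum (hT : IsStair m T) (hT' : IsStair m T') (hD : ∀ j, IsStair m (D j))
    (hD' : ∀ j, IsStair m (D' j)) {j : ℕ} (h : EqBelow (j + 1) T (∑ i ∈ Finset.range (j + 1),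
    shiftDeriv m i (D i))) (h' : EqBelow (j + 1) T' (∑ i ∈ Finset.range (j + 1), shiftDeriv m i
    (D' i))) :
    EqBelow (j + 1) (stairConv m T T') (∑ i ∈ Finset.range (j + 1), shiftDeriv m i
      (∑ k ∈ Finset.range (i + 1), stairConv m (D k) (D' (i - k)))) := by
  have h1 := h.conv hT (IsStair.sum _ fun i _ => (hD i).shift i) hT'
    (IsStair.sum _ fun i _ => (hD' i).shift i) h'
  refine eqBelow_trans h1 ?_
  rw [stairConv_sum_sum _ _ (fun i => (hD i).shift i) (fun i => (hD' i).shift i)]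
  refine eqBelow_iff.2 fun φ hφ hs => ?_
  simp only [cval_sum]
  have h2 : ∀ i, (shiftDeriv m i
      (∑ k ∈ Finset.range (i + 1), stairConv m (D k) (D' (i - k)))).cval φ =
      ∑ k ∈ Finset.range (i + 1),
        (stairConv m (shiftDeriv m k (D k)) (shiftDeriv m (i - k) (D' (i - k)))).cval φ := by
    intro i
    rw [shiftDeriv_sum _ (fun k => (hD k).conv (hD' (i - k))), cval_sum]
    refine sum_congr rfl fun k hk => ?_
    rw [stairConv_shift (hD k) (hD' _), Nat.add_sub_cancel' (mem_range_succ_iff.1 hk)]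
  simp_rw [h2]
  refine (sum_triangle (I := fun i k =>
    (stairConv m (shiftDeriv m i (D i)) (shiftDeriv m k (D' k))).cval φ) fun i k hik => ?_).symm
  rw [stairConv_shift (hD i) (hD' k)]
  have h3 := eqBelow_iff.1 (shiftDeriv_eqBelow_zero ((hD i).conv (hD' k)) (i + k)) φ hφ
    (hs.trans (Iio_subset_Iio (by exact_mod_cast hik)))
  simpa using h3

/-- The convolution of two sequences of components. -/
abbrev seqConv (m : ℕ) (D D' : ℕ → Dist) : ℕ → Dist :=
  fun j => ∑ k ∈ Finset.range (j + 1), stairConv m (D k) (D' (j - k))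

lemma HasDecomp.conv (hc : 3 < c) {h : ℂ → ℂ} {g' : ℕ → ℂ → ℂ} (hf : Components c m s ψA ψB f T g D)
    (hf' : Components c m s ψA ψB f' T' g' D') (h1 : DifferentiableOn ℂ h (side (-s) ψA))
    (h2 : DifferentiableOn ℂ h (side s ψB)) (h3 : ∀ᶠ ν in atTop, RayLim c m ν (-s) h
    (stairConv m T T')) (h4 : ∀ᶠ ν in atTop, RayLim c m ν s h (stairConv m (D 0) (D' 0))) :
    HasDecomp c m s ψA ψB h (seqConv m D D') := by
  obtain ⟨ν₀, hν₀, h5, h6⟩ := ((eventually_ge_succ m).and (hf.limB.and hf'.limB)).exists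
  choose G hG1 hG2 using fun i j => exists_conv_rayLim (m := m) hc (hf.diffB i)
    (hf'.diffB j) (one_le_of_succ_le hν₀) (h5 i) (h6 j)
  refine ⟨stairConv m T T', fun j => if j = 0 then h else fun z =>
    ∑ k ∈ Finset.range (j + 1), G k (j - k) z, by simp, h1, fun j => ?_, h3, ?_, fun j =>
      eqBelow_conv_sum hf.isStairA hf'.isStairA hf.isStair hf'.isStair (hf.rel j) (hf'.rel j)⟩
  · split_ifs
    · exact h2
    · exact DifferentiableOn.fun_sum fun k _ => hG1 _ _
  · filter_upwards [h4, hf.limB, hf'.limB, eventually_ge_succ m] with ν e1 e2 e3 hν j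
    rcases eq_or_ne j 0 with rfl | hj
    · simpa [seqConv] using e1
    · simp only [if_neg hj]
      exact RayLim.sum _ (fun k => hG1 _ _) fun k => hG2 _ _ ν hν _ _ (e2 k) (e3 (j - k))

end

section

/-! ### Convolution in the class -/

variable {c : ℝ≥0} {m : ℕ} {s ψ ψA ψB : ℝ} [IsSign s] [IsAngle ψ] [IsAngle ψA] [IsAngle ψB]

variable {ν : ℝ} {f g : ℂ → ℂ} {D : Dist}

/-- The restriction to `(0, 1)` of a function on the real axis. -/
def unitPart (f : ℂ → ℂ) : ℝ → ℂ := (Ioo (0 : ℝ) 1).indicator fun t => f t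

/-- A boundary value is given on `(0, 1)` by the values of the function, if it is continuous up to
this interval: convergence in the norm implies convergence in `L^1(0, 1)`. -/
lemma RayLim.eqBelow_unitPart (hc : 1 ≤ c) (hν : 1 ≤ ν)
    (hf : ContinuousOn f (side s ψ ∪ Complex.ofReal '' Ioo 0 1)) (hD : RayLim c m ν s f D) :
    Causal (unitPart f) ∧ EqBelow 1 D (Dist.ofFun (unitPart f)) := by
  have hfs := hf.mono subset_union_left
  obtain ⟨Δ, hΔ⟩ := exists_isStairDecomp hD.fin
  obtain ⟨θ₀, hθ₀, _, -, hnear⟩ := hD.near_zero hc hν hfs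
  have hray : ∀ θ ∈ Ioo 0 θ₀, ContinuousOn (fun t => f (rayPt s θ t)) (Ioi 0) :=
    fun θ hθ => continuousOn_ray hfs ⟨hθ.1, hθ.2.trans_le hθ₀.2⟩
  have hle : ∀ θ ∈ Ioo 0 θ₀, ∫⁻ t in Ioo 0 1, ‖f (rayPt s θ t) - Δ 0 t‖ₑ ≤
      ofReal (exp ν) * stairNorm c m ν (Dist.ofFun (rayFun f s θ) - D) := by
    intro θ hθ
    obtain ⟨Δ', hΔ'⟩ := (((hnear θ hθ).1.isStair m).sub (isStair_of_stairNorm hD.fin)).exists_decomp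
    have h1 := hΔ.add hΔ'
    rw [add_sub_cancel] at h1
    refine le_trans (le_of_eq ?_) (hΔ'.lintegral_unit_le hc (by linarith))
    refine setLIntegral_congr_fun_ae measurableSet_Ioo ?_
    filter_upwards [(IsStair.causal_indicator (hray θ hθ) h1).2] with t ht ht'
    rw [ht ht', add_sub_cancel_left]
  obtain ⟨θ, hθ⟩ := exists_seq_tendsto (𝓝[>] (0 : ℝ))
  obtain ⟨n₀, hn₀⟩ := eventually_atTop.1 (hθ.eventually (Ioo_mem_nhdsGT hθ₀.1))
  replace hθ := (tendsto_add_atTop_iff_nat n₀).2 hθ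
  have hlim : ∀ t ∈ Ioo (0 : ℝ) 1, Tendsto (fun n => f (rayPt s (θ (n + n₀)) t)) atTop (𝓝 (f t)) := by
    intro t ht
    have h1 : Tendsto (fun n => rayPt s (θ (n + n₀)) t) atTop
        (𝓝[side s ψ ∪ Complex.ofReal '' Ioo 0 1] t) := by
      refine tendsto_nhdsWithin_iff.2 ⟨(tendsto_rayPt_zero s t).comp hθ, .of_forall fun n => ?_⟩
      have := hn₀ (n + n₀) (Nat.le_add_left _ _)
      exact Or.inl (rayPt_mem_side this.1 (this.2.trans_le hθ₀.2) ht.1)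
    exact (hf t (Or.inr ⟨t, ht, rfl⟩)).tendsto.comp h1
  have hreal : ContinuousOn (fun t : ℝ => f t) (Ioo 0 1) :=
    hf.comp (by fun_prop) fun t ht => Or.inr ⟨t, ht, rfl⟩
  have hmΔ := (hΔ.1 0).aestronglyMeasurable.restrict (s := Ioo 0 1)
  have hae : ∀ᵐ t, t ∈ Ioo (0 : ℝ) 1 → f t = Δ 0 t := by
    have h1 : ∫⁻ t : ℝ in Ioo 0 1, ‖f t - Δ 0 t‖ₑ = 0 := by
      refine le_antisymm ?_ bot_le
      calc _ = ∫⁻ t in Ioo 0 1, liminf (fun n => ‖f (rayPt s (θ (n + n₀)) t) - Δ 0 t‖ₑ) atTop :=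
            setLIntegral_congr_fun measurableSet_Ioo fun t ht =>
              (((hlim t ht).sub_const _).enorm.liminf_eq).symm
        _ ≤ liminf (fun n => ∫⁻ t in Ioo 0 1, ‖f (rayPt s (θ (n + n₀)) t) - Δ 0 t‖ₑ) atTop :=
            lintegral_liminf_le' fun n => (((hray _ (hn₀ _ (Nat.le_add_left _ _))).mono
              Ioo_subset_Ioi_self).aestronglyMeasurable measurableSet_Ioo |>.sub hmΔ).enorm
        _ ≤ liminf (fun n => ofReal (exp ν) *
              stairNorm c m ν (Dist.ofFun (rayFun f s (θ (n + n₀))) - D)) atTop :=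
            liminf_le_liminf (.of_forall fun n => hle _ (hn₀ _ (Nat.le_add_left _ _)))
        _ = 0 := by
            have := ENNReal.Tendsto.const_mul (hD.lim.comp hθ) (Or.inr (ofReal_ne_top (r := exp ν)))
            rw [mul_zero] at this
            exact this.liminf_eq
    have h2 := (lintegral_eq_zero_iff'
      ((hreal.aestronglyMeasurable measurableSet_Ioo).sub hmΔ).enorm).1 h1
    filter_upwards [(ae_restrict_iff' measurableSet_Ioo).1 h2] with t ht ht1
    exact sub_eq_zero.1 (enorm_eq_zero.1 (ht ht1))
  have hC : Causal (unitPart f) := by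
    refine causal_of_integrable (((hΔ.1 0).indicator (measurableSet_Ioo (a := 0) (b := 1))).congr
      (g := unitPart f) ?_) fun t ht => by simp [unitPart, not_lt.2 ht.le]
    filter_upwards [hae] with t ht
    simp only [unitPart, indicator]
    split_ifs with h
    exacts [(ht h).symm, rfl]
  refine ⟨hC, eqBelow_iff.2 fun φ hφ hs1 => ?_⟩
  rw [hΔ.isLoose.pair φ hφ 1 (by simpa using hs1), cval_ofFun hC.locOn hφ]
  simp only [loosePair, Finset.range_one, sum_singleton, mul_zero, pow_zero, one_mul,
    iteratedDeriv_zero]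
  refine integral_congr_ae (hae.mono fun t ht => ?_)
  by_cases h : t ∈ tsupport φ
  · have h2 : t ∈ Ioo (0 : ℝ) 1 := ⟨hφ.supp h, hs1 h⟩
    simp only [unitPart, indicator_of_mem h2, ht h2]
  · simp [image_eq_zero_of_notMem_tsupport h]

lemma continuousAt_half_conv {F G : ℝ → ℂ} (hF : Causal F) (hG : Causal G) {R x₀ : ℝ}
    (cG : ContinuousOn G (Ioo 0 R)) (hx₀ : x₀ ∈ Ioo 0 R) :
    ContinuousAt (fun x => ∫ t in 0..(x / 2), F t * G (x - t)) x₀ := by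
  obtain ⟨b, hb⟩ := exists_between hx₀.2
  obtain ⟨B, hB⟩ := (isCompact_Icc (a := x₀ / 4) (b := b)).exists_bound_of_continuousOn
    (cG.mono fun t ht => ⟨by linarith [ht.1, hx₀.1], ht.2.trans_lt hb.2⟩)
  have hnhds : ∀ᶠ x in 𝓝 x₀, x ∈ Ioo (x₀ / 2) b :=
    isOpen_Ioo.mem_nhds ⟨by linarith [hx₀.1], hb.1⟩
  have hI : ContinuousAt (fun x => ∫ t in Ioo 0 b, (Iio (x / 2)).indicator
      (fun t => F t * G (x - t)) t) x₀ := by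
    refine continuousAt_of_dominated (bound := fun t => ‖F t‖ * B) (.of_forall fun x => ?_) ?_
      (((hF.integrableOn_Iio b).mono_set Ioo_subset_Iio_self).norm.mul_const B) ?_
    · exact ((hF.aesm.mul (hG.aesm.comp_quasiMeasurePreserving
        (quasiMeasurePreserving_sub_left volume x))).indicator measurableSet_Iio).restrict
    · filter_upwards [hnhds] with x hx
      filter_upwards [ae_restrict_mem measurableSet_Ioo] with t ht
      by_cases h : t < x / 2
      · rw [indicator_of_mem (mem_Iio.2 h), norm_mul]
        gcongr
        exact hB _ ⟨by linarith [hx.1], by linarith [hx.2, ht.1]⟩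
      · rw [indicator_of_notMem (by simpa using h), norm_zero]
        exact mul_nonneg (norm_nonneg _) ((norm_nonneg _).trans
          (hB b ⟨by linarith [hx₀.1, hb.1], le_rfl⟩))
    · filter_upwards [ae_restrict_mem measurableSet_Ioo,
        ae_restrict_of_ae (Measure.ae_ne volume (x₀ / 2))] with t ht hne
      rcases lt_or_gt_of_ne hne with h | h
      · have h1 : ContinuousAt G (x₀ - t) :=
          cG.continuousAt (isOpen_Ioo.mem_nhds ⟨by linarith [ht.1], by linarith [ht.1, hx₀.2]⟩)
        refine ((continuousAt_const (y := F t)).mul (ContinuousAt.comp (f := fun x => x - t) h1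
          (by fun_prop : ContinuousAt (fun x => x - t) x₀))).congr ?_
        filter_upwards [lt_mem_nhds (by linarith : 2 * t < x₀)] with x hx
        rw [indicator_of_mem (mem_Iio.2 (by linarith : t < x / 2))]; rfl
      · refine (continuousAt_const (y := (0 : ℂ))).congr ?_
        filter_upwards [gt_mem_nhds (by linarith : x₀ < 2 * t)] with x hx
        rw [indicator_of_notMem (by simpa using (by linarith : x / 2 ≤ t))]
  refine hI.congr ?_
  filter_upwards [hnhds] with x hx
  have h0 : 0 ≤ x / 2 := by linarith [hx.1, hx₀.1]
  rw [integral_of_le h0, integral_Ioc_eq_integral_Ioo, setIntegral_indicator measurableSet_Iio,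
    Ioo_inter_Iio, min_eq_right (by linarith [hx.2])]

/-- If the boundary value of `h` is the convolution of those of `f` and `g` then `h` is the
convolution of `f` and `g` near the origin. -/
lemma isConvNearZero_of_rayLim (hc : 1 ≤ c) (hν : 1 ≤ ν) {h : ℂ → ℂ} {D' : Dist}
    (hf : ContinuousOn f (side s ψ ∪ Complex.ofReal '' Ioo 0 1)) (hD : RayLim c m ν s f D)
    (hg : ContinuousOn g (side s ψ ∪ Complex.ofReal '' Ioo 0 1)) (hD' : RayLim c m ν s g D')
    (hh : ContinuousOn h (side s ψ ∪ Complex.ofReal '' Ioo 0 1)) (hDD : RayLim c m ν s h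
    (stairConv m D D')) : IsConvNearZero f g h := by
  have hreal : ∀ {f : ℂ → ℂ}, ContinuousOn f (side s ψ ∪ Complex.ofReal '' Ioo 0 1) →
      ContinuousOn (fun t : ℝ => f t) (Ioo 0 1) := fun hf =>
    hf.comp (by fun_prop) fun t ht => Or.inr ⟨t, ht, rfl⟩
  have hu : ∀ {f : ℂ → ℂ}, ContinuousOn f (side s ψ ∪ Complex.ofReal '' Ioo 0 1) →
      ContinuousOn (unitPart f) (Ioo 0 1) := fun hf =>
    (hreal hf).congr fun t ht => indicator_of_mem ht _
  obtain ⟨f1, f2⟩ := hD.eqBelow_unitPart hc hν hf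
  obtain ⟨g1, g2⟩ := hD'.eqBelow_unitPart hc hν hg
  obtain ⟨h1, h2⟩ := hDD.eqBelow_unitPart hc hν hh
  have e1 : EqBelow 1 (Dist.ofFun (unitPart h)) (Dist.ofFun (convFun (unitPart f) (unitPart g))) := by
    rw [← stairConv_ofFun f1 g1 m]
    refine eqBelow_trans (eqBelow_symm h2) ?_
    have := EqBelow.conv (k := 0) (isStair_of_stairNorm hD.fin) (f1.isStair m)
      (isStair_of_stairNorm hD'.fin) (g1.isStair m) (by simpa using f2) (by simpa using g2)
    simpa using this
  have hcc := f1.conv g1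
  have hae : ∀ᵐ t, t ∈ Ioo (0 : ℝ) 1 →
      unitPart h t - convFun (unitPart f) (unitPart g) t = 0 := by
    refine ae_eq_zero_of_integral_isTest ((h1.locInt.sub hcc.locInt).locallyIntegrableOn _)
      fun φ hφ hs1 => ?_
    have e2 := eqBelow_iff.1 e1 φ hφ hs1
    rw [cval_ofFun h1.locOn hφ, cval_ofFun hcc.locOn hφ] at e2
    simp_rw [mul_sub]
    rw [integral_sub (h1.integrable_mul hφ.smooth.continuous hφ.compact)
      (hcc.integrable_mul hφ.smooth.continuous hφ.compact), e2, sub_self]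
  have heq : EqOn (fun t : ℝ => h t) (convFun (unitPart f) (unitPart g)) (Ioo 0 1) := by
    refine Measure.eqOn_open_of_ae_eq (μ := volume) ?_ isOpen_Ioo (hreal hh)
      (ContinuousOn.congr (fun x hx => ((continuousAt_half_conv f1 g1 (hu hg) hx).add
        (continuousAt_half_conv g1 f1 (hu hf) hx)).continuousWithinAt)
        fun x hx => f1.conv_eq_add_half g1 (hu hf) (hu hg) hx)
    filter_upwards [ae_restrict_of_ae hae, ae_restrict_mem measurableSet_Ioo] with t ht ht1
    have := ht ht1
    rw [sub_eq_zero] at this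
    rw [← this]; simp [unitPart, ht1.1, ht1.2]
  intro x hx
  have h0 : h x = convFun (unitPart f) (unitPart g) x := heq hx
  rw [h0, convFun, integral_of_le hx.1.le,
    integral_of_le hx.1.le, integral_Ioc_eq_integral_Ioo,
    integral_Ioc_eq_integral_Ioo]
  refine setIntegral_congr_fun measurableSet_Ioo fun t ht => ?_
  have h3 : t < 1 := ht.2.trans hx.2
  have h4 : x - t < 1 := by linarith [ht.1, hx.2]
  simp [unitPart, ht.1, ht.2, h3, h4]

end

section

/-! ### The class and its closure under convolution and linear combinations -/

variable {c : ℝ≥0} {m : ℕ} {s ψ ψA ψB : ℝ} [IsSign s] [IsAngle ψ] [IsAngle ψA] [IsAngle ψB]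

variable {f f' h : ℂ → ℂ} {K K' : ℝ → ℝ≥0} {D D' Dp Dm Dp' Dm' : ℕ → Dist}

lemma crossing_zero_eq (A B : Set ℂ) :
    crossing A B 0 = A ∪ B ∪ Complex.ofReal '' Ioo 0 1 := by
  ext z; simp only [crossing, mem_union, mem_ofPred_eq, Nat.cast_zero, sub_zero, zero_add]; tauto

lemma isOpen_crossing_zero : IsOpen (crossing (side (-1) ψA) (side 1 ψB) 0) :=
  isOpen_crossing 0

lemma isPreconnected_crossing_zero : IsPreconnected (crossing (side (-1) ψA) (side 1 ψB) 0) :=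
  isPreconnected_crossing 0

lemma side_subset_crossing_zero_left : side (-1) ψA ⊆ crossing (side (-1) ψA) (side 1 ψB) 0 :=
  fun _ hz => Or.inl (Or.inl hz)

lemma side_subset_crossing_zero_right : side 1 ψB ⊆ crossing (side (-1) ψA) (side 1 ψB) 0 :=
  fun z hz => Or.inr (by simpa using hz)

/-- The two decompositions of a function of the class. -/
structure HasDecomps (c : ℝ≥0) (m : ℕ) (ψA ψB : ℝ) (f : ℂ → ℂ) (Dp Dm : ℕ → Dist) : Prop where
  an : AnalyticOnNhd ℂ f (crossing (side (-1) ψA) (side 1 ψB) 0)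
  up : HasDecomp c m 1 ψA ψB f Dp
  low : HasDecomp c m (-1) ψB ψA f Dm

/-- The growth condition, with the admissible function `K`. -/
def Admits (c : ℝ≥0) (m : ℕ) (K : ℝ → ℝ≥0) (D : ℕ → Dist) : Prop :=
  ∀ᶠ ν in atTop, ∀ j : ℕ, stairNorm c m ν (shiftDeriv m j (D j)) ≤ (K ν : ℝ≥0∞) ^ j

lemma isGrowthBound_iff (hc : 1 ≤ c) :
    IsGrowthBound c m (-ψA) ψB f K ↔ Tendsto K atTop (𝓝 0) ∧ ∃ Dp Dm, HasDecomp c m 1 ψA ψB f Dp ∧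
      HasDecomp c m (-1) ψB ψA f Dm ∧ Admits c m K Dp ∧ Admits c m K Dm := by
  refine and_congr_right fun _ => exists_congr fun Dp => exists_congr fun Dm => ?_
  rw [isUpperDecomp_iff hc, isLowerDecomp_iff hc, Admits, Admits,
    ← eventually_and]
  refine and_congr_right fun _ => and_congr_right fun _ => ?_
  refine eventually_congr (.of_forall fun ν => ?_)
  exact forall_and

lemma memF_iff (hc : 1 ≤ c) :
    MemF c m (-ψA) ψB f ↔ ∃ Dp Dm, HasDecomps c m ψA ψB f Dp Dm ∧ ∃ K : ℝ → ℝ≥0, Tendsto K atTop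
      (𝓝 0) ∧ Admits c m K Dp ∧ Admits c m K Dm := by
  rw [MemF, lowerSector_eq, upperSector_eq, neg_neg]
  simp_rw [isGrowthBound_iff hc]
  constructor
  · rintro ⟨h, K, hK, Dp, Dm, h1, h2, h3, h4⟩
    exact ⟨Dp, Dm, ⟨h, h1, h2⟩, K, hK, h3, h4⟩
  · rintro ⟨Dp, Dm, ⟨h, h1, h2⟩, K, hK, h3, h4⟩
    exact ⟨h, K, hK, Dp, Dm, h1, h2, h3, h4⟩

/-- On the common sector, the boundary value that enters into a decomposition is the first
component of the opposite one. -/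
lemma Components.eq_zero_comp (hc : 1 ≤ c) {T : Dist} {g : ℕ → ℂ → ℂ} (h : Components c m s ψA ψB f
    T g D) (h' : HasDecomp c m (-s) ψB ψA f D') : T = D' 0 := by
  obtain ⟨ν, hν, h1, h2⟩ := ((eventually_ge_succ m).and (h.limA.and h'.limB_zero.2)).exists
  exact h1.unique hc (one_le_of_succ_le hν) h2

lemma HasDecomps.contOn_up (h : HasDecomps c m ψA ψB f Dp Dm) :
    ContinuousOn f (side 1 ψB ∪ Complex.ofReal '' Ioo 0 1) :=
  h.an.continuousOn.mono (by rw [crossing_zero_eq]; gcongr; exact subset_union_right)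

/-- The convolution of two functions of the class. -/
theorem HasDecomps.exists_conv (hc : 3 < c) (hf : HasDecomps c m ψA ψB f Dp Dm)
    (hf' : HasDecomps c m ψA ψB f' Dp' Dm') :
    ∃ h, IsConvNearZero f f' h ∧ HasDecomps c m ψA ψB h (seqConv m Dp Dp') (seqConv m Dm Dm') := by
  have hc1 := one_le_of_three_lt hc
  obtain ⟨T, g, cf⟩ := hf.up
  obtain ⟨T', g', cf'⟩ := hf'.up
  obtain ⟨S, k, df⟩ := hf.low
  obtain ⟨S', k', df'⟩ := hf'.low
  obtain rfl : T = Dm 0 := cf.eq_zero_comp hc1 hf.low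
  obtain rfl : T' = Dm' 0 := cf'.eq_zero_comp hc1 hf'.low
  obtain rfl : S = Dp 0 := df.eq_zero_comp hc1 (by simpa using hf.up)
  obtain rfl : S' = Dp' 0 := df'.eq_zero_comp hc1 (by simpa using hf'.up)
  have hup := hf.up.limB_zero
  have hup' := hf'.up.limB_zero
  have hlo := hf.low.limB_zero
  have hlo' := hf'.low.limB_zero
  obtain ⟨ν, hν, ⟨u1, u2⟩, l1, l2⟩ := ((eventually_ge_succ m).and
    ((hup.2.and hup'.2).and (hlo.2.and hlo'.2))).exists
  have hν1 := one_le_of_succ_le hν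
  obtain ⟨hb, b1, b2⟩ := exists_conv_rayLim (m := m) hc hup.1 hup'.1 hν1 u1 u2
  obtain ⟨ha, a1, a2⟩ := exists_conv_rayLim (m := m) hc hlo.1 hlo'.1 hν1 l1 l2
  have hrel : EqBelow ((0 : ℕ) + 1) (stairConv m (Dm 0) (Dm' 0)) (∑ i ∈ Finset.range (0 + 1),
      shiftDeriv m i ((fun _ => stairConv m (Dp 0) (Dp' 0)) i)) := by
    simpa using eqBelow_conv_sum cf.isStairA cf'.isStairA cf.isStair cf'.isStair (cf.rel 0)
      (cf'.rel 0)
  obtain ⟨h, h1, h2, h3⟩ := exists_continuation hc1 hν1 a1 (a2 ν hν _ _ l1 l2)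
    (fun _ => b1) (fun _ => b2 ν hν _ _ u1 u2) 0 hrel
  have h3' : EqOn hb h (side 1 ψB) := by
    intro z hz
    have := h3 z (by simpa using hz)
    simpa using this.symm
  have r1 : ∀ᶠ ν in atTop, RayLim c m ν (-1) h (stairConv m (Dm 0) (Dm' 0)) := by
    filter_upwards [hlo.2, hlo'.2, eventually_ge_succ m] with ν e1 e2 hν
    exact (a2 ν hν _ _ e1 e2).congr h2.symm
  have r2 : ∀ᶠ ν in atTop, RayLim c m ν 1 h (stairConv m (Dp 0) (Dp' 0)) := by
    filter_upwards [hup.2, hup'.2, eventually_ge_succ m] with ν e1 e2 hν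
    exact (b2 ν hν _ _ e1 e2).congr h3'
  have d1 : DifferentiableOn ℂ h (side (-1) ψA) := a1.congr h2
  have d2 : DifferentiableOn ℂ h (side 1 ψB) := b1.congr fun z hz => (h3' hz).symm
  have hD : HasDecomps c m ψA ψB h
      (seqConv m Dp Dp')
      (seqConv m Dm Dm') := by
    refine ⟨h1, HasDecomp.conv hc cf cf' d1 d2 r1 r2, ?_⟩
    exact HasDecomp.conv hc df df' (by simpa using d2) d1 (by simpa using r2) r1
  refine ⟨h, ?_, hD⟩
  exact isConvNearZero_of_rayLim hc1 hν1 hf.contOn_up u1 hf'.contOn_up u2 hD.contOn_up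
    ((b2 ν hν _ _ u1 u2).congr h3')

/-- A function analytic on the base sheet is determined by its values on `(0, 1)`. -/
lemma eqOn_crossing_zero {h' : ℂ → ℂ} (h1 : AnalyticOnNhd ℂ h (crossing (side (-1) ψA) (side 1 ψB)
    0)) (h2 : AnalyticOnNhd ℂ h' (crossing (side (-1) ψA) (side 1 ψB) 0)) (heq : ∀ x : ℝ, x ∈
    Ioo (0 : ℝ) 1 → h x = h' x) : EqOn h h' (crossing (side (-1) ψA) (side 1 ψB) 0) := by
  refine eqOn_of_ray (s := 1) (θ := 0) (r := 1 / 2) isOpen_crossing_zero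
    isPreconnected_crossing_zero h1.differentiableOn h2.differentiableOn ?_ ?_
  · rw [rayPt_zero, crossing_zero_eq]
    exact Or.inr ⟨1 / 2, by norm_num, rfl⟩
  · filter_upwards [isOpen_Ioo.mem_nhds (by norm_num : (1 / 2 : ℝ) ∈ Ioo 0 1)] with t ht
    rw [rayPt_zero, heq t ht]

lemma HasDecomps.congr (h : HasDecomps c m ψA ψB f Dp Dm)
    (h1 : EqOn f f' (crossing (side (-1) ψA) (side 1 ψB) 0)) : HasDecomps c m ψA ψB f' Dp Dm := by
  have h2 := h1.mono side_subset_crossing_zero_left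
  have h3 := h1.mono side_subset_crossing_zero_right
  refine ⟨h.an.congr isOpen_crossing_zero h1, h.up.congr
    h2 h3, h.low.congr (by simpa using h3) h2⟩

/-- The components of a given convolution. -/
theorem HasDecomps.conv (hc : 3 < c) (hf : HasDecomps c m ψA ψB f Dp Dm) (hf' : HasDecomps c m ψA ψB
    f' Dp' Dm') (hh : AnalyticOnNhd ℂ h (crossing (side (-1) ψA) (side 1 ψB) 0))
    (hconv : IsConvNearZero f f' h) :
    HasDecomps c m ψA ψB h (seqConv m Dp Dp') (seqConv m Dm Dm') := by
  obtain ⟨h', h1, h2⟩ := hf.exists_conv hc hf'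
  exact h2.congr (eqOn_crossing_zero h2.an hh fun x hx => by
    rw [h1 x hx, hconv x hx])

lemma HasDecomps.lin (h : HasDecomps c m ψA ψB f Dp Dm) (h' : HasDecomps c m ψA ψB f' Dp' Dm')
    (a b : ℂ) :
    HasDecomps c m ψA ψB (fun z => a * f z + b * f' z) (fun j => a • Dp j + b • Dp' j)
      (fun j => a • Dm j + b • Dm' j) :=
  ⟨(analyticOnNhd_const.mul h.an).add (analyticOnNhd_const.mul h'.an),
    h.up.lin h'.up a b, h.low.lin h'.low a b⟩

/-- For `j = 0` the growth condition holds for every component. -/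
lemma eventually_stairNorm_le_one (hc : 1 ≤ c) {D : Dist}
    (h : ∀ᶠ ν in atTop, stairNorm c m ν D < ⊤) : ∀ᶠ ν in atTop, stairNorm c m ν D ≤ 1 := by
  obtain ⟨ν, h1, h2⟩ := (h.and (eventually_ge_succ m)).exists
  exact (tendsto_stairNorm_atTop h1 (zero_lt_one.trans_le hc).ne' h2).eventually_le_const one_pos

lemma Admits.conv (hc : 3 < c) (hD : ∀ j, IsStair m (D j)) (hD' : ∀ j, IsStair m (D' j))
    (h : Admits c m K D) (h' : Admits c m K' D') :
    Admits c m (fun ν => K ν + K' ν) (seqConv m D D') := by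
  filter_upwards [h, h', eventually_ge_succ m] with ν h1 h2 hν j
  rw [shiftDeriv_sum _ fun k => (hD k).conv (hD' _)]
  refine (stairNorm_sum_le _ _ _ _ _).trans ?_
  push_cast
  rw [add_pow]
  refine sum_le_sum fun k hk => ?_
  have hk' : k ≤ j := mem_range_succ_iff.1 hk
  have e1 : shiftDeriv m j (stairConv m (D k) (D' (j - k))) =
      stairConv m (shiftDeriv m k (D k)) (shiftDeriv m (j - k) (D' (j - k))) := by
    rw [stairConv_shift (hD k) (hD' _), Nat.add_sub_cancel' hk']
  rw [e1]
  refine (stairNorm_conv_le hc hν ((hD k).shift _) ((hD' _).shift _)).trans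
    ((mul_le_mul' (h1 k) (h2 _)).trans ?_)
  refine le_mul_of_one_le_right zero_le ?_
  exact_mod_cast Nat.choose_pos hk'

lemma Admits.lin (hc : 1 ≤ c) (hD : ∀ j, IsStair m (D j)) (hD' : ∀ j, IsStair m (D' j))
    (h : Admits c m K D) (h' : Admits c m K' D') (a b : ℂ) :
    Admits c m (fun ν => (1 + ‖a‖₊) * K ν + (1 + ‖b‖₊) * K' ν) (fun j => a • D j + b • D' j) := by
  have hle : ∀ ν, ∀ X Y : Dist, stairNorm c m ν (a • X + b • Y) ≤
      ‖a‖ₑ * stairNorm c m ν X + ‖b‖ₑ * stairNorm c m ν Y := fun ν X Y =>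
    (stairNorm_add_le _ _ _ _ _).trans
      (add_le_add (stairNorm_smul_le _ _ _ _ _) (stairNorm_smul_le _ _ _ _ _))
  have h0 : ∀ᶠ ν in atTop, stairNorm c m ν (a • D 0 + b • D' 0) ≤ 1 := by
    refine eventually_stairNorm_le_one hc ?_
    filter_upwards [h, h'] with ν h1 h2
    have e1 := h1 0
    have e2 := h2 0
    rw [shiftDeriv_zero_index (hD 0), pow_zero] at e1
    rw [shiftDeriv_zero_index (hD' 0), pow_zero] at e2
    exact (hle ν _ _).trans_lt (ENNReal.add_lt_top.2
      ⟨mul_lt_top enorm_lt_top (e1.trans_lt one_lt_top),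
        mul_lt_top enorm_lt_top (e2.trans_lt one_lt_top)⟩)
  filter_upwards [h, h', h0] with ν h1 h2 h3 j
  rcases eq_or_ne j 0 with rfl | hj
  · rw [shiftDeriv_zero_index (((hD 0).smul a).add ((hD' 0).smul b)), pow_zero]
    exact h3
  rw [shiftDeriv_add ((hD j).smul a) ((hD' j).smul b), shiftDeriv_smul (hD j),
    shiftDeriv_smul (hD' j)]
  refine (hle ν _ _).trans ?_
  have key : ∀ (a : ℂ) (x : ℝ≥0), ‖a‖ₑ * (x : ℝ≥0∞) ^ j ≤ (((1 + ‖a‖₊) * x : ℝ≥0) : ℝ≥0∞) ^ j := by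
    intro a x
    rw [enorm_eq_nnnorm, ← ENNReal.coe_pow, ← ENNReal.coe_mul, ← ENNReal.coe_pow, mul_pow]
    refine ENNReal.coe_le_coe.2 ?_
    gcongr
    calc ‖a‖₊ ≤ 1 + ‖a‖₊ := le_add_of_nonneg_left zero_le_one
      _ ≤ _ := le_self_pow₀ (le_add_of_nonneg_right zero_le) hj
  calc _ ≤ ‖a‖ₑ * (K ν : ℝ≥0∞) ^ j + ‖b‖ₑ * (K' ν : ℝ≥0∞) ^ j := by
        gcongr
        · exact h1 j
        · exact h2 j
    _ ≤ _ := add_le_add (key a _) (key b _)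
    _ ≤ _ := by
        rw [← ENNReal.coe_pow, ← ENNReal.coe_pow, ← ENNReal.coe_pow, ← ENNReal.coe_add]
        exact ENNReal.coe_le_coe.2 (pow_add_pow_le zero_le zero_le hj)

end

section

/-! ### Functions analytic across the half line -/

variable {c : ℝ≥0} {m : ℕ} {s ψ ψA ψB : ℝ} [IsSign s] [IsAngle ψ] [IsAngle ψA] [IsAngle ψB]

variable {F : ℝ → ℂ} {κ ν : ℝ} {G : ℂ → ℂ} {T : Dist} {K : ℝ → ℝ≥0}

lemma Dist.sub_eq_lin (T S : Dist) : T - S = (1 : ℂ) • T + (-1 : ℂ) • S := by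
  module

lemma lap_le_of_exp_bound {μ : ℝ} (hμ : κ < μ) (hF : ∀ t, ‖F t‖ₑ ≤ ofReal (exp (κ * t))
    * ‖heaviside t‖ₑ) : lap μ F ≤ ofReal (1 / (μ - κ)) := by
  rw [← lap_heaviside (sub_pos.2 hμ)]
  refine lintegral_mono fun t => ?_
  calc _ ≤ ofReal (exp (-μ * t)) *
        (ofReal (exp (κ * t)) * ‖heaviside t‖ₑ) := by gcongr; exact hF t
    _ = _ := by
        rw [← mul_assoc, ← ofReal_mul (exp_nonneg _), ← exp_add]
        congr 3; ring_nf

lemma enorm_indicator_le (hF : ∀ t > 0, ‖F t‖ ≤ exp (κ * t)) (t : ℝ) :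
    ‖(Ioi (0 : ℝ)).indicator F t‖ₑ ≤ ofReal (exp (κ * t)) * ‖heaviside t‖ₑ := by
  by_cases ht : 0 < t
  · rw [indicator_of_mem (mem_Ioi.2 ht), heaviside, indicator_of_mem (mem_Ici.2 ht.le), enorm_one,
      mul_one, ← ofReal_norm]
    exact ofReal_le_ofReal (hF t ht)
  · rw [indicator_of_notMem (by simpa using ht), enorm_zero]; exact zero_le

lemma causal_of_exp_bound (hc : ContinuousOn F (Ioi 0)) (hF : ∀ t > 0, ‖F t‖ ≤ exp (κ * t)) :
    Causal ((Ioi (0 : ℝ)).indicator F) := by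
  refine causal_indicator (hc.locallyIntegrableOn measurableSet_Ioi) ?_
  refine (integrable_const (exp |κ|)).mono'
    ((hc.mono fun t ht => ht.1).aestronglyMeasurable measurableSet_Ioo) ?_
  filter_upwards [ae_restrict_mem measurableSet_Ioo] with t ht
  refine (hF t ht.1).trans (Real.exp_le_exp.2 ?_)
  calc κ * t ≤ |κ| * 1 := mul_le_mul (le_abs_self κ) ht.2.le ht.1.le (abs_nonneg κ)
    _ = |κ| := mul_one _

lemma stairNorm_ofFun_exp_le (hFc : ContinuousOn F (Ioi 0)) (hF : ∀ t > 0, ‖F t‖ ≤ exp (κ * t))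
    (c : ℝ≥0) (hν : m + 1 ≤ ν) (hκ : κ + 1 ≤ ν) :
    stairNorm c m ν (Dist.ofFun F) ≤ c * ofReal (1 / (ν - 1 / 2 - κ)) := by
  rw [← ofFun_indicator hFc]
  refine ((causal_of_exp_bound hFc hF).stairNorm_ofFun_le c hν).trans ?_
  gcongr
  exact lap_le_of_exp_bound (by linarith) (enorm_indicator_le hF)

lemma ofReal_mem_sector {t : ℝ} (ht : 0 < t) : (t : ℂ) ∈ sector (-ψA) ψB := by
  refine ⟨by exact_mod_cast ht.ne', ?_, ?_⟩ <;> rw [Complex.arg_ofReal_of_nonneg ht.le]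
  exacts [neg_lt_zero.2 IsAngle.pos, IsAngle.pos]

lemma side_neg_subset_sector : side (-1) ψA ⊆ sector (-ψA) ψB := by
  rintro z ⟨h1, h2⟩
  have := IsAngle.pos (ψ := ψB)
  exact ⟨fun h => by simp [h] at h1, by linarith, by linarith⟩

lemma side_one_subset_sector : side 1 ψB ⊆ sector (-ψA) ψB := by
  rintro z ⟨h1, h2⟩
  have := IsAngle.pos (ψ := ψA)
  exact ⟨fun h => by simp [h] at h1, by linarith, by linarith⟩

section

variable (hG : AnalyticOnNhd ℂ G (sector (-ψA) ψB))
include hG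

lemma AnalyticOnNhd.continuousOn_pos : ContinuousOn (fun t : ℝ => G t) (Ioi 0) := fun t ht =>
  ((hG t (ofReal_mem_sector ht)).continuousAt.comp
    Complex.continuous_ofReal.continuousAt).continuousWithinAt

variable (hb : ∀ p ∈ sector (-ψA) ψB, ‖G p‖ ≤ exp (κ * ‖p‖))
include hb

lemma causal_sector : Causal ((Ioi (0 : ℝ)).indicator fun t => G t) :=
  causal_of_exp_bound (AnalyticOnNhd.continuousOn_pos hG) fun t ht => by
    simpa [abs_of_pos ht] using hb t (ofReal_mem_sector ht)

lemma isStair_sector (m : ℕ) : IsStair m (Dist.ofFun fun t => G t) := by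
  rw [← ofFun_indicator (AnalyticOnNhd.continuousOn_pos hG)]
  exact (causal_sector hG hb).isStair m

lemma stairNorm_sector_le (c : ℝ≥0) (hν : m + 1 ≤ ν) (hκ : κ + 1 ≤ ν) :
    stairNorm c m ν (Dist.ofFun fun t => G t) ≤ c * ofReal (1 / (ν - 1 / 2 - κ)) :=
  stairNorm_ofFun_exp_le (AnalyticOnNhd.continuousOn_pos hG) (fun t ht => by
    simpa [abs_of_pos ht] using hb t (ofReal_mem_sector ht)) c hν hκ

/-- The boundary value of a function which is analytic across the half line and of exponential
type. -/
lemma rayLim_sector (hs : side s ψ ⊆ sector (-ψA) ψB) (hν : m + 1 ≤ ν) (hκ : κ + 1 ≤ ν) :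
    RayLim c m ν s G (Dist.ofFun fun t => G t) := by
  have hψ : 0 < ψ := IsAngle.pos
  have hc0 := AnalyticOnNhd.continuousOn_pos hG
  refine ⟨(stairNorm_sector_le hG hb c hν hκ).trans_lt
    (mul_lt_top coe_lt_top ofReal_lt_top), ?_⟩
  set μ := ν - 1 / 2 with hμ
  set F₀ := (Ioi (0 : ℝ)).indicator fun t => G t with hF₀
  have hcF₀ : Causal F₀ := causal_sector hG hb
  have hray : ∀ θ ∈ Ioo 0 ψ, ContinuousOn (fun t => G (rayPt s θ t)) (Ioi 0) ∧
      ∀ t > 0, ‖G (rayPt s θ t)‖ ≤ exp (κ * t) := fun θ hθ =>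
    ⟨continuousOn_ray (hG.continuousOn.mono hs) hθ, fun t ht => by
      simpa [norm_rayPt s θ ht.le] using hb _ (hs (rayPt_mem_side hθ.1 hθ.2 ht))⟩
  have hcF : ∀ θ ∈ Ioo 0 ψ, Causal (rayFun G s θ) := fun θ hθ =>
    causal_of_exp_bound (hray θ hθ).1 (hray θ hθ).2
  have hlap : Tendsto (fun θ => lap μ fun t => 1 * rayFun G s θ t + -1 * F₀ t) (𝓝[>] 0) (𝓝 0) := by
    have h0 : (∫⁻ _ : ℝ, (0 : ℝ≥0∞)) = 0 := by simp
    rw [← h0]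
    refine tendsto_lintegral_filter_of_dominated_convergence' (fun t => 2 *
      (ofReal (exp (-(μ - κ) * t)) * ‖heaviside t‖ₑ)) ?_ ?_ ?_ ?_
    · filter_upwards [Ioo_mem_nhdsGT hψ] with θ hθ
      exact aemeasurable_lap (((hcF θ hθ).const_mul 1).add (hcF₀.const_mul (-1))).aesm μ
    · filter_upwards [Ioo_mem_nhdsGT hψ] with θ hθ
      refine .of_forall fun t => ?_
      have h1 := enorm_indicator_le (hray θ hθ).2 t
      have h2 := enorm_indicator_le (κ := κ) (F := fun t : ℝ => G t) (fun t ht => by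
        simpa [abs_of_pos ht] using hb t (ofReal_mem_sector ht)) t
      calc _ ≤ ofReal (exp (-μ * t)) *
            (ofReal (exp (κ * t)) * ‖heaviside t‖ₑ +
              ofReal (exp (κ * t)) * ‖heaviside t‖ₑ) := by
            gcongr
            refine (enorm_add_le _ _).trans (add_le_add ?_ ?_)
            · rw [one_mul]; exact h1
            · rw [neg_one_mul, enorm_neg]; exact h2
        _ = _ := by
            rw [← two_mul, mul_left_comm, ← mul_assoc (ofReal _),
              ← ofReal_mul (exp_nonneg _), ← exp_add]
            congr 4; ring
    · rw [lintegral_const_mul' _ _ (by simp)]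
      refine mul_ne_top (by simp) ?_
      have := lap_heaviside (μ := μ - κ) (by linarith)
      rw [lap] at this
      rw [this]; simp
    · refine .of_forall fun t => ?_
      by_cases ht : 0 < t
      · have h3 := (hG t (ofReal_mem_sector ht)).continuousAt.tendsto.comp (tendsto_rayPt_zero s t)
        have h4 : Tendsto (fun θ => ‖1 * rayFun G s θ t + -1 * F₀ t‖ₑ) (𝓝[>] 0) (𝓝 0) := by
          have h5 : Tendsto (fun θ => ‖G (rayPt s θ t) - G t‖ₑ) (𝓝[>] 0) (𝓝 ‖G t - G t‖ₑ) :=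
            (h3.sub_const _).enorm
          rw [sub_self, enorm_zero] at h5
          refine h5.congr fun θ => ?_
          rw [rayFun_of_pos _ _ _ ht, hF₀, indicator_of_mem (mem_Ioi.2 ht)]
          ring_nf
        simpa using ENNReal.Tendsto.const_mul h4 (Or.inr ofReal_ne_top)
      · simp [rayFun, hF₀, ht]
  have hle : Tendsto (fun θ => c * lap μ fun t => 1 * rayFun G s θ t + -1 * F₀ t) (𝓝[>] 0)
      (𝓝 0) := by
    simpa using ENNReal.Tendsto.const_mul hlap (Or.inr (ENNReal.coe_ne_top (r := c)))
  refine tendsto_zero_of_le hle ?_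
  filter_upwards [Ioo_mem_nhdsGT hψ] with θ hθ
  have h1 := ofFun_add (hcF θ hθ).locOn hcF₀.locOn 1 (-1)
  have h2 : Dist.ofFun (rayFun G s θ) - Dist.ofFun (fun t => G t) =
      Dist.ofFun fun t => 1 * rayFun G s θ t + -1 * F₀ t := by
    rw [h1, hF₀, ofFun_indicator hc0, Dist.sub_eq_lin]
  rw [h2]
  exact (((hcF θ hθ).const_mul 1).add (hcF₀.const_mul (-1))).stairNorm_ofFun_le c hν

end

/-- The sequence `(T, 0, 0, …)`. -/
def single (T : Dist) : ℕ → Dist := fun j => if j = 0 then T else 0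

lemma sum_shift_single (hT : IsStair m T) (j : ℕ) :
    ∑ i ∈ Finset.range (j + 1), shiftDeriv m i (single T i) = T := by
  rw [Finset.sum_range_succ', sum_eq_zero fun i _ => by simp [single, shiftDeriv_zero],
    zero_add]
  simp [single, shiftDeriv_zero_index hT]

lemma tendsto_one_div_sub (κ : ℝ) : Tendsto (fun ν : ℝ => 1 / (ν - 1 / 2 - κ)) atTop (𝓝 0) := by
  simp_rw [one_div, sub_sub]
  exact tendsto_inv_atTop_zero.comp (tendsto_atTop_add_const_right _ _ tendsto_id)

/-- A function which is analytic across the half line and of exponential type belongs to the class,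
and its only component is the function itself. -/
lemma hasDecomps_sector (hG : AnalyticOnNhd ℂ G (sector (-ψA) ψB)) (hb : ∀ p ∈ sector (-ψA) ψB,
    ‖G p‖ ≤ exp (κ * ‖p‖)) :
    HasDecomps c m ψA ψB G (single (Dist.ofFun fun t => G t)) (single (Dist.ofFun fun t => G t)) ∧
      Admits c m (fun _ => 0) (single (Dist.ofFun fun t => G t)) := by
  have hm := side_neg_subset_sector (ψA := ψA) (ψB := ψB)
  have hp := side_one_subset_sector (ψA := ψA) (ψB := ψB)
  have hev : ∀ᶠ ν : ℝ in atTop, m + 1 ≤ ν ∧ κ + 1 ≤ ν :=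
    (eventually_ge_succ m).and (eventually_ge_atTop _)
  have hst := isStair_sector hG hb m
  have key : ∀ {s ψ ψ' : ℝ} [IsSign s] [IsAngle ψ] [IsAngle ψ'], side s ψ ⊆ sector (-ψA) ψB →
      side (-s) ψ' ⊆ sector (-ψA) ψB → HasDecomp c m s ψ' ψ G (single (Dist.ofFun fun t => G t)) := by
    intro s ψ ψ' _ _ _ h5 h6
    refine ⟨Dist.ofFun fun t => G t, fun j => if j = 0 then G else fun _ => 0, by simp,
      hG.differentiableOn.mono h6, fun j => ?_, hev.mono fun ν hν => rayLim_sector hG hb h6 hν.1 hν.2,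
      hev.mono fun ν hν j => ?_, fun j => ?_⟩
    · split_ifs
      · exact hG.differentiableOn.mono h5
      · exact differentiableOn_const 0
    · rcases eq_or_ne j 0 with rfl | hj
      · simpa [single] using rayLim_sector hG hb h5 hν.1 hν.2
      · simpa [single, hj] using RayLim.zero c m ν s
    · rw [sum_shift_single hst]; exact eqBelow_refl _ _
  refine ⟨⟨hG.mono ?_, key hp hm, key hm (by simpa using hp)⟩, ?_⟩
  · rw [crossing_zero_eq]
    refine union_subset (union_subset hm hp) ?_
    rintro _ ⟨t, ht, rfl⟩
    exact ofReal_mem_sector ht.1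
  · have h1 : Tendsto (fun ν : ℝ => c * ofReal (1 / (ν - 1 / 2 - κ))) atTop (𝓝 0) := by
      simpa using ENNReal.Tendsto.const_mul (tendsto_ofReal (tendsto_one_div_sub κ))
        (Or.inr (ENNReal.coe_ne_top (r := c)))
    filter_upwards [hev, h1.eventually_le_const one_pos] with ν hν h2 j
    rcases eq_or_ne j 0 with rfl | hj
    · simp only [single, if_true, pow_zero]
      rw [shiftDeriv_zero_index hst]
      exact (stairNorm_sector_le hG hb c hν.1 hν.2).trans h2
    · simp [single, hj, shiftDeriv_zero]

/-! ### Averages -/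

/-- The distribution `A` is `∑ⱼ α^j [D_j(p - j)]^(mj)`, as a locally finite sum. -/
def IsAvg (m : ℕ) (α : ℂ) (D : ℕ → Dist) (A : Dist) : Prop :=
  ∀ j : ℕ, EqBelow (j + 1) A (∑ i ∈ Finset.range (j + 1), shiftDeriv m i (α ^ i • D i))

variable {α : ℂ} {D D' : ℕ → Dist} {A B : Dist}

lemma hasSum_cval_shift (hD : ∀ j, IsStair m (D j)) (α : ℂ) {φ : ℝ → ℂ} (hφ : IsTest φ) {j : ℕ}
    (hs : tsupport φ ⊆ Iio (j + 1 : ℝ)) : HasSum (fun j => (α ^ j • shiftDeriv m j (D j)).cval φ)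
      ((∑ i ∈ Finset.range (j + 1), shiftDeriv m i (α ^ i • D i)).cval φ) := by
  rw [cval_sum]
  simp_rw [shiftDeriv_smul (hD _)]
  refine hasSum_sum_of_ne_finset_zero fun i hi => ?_
  have hj' : j + 1 ≤ i := by simp at hi; omega
  rw [cval_smul, eqBelow_iff.1 (shiftDeriv_eqBelow_zero (hD i) i) φ hφ
    (hs.trans (Iio_subset_Iio (by exact_mod_cast hj'))), cval_zero, mul_zero]

lemma IsAvg.hasSum_cval (hD : ∀ j, IsStair m (D j)) (h : IsAvg m α D A) {φ : ℝ → ℂ}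
    (hφ : IsTest φ) : HasSum (fun j => (α ^ j • shiftDeriv m j (D j)).cval φ) (A.cval φ) := by
  obtain ⟨N, hN'⟩ := hφ.exists_nat_succ
  rw [eqBelow_iff.1 (h N) φ hφ hN']
  exact hasSum_cval_shift hD α hφ hN'

lemma IsAvg.of_hasSum (hD : ∀ j, IsStair m (D j))
    (h : ∀ φ, IsTest φ → HasSum (fun j => (α ^ j • shiftDeriv m j (D j)).cval φ) (A.cval φ)) :
    IsAvg m α D A := fun _ =>
  eqBelow_iff.2 fun φ hφ hs => (h φ hφ).unique (hasSum_cval_shift hD α hφ hs)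

lemma IsAvg.unique (h : IsAvg m α D A) (h' : IsAvg m α D B) : A = B := by
  refine Dist.ext_cval fun φ hφ => ?_
  obtain ⟨N, hN'⟩ := hφ.exists_nat_succ
  rw [eqBelow_iff.1 (h N) φ hφ hN', eqBelow_iff.1 (h' N) φ hφ hN']

lemma Admits.tsum_lt (h : Admits c m K D) (hK : Tendsto K atTop (𝓝 0)) (α : ℂ) :
    ∀ᶠ ν in atTop, ∑' j, stairNorm c m ν (α ^ j • shiftDeriv m j (D j)) < ⊤ := by
  have h1 : Tendsto (fun ν => ‖α‖₊ * K ν) atTop (𝓝 0) := by simpa using hK.const_mul ‖α‖₊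
  filter_upwards [h, h1.eventually_lt_const (by norm_num : (0 : ℝ≥0) < 1)] with ν h2 h3
  calc _ ≤ ∑' j, ((‖α‖₊ * K ν : ℝ≥0) : ℝ≥0∞) ^ j := by
        refine tsum_le_tsum fun j => (stairNorm_smul_le _ _ _ _ _).trans ?_
        rw [enorm_pow, enorm_eq_nnnorm, ENNReal.coe_mul, mul_pow]
        gcongr
        exact h2 j
    _ = (1 - ((‖α‖₊ * K ν : ℝ≥0) : ℝ≥0∞))⁻¹ := ENNReal.tsum_geometric _
    _ < ⊤ := by
        rw [ENNReal.inv_lt_top, tsub_pos_iff_lt]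
        exact_mod_cast h3

/-- The average in the sense of distributions is the one in the sense of the norms. -/
lemma IsAvg.stairHasSum (hc : 1 ≤ c) (hD : ∀ j, IsStair m (D j)) (hK : Tendsto K atTop (𝓝 0))
    (h : Admits c m K D) (hA : IsAvg m α D A) :
    ∀ᶠ ν in atTop, StairHasSum c m ν (fun j => α ^ j • shiftDeriv m j (D j)) A ∧ stairNorm c m ν A <
      ⊤ := by
  filter_upwards [h.tsum_lt hK α, eventually_ge_succ m] with ν h1 hν
  have h2 := stair_sum_of_hasSum_cval hc (one_le_of_succ_le hν) h1 fun φ hφ => hA.hasSum_cval hD hφ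
  exact ⟨h2.1, h2.2.trans_lt h1⟩

lemma IsAvg.isStair (hc : 1 ≤ c) (hD : ∀ j, IsStair m (D j)) (hK : Tendsto K atTop (𝓝 0))
    (h : Admits c m K D) (hA : IsAvg m α D A) : IsStair m A := by
  obtain ⟨ν, -, hν⟩ := (hA.stairHasSum hc hD hK h).exists
  exact isStair_of_stairNorm hν

lemma exists_isAvg (hc : 1 ≤ c) (hD : ∀ j, IsStair m (D j)) (hK : Tendsto K atTop (𝓝 0))
    (h : Admits c m K D) (α : ℂ) : ∃ A, IsAvg m α D A := by
  obtain ⟨ν, h1, hν⟩ := ((h.tsum_lt hK α).and (eventually_ge_succ m)).exists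
  have hν1 := one_le_of_succ_le hν
  obtain ⟨A, hA⟩ := exists_stair_sum hc hν1 h1
  exact ⟨A, IsAvg.of_hasSum hD fun φ hφ => (stairHasSum_of_bound h1 hA).hasSum_cval hc hν1 hφ⟩

/-- For a function of the class, `A` is the average if and only if it is so in the sense of
distributions. -/
lemma isAverage_iff (hc : 1 ≤ c) {f : ℂ → ℂ} (hD : HasDecomp c m 1 ψA ψB f D)
    (hK : Tendsto K atTop (𝓝 0)) (h : Admits c m K D) :
    IsAverage c m (-ψA) ψB α f A ↔ IsAvg m α D A := by
  constructor
  · rintro ⟨D', h1, h2⟩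
    rw [isUpperDecomp_iff hc] at h1
    obtain rfl := hD.unique hc h1
    obtain ⟨ν, h3, hν⟩ := (h2.and (eventually_ge_succ m)).exists
    exact IsAvg.of_hasSum hD.isStair fun φ hφ => h3.hasSum_cval hc (one_le_of_succ_le hν) hφ
  · intro h1
    refine ⟨D, (isUpperDecomp_iff hc).2 hD, ?_⟩
    filter_upwards [h1.stairHasSum hc hD.isStair hK h] with ν hν using hν.1

lemma IsAvg.lin (hD : ∀ j, IsStair m (D j)) (hD' : ∀ j, IsStair m (D' j)) (h : IsAvg m α D A)
    (h' : IsAvg m α D' B) (a b : ℂ) :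
    IsAvg m α (fun j => a • D j + b • D' j) (a • A + b • B) := by
  intro j
  have h1 := (h j).lin (h' j) a b
  rw [← sum_shift_lin (fun i => (hD i).smul _) (fun i => (hD' i).smul _)] at h1
  have h2 : ∀ i, α ^ i • (a • D i + b • D' i) = a • α ^ i • D i + b • α ^ i • D' i := fun i => by module
  simp_rw [h2]
  exact h1

lemma IsAvg.conv (hD : ∀ j, IsStair m (D j)) (hD' : ∀ j, IsStair m (D' j)) (hA : IsStair m A)
    (hB : IsStair m B) (h : IsAvg m α D A) (h' : IsAvg m α D' B) :
    IsAvg m α (seqConv m D D') (stairConv m A B) := by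
  intro j
  have h1 := eqBelow_conv_sum hA hB (fun i => (hD i).smul (α ^ i)) (fun i => (hD' i).smul (α ^ i))
    (h j) (h' j)
  have h2 : ∀ i, α ^ i • ∑ k ∈ Finset.range (i + 1), stairConv m (D k) (D' (i - k)) =
      ∑ k ∈ Finset.range (i + 1), stairConv m (α ^ k • D k) (α ^ (i - k) • D' (i - k)) := by
    intro i
    rw [smul_sum]
    refine sum_congr rfl fun k hk => ?_
    rw [stairConv_smul_left (hD k) ((hD' _).smul _), stairConv_smul_right (hD k) (hD' _), smul_smul,
      ← pow_add, Nat.add_sub_cancel' (mem_range_succ_iff.1 hk)]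
  simp_rw [h2]
  exact h1

lemma isAvg_single (hT : IsStair m T) (α : ℂ) : IsAvg m α (single T) T := by
  intro j
  have h1 : ∀ i, α ^ i • single T i = single T i := fun i => by
    by_cases hi : i = 0 <;> simp [single, hi]
  simp_rw [h1]
  rw [sum_shift_single hT]
  exact eqBelow_refl _ _

end

section

/-! ### Convolution powers and sums of branches -/

variable {c : ℝ≥0} {m : ℕ} {ψA ψB : ℝ} [IsAngle ψA] [IsAngle ψB]

variable {f f' : ℂ → ℂ} {Dp Dm Dp' Dm' : ℕ → Dist} {α : ℂ} {A : Dist} {n : ℕ} {x : ℝ≥0∞}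

/-- `f` belongs to the class, with the components `Dp` and `Dm`. -/
def Belongs (c : ℝ≥0) (m : ℕ) (ψA ψB : ℝ) (f : ℂ → ℂ) (Dp Dm : ℕ → Dist) : Prop :=
  HasDecomps c m ψA ψB f Dp Dm ∧ ∃ K : ℝ → ℝ≥0, Tendsto K atTop (𝓝 0) ∧
    Admits c m K Dp ∧ Admits c m K Dm

lemma Belongs.isStair (h : Belongs c m ψA ψB f Dp Dm) (j : ℕ) : IsStair m (Dp j) := h.1.up.isStair j

lemma Belongs.isAverage_iff (hc : 1 ≤ c) (h : Belongs c m ψA ψB f Dp Dm) :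
    IsAverage c m (-ψA) ψB α f A ↔ IsAvg m α Dp A :=
  let ⟨_, hK, h1, _⟩ := h.2
  Staircase.isAverage_iff hc h.1.up hK h1

lemma isBoundaryValue_iff (hc : 1 ≤ c) {D : ℕ → Dist} (h : HasDecomp c m 1 ψA ψB f D) {T : Dist} :
    IsBoundaryValue c m f T ↔ T = D 0 := by
  obtain ⟨h1, h2⟩ := h.limB_zero
  have key : ∀ ν S, HasRayLimit c m ν (𝓝[>] 0) f S ↔ RayLim c m ν 1 f S := fun ν S =>
    hasRayLimit_upper h1.continuousOn
  simp only [IsBoundaryValue, key]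
  constructor
  · intro h3
    obtain ⟨ν, h4, h5, hν⟩ := (h2.and (h3.and (eventually_ge_atTop 1))).exists
    exact h5.unique hc hν h4
  · rintro rfl; exact h2

/-- An element of the class is determined by its boundary value. -/
lemma Belongs.unique (hc : 1 ≤ c) (h : Belongs c m ψA ψB f Dp Dm) (h' : Belongs c m ψA ψB f' Dp'
    Dm') (h0 : Dp 0 = Dp' 0) : Dp = Dp' := by
  obtain ⟨h1, h2⟩ := h.1.up.limB_zero
  obtain ⟨h3, h4⟩ := h'.1.up.limB_zero
  obtain ⟨ν, hν1, hν2, hν⟩ := (h2.and (h4.and (eventually_ge_atTop 1))).exists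
  have heq := eqOn_of_rayLim hc hν h1 hν1 h3 hν2 (h0 ▸ eqBelow_refl 1 _)
  have hne : (rayPt 1 (ψB / 2) 1) ∈ side 1 ψB :=
    rayPt_mem_side (half_pos IsAngle.pos) (half_lt_self IsAngle.pos) one_pos
  have := h.1.an.eqOn_of_preconnected_of_eventuallyEq h'.1.an
    isPreconnected_crossing_zero (side_subset_crossing_zero_right hne)
    (eventually_of_mem (isOpen_side.mem_nhds hne) heq)
  exact HasDecomp.unique hc h.1.up
    (h'.1.congr fun z hz => (this hz).symm).up

/-- The components of a convolution product over a list of factors. -/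
def listSeq (m : ℕ) {ι : Type} (D : ι → ℕ → Dist) : List ι → ℕ → Dist
  | [] => fun _ => 0
  | [i] => D i
  | i :: k :: L => fun j => ∑ s ∈ Finset.range (j + 1),
      stairConv m (D i s) (listSeq m D (k :: L) (j - s))

/-- The list of the factors of the monomial with exponents `l`. -/
def midxList {n : ℕ} (l : MIdx n) : List (Fin n) :=
  (List.finRange n).flatMap fun i => List.replicate (l.1 i) i

lemma multiConv_eq (Y : Fin n → Dist) (l : MIdx n) :
    multiConv m Y l = listConv m ((midxList l).map Y) := by
  simp [multiConv, midxList, List.map_flatMap]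

lemma length_midxList (l : MIdx n) : (midxList l).length = ∑ i, l.1 i := by
  simp [midxList, Fin.sum_univ_def, List.length_flatMap]

lemma midxList_ne_nil (l : MIdx n) : midxList l ≠ [] := by
  intro h
  have h1 := length_midxList l
  rw [h, List.length_nil, eq_comm, Finset.sum_eq_zero_iff] at h1
  exact l.2 (funext fun i => h1 i (Finset.mem_univ i))

lemma listSeq_zero {ι : Type} (D : ι → ℕ → Dist) (L : List ι) :
    listSeq m D L 0 = listConv m (L.map fun i => D i 0) := by
  fun_induction listSeq m D L with
  | case1 => rfl
  | case2 => rfl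
  | case3 i k L ih => simpa [listConv] using congrArg (stairConv m (D i 0)) ih

lemma Belongs.isStair_avg (hc : 1 ≤ c) (h : Belongs c m ψA ψB f Dp Dm) (hA : IsAvg m α Dp A) :
    IsStair m A :=
  let ⟨_, hK, h1, _⟩ := h.2
  hA.isStair hc h.isStair hK h1

lemma Belongs.eventually_avg_lt (hc : 1 ≤ c) (h : Belongs c m ψA ψB f Dp Dm)
    (hA : IsAvg m α Dp A) : ∀ᶠ ν in atTop, stairNorm c m ν A < ⊤ :=
  let ⟨_, hK, h1, _⟩ := h.2
  (hA.stairHasSum hc h.isStair hK h1).mono fun _ h => h.2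

lemma Belongs.exists_conv (hc : 3 < c) (hf : Belongs c m ψA ψB f Dp Dm) (hf' : Belongs c m ψA ψB f'
    Dp' Dm') :
    ∃ h, IsConvNearZero f f' h ∧ Belongs c m ψA ψB h (seqConv m Dp Dp') (seqConv m Dm Dm') := by
  obtain ⟨hD, K, hK, hKp, hKm⟩ := hf
  obtain ⟨hD', K', hK', hKp', hKm'⟩ := hf'
  obtain ⟨h, h1, h2⟩ := hD.exists_conv hc hD'
  exact ⟨h, h1, h2, fun ν => K ν + K' ν, by simpa using hK.add hK',
    hKp.conv hc hD.up.isStair hD'.up.isStair hKp',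
    hKm.conv hc hD.low.isStair hD'.low.isStair hKm'⟩

lemma exists_belongs_listSeq (hc : 3 < c) {ι : Type} {Y : ι → ℂ → ℂ} {Dp Dm : ι → ℕ → Dist}
    (hY : ∀ i, Belongs c m ψA ψB (Y i) (Dp i) (Dm i)) {A : ι → Dist} (hav : ∀ i, IsAvg m α (Dp i)
    (A i)) (L : List ι) (hL : L ≠ []) :
    ∃ y, Belongs c m ψA ψB y (listSeq m Dp L) (listSeq m Dm L) ∧ IsAvg m α (listSeq m Dp L)
      (listConv m (L.map A)) := by
  have hc1 := one_le_of_three_lt hc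
  fun_induction listSeq m Dp L with
  | case1 => exact absurd rfl hL
  | case2 i => exact ⟨Y i, hY i, hav i⟩
  | case3 i k L ih =>
    obtain ⟨y, hy, hy'⟩ := ih (by simp)
    obtain ⟨h, -, h2⟩ := (hY i).exists_conv hc hy
    exact ⟨h, h2, (hav i).conv (hY i).isStair hy.isStair ((hY i).isStair_avg hc1 (hav i))
      (hy.isStair_avg hc1 hy') hy'⟩

lemma isStair_listConv {ι : Type} {A : ι → Dist} (hA : ∀ i, IsStair m (A i)) (L : List ι) :
    IsStair m (listConv m (L.map A)) := by
  induction L with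
  | nil => exact isStair_zero m
  | cons i L ih => cases L with
    | nil => exact hA i
    | cons k L => exact (hA i).conv ih

lemma stairNorm_listConv_le (hc : 3 < c) {ν : ℝ} (hν : m + 1 ≤ ν) {ι : Type} {A : ι → Dist}
    (hA : ∀ i, IsStair m (A i)) (hx : ∀ i, stairNorm c m ν (A i) ≤ x) (L : List ι) :
    stairNorm c m ν (listConv m (L.map A)) ≤ x ^ L.length := by
  induction L with
  | nil => simp [listConv]
  | cons i L ih => cases L with
    | nil => simpa [listConv] using hx i
    | cons k L =>
      refine (stairNorm_conv_le hc hν (hA i) (isStair_listConv hA (k :: L))).trans ?_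
      rw [List.length_cons, pow_succ']
      exact mul_le_mul' (hx i) ih

lemma tsum_pow_lt_top (hx : x < 1) (n : ℕ) : ∑' l : Fin n → ℕ, x ^ (∑ i, l i) < ⊤ := by
  induction n with
  | zero => simp
  | succ n ih =>
    rw [← (Fin.consEquiv fun _ : Fin (n + 1) => ℕ).tsum_eq, ENNReal.tsum_prod']
    have : ∀ (a : ℕ) (b : Fin n → ℕ), x ^ (∑ i, (Fin.consEquiv fun _ : Fin (n + 1) => ℕ) (a, b) i)
        = x ^ a * x ^ (∑ i, b i) := fun a b => by
      rw [Fin.sum_univ_succ, pow_add]; rfl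
    simp only [this, ENNReal.tsum_mul_left, ENNReal.tsum_mul_right, ENNReal.tsum_geometric]
    exact mul_lt_top (by simpa using hx) ih

lemma tsum_midx_lt_top (hx : x < 1) (n : ℕ) : ∑' l : MIdx n, x ^ (∑ i, l.1 i) < ⊤ :=
  (ENNReal.tsum_comp_le_tsum_of_injective Subtype.val_injective
    (fun l : Fin n → ℕ => x ^ (∑ i, l i))).trans_lt (tsum_pow_lt_top hx n)

/-- Weak summation of the components entails weak summation of the averages. -/
lemma IsAvg.hasSum {ι : Type} {D : ι → ℕ → Dist} {E : ℕ → Dist} {A : ι → Dist} {B : Dist}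
    (hD : ∀ l j, IsStair m (D l j)) (hE : ∀ j, IsStair m (E j)) (hA : ∀ l, IsAvg m α (D l) (A l))
    (hB : IsAvg m α E B) (h : ∀ j φ, IsTest φ → HasSum (fun l => (shiftDeriv m j (D l j)).cval φ)
    ((shiftDeriv m j (E j)).cval φ)) {φ : ℝ → ℂ} (hφ : IsTest φ) :
    HasSum (fun l => (A l).cval φ) (B.cval φ) := by
  obtain ⟨N, hN'⟩ := hφ.exists_nat_succ
  have key : ∀ {D : ℕ → Dist} {A : Dist}, (∀ j, IsStair m (D j)) → IsAvg m α D A →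
      A.cval φ = ∑ i ∈ Finset.range (N + 1), α ^ i * (shiftDeriv m i (D i)).cval φ := by
    intro D A hD hA
    rw [eqBelow_iff.1 (hA N) φ hφ hN', cval_sum]
    exact sum_congr rfl fun i _ => by rw [shiftDeriv_smul (hD i), cval_smul]
  rw [key hE hB]
  simp_rw [fun l => key (hD l) (hA l)]
  exact hasSum_sum fun i _ => (h i φ hφ).mul_left _

/-- Under the growth assumptions on the operators, the series `∑ M_l (A^{*l})` converges absolutely,
so that its convergence follows from the weak one. -/
lemma IsAdmissible.isMValue (hc : 3 < c) {M : MIdx n → Dist → Fin n → Dist}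
    (hM : IsAdmissible c m M) {F₀ A B : Fin n → Dist} (hA : ∀ i, ∀ᶠ ν in atTop, stairNorm c m ν
    (A i) < ⊤) (h : ∀ i φ, IsTest φ → HasSum (fun l => (M l (multiConv m A l) i).cval φ)
    ((B i - F₀ i).cval φ)) : IsMValue c m M F₀ A B := by
  intro i
  have hc1 := one_le_of_three_lt hc
  obtain ⟨κ, C, ε, -, hM⟩ := hM
  have hx : Tendsto (fun ν => (κ : ℝ≥0∞) * ∑ i, stairNorm c m ν (A i)) atTop (𝓝 0) := by
    have h1 : ∀ i, Tendsto (fun ν => stairNorm c m ν (A i)) atTop (𝓝 0) := fun i => by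
      obtain ⟨ν, hν, hν'⟩ := ((hA i).and (eventually_ge_succ m)).exists
      exact tendsto_stairNorm_atTop hν (zero_lt_one.trans_le hc1).ne' hν'
    simpa using ENNReal.Tendsto.const_mul (tendsto_finsetSum _ fun i _ => h1 i)
      (Or.inr ENNReal.coe_ne_top)
  filter_upwards [hM, eventually_ge_succ m, hx.eventually_lt_const zero_lt_one,
    eventually_all.2 hA] with ν h1 h2 h3 h4
  have hν := one_le_of_succ_le h2
  refine (stair_sum_of_hasSum_cval hc1 hν ?_ (h i)).1
  have hAs : ∀ i, IsStair m (A i) := fun i => isStair_of_stairNorm (h4 i)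
  have hle : ∀ l : MIdx n, stairNorm c m ν (multiConv m A l) ≤
      (∑ i, stairNorm c m ν (A i)) ^ (∑ i, l.1 i) := fun l => by
    rw [multiConv_eq, ← length_midxList]
    exact stairNorm_listConv_le hc h2 hAs (fun i => Finset.single_le_sum_of_canonicallyOrdered
      (f := fun i => stairNorm c m ν (A i)) (Finset.mem_univ i)) _
  refine lt_of_le_of_lt ?_
    (mul_lt_top (coe_lt_top (r := C ν)) (tsum_midx_lt_top h3 n))
  rw [← ENNReal.tsum_mul_left]
  refine tsum_le_tsum fun l => ?_
  refine (Finset.single_le_sum_of_canonicallyOrdered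
    (f := fun i => stairNorm c m ν (M l (multiConv m A l) i)) (Finset.mem_univ i)).trans ?_
  refine ((h1 l).2.1 _ ((hle l).trans_lt ?_)).trans ?_
  · exact pow_lt_top (ENNReal.sum_lt_top.2 fun i _ => h4 i)
  · rw [mul_pow, mul_assoc]
    exact mul_le_mul_right (mul_le_mul_right (hle l) _) _

/-- Averaging commutes with the nonlinear operator: each branch of the series converges, hence so does
each component, and averages are combinations of components. -/
theorem isMValue_of_surface (hc : 3 < c) {M : MIdx n → Dist → Fin n → Dist} {F Y Z : Fin n → ℂ → ℂ}
    {F₀ A B : Fin n → Dist} (hM : IsAdmissible c m M) (hcom : CommutesWithAverage c m (-ψA) ψB α M)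
    (hF : ∀ i, MemF c m (-ψA) ψB (F i) ∧ IsAverage c m (-ψA) ψB α (F i) (F₀ i))
    (hY : ∀ i, MemF c m (-ψA) ψB (Y i) ∧ IsAverage c m (-ψA) ψB α (Y i) (A i))
    (hZ : ∀ i, MemF c m (-ψA) ψB (Z i) ∧ IsAverage c m (-ψA) ψB α (Z i) (B i))
    (hS : IsSurfaceMValue c m (-ψA) ψB M F Y Z) : IsMValue c m M F₀ A B := by
  have hc1 := one_le_of_three_lt hc
  have memF : ∀ {f : ℂ → ℂ}, MemF c m (-ψA) ψB f ↔ ∃ Dp Dm, Belongs c m ψA ψB f Dp Dm :=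
    memF_iff hc1
  have avg : ∀ {f : ℂ → ℂ} {Dp Dm : ℕ → Dist} {A : Dist}, Belongs c m ψA ψB f Dp Dm →
      IsAverage c m (-ψA) ψB α f A → IsAvg m α Dp A := fun h h' =>
    (h.isAverage_iff hc1).1 h'
  choose DF DF' hDF using fun i => memF.1 (hF i).1
  choose DY DY' hDY using fun i => memF.1 (hY i).1
  choose DZ DZ' hDZ using fun i => memF.1 (hZ i).1
  have hAavg := fun i => avg (hDY i) (hY i).2
  obtain ⟨T, U, hT, hU, hbr⟩ := hS
  choose DU DU' hDU using fun l i => memF.1 (hU l i).1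
  have hT0 : T = fun i => DY i 0 :=
    funext fun i => (isBoundaryValue_iff hc1 (hDY i).1.up).1 (hT i)
  have hUavg : ∀ l i, IsAvg m α (DU l i) (M l (multiConv m A l) i) := by
    intro l i
    obtain ⟨y, hy, hy'⟩ := exists_belongs_listSeq hc hDY hAavg (midxList l)
      (midxList_ne_nil l)
    rw [← multiConv_eq] at hy'
    obtain ⟨u, hu⟩ := hcom l y (multiConv m T l) _ (memF.2 ⟨_, _, hy⟩)
      ((isBoundaryValue_iff hc1 hy.1.up).2 (by rw [listSeq_zero, multiConv_eq, hT0]))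
      ((hy.isAverage_iff hc1).2 hy')
    obtain ⟨h1, h2, h3⟩ := hu i
    obtain ⟨Du, Du', hDu⟩ := memF.1 h1
    rw [(hDU l i).unique hc1 hDu ?_]
    · exact avg hDu h3
    · rw [← (isBoundaryValue_iff hc1 hDu.1.up).1 h2,
        ← (isBoundaryValue_iff hc1 (hDU l i).1.up).1 (hU l i).2]
  refine hM.isMValue hc (fun i => (hDY i).eventually_avg_lt hc1 (hAavg i)) fun i φ hφ => ?_
  have hbranch : ∀ (j : ℕ) φ, IsTest φ →
      HasSum (fun l => (∑ k ∈ Finset.range (j + 1), shiftDeriv m k (DU l i k)).cval φ)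
        ((∑ k ∈ Finset.range (j + 1), shiftDeriv m k (DZ i k)).cval φ -
          (∑ k ∈ Finset.range (j + 1), shiftDeriv m k (DF i k)).cval φ) := by
    intro j φ hφ
    obtain ⟨SZ, SF, SU, h1, h2, h3, h4⟩ := hbr i j
    have br : ∀ {f : ℂ → ℂ} {Dp Dm : ℕ → Dist} {S : Dist}, Belongs c m ψA ψB f Dp Dm →
        IsBranchValue c m (-ψA) ψB j f S →
        S = ∑ k ∈ Finset.range (j + 1), shiftDeriv m k (Dp k) := by
      rintro f Dp Dm S h ⟨D, hD, rfl⟩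
      rw [isUpperDecomp_iff hc1] at hD
      rw [hD.unique hc1 h.1.up]
    obtain ⟨ν, hν, hν'⟩ := (h4.and (eventually_ge_atTop 1)).exists
    rw [← br (hDZ i) h1, ← br (hDF i) h2, ← cval_sub]
    simp_rw [← fun l => br (hDU l i) (h3 l)]
    exact hν.hasSum_cval hc1 hν' hφ
  rw [Dist.sub_eq_lin]
  refine IsAvg.hasSum (fun l j => (hDU l i).isStair j)
    (fun j => (((hDZ i).isStair j).smul 1).add (((hDF i).isStair j).smul (-1)))
    (fun l => hUavg l i) ((avg (hDZ i) (hZ i).2).lin (hDZ i).isStair (hDF i).isStair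
      (avg (hDF i) (hF i).2) 1 (-1)) (fun j φ hφ => ?_) hφ
  rw [shiftDeriv_add (((hDZ i).isStair j).smul 1) (((hDF i).isStair j).smul (-1)),
    shiftDeriv_smul ((hDZ i).isStair j), shiftDeriv_smul ((hDF i).isStair j)]
  cases j with
  | zero => simpa [cval_sub, cval_add, cval_smul, sub_eq_add_neg] using hbranch 0 φ hφ
  | succ j =>
    have h3 := (hbranch (j + 1) φ hφ).sub (hbranch j φ hφ)
    simp only [sum_range_succ _ (j + 1), cval_add, add_sub_cancel_left] at h3
    simp only [cval_add, cval_smul]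
    convert h3 using 1 <;> first | rfl | ring

end

section

/-! ### Series of functions with boundary values -/

variable {c : ℝ≥0} {m : ℕ} {s ψ ν : ℝ} [IsSign s] [IsAngle ψ]

/-- Bounds for the norm along the rays give pointwise bounds: a primitive of high order is bounded, and
Cauchy's estimate applies to it. -/
lemma exists_norm_le_of_ray_bound (hc : 1 ≤ c) (hν : 1 ≤ ν) (m : ℕ) {K : Set ℂ} (hK : IsCompact K)
    (hKs : K ⊆ side s ψ) :
    ∃ C : ℝ, ∀ g : ℂ → ℂ, DifferentiableOn ℂ g (side s ψ) → ∀ b : ℝ≥0,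
      (∀ θ ∈ Ioo 0 ψ, stairNorm c m ν (Dist.ofFun (rayFun g s θ)) ≤ b) → ∀ z ∈ K, ‖g z‖ ≤ C * b := by
  have hψ : 0 < ψ := IsAngle.pos
  obtain ⟨δ, hδ, hδK⟩ := hK.exists_cthickening_subset_open isOpen_side hKs
  obtain ⟨R, hR⟩ := hK.isBounded.exists_norm_le
  obtain ⟨k, hk⟩ := exists_nat_ge (R + δ)
  refine ⟨(m * k + 1).factorial * exp (ν * (k + 1)) / δ ^ (m * k + 1), fun g hg b hb z hz => ?_⟩
  have hray : RayInt s ψ _ g := fun θ hθ => causal_of_stairNorm_le hc hν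
    (continuousOn_ray hg.continuousOn hθ) coe_lt_top (hb θ hθ)
  obtain ⟨Φ, h1, h2, -, h3⟩ := exists_ray_primitive_iterate hg ⟨hψ, le_rfl⟩
    (mul_lt_top ofReal_lt_top coe_lt_top) hray (m * k + 1)
  have hball := (Metric.closedBall_subset_cthickening hz δ).trans hδK
  rw [← h2 z (hKs hz)]
  refine (Complex.norm_iteratedDeriv_le_of_forall_mem_sphere_norm_le (m * k + 1) hδ
    (h1.diffContOnCl_ball hball) (C := exp (ν * (k + 1)) * b) fun w hw => ?_).trans
    (le_of_eq (by ring))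
  have hws := hball (sphere_subset_closedBall hw)
  obtain ⟨h4, h5⟩ := exists_rayPt hws
  have hθ : s * w.arg ∈ Ioo 0 ψ := hws
  have hwn : ‖w‖ ≤ k + 1 := by
    have h6 : ‖w‖ ≤ ‖z‖ + δ := by
      have := norm_le_norm_add_norm_sub' w z
      rwa [← dist_eq_norm, Metric.mem_sphere.1 hw] at this
    linarith [hR z hz]
  rw [h5, ← rayFun_of_pos Φ _ _ h4, h3 _ hθ, norm_mul, norm_pow, norm_dir, one_pow, one_mul]
  have h7 := ((hray _ hθ).1.isLoose_level0 m).enorm_primitive_SP_le (c := c) hc hν k hwn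
  rw [SP_level0, ← iterate_succ_apply' primitive] at h7
  have h8 := h7.trans (mul_le_mul_right (hb _ hθ) _)
  rw [← ofReal_norm, ← ENNReal.ofReal_coe_nnreal, ← ofReal_mul (exp_nonneg _)] at h8
  exact (ENNReal.ofReal_le_ofReal_iff (by positivity)).1 h8

/-- Normally convergent series of functions with boundary values may be summed term by term. -/
theorem exists_rayLim_tsum (hc : 1 ≤ c) (hν : 1 ≤ ν) {ι : Type} [Countable ι] {g : ι → ℂ → ℂ}
    {D : ι → Dist} {b : ι → ℝ≥0∞} (hb : ∑' l, b l < ⊤) (hg : ∀ l, DifferentiableOn ℂ (g l)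
    (side s ψ)) (hD : ∀ l, RayLim c m ν s (g l) (D l)) (hbd : ∀ l, ∀ θ ∈ Ioo 0 ψ, stairNorm c m ν
    (Dist.ofFun (rayFun (g l) s θ)) ≤ b l) :
    ∃ W S, DifferentiableOn ℂ W (side s ψ) ∧ RayLim c m ν s W S ∧ StairHasSum c m ν D S := by
  have hψ : 0 < ψ := IsAngle.pos
  lift b to ι → ℝ≥0 using fun l => (le_tsum l).trans_lt hb |>.ne
  have hbs : Summable fun l => (b l : ℝ) := NNReal.summable_coe.2 (ENNReal.tsum_coe_ne_top_iff_summable.1 hb.ne)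
  have hopen := isOpen_side (s := s) (ψ := ψ)
  have hloc : ∀ K ⊆ side s ψ, IsCompact K → ∃ C : ℝ, ∀ l, ∀ z ∈ K, ‖g l z‖ ≤ C * b l :=
    fun K hK hK' => by
      obtain ⟨C, hC⟩ := exists_norm_le_of_ray_bound hc hν m hK' hK
      exact ⟨C, fun l => hC _ (hg l) _ (hbd l)⟩
  set W : ℂ → ℂ := fun z => ∑' l, g l z
  have hsum : ∀ z ∈ side s ψ, HasSum (fun l => g l z) (W z) := fun z hz => by
    obtain ⟨C, hC⟩ := hloc {z} (by simpa using hz) isCompact_singleton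
    exact (Summable.of_norm_bounded (hbs.mul_left C) fun l => hC l z rfl).hasSum
  have hW : DifferentiableOn ℂ W (side s ψ) := fun z hz => by
    obtain ⟨r, hr, hr'⟩ := Metric.nhds_basis_closedBall.mem_iff.1 (hopen.mem_nhds hz)
    obtain ⟨C, hC⟩ := hloc _ hr' (isCompact_closedBall z r)
    exact ((Complex.differentiableOn_tsum_of_summable_norm (hbs.mul_left C)
      (fun l => (hg l).mono (Metric.ball_subset_closedBall.trans hr')) isOpen_ball
      fun l w hw => hC l w (ball_subset_closedBall hw)).differentiableAt
      (Metric.isOpen_ball.mem_nhds (Metric.mem_ball_self hr))).differentiableWithinAt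
  have hcval : ∀ θ ∈ Ioo 0 ψ, ∀ φ, IsTest φ →
      HasSum (fun l => (Dist.ofFun (rayFun (g l) s θ)).cval φ)
        ((Dist.ofFun (rayFun W s θ)).cval φ) := by
    intro θ hθ φ hφ
    rw [cval_ofFun (continuousOn_rayFun hW.continuousOn hθ) hφ]
    simp_rw [fun l => cval_ofFun (continuousOn_rayFun (hg l).continuousOn hθ) hφ]
    have hmem : ∀ t > 0, rayPt s θ t ∈ side s ψ := fun t => rayPt_mem_side hθ.1 hθ.2
    obtain ⟨C, hC⟩ := hloc (rayPt s θ '' tsupport φ)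
      (by rintro _ ⟨t, ht, rfl⟩; exact hmem t (hφ.supp ht))
      (hφ.compact.isCompact.image (continuous_rayPt_right s θ))
    refine hasSum_integral_of_dominated_convergence (fun l t => ‖φ t‖ * (C * b l)) (fun l => ?_)
      (fun l => Eventually.of_forall fun t => ?_)
      (.of_forall fun t => (hbs.mul_left C).mul_left _) ?_
      (.of_forall fun t => ?_)
    · exact hφ.smooth.continuous.aestronglyMeasurable.mul (causal_of_stairNorm_le hc hν
        (continuousOn_ray (hg l).continuousOn hθ) coe_lt_top (hbd l θ hθ)).1.aesm
    · by_cases ht : t ∈ tsupport φ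
      · rw [norm_mul, rayFun_of_pos _ _ _ (hφ.supp ht)]
        exact mul_le_mul_of_nonneg_left (hC l _ ⟨t, ht, rfl⟩) (norm_nonneg _)
      · simp [image_eq_zero_of_notMem_tsupport ht]
    · simp_rw [tsum_mul_left]
      exact (hφ.smooth.continuous.norm.integrable_of_hasCompactSupport hφ.compact.norm).mul_const _
    · by_cases ht : 0 < t
      · simpa only [rayFun_of_pos _ _ _ ht] using (hsum _ (hmem t ht)).mul_left (φ t)
      · simp [hφ.eq_zero ht]
  have hDb : ∀ l, stairNorm c m ν (D l) ≤ b l := fun l => by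
    have h1 : Tendsto (fun θ => (b l : ℝ≥0∞) +
        stairNorm c m ν (Dist.ofFun (rayFun (g l) s θ) - D l)) (𝓝[>] 0) (𝓝 (b l + 0)) :=
      tendsto_const_nhds.add (hD l).lim
    rw [add_zero] at h1
    refine ge_of_tendsto h1 ?_
    filter_upwards [Ioo_mem_nhdsGT hψ] with θ hθ
    have h2 := stairNorm_sub_le c m ν (Dist.ofFun (rayFun (g l) s θ))
      (Dist.ofFun (rayFun (g l) s θ) - D l)
    rw [sub_sub_cancel] at h2
    exact h2.trans (add_le_add_left (hbd l θ hθ) _)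
  have hDs : ∑' l, stairNorm c m ν (D l) < ⊤ := (tsum_le_tsum hDb).trans_lt hb
  obtain ⟨S, hS⟩ := exists_stair_sum hc hν hDs
  have hSs := stairHasSum_of_bound hDs hS
  have hSc := fun φ hφ => hSs.hasSum_cval hc hν (ψ := φ) hφ
  refine ⟨W, S, hW, ⟨((stair_sum_of_hasSum_cval hc hν hDs hSc).2).trans_lt hDs, ?_⟩, hSs⟩
  have hdb : ∀ θ ∈ Ioo 0 ψ, ∀ l, stairNorm c m ν (Dist.ofFun (rayFun (g l) s θ) - D l) ≤
      b l + b l := fun θ hθ l =>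
    (stairNorm_sub_le _ _ _ _ _).trans (add_le_add (hbd l θ hθ) (hDb l))
  have hbb : ∑' l, ((b l : ℝ≥0∞) + b l) < ⊤ := by
    rw [ENNReal.tsum_add]; exact ENNReal.add_lt_top.2 ⟨hb, hb⟩
  let : MeasurableSpace ι := ⊤
  have h0 : Tendsto (fun θ => ∑' l, stairNorm c m ν (Dist.ofFun (rayFun (g l) s θ) - D l))
      (𝓝[>] 0) (𝓝 0) := by
    have h1 := tendsto_lintegral_filter_of_dominated_convergence (μ := Measure.count)
      (F := fun θ l => stairNorm c m ν (Dist.ofFun (rayFun (g l) s θ) - D l)) (f := fun _ => 0)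
      (l := 𝓝[>] (0 : ℝ)) (fun l => (b l : ℝ≥0∞) + b l)
      (.of_forall fun θ => measurable_from_top)
      (by filter_upwards [Ioo_mem_nhdsGT hψ] with θ hθ using Eventually.of_forall (hdb θ hθ))
      (by rw [lintegral_count]; exact hbb.ne) (.of_forall fun l => (hD l).lim)
    simpa only [lintegral_count, tsum_zero] using h1
  refine tendsto_zero_of_le h0 ?_
  filter_upwards [Ioo_mem_nhdsGT hψ] with θ hθ
  refine (stair_sum_of_hasSum_cval hc hν
    ((tsum_le_tsum (hdb θ hθ)).trans_lt hbb) fun φ hφ => ?_).2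
  simpa only [cval_sub] using (hcval θ hθ φ hφ).sub (hSc φ hφ)

end

section

/-! ### Convolution equations -/

variable {c : ℝ≥0} {m : ℕ} {s ψ ν ψA ψB : ℝ} [IsSign s] [IsAngle ψ] [IsAngle ψA] [IsAngle ψB]

variable {J : ℕ} {g : ℕ → ℂ → ℂ} {D : ℕ → Dist} {x : ℝ≥0∞} {θ : ℝ}

/-- The first `J + 1` components and their boundary values, with a bound `x` for the sum of the norms
along all the rays. -/
structure RayBdd (c : ℝ≥0) (m : ℕ) (ν s ψ : ℝ) (J : ℕ) (g : ℕ → ℂ → ℂ) (D : ℕ → Dist)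
    (x : ℝ≥0∞) : Prop where
  diff : ∀ j ≤ J, DifferentiableOn ℂ (g j) (side s ψ)
  lim : ∀ j ≤ J, RayLim c m ν s (g j) (D j)
  bdd : ∀ θ ∈ Ioo 0 ψ, ∑ j ∈ Finset.range (J + 1), stairNorm c m ν (Dist.ofFun (rayFun (g j) s θ)) ≤ x

lemma RayBdd.le (h : RayBdd c m ν s ψ J g D x) {j : ℕ} (hj : j ≤ J) (hθ : θ ∈ Ioo 0 ψ) :
    stairNorm c m ν (Dist.ofFun (rayFun (g j) s θ)) ≤ x :=
  (Finset.single_le_sum_of_canonicallyOrdered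
    (f := fun j => stairNorm c m ν (Dist.ofFun (rayFun (g j) s θ)))
    (mem_range_succ_iff.2 hj)).trans (h.bdd θ hθ)

lemma ofFun_rayFun_sum {ι : Type*} (S : Finset ι) {g : ι → ℂ → ℂ} (hg : ∀ i ∈ S, ContinuousOn (g i)
    (side s ψ)) (hθ : θ ∈ Ioo 0 ψ) :
    Dist.ofFun (rayFun (fun z => ∑ i ∈ S, g i z) s θ) = ∑ i ∈ S, Dist.ofFun (rayFun (g i) s θ) := by
  induction S using cons_induction with
  | empty =>
    simp_rw [sum_empty, rayFun_zero, ofFun_zero]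
  | cons i S hi ih =>
    have h1 := ofFun_add (continuousOn_rayFun (hg i (by simp)) hθ)
      (continuousOn_rayFun (continuousOn_finsetSum S fun k hk =>
        hg k (by simp [hk])) hθ) 1 1
    simp only [one_mul, one_smul] at h1
    rw [sum_cons hi, ← ih fun k hk => hg k (by simp [hk]), ← h1]
    congr 1
    funext t
    by_cases ht : 0 < t
    · simp [rayFun_of_pos _ _ _ ht, sum_cons hi]
    · simp [rayFun, ht]

lemma RayBdd.conv (hc : 3 < c) (hν : m + 1 ≤ ν) {g' : ℕ → ℂ → ℂ} {D' : ℕ → Dist} {x' : ℝ≥0∞}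
    (hx : x < ⊤) (hx' : x' < ⊤) (h : RayBdd c m ν s ψ J g D x) (h' : RayBdd c m ν s ψ J g' D' x') :
    ∃ k, RayBdd c m ν s ψ J k (seqConv m D D') (x * x') := by
  have hψ : 0 < ψ := IsAngle.pos
  have hc1 := one_le_of_three_lt hc
  have hν1 := one_le_of_succ_le hν
  have key : ∀ {g : ℕ → ℂ → ℂ} {D : ℕ → Dist} {x : ℝ≥0∞}, RayBdd c m ν s ψ J g D x → x < ⊤ →
      ∀ {j}, j ≤ J → RayInt s ψ (ofReal (exp ν) * x) (g j) :=
    fun {g D x} h hx {j} hj θ hθ => causal_of_stairNorm_le hc1 hν1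
      (continuousOn_ray (h.diff j hj).continuousOn hθ) hx (h.le hj hθ)
  have hex : ∀ a b, ∃ k : ℂ → ℂ, a ≤ J → b ≤ J → DifferentiableOn ℂ k (side s ψ) ∧
      ∀ θ ∈ Ioo 0 ψ, ∀ t > 0, k (rayPt s θ t) = dir s θ *
        convFun (rayFun (g a) s θ) (rayFun (g' b) s θ) t := by
    intro a b
    by_cases hab : a ≤ J ∧ b ≤ J
    swap
    · exact ⟨0, fun h1 h2 => absurd ⟨h1, h2⟩ hab⟩
    obtain ⟨ha, hb⟩ := hab
    obtain ⟨k, hk⟩ := exists_conv (h.diff a ha) (h'.diff b hb)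
      (C := ofReal (exp ν) * (x + x')) (mul_lt_top ofReal_lt_top
        (ENNReal.add_lt_top.2 ⟨hx, hx'⟩)) (θ₀ := ψ) ⟨hψ, le_rfl⟩
      ((key h hx ha).mono le_rfl (by gcongr; exact le_self_add))
      ((key h' hx' hb).mono le_rfl (by gcongr; exact le_add_self))
    exact ⟨k, fun _ _ => hk⟩
  choose k hk using hex
  have hk' : ∀ {j i}, j ≤ J → i ∈ Finset.range (j + 1) → _ := fun {j i} hj hi =>
    hk i (j - i) ((mem_range_succ_iff.1 hi).trans hj) ((Nat.sub_le j i).trans hj)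
  refine ⟨fun j z => ∑ i ∈ Finset.range (j + 1), k i (j - i) z, fun j hj =>
    DifferentiableOn.fun_sum fun i hi => (hk' hj hi).1, fun j hj => ?_, fun θ hθ => ?_⟩
  · have h1 : ∀ i : Finset.range (j + 1), RayLim c m ν s (k i (j - i))
        (stairConv m (D i) (D' (j - i))) := fun ⟨i, hi⟩ => by
      have h2 := (mem_range_succ_iff.1 hi).trans hj
      have h3 := (Nat.sub_le j i).trans hj
      exact RayLim.conv hc hν (h.diff _ h2).continuousOn (h.lim _ h2)
        (h'.diff _ h3).continuousOn (h'.lim _ h3) hψ (hk' hj hi).2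
    have h2 := RayLim.sum Finset.univ (fun i : Finset.range (j + 1) => (hk' hj i.2).1) h1
    rw [Finset.univ_eq_attach, Finset.sum_attach _ (fun i => stairConv m (D i) (D' (j - i)))] at h2
    convert h2 using 2 with z
    exact (Finset.sum_attach _ (fun i => k i (j - i) z)).symm
  · set a := fun j => stairNorm c m ν (Dist.ofFun (rayFun (g j) s θ))
    set b := fun j => stairNorm c m ν (Dist.ofFun (rayFun (g' j) s θ))
    calc _ ≤ ∑ j ∈ Finset.range (J + 1), ∑ i ∈ Finset.range (j + 1), a i * b (j - i) := by
          refine sum_le_sum fun j hj => ?_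
          have hj := mem_range_succ_iff.1 hj
          rw [ofFun_rayFun_sum _ (fun i hi => (hk' hj hi).1.continuousOn) hθ]
          refine (stairNorm_sum_le _ _ _ _ _).trans (sum_le_sum fun i hi => ?_)
          have hF := (key h hx ((mem_range_succ_iff.1 hi).trans hj) θ hθ).1
          have hG := (key h' hx' ((Nat.sub_le j i).trans hj) θ hθ).1
          have h3 : Dist.ofFun (rayFun (k i (j - i)) s θ) = dir s θ •
              stairConv m (Dist.ofFun (rayFun (g i) s θ)) (Dist.ofFun (rayFun (g' (j - i)) s θ)) := by
            rw [stairConv_ofFun hF hG]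
            exact ofFun_smul_congr (hF.conv hG).locOn fun t ht => by
              rw [rayFun_of_pos _ _ _ ht, (hk' hj hi).2 θ hθ t ht]
          rw [h3]
          refine (stairNorm_smul_le _ _ _ _ _).trans ?_
          rw [enorm_dir, one_mul]
          exact stairNorm_conv_le hc hν (hF.isStair m) (hG.isStair m)
      _ = ∑ i ∈ Finset.range (J + 1), ∑ k ∈ Finset.range (J + 1 - i), a i * b k :=
          Finset.sum_range_diag_flip (J + 1) fun i k => a i * b k
      _ ≤ ∑ i ∈ Finset.range (J + 1), ∑ k ∈ Finset.range (J + 1), a i * b k :=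
          sum_le_sum fun i _ => Finset.sum_le_sum_of_subset
            (Finset.range_subset_range.2 (Nat.sub_le _ _))
      _ ≤ x * x' := by
          rw [← Finset.sum_mul_sum]; exact mul_le_mul' (h.bdd θ hθ) (h'.bdd θ hθ)

lemma RayBdd.listSeq (hc : 3 < c) (hν : m + 1 ≤ ν) {ι : Type} {g : ι → ℕ → ℂ → ℂ} {D : ι → ℕ → Dist}
    (hx : x < ⊤) (h : ∀ i, RayBdd c m ν s ψ J (g i) (D i) x) (L : List ι) (hL : L ≠ []) :
    ∃ k, RayBdd c m ν s ψ J k (Staircase.listSeq m D L) (x ^ L.length) := by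
  fun_induction Staircase.listSeq m D L with
  | case1 => exact absurd rfl hL
  | case2 i => exact ⟨g i, by simpa using h i⟩
  | case3 i k L ih =>
    obtain ⟨y, hy⟩ := ih (by simp)
    rw [List.length_cons, pow_succ']
    exact (h i).conv hc hν hx (pow_lt_top hx) hy

/-- Given finitely many boundary values of norm less than `x`, the bound holds in small sectors. -/
lemma eventually_rayBdd (hg : ∀ j, DifferentiableOn ℂ (g j) (side s ψ)) (hD : ∀ j, RayLim c m ν s
    (g j) (D j)) (hx : ∑ j ∈ Finset.range (J + 1), stairNorm c m ν (D j) < x) :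
    ∀ᶠ θ₀ in 𝓝[>] 0, RayBdd c m ν s θ₀ J g D x := by
  have hψ : 0 < ψ := IsAngle.pos
  have h1 : Tendsto (fun θ => ∑ j ∈ Finset.range (J + 1),
      (stairNorm c m ν (Dist.ofFun (rayFun (g j) s θ) - D j) + stairNorm c m ν (D j))) (𝓝[>] 0)
      (𝓝 (∑ j ∈ Finset.range (J + 1), (0 + stairNorm c m ν (D j)))) :=
    tendsto_finsetSum _ fun j _ => (hD j).lim.add tendsto_const_nhds
  simp only [zero_add] at h1
  obtain ⟨θ₁, h2, h3⟩ := mem_nhdsGT_iff_exists_Ioo_subset.1 (h1.eventually_lt_const hx)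
  filter_upwards [Ioo_mem_nhdsGT hψ, Ioo_mem_nhdsGT h2] with θ₀ h4 h5
  exact ⟨fun j _ => (hg j).mono fun z hz => ⟨hz.1, hz.2.trans h4.2⟩, fun j _ => hD j, fun θ hθ =>
    (sum_le_sum fun j _ => stairNorm_le_sub_add _ _ _ _ _).trans (h3 ⟨hθ.1, hθ.2.trans h5.2⟩).le⟩

end

section

variable {c : ℝ≥0} {m : ℕ} {s ψ ν κ ψA ψB : ℝ} [IsSign s] [IsAngle ψ] [IsAngle ψA] [IsAngle ψB]

variable {D : ℕ → Dist} {f : ℂ → ℂ} {α : ℂ}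

lemma rayBdd_single {G : ℂ → ℂ} (hG : AnalyticOnNhd ℂ G (sector (-ψA) ψB))
    (hb : ∀ p ∈ sector (-ψA) ψB, ‖G p‖ ≤ exp (κ * ‖p‖)) (hs : side s ψ ⊆ sector (-ψA) ψB)
    (hν : m + 1 ≤ ν) (hκ : κ + 1 ≤ ν) (J : ℕ) :
    RayBdd c m ν s ψ J (fun j => if j = 0 then G else fun _ => 0) (single (Dist.ofFun fun t => G t))
      (c * ofReal (1 / (ν - 1 / 2 - κ))) := by
  have hd := hG.differentiableOn.mono hs
  refine ⟨fun j _ => ?_, fun j _ => ?_, fun θ hθ => ?_⟩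
  · split_ifs
    · exact hd
    · exact differentiableOn_const 0
  · cases j with
    | zero => exact rayLim_sector hG hb hs hν hκ
    | succ j => exact RayLim.zero c m ν s
  · have h0 : Dist.ofFun (rayFun (fun _ => 0) s θ) = 0 := by rw [rayFun_zero, ofFun_zero]
    rw [Finset.sum_range_succ', sum_eq_zero fun j _ => by simp [h0], zero_add, if_pos rfl]
    have hF := continuousOn_ray hd.continuousOn hθ
    rw [rayFun, ofFun_indicator hF]
    refine stairNorm_ofFun_exp_le hF (fun t ht => ?_) c hν hκ
    simpa only [norm_rayPt s θ ht.le] using hb _ (hs (rayPt_mem_side hθ.1 hθ.2 ht))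

lemma StairHasSum.shift {ι : Type} {D : ι → Dist} {S : Dist} (hD : ∀ l, IsStair m (D l))
    (hS : IsStair m S) (h : StairHasSum c m ν D S) (j : ℕ) :
    StairHasSum c m ν (fun l => shiftDeriv m j (D l)) (shiftDeriv m j S) := by
  have key : ∀ F : Finset ι, stairNorm c m ν (shiftDeriv m j S - ∑ l ∈ F, shiftDeriv m j (D l)) =
      (ofReal ν ^ m * ofReal (exp (-ν))) ^ j *
        stairNorm c m ν (S - ∑ l ∈ F, D l) := fun F => by
    have h1 := IsStair.sum F fun l _ => hD l
    rw [← shiftDeriv_sum F hD, ← shiftDeriv_sub hS h1, stairNorm_shift (hS.sub h1)]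
  simp only [StairHasSum, key]
  simpa using ENNReal.Tendsto.const_mul h (Or.inr (pow_ne_top
    (mul_ne_top (pow_ne_top ofReal_ne_top) ofReal_ne_top)))

lemma eventually_sum_stairNorm_lt (hc : 1 ≤ c) (hD : ∀ᶠ ν in atTop, ∀ j, stairNorm c m ν (D j) < ⊤)
    (J : ℕ) {x : ℝ≥0∞} (hx : 0 < x) :
    ∀ᶠ ν in atTop, ∑ j ∈ Finset.range (J + 1), stairNorm c m ν (D j) < x := by
  obtain ⟨ν₀, h1, h2⟩ := (hD.and (eventually_ge_succ m)).exists
  have := tendsto_finsetSum (Finset.range (J + 1)) fun j _ =>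
    tendsto_stairNorm_atTop (h1 j) (zero_lt_one.trans_le hc).ne' h2
  simp only [Finset.sum_const_zero] at this
  exact this.eventually_lt_const hx

/-- If the equation `f = ∑ G_l * Y^{*l}` holds for the upper boundary values, then it holds for all the
components: the two sides agree in a small upper sector, hence near `(0, 1)`, hence
in a small lower sector, and then for the components one after the other. -/
theorem hasSum_components (hc : 3 < c) {n : ℕ} {Y : Fin n → ℂ → ℂ} {DY DY' : Fin n → ℕ → Dist}
    (hY : ∀ i, HasDecomps c m ψA ψB (Y i) (DY i) (DY' i)) {G : MIdx n → ℂ → ℂ}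
    (hG : ∀ l, AnalyticOnNhd ℂ (G l) (sector (-ψA) ψB)) (hGb : ∀ l, ∀ p ∈ sector (-ψA) ψB, ‖G l p‖ ≤
    exp (κ * ‖p‖)) {y : MIdx n → ℂ → ℂ} {D D' : MIdx n → ℕ → Dist} (hD : D = fun l => seqConv m
    (single (Dist.ofFun fun t => G l t)) (listSeq m DY (midxList l))) (hD' : D' = fun l => seqConv m
    (single (Dist.ofFun fun t => G l t)) (listSeq m DY' (midxList l))) (hy : ∀ l, HasDecomps c m ψA
    ψB (y l) (D l) (D' l)) {E : ℕ → Dist} (hf : HasDecomp c m 1 ψA ψB f E) (h0 : ∀ φ, IsTest φ →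
    HasSum (fun l => (D l 0).cval φ) ((E 0).cval φ)) (J : ℕ) {φ : ℝ → ℂ} (hφ : IsTest φ) :
    HasSum (fun l => (shiftDeriv m J (D l J)).cval φ) ((shiftDeriv m J (E J)).cval φ) := by
  have hA : 0 < ψA := IsAngle.pos
  have hB : 0 < ψB := IsAngle.pos
  have hc1 := one_le_of_three_lt hc
  obtain ⟨T, e, hE⟩ := hf
  choose TY gY hgY using fun i => (hY i).up
  choose TY' gY' hgY' using fun i => (hY i).low
  have half : (0 : ℝ≥0∞) < 1 / 2 := by simp
  obtain ⟨ν, hν, hκ, ⟨hT, hEl⟩, h1, h2, h3, h4⟩ := ((eventually_ge_succ m).and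
    ((eventually_ge_atTop (κ + 1)).and ((hE.limA.and hE.limB).and
    ((eventually_all.2 fun i => (hgY i).limB).and ((eventually_all.2 fun i => (hgY' i).limB).and
    ((eventually_all.2 fun i => eventually_sum_stairNorm_lt hc1
      ((hgY i).limB.mono fun ν h j => (h j).fin) J half).and
    (eventually_all.2 fun i => eventually_sum_stairNorm_lt hc1
      ((hgY' i).limB.mono fun ν h j => (h j).fin) 0 half))))))).exists
  have hν1 := one_le_of_succ_le hν
  obtain ⟨θ, ⟨h5, h6⟩, h7, h8⟩ := (((eventually_all.2 fun i => eventually_rayBdd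
    (hgY i).diffB (h1 i) (h3 i)).and (eventually_all.2 fun i => eventually_rayBdd
    (hgY' i).diffB (h2 i) (h4 i))).and ((eventually_mem_set.2 (Ioo_mem_nhdsGT hA)).and
    (eventually_mem_set.2 (Ioo_mem_nhdsGT hB)))).exists
  have : IsAngle θ := ⟨h7.1, h7.2.le.trans IsAngle.le⟩
  have hup : side 1 θ ⊆ side 1 ψB := fun z hz => ⟨hz.1, hz.2.trans h8.2⟩
  have hlo : side (-1) θ ⊆ side (-1) ψA := fun z hz => ⟨hz.1, hz.2.trans h7.2⟩
  have hb : ∑' l : MIdx n, (c * ofReal (1 / (ν - 1 / 2 - κ))) *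
      (1 / 2 : ℝ≥0∞) ^ (midxList l).length < ⊤ := by
    simp_rw [length_midxList]
    rw [ENNReal.tsum_mul_left]
    exact mul_lt_top (mul_lt_top coe_lt_top ofReal_lt_top)
      (tsum_midx_lt_top (by simp) n)
  -- the series of the components, in small upper and lower sectors
  have hsum : ∀ {s : ℝ} [IsSign s] (hsub : side s θ ⊆ sector (-ψA) ψB) (J : ℕ)
      {g : Fin n → ℕ → ℂ → ℂ} {DY : Fin n → ℕ → Dist}
      (hr : ∀ i, RayBdd c m ν s θ J (g i) (DY i) (1 / 2)) (j : ℕ), ∃ W S, j ≤ J →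
      DifferentiableOn ℂ W (side s θ) ∧ RayLim c m ν s W S ∧
      StairHasSum c m ν (fun l => ∑ k ∈ Finset.range (j + 1),
        stairConv m (single (Dist.ofFun fun t => G l t) k)
          (listSeq m DY (midxList l) (j - k))) S := by
    intro s _ hsub J g DY hr j
    by_cases hj : j ≤ J
    swap
    · exact ⟨0, 0, fun h => absurd h hj⟩
    choose k hk using fun l => RayBdd.listSeq hc hν (by simp) hr (midxList l)
      (midxList_ne_nil l)
    choose k' hk' using fun l => (rayBdd_single (hG l) (hGb l) hsub hν hκ J).conv hc hν
      (mul_lt_top coe_lt_top ofReal_lt_top)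
      (pow_lt_top (by simp)) (hk l)
    obtain ⟨W, S, h⟩ := exists_rayLim_tsum hc1 hν1 hb (fun l => (hk' l).diff j hj)
      (fun l => (hk' l).lim j hj) (fun l θ hθ => (hk' l).le hj hθ)
    exact ⟨W, S, fun _ => h⟩
  choose W S hWS using hsum (hup.trans side_one_subset_sector) J h5
  obtain ⟨W', S', hWS'⟩ := hsum (hlo.trans side_neg_subset_sector) 0 h6 0
  obtain ⟨hW', hS', hs'⟩ := hWS' le_rfl
  have hst : ∀ j ≤ J, IsStair m (S j) := fun j hj => isStair_of_stairNorm (hWS j hj).2.1.fin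
  have hs : ∀ j ≤ J, StairHasSum c m ν (fun l => shiftDeriv m j (D l j)) (shiftDeriv m j (S j)) :=
    fun j hj => StairHasSum.shift (fun l => (hy l).up.isStair j) (hst j hj)
      (by simpa only [hD] using (hWS j hj).2.2) j
  have hS0 : S 0 = E 0 := Dist.ext_cval fun φ hφ => by
    have := (hWS 0 (Nat.zero_le J)).2.2.hasSum_cval hc1 hν1 hφ
    exact this.unique (by simpa only [hD] using h0 φ hφ)
  have hrel : ∀ j ≤ J, EqBelow (j + 1) S' (∑ i ∈ Finset.range (j + 1), shiftDeriv m i (S i)) := by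
    intro j hj
    refine eqBelow_iff.2 fun φ hφ hφs => ?_
    rw [cval_sum]
    refine (hs'.hasSum_cval hc1 hν1 hφ).unique ?_
    refine (hasSum_sum fun i hi => (hs i ((mem_range_succ_iff.1 hi).trans hj)).hasSum_cval
      hc1 hν1 hφ).congr_fun fun l => ?_
    obtain ⟨Tl, gl, hl⟩ := (hy l).up
    have h9 := hl.eq_zero_comp hc1 (hy l).low
    have := eqBelow_iff.1 (hl.rel j) φ hφ hφs
    rw [h9, cval_sum, hD'] at this
    exact this
  have hTS : T = S' := by
    have h9 : EqBelow 1 T S' := by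
      have h10 := hE.rel 0
      have h11 := hrel 0 (Nat.zero_le J)
      simp only [Nat.cast_zero, zero_add, Finset.range_one, sum_singleton, hS0] at h10 h11
      exact eqBelow_trans h10 (eqBelow_symm h11)
    have h10 := eqOn_of_rayLim hc1 hν1 (hE.diffA.mono hlo) hT hW' hS' h9
    exact (hT.congr h10).unique hc1 hν1 hS'
  rw [components_unique hc1 hν1 (fun i _ => (hE.diffB i).mono hup)
    (fun i _ => hEl i) (fun i hi => (hWS i hi).1) (fun i hi => (hWS i hi).2.1)
    (fun j hj => eqBelow_trans (eqBelow_symm (hE.rel j)) (hTS ▸ hrel j hj)) J le_rfl]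
  exact (hs J le_rfl).hasSum_cval hc1 hν1 hφ

/-- Convolution with a function which is analytic across the half line. -/
lemma Belongs.conv_sector (hc : 3 < c) {G : ℂ → ℂ} (hG : AnalyticOnNhd ℂ G (sector (-ψA) ψB))
    (hGb : ∀ p ∈ sector (-ψA) ψB, ‖G p‖ ≤ exp (κ * ‖p‖)) {D' : ℕ → Dist}
    (hf : Belongs c m ψA ψB f D D') {A : Dist} (hav : IsAvg m α D A) :
    ∃ h, Belongs c m ψA ψB h (seqConv m (single (Dist.ofFun fun t => G t)) D)
      (seqConv m (single (Dist.ofFun fun t => G t)) D') ∧ IsAvg m α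
      (seqConv m (single (Dist.ofFun fun t => G t)) D) (stairConv m (Dist.ofFun fun t => G t) A) := by
  have hc1 := one_le_of_three_lt hc
  obtain ⟨h1, h2⟩ := hasDecomps_sector (c := c) (m := m) hG hGb
  have h3 : Belongs c m ψA ψB G _ _ := ⟨h1, _, tendsto_const_nhds, h2, h2⟩
  obtain ⟨h, -, h4⟩ := h3.exists_conv hc hf
  exact ⟨h, h4, (isAvg_single (h1.up.isStair 0) α).conv h1.up.isStair hf.isStair (h1.up.isStair 0)
    (hf.isStair_avg hc1 hav) hav⟩

section

variable {n : ℕ} {G : MIdx n → Fin n → ℂ → ℂ}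

lemma isAdmissible_convOperator (hc : 3 < c) (hG : ∀ l i, AnalyticOnNhd ℂ (G l i) (sector (-ψA) ψB))
    (hGb : ∀ l i, ∀ p ∈ sector (-ψA) ψB, ‖G l i p‖ ≤ exp (κ * ‖p‖)) :
    IsAdmissible c m (convOperator m G) := by
  have hst := fun l i => isStair_sector (hG l i) (hGb l i) m
  set ε : ℝ → ℝ≥0 := fun ν => n * (c * (1 / (ν - 1 / 2 - κ)).toNNReal)
  have hε : Tendsto ε atTop (𝓝 0) := by
    simpa [ε] using (((continuous_real_toNNReal.tendsto 0).comp (tendsto_one_div_sub κ)).const_mul c).const_mul (n : ℝ≥0)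
  have key : ∀ ν : ℝ, m + 1 ≤ ν → κ + 1 ≤ ν → ∀ (l : MIdx n) T, stairNorm c m ν T < ⊤ →
      ∑ i, stairNorm c m ν (convOperator m G l T i) ≤ ε ν * stairNorm c m ν T := by
    intro ν hν hκ l T hT
    calc _ ≤ ∑ i : Fin n, (c * ofReal (1 / (ν - 1 / 2 - κ))) * stairNorm c m ν T := by
          refine sum_le_sum fun i _ => (stairNorm_conv_le hc hν (hst l i)
            (isStair_of_stairNorm hT)).trans
              (mul_le_mul_left (stairNorm_sector_le (hG l i) (hGb l i) c hν hκ) _)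
      _ = ε ν * stairNorm c m ν T := by
          simp [ε, ofReal, mul_assoc]
  refine ⟨1, ε, ε, hε, ?_⟩
  filter_upwards [eventually_ge_succ m, eventually_ge_atTop (κ + 1)] with ν hν hκ l
  refine ⟨fun T S a b hT hS => funext fun i => ?_, fun T hT => ?_, fun _ => key ν hν hκ l⟩
  · have hT := isStair_of_stairNorm hT
    have hS := isStair_of_stairNorm hS
    simp only [convOperator, Pi.add_apply, Pi.smul_apply]
    rw [stairConv_add_right (hst l i) (hT.smul a) (hS.smul b), stairConv_smul_right (hst l i) hT,
      stairConv_smul_right (hst l i) hS]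
  · simpa using key ν hν hκ l T hT

lemma commutesWithAverage_convOperator (hc : 3 < c) (hG : ∀ l i, AnalyticOnNhd ℂ (G l i)
    (sector (-ψA) ψB)) (hGb : ∀ l i, ∀ p ∈ sector (-ψA) ψB, ‖G l i p‖ ≤ exp (κ * ‖p‖)) (α : ℂ)
    : CommutesWithAverage c m (-ψA) ψB α (convOperator m G) := by
  have hc1 := one_le_of_three_lt hc
  intro l f T A hf hT hA1
  obtain ⟨D, D', hD⟩ := (memF_iff hc1).1 hf
  rw [isBoundaryValue_iff hc1 hD.1.up] at hT
  choose u hu hu' using fun i => Belongs.conv_sector hc (hG l i) (hGb l i) hD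
    ((Belongs.isAverage_iff hc1 hD).1 hA1)
  refine ⟨u, fun i => ⟨(memF_iff hc1).2 ⟨_, _, hu i⟩,
    (isBoundaryValue_iff hc1 (hu i).1.up).2 ?_,
    ((hu i).isAverage_iff hc1).2 (hu' i)⟩⟩
  simp [convOperator, hT, single, seqConv]

theorem isMValue_convOperator (hc : 3 < c) (hG : ∀ l i, AnalyticOnNhd ℂ (G l i) (sector (-ψA) ψB))
    (hGb : ∀ l i, ∀ p ∈ sector (-ψA) ψB, ‖G l i p‖ ≤ exp (κ * ‖p‖)) {F Y Z : Fin n → ℂ → ℂ}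
    {F₀ S T A B : Fin n → Dist} (hF : ∀ i, MemF c m (-ψA) ψB (F i) ∧ IsBoundaryValue c m (F i)
    (F₀ i) ∧ IsAverage c m (-ψA) ψB α (F i) (F₀ i)) (hY : ∀ i, MemF c m (-ψA) ψB (Y i) ∧
    IsBoundaryValue c m (Y i) (S i) ∧ IsAverage c m (-ψA) ψB α (Y i) (A i))
    (hZ : ∀ i, MemF c m (-ψA) ψB (Z i) ∧ IsBoundaryValue c m (Z i) (T i) ∧ IsAverage c m (-ψA) ψB α
    (Z i) (B i)) (hM : IsMValue c m (convOperator m G) F₀ S T) :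
    IsMValue c m (convOperator m G) F₀ A B := by
  have hc1 := one_le_of_three_lt hc
  have hmem : ∀ {f : ℂ → ℂ} {T A : Dist}, (MemF c m (-ψA) ψB f ∧ IsBoundaryValue c m f T ∧
      IsAverage c m (-ψA) ψB α f A) → ∃ D D', Belongs c m ψA ψB f D D' ∧ T = D 0 ∧
      IsAvg m α D A := by
    rintro f T A ⟨h1, h2, h3⟩
    obtain ⟨D, D', hD⟩ := (memF_iff hc1).1 h1
    exact ⟨D, D', hD, (isBoundaryValue_iff hc1 hD.1.up).1 h2,
      (Belongs.isAverage_iff hc1 hD).1 h3⟩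
  choose DF DF' hF hF0 hFA using fun i => hmem (hF i)
  choose DY DY' hY hY0 hYA using fun i => hmem (hY i)
  choose DZ DZ' hZ hZ0 hZA using fun i => hmem (hZ i)
  refine (isAdmissible_convOperator hc hG hGb).isMValue hc (fun i => (hY i).eventually_avg_lt hc1 (hYA i))
    fun i φ hφ => ?_
  choose y hy hyA using fun l => exists_belongs_listSeq hc hY hYA (midxList l)
    (midxList_ne_nil l)
  choose u hu huA using fun l => (hy l).conv_sector hc (hG l i) (hGb l i) (hyA l)
  simp_rw [multiConv_eq, Dist.sub_eq_lin (B i)]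
  refine IsAvg.hasSum (fun l => (hu l).isStair)
    (fun j => (((hZ i).isStair j).smul 1).add (((hF i).isStair j).smul (-1)))
    huA ((hZA i).lin (hZ i).isStair (hF i).isStair (hFA i) 1 (-1)) (fun j φ hφ => ?_) hφ
  refine hasSum_components hc (fun i => (hY i).1) (fun l => hG l i) (fun l => hGb l i)
    rfl rfl (fun l => (hu l).1) ((hZ i).1.lin (hF i).1 1 (-1)).up (fun φ hφ => ?_) j hφ
  obtain ⟨ν, hν, hν'⟩ := ((hM i).and (eventually_ge_atTop 1)).exists
  have h1 := hν.hasSum_cval hc1 hν' hφ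
  rw [Dist.sub_eq_lin, hZ0 i, hF0 i, show S = fun i => DY i 0 from funext hY0] at h1
  simpa [seqConv, convOperator, multiConv_eq, listSeq_zero, single] using h1

end

end

section

/-! ### Multiplication by analytic functions -/

variable {F φ : ℝ → ℂ} {H : ℂ → ℂ} {m n j l M : ℕ} {a C ν : ℝ} {c : ℝ≥0} {T S : Dist}

/-- The order of differentiation on the real axis is the one in the complex plane. -/
lemma iteratedDeriv_ofReal (l : ℕ) {t : ℝ} (hH : AnalyticAt ℂ H t) :
    iteratedDeriv l (fun x : ℝ => H x) t = iteratedDeriv l H t := by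
  induction l generalizing t with
  | zero => simp
  | succ l ih =>
    rw [iteratedDeriv_succ, iteratedDeriv_succ]
    have h1 : ∀ᶠ x : ℝ in 𝓝 t, AnalyticAt ℂ H x :=
      Complex.continuous_ofReal.continuousAt.eventually hH.eventually_analyticAt
    rw [EventuallyEq.deriv_eq (h1.mono fun x hx => ih hx)]
    exact (iteratedDeriv_eq_iterate (f := H) ▸ hH.iterated_deriv l).differentiableAt.hasDerivAt.comp_ofReal.deriv

lemma contDiffAt_comp_ofReal {t : ℝ} (hH : AnalyticAt ℂ H t) :
    ContDiffAt ℝ ∞ (fun x : ℝ => H x) t :=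
  ((hH.contDiffAt (n := ∞)).restrict_scalars ℝ).comp t Complex.ofRealCLM.contDiff.contDiffAt

lemma IsTest.analytic_mul (hφ : IsTest φ) (hH : ∀ t ∈ tsupport φ, AnalyticAt ℂ H (t : ℝ)) :
    IsTest (fun t => H t * φ t) ∧ tsupport (fun t : ℝ => H t * φ t) ⊆ tsupport φ := by
  have hs : tsupport (fun t : ℝ => H t * φ t) ⊆ tsupport φ := tsupport_mul_subset_right
  refine ⟨⟨contDiff_iff_contDiffAt.2 fun t => ?_, hφ.compact.mul_left, hs.trans hφ.supp⟩, hs⟩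
  by_cases ht : t ∈ tsupport φ
  · exact (contDiffAt_comp_ofReal (hH t ht)).mul hφ.smooth.contDiffAt
  · refine (contDiffAt_const (c := (0 : ℂ))).congr_of_eventuallyEq ?_
    filter_upwards [notMem_tsupport_iff_eventuallyEq.1 ht] with x hx
    simp [hx]

lemma IsTest.iteratedDeriv_analytic_mul (hφ : IsTest φ)
    (hH : ∀ t ∈ tsupport φ, AnalyticAt ℂ H (t : ℝ)) (M : ℕ) (t : ℝ) :
    _root_.iteratedDeriv M (fun t : ℝ => H t * φ t) t = ∑ l ∈ Finset.range (M + 1),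
      M.choose l * _root_.iteratedDeriv l H t * _root_.iteratedDeriv (M - l) φ t := by
  by_cases ht : t ∈ tsupport φ
  · rw [iteratedDeriv_fun_mul ((contDiffAt_comp_ofReal (hH t ht)).of_le (by exact_mod_cast le_top))
      (hφ.smooth.contDiffAt.of_le (by exact_mod_cast le_top))]
    simp only [iteratedDeriv_ofReal _ (hH t ht)]
  · have h0 : ∀ {ψ : ℝ → ℂ}, tsupport ψ ⊆ tsupport φ → ∀ k, _root_.iteratedDeriv k ψ t = 0 :=
      fun h k => image_eq_zero_of_notMem_tsupport fun h' =>
        ht (h (tsupport_iteratedDeriv_subset k h'))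
    simp [h0 (hφ.analytic_mul hH).2, h0 subset_rfl]

/-- The product of `F` with the `l`-th derivative of `H`. -/
def derivMul (H : ℂ → ℂ) (l : ℕ) (F : ℝ → ℂ) : ℝ → ℂ :=
  (Ioi (0 : ℝ)).indicator fun t => iteratedDeriv l H t * F t

/-- The function whose `M`-th derivative is `H F^(M)`, by Leibniz' rule. -/
def mulPrim (M : ℕ) (H : ℂ → ℂ) (F : ℝ → ℂ) : ℝ → ℂ :=
  fun t => ∑ l ∈ Finset.range (M + 1), (-1) ^ l * M.choose l * (primitive^[l] (derivMul H l F)) t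

/-- `H` is analytic near the positive half line, with the bounds on `[a, ∞)` that Cauchy's
estimate gives for a function bounded in the discs about `t` of radius proportional to `t`. -/
structure ConeBdd (H : ℂ → ℂ) (a C : ℝ) : Prop where
  nonneg : 0 ≤ C
  an : ∀ t : ℝ, 0 < t → AnalyticAt ℂ H t
  bd : ∀ t : ℝ, 0 < t → a ≤ t → ∀ l, ‖iteratedDeriv l H t‖ ≤ C * l.factorial * (8 / t) ^ l

lemma ConeBdd.norm_derivMul_le (hH : ConeBdd H a C) (hFa : ∀ t < a, F t = 0)
    (hFn : ∀ t < (n : ℝ), F t = 0) (hl : n = 0 → l = 0) (t : ℝ) :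
    ‖derivMul H l F t‖ ≤ ‖((C * l.factorial * (8 / n) ^ l : ℝ) : ℂ) * F t‖ := by
  have hC := hH.nonneg
  have h0 : 0 ≤ C * l.factorial * (8 / (n : ℝ)) ^ l := by positivity
  rw [derivMul, indicator_apply]
  split_ifs with ht
  · rcases lt_or_ge t a with h | h
    · simp [hFa t h]
    rcases lt_or_ge t n with h' | h'
    · simp [hFn t h']
    rw [norm_mul, norm_mul, Complex.norm_real, Real.norm_of_nonneg h0]
    gcongr
    refine (hH.bd t ht h l).trans ?_
    rcases Nat.eq_zero_or_pos n with hn | hn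
    · simp [hl hn]
    · have := ht.out.le
      gcongr
  · rw [norm_zero]; exact norm_nonneg _

lemma ConeBdd.causal_derivMul (hH : ConeBdd H a C) (hF : Causal F) (hFa : ∀ t < a, F t = 0)
    (hFn : ∀ t < (n : ℝ), F t = 0) (hl : n = 0 → l = 0) : Causal (derivMul H l F) := by
  refine ⟨(hF.const_mul _).locInt.mono ?_ (ae_of_all _ (hH.norm_derivMul_le hFa hFn hl)),
    fun t ht => indicator_of_notMem (by simpa using ht.le) _⟩
  refine (aestronglyMeasurable_indicator_iff measurableSet_Ioi).2
    (ContinuousOn.aestronglyMeasurable (fun t ht => ?_) measurableSet_Ioi |>.mul hF.aesm.restrict)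
  rw [iteratedDeriv_eq_iterate]
  exact (((hH.an t ht).iterated_deriv l).continuousAt.comp
    Complex.continuous_ofReal.continuousAt).continuousWithinAt

lemma mulPrim_eq_zero (hFn : ∀ t < (n : ℝ), F t = 0) (t : ℝ) (ht : t < n) :
    mulPrim M H F t = 0 :=
  sum_eq_zero fun l _ => by
    rw [primitive_iterate_eq_zero (Nat.cast_nonneg n)
      (fun x hx => by simp [derivMul, indicator_apply, hFn x hx]) l t ht, mul_zero]

section

variable (hH : ConeBdd H a C) (hF : Causal F) (hFa : ∀ t < a, F t = 0)
  (hFn : ∀ t < (n : ℝ), F t = 0)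
include hH hF hFa hFn

lemma ConeBdd.causal_term (hl : l ∈ Finset.range (m * n + 1)) :
    Causal (primitive^[l] (derivMul H l F)) :=
  (hH.causal_derivMul hF hFa hFn fun h => by simpa [h] using hl).primitive_iterate l

lemma ConeBdd.causal_mulPrim : Causal (mulPrim (m * n) H F) :=
  Causal.finset_sum _ fun _ hl => (hH.causal_term hF hFa hFn hl).const_mul _

lemma ConeBdd.integral_mulPrim (hφ : IsTest φ) :
    ∫ t, iteratedDeriv (m * n) φ t * mulPrim (m * n) H F t =
      ∫ t, iteratedDeriv (m * n) (fun t : ℝ => H t * φ t) t * F t := by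
  have h1 : ∀ l ∈ Finset.range (m * n + 1), Causal (derivMul H l F) := fun l hl =>
    hH.causal_derivMul hF hFa hFn fun h => by simpa [h] using hl
  have hi := fun l (hl : l ∈ Finset.range (m * n + 1)) => (hH.causal_term hF hFa hFn hl).integrable_test hφ (m * n)
  have hj := fun l (hl : l ∈ Finset.range (m * n + 1)) => ((h1 l hl).integrable_test hφ (m * n - l)).const_mul
    ((m * n).choose l : ℂ)
  have e1 : ∀ t, iteratedDeriv (m * n) φ t * mulPrim (m * n) H F t =
      ∑ l ∈ Finset.range (m * n + 1), (-1) ^ l * ((m * n).choose l : ℂ) *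
        (iteratedDeriv (m * n) φ t * (primitive^[l] (derivMul H l F)) t) := fun t => by
    rw [mulPrim, mul_sum]; exact sum_congr rfl fun _ _ => by ring
  have e2 : ∀ t, iteratedDeriv (m * n) (fun t : ℝ => H t * φ t) t * F t =
      ∑ l ∈ Finset.range (m * n + 1), ((m * n).choose l : ℂ) *
        (iteratedDeriv (m * n - l) φ t * derivMul H l F t) := fun t => by
    rw [hφ.iteratedDeriv_analytic_mul fun t ht => hH.an t (hφ.supp ht), Finset.sum_mul]
    refine sum_congr rfl fun l _ => ?_
    rw [derivMul, indicator_apply]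
    split_ifs with ht
    · ring
    · rw [image_eq_zero_of_notMem_tsupport fun h => ht ((hφ.iteratedDeriv _).supp h)]; ring
  simp only [e1, e2]
  rw [integral_finsetSum _ fun l hl => (hi l hl).const_mul _, integral_finsetSum _ hj]
  refine sum_congr rfl fun l hl => ?_
  have h2 := (h1 l hl).integral_iteratedDeriv_mul_primitive
    (hφ.iteratedDeriv (m * n - l)).smooth (hφ.iteratedDeriv _).compact l
  rw [iteratedDeriv_add_index,
    Nat.add_sub_cancel' (mem_range_succ_iff.1 hl)] at h2
  rw [integral_const_mul, integral_const_mul, h2]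
  linear_combination (((m * n).choose l : ℂ) *
    ∫ t, iteratedDeriv (m * n - l) φ t * derivMul H l F t) *
      (pow_mul_pow_eq_one l (show (-1 : ℂ) * -1 = 1 by norm_num))

/-- The factor `1/μ` that each integration gains outweighs the derivatives of `H`. -/
lemma ConeBdd.lap_mulPrim_le {μ : ℝ} (hμ : 0 < μ) (hmμ : 16 * m ≤ μ) :
    lap μ (mulPrim (m * n) H F) ≤ ofReal (2 * C) * lap μ F := by
  have hC := hH.nonneg
  refine (lap_finset_sum_le _ (fun l hl =>
    ((hH.causal_term hF hFa hFn hl).const_mul _).aesm) μ).trans ?_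
  have key : ∀ l ∈ Finset.range (m * n + 1),
      lap μ (fun t => (-1) ^ l * ((m * n).choose l : ℂ) * (primitive^[l] (derivMul H l F)) t) ≤
        ofReal (C * (1 / 2) ^ l) * lap μ F := fun l hl => by
    have hl0 : n = 0 → l = 0 := fun h => by simpa [h] using hl
    rw [lap_const_mul]
    refine (mul_le_mul_right (((hH.causal_derivMul hF hFa hFn hl0).lap_primitive_iterate_le hμ l).trans
      (mul_le_mul_right (lap_mono μ (hH.norm_derivMul_le hFa hFn hl0)) _)) _).trans ?_
    rw [lap_const_mul, ← mul_assoc, ← mul_assoc]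
    refine mul_le_mul_left ?_ _
    rw [← ofReal_norm, ← ofReal_norm, ← ofReal_pow (by positivity),
      ← ofReal_mul (by positivity), ← ofReal_mul (by positivity)]
    refine ofReal_le_ofReal ?_
    have h1 : ((m * n).choose l * l.factorial : ℝ) ≤ (m * n) ^ l := by
      have := Nat.descFactorial_le_pow (m * n) l
      rw [Nat.descFactorial_eq_factorial_mul_choose, mul_comm] at this
      exact_mod_cast this
    have h2 : (m * n) * (8 / n) * (1 / μ) ≤ (1 / 2 : ℝ) := by
      rcases Nat.eq_zero_or_pos n with rfl | hn
      · simp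
      · have : (0 : ℝ) < n := by exact_mod_cast hn
        rw [show (m * n * (8 / n) * (1 / μ) : ℝ) = 8 * m / μ by field_simp, div_le_iff₀ hμ]
        linarith
    simp only [norm_mul, norm_pow, norm_neg, norm_one, one_pow, one_mul, Complex.norm_natCast,
      Complex.norm_real, Real.norm_of_nonneg (show 0 ≤ C * l.factorial * (8 / (n : ℝ)) ^ l by positivity)]
    calc _ = C * ((m * n).choose l * l.factorial) * (8 / n) ^ l * (1 / μ) ^ l := by ring
      _ ≤ C * (m * n) ^ l * (8 / n) ^ l * (1 / μ) ^ l := by gcongr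
      _ = C * (m * n * (8 / n) * (1 / μ)) ^ l := by ring
      _ ≤ _ := by gcongr
  refine (sum_le_sum key).trans ?_
  rw [← Finset.sum_mul, ← ENNReal.ofReal_sum_of_nonneg fun l _ => by positivity, ← mul_sum,
    mul_comm 2]
  gcongr
  exact sum_geometric_two_le _
end

lemma ConeBdd.loose_mul {u : ℕ → ℝ → ℂ} (hH : ConeBdd H a C) (hu : Loose u)
    (hua : ∀ n, ∀ t < a, u n t = 0) (m : ℕ) : Loose (fun n => mulPrim (m * n) H (u n)) :=
  ⟨fun n => (hH.causal_mulPrim (hu.causal n) (hua n) (hu.zero n)).locInt,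
    fun n => mulPrim_eq_zero (hu.zero n)⟩

lemma ConeBdd.cval_mul {u : ℕ → ℝ → ℂ} (hH : ConeBdd H a C) (hu : IsLoose m u T)
    (hua : ∀ n, ∀ t < a, u n t = 0) (hS : IsLoose m (fun n => mulPrim (m * n) H (u n)) S)
    (hφ : IsTest φ) : S.cval φ = T.cval (fun t => H t * φ t) := by
  obtain ⟨N, hN⟩ := hφ.exists_nat
  have h1 := hφ.analytic_mul fun t ht => hH.an t (hφ.supp ht)
  rw [hS.pair φ hφ N hN, hu.pair _ h1.1 N (h1.2.trans hN)]
  exact sum_congr rfl fun n _ => by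
    rw [hH.integral_mulPrim (hu.causal n) (hua n) (hu.zero n) hφ]

lemma Causal.locInt_comp_add (hF : Causal F) (a : ℝ) : LocallyIntegrable fun t => F (t + a) :=
  locallyIntegrable_of_Iio fun R => (integrable_indicator_iff measurableSet_Iio).1
    (((hF.integrable_cut (R + a)).comp_add_right a).congr
      (.of_forall fun t => by simp [Set.indicator]))

lemma Loose.exists_shiftFam_eq {w : ℕ → ℝ → ℂ} (hw : Loose w) (h0 : ∀ n < j, ∀ t, w n t = 0) :
    ∃ v, Loose v ∧ Staircase.shiftFam j v = w := by
  refine ⟨fun n t => w (n + j) (t + j), ⟨fun n => ?_, fun n t ht => hw.zero _ _ ?_⟩,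
    funext fun n => funext fun t => ?_⟩
  · exact (hw.causal (n + j)).locInt_comp_add j
  · push_cast; linarith
  · rw [Staircase.shiftFam]
    split_ifs with h
    · simp [Nat.sub_add_cancel h]
    · exact (h0 n (not_le.1 h) t).symm

lemma shift_injective (hT : IsStair m T) (hS : IsStair m S)
    (h : shiftDeriv m j T = shiftDeriv m j S) : T = S := by
  have h1 := stairNorm_shift (c := 1) (ν := 1) (hT.sub hS) j
  rw [shiftDeriv_sub hT hS, h, sub_self, stairNorm_zero, eq_comm, mul_eq_zero] at h1
  refine sub_eq_zero.1 (eq_zero_of_stairNorm_eq_zero (c := 1) (m := m) le_rfl le_rfl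
    (h1.resolve_left (pow_ne_zero _ ?_)))
  simp [Real.exp_pos]

/-- Multiplication by `H` on the distributions `[T(p - j)]^(mj)`. -/
theorem ConeBdd.exists_mul (hH : ConeBdd H j C) (hT : IsStair m T) :
    ∃ S, IsStair m S ∧
      (∀ φ, IsTest φ → (shiftDeriv m j S).cval φ = (shiftDeriv m j T).cval fun t => H t * φ t) ∧
      ∀ (c : ℝ≥0) (ν : ℝ), 16 * m + 2 ≤ ν → stairNorm c m ν S ≤
        ofReal (2 * C * exp (1 / 2)) * stairNorm c m ν T := by
  obtain ⟨Δ, hΔ⟩ := hT.exists_decomp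
  have hd := hΔ.shift j
  have hw0 : ∀ n < j, shiftFam j Δ n = fun _ => 0 := fun n hn =>
    funext fun t => by simp [shiftFam, not_le.2 hn]
  have hwa : ∀ n, ∀ t < (j : ℝ), shiftFam j Δ n t = 0 := fun n t ht => by
    rcases lt_or_ge n j with h | h
    · rw [hw0 n h]
    · exact hd.loose.zero n t (ht.trans_le (by exact_mod_cast h))
  have hl := hH.loose_mul hd.loose hwa m
  obtain ⟨v, hv, hvw⟩ := hl.exists_shiftFam_eq (j := j) fun n hn t => by
    have : ∀ l, derivMul H l (fun _ => 0) = fun _ => 0 := fun l => by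
      simp [derivMul]
    simp [hw0 n hn, mulPrim, this, primitive_iterate_zero]
  obtain ⟨S, hS⟩ := hv.exists_isLoose m
  have hS' := hvw ▸ hS.shift j
  refine ⟨S, ⟨v, hS⟩, fun φ hφ => hH.cval_mul hd.isLoose hwa hS' hφ, fun c ν hν => ?_⟩
  have hC := hH.nonneg
  have hm : (0 : ℝ) ≤ m := Nat.cast_nonneg m
  have h2 : looseSum m ν (fun n => mulPrim (m * n) H (shiftFam j Δ n)) ≤
      ofReal (2 * C * exp (1 / 2)) * stairSum m ν (shiftFam j Δ) := by
    rw [looseSum, stairSum, ← ENNReal.tsum_mul_left]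
    refine tsum_le_tsum fun i => ?_
    have h3 := (hH.lap_mulPrim_le (hd.loose.causal i) (hwa i) (hd.loose.zero i) (m := m)
      (μ := ν - 1 / 2) (by linarith) (by linarith)).trans (mul_le_mul_right
        (lap_le_of_support_le (a := i + 1) (sub_le_self ν (by norm_num))
          fun t ht => hd.2.1 i t fun h => not_lt.2 h.2 ht) _)
    refine (mul_le_mul_right h3 _).trans (le_of_eq ?_)
    have h4 : ofReal (exp (-(1 / 2) * i)) *
        ofReal (exp ((ν - (ν - 1 / 2)) * (i + 1))) =
          ofReal (exp (1 / 2)) := by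
      rw [← ofReal_mul (exp_nonneg _), ← exp_add]; ring_nf
    rw [ofReal_mul (p := 2 * C) (by positivity), ← h4]
    ring
  have h5 := (hS'.stairNorm_le (c := c) (ν := ν) (by linarith)).trans (mul_le_mul_right h2 _)
  rw [mul_left_comm, ← stairNorm_eq hd, stairNorm_shift ⟨v, hS⟩, stairNorm_shift hT,
    mul_left_comm] at h5
  have h6 : ofReal ν ^ m * ofReal (exp (-ν)) ≠ 0 :=
    mul_ne_zero (pow_ne_zero _ (by simp; linarith)) (by simp [Real.exp_pos])
  exact (ENNReal.mul_le_mul_iff_right (pow_ne_zero j h6) (pow_ne_top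
    (mul_ne_top (pow_ne_top ofReal_ne_top) ofReal_ne_top))).1 h5

end

section

/-! ### Multiplication by bounded analytic functions -/

variable {s ψ ψA ψB x θ C ν : ℝ} [IsSign s] [IsAngle ψ] [IsAngle ψA] [IsAngle ψB] {j l m : ℕ}
  {c : ℝ≥0} {h g : ℂ → ℂ} {z : ℂ} {F φ : ℝ → ℂ} {T D : Dist}

/-- The function whose values at `t > j` are those of `h` on the ray of angle `x` from `j`. -/
def turn (x : ℝ) (j : ℕ) (h : ℂ → ℂ) : ℂ → ℂ := fun τ => h (Complex.exp (x * I) * (τ - j) + j)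

lemma turn_zero : turn 0 j h = h := funext fun τ => by simp [turn]

lemma iteratedDeriv_turn (x : ℝ) (j l : ℕ) (h : ℂ → ℂ) (τ : ℂ) :
    iteratedDeriv l (turn x j h) τ = Complex.exp (x * I) ^ l *
      iteratedDeriv l h (Complex.exp (x * I) * (τ - j) + j) := by
  have h1 : ∀ (k : ℂ → ℂ) (e : ℂ), iteratedDeriv l (fun u => k (e * u)) =
      fun u => e ^ l * iteratedDeriv l k (e * u) := fun k e => by
    induction l with
    | zero => simp
    | succ l ih =>
      funext u
      rw [iteratedDeriv_succ, iteratedDeriv_succ, ih, deriv_const_mul_field,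
        deriv_comp_mul_left e (iteratedDeriv l k), smul_eq_mul]
      ring
  have h2 := congrFun (iteratedDeriv_comp_add_const l (fun u => h (Complex.exp (x * I) * u + j))
    (-(j : ℂ))) τ
  simp only [← sub_eq_add_neg] at h2
  rw [show turn x j h = fun τ => h (Complex.exp (x * I) * (τ - j) + j) from rfl, h2,
    h1 (fun u => h (u + j)), iteratedDeriv_comp_add_const]

lemma re_pos_of_mem_side (hz : z ∈ side s ψ) : 0 < z.re := by
  have h1 := IsAngle.le (ψ := ψ)
  refine (Complex.abs_arg_lt_pi_div_two_iff.1 ?_).resolve_right fun h0 => by simp [side, h0] at hz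
  rcases IsSign.out (s := s) with rfl | rfl <;> rw [abs_lt] <;> constructor <;>
    linarith [hz.1, hz.2]

lemma coneBdd_of_bound (hC : 0 ≤ C) (han : ∀ t : ℝ, 0 < t → AnalyticAt ℂ h t)
    (hb : ∀ t : ℝ, 0 < t → j ≤ t → ∀ z ∈ closedBall (t : ℂ) (t / 8),
      DifferentiableAt ℂ h z ∧ ‖h z‖ ≤ C) : ConeBdd h j C := by
  refine ⟨hC, han, fun t ht htj l => ?_⟩
  have h1 := hb t ht htj
  refine (Complex.norm_iteratedDeriv_le_of_forall_mem_sphere_norm_le l (by positivity)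
    (DifferentiableOn.diffContOnCl_ball (U := closedBall (t : ℂ) (t / 8))
      (fun z hz => (h1 z hz).1.differentiableWithinAt) subset_rfl)
    fun z hz => (h1 z (sphere_subset_closedBall hz)).2).trans (le_of_eq ?_)
  rw [div_pow, div_pow]; field_simp

lemma analyticAt_of_re_pos (hh : DifferentiableOn ℂ h {z | 0 < z.re}) (hz : 0 < z.re) :
    AnalyticAt ℂ h z :=
  hh.analyticAt ((isOpen_lt continuous_const continuous_re).mem_nhds hz)

/-- Cauchy's estimate in the right half plane. -/
lemma norm_iteratedDeriv_le_of_re (hh : DifferentiableOn ℂ h {z | 0 < z.re})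
    (hb : ∀ z : ℂ, 0 < z.re → ‖h z‖ ≤ C) {r : ℝ} (hr : 0 < r) (hz : r < z.re) (l : ℕ) :
    ‖iteratedDeriv l h z‖ ≤ l.factorial * C / r ^ l := by
  have h1 : ∀ w ∈ closedBall z r, 0 < w.re := fun w hw => by
    have := (Complex.abs_re_le_norm (z - w)).trans (mem_closedBall_iff_norm'.1 hw)
    rw [Complex.sub_re, abs_le] at this
    linarith
  exact Complex.norm_iteratedDeriv_le_of_forall_mem_sphere_norm_le l hr
    (DifferentiableOn.diffContOnCl_ball (U := closedBall z r) (fun w hw =>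
      (analyticAt_of_re_pos hh (h1 w hw)).differentiableWithinAt) subset_rfl)
    fun w hw => hb w (h1 w (sphere_subset_closedBall hw))

lemma norm_turn_sub_le {t : ℝ} (htj : j ≤ t)
    (hz : z ∈ closedBall (t : ℂ) (t / 8)) :
    ‖Complex.exp (x * I) * (z - j) + j - z‖ ≤ |x| * (9 / 8 * t) ∧ 7 / 8 * t ≤ z.re := by
  rw [mem_closedBall_iff_norm] at hz
  have hj : (0 : ℝ) ≤ j := Nat.cast_nonneg j
  constructor
  · rw [show Complex.exp (x * I) * (z - j) + j - z =
      (Complex.exp (I * x) - 1) * ((z - t) + (t - j : ℝ)) by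
        rw [mul_comm I]; push_cast; ring, norm_mul]
    refine mul_le_mul (Real.norm_exp_I_mul_ofReal_sub_one_le) ((norm_add_le _ _).trans ?_)
      (norm_nonneg _) (abs_nonneg _)
    rw [Complex.norm_real, Real.norm_of_nonneg (by linarith)]
    linarith
  · have := (Complex.abs_re_le_norm (z - t)).trans hz
    rw [Complex.sub_re, Complex.ofReal_re, abs_le] at this
    linarith

lemma coneBdd_turn (hh : DifferentiableOn ℂ h {z | 0 < z.re})
    (hb : ∀ z : ℂ, 0 < z.re → ‖h z‖ ≤ C) (hC : 0 ≤ C) (hx : |x| ≤ 1 / 4) :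
    ConeBdd (turn x j h) j C ∧ ConeBdd (fun z => turn x j h z - h z) j (5 * C * |x|) := by
  have hd : ∀ z : ℂ, 0 < (Complex.exp (x * I) * (z - j) + j).re → AnalyticAt ℂ (turn x j h) z :=
    fun z hz => AnalyticAt.fun_comp (g := h) (analyticAt_of_re_pos hh hz) (by fun_prop)
  have hre : ∀ t : ℝ, 0 < t → 0 < (Complex.exp (x * I) * ((t : ℂ) - j) + j).re := fun t ht => by
    have hj : (0 : ℝ) ≤ j := Nat.cast_nonneg j
    have h1 : 0 < Real.cos x := Real.cos_pos_of_mem_Ioo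
      ⟨by linarith [(abs_le.1 hx).1, Real.pi_gt_three], by linarith [(abs_le.1 hx).2, Real.pi_gt_three]⟩
    rw [← Complex.ofReal_natCast, ← Complex.ofReal_sub, Complex.add_re, Complex.re_mul_ofReal,
      Complex.exp_ofReal_mul_I_re, Complex.ofReal_re]
    nlinarith [Real.cos_le_one x]
  have key : ∀ t : ℝ, 0 < t → j ≤ t → ∀ z ∈ closedBall (t : ℂ) (t / 8), t / 2 < z.re ∧
      t / 2 < (Complex.exp (x * I) * (z - j) + j).re ∧
      ‖Complex.exp (x * I) * (z - j) + j - z‖ ≤ |x| * (9 / 8 * t) := fun t ht htj z hz => by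
    obtain ⟨h1, h2⟩ := norm_turn_sub_le htj hz
    have h3 := (Complex.abs_re_le_norm _).trans h1
    rw [Complex.sub_re, abs_le] at h3
    exact ⟨by linarith, by nlinarith, h1⟩
  refine ⟨coneBdd_of_bound hC (fun t ht => hd t (hre t ht)) fun t ht htj z hz => ?_, coneBdd_of_bound (by positivity)
    (fun t ht => (hd t (hre t ht)).sub (analyticAt_of_re_pos hh (by simpa using ht)))
      fun t ht htj z hz => ?_⟩
  all_goals obtain ⟨h1, h2, h3⟩ := key t ht htj z hz
  · exact ⟨(hd z (by linarith)).differentiableAt, hb _ (by linarith)⟩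
  · refine ⟨((hd z (by linarith)).sub (analyticAt_of_re_pos hh (by linarith))).differentiableAt, ?_⟩
    refine (Convex.norm_image_sub_le_of_norm_deriv_le (s := {w : ℂ | t / 2 < w.re}) (C := 4 * C / t)
      (fun w hw => (analyticAt_of_re_pos hh (lt_trans (by positivity) hw)).differentiableAt) (fun w hw => ?_)
      (convex_halfSpace_re_gt _) h1 h2).trans ?_
    · rw [← iteratedDeriv_one]
      refine (norm_iteratedDeriv_le_of_re hh hb (r := t / 4) (by positivity)
        (lt_trans (by linarith) hw) 1).trans (le_of_eq ?_)
      simp; field_simp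
    · refine (mul_le_mul_of_nonneg_left h3 (by positivity)).trans ?_
      rw [show 4 * C / t * (|x| * (9 / 8 * t)) = 9 / 2 * (C * |x|) by field_simp; ring]
      nlinarith [mul_nonneg hC (abs_nonneg x)]

lemma exists_ray_primitive_turn (hh : DifferentiableOn ℂ h {z | 0 < z.re})
    (hb : ∀ z : ℂ, 0 < z.re → ‖h z‖ ≤ C) {θ₀ : ℝ} {B : ℝ≥0∞}
    (hg : DifferentiableOn ℂ g (side s ψ)) (hθ₀ : θ₀ ∈ Ioc 0 ψ) (hB : B < ⊤)
    (hint : RayInt s θ₀ B g) (hl : j = 0 → l = 0) :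
    ∃ Φ : ℂ → ℂ, DifferentiableOn ℂ Φ (side s ψ) ∧
      (∀ z ∈ side s ψ, iteratedDeriv l Φ z = iteratedDeriv l h (z + j) * g z) ∧
      ∀ θ ∈ Ioo 0 θ₀, ∀ t > (j : ℝ), Φ (rayPt s θ (t - j)) =
        (primitive^[l] (derivMul (turn (s * θ) j h) l fun t => rayFun g s θ (t - j))) t := by
  have hre : ∀ z ∈ side s ψ, (j : ℝ) < (z + j).re ∧ 0 < (z + j).re := fun z hz => by
    have h1 := re_pos_of_mem_side hz
    have h2 : (0 : ℝ) ≤ j := Nat.cast_nonneg j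
    simp only [Complex.add_re, Complex.natCast_re]
    constructor <;> linarith
  have hk : DifferentiableOn ℂ (fun z => iteratedDeriv l h (z + j) * g z) (side s ψ) :=
    fun z hz => by
      refine DifferentiableWithinAt.mul (DifferentiableAt.differentiableWithinAt ?_) (hg z hz)
      rw [iteratedDeriv_eq_iterate]
      exact DifferentiableAt.comp z ((analyticAt_of_re_pos hh (hre z hz).2).iterated_deriv l).differentiableAt
          (by fun_prop)
  have hkb : ∀ z ∈ side s ψ, ‖iteratedDeriv l h (z + j)‖ₑ ≤
      ofReal (l.factorial * C / (1 / 2) ^ l) := fun z hz => by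
    rw [← ofReal_norm]
    refine ofReal_le_ofReal ?_
    rcases Nat.eq_zero_or_pos j with h0 | h0
    · simpa [hl h0, h0] using hb z (re_pos_of_mem_side hz)
    · exact norm_iteratedDeriv_le_of_re hh hb (by norm_num) (lt_of_lt_of_le (by norm_num)
        ((Nat.one_le_cast.2 h0).trans (hre z hz).1.le)) l
  have hc : RayInt s θ₀ (ofReal (l.factorial * C / (1 / 2) ^ l) * B)
      fun z => iteratedDeriv l h (z + j) * g z := fun θ hθ => by
    have hc := continuousOn_ray hk.continuousOn ⟨hθ.1, hθ.2.trans_le hθ₀.2⟩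
    have hle : ∫⁻ t in Ioo 0 1, ‖iteratedDeriv l h (rayPt s θ t + j) * g (rayPt s θ t)‖ₑ ≤
        ofReal (l.factorial * C / (1 / 2) ^ l) * B := by
      refine (setLIntegral_mono' measurableSet_Ioo fun t ht => ?_).trans
        ((lintegral_const_mul' _ _ ofReal_ne_top).le.trans (mul_le_mul_right (hint θ hθ).2 _))
      rw [enorm_mul]
      exact mul_le_mul_left (hkb _ (rayPt_mem_side hθ.1 (hθ.2.trans_le hθ₀.2) ht.1)) _
    exact ⟨causal_indicator (hc.locallyIntegrableOn measurableSet_Ioi)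
      ⟨(hc.mono Ioo_subset_Ioi_self).aestronglyMeasurable measurableSet_Ioo,
        hle.trans_lt (mul_lt_top ofReal_lt_top hB)⟩, hle⟩
  obtain ⟨Φ, h1, h2, -, h3⟩ := exists_ray_primitive_iterate hk hθ₀
    (mul_lt_top ofReal_lt_top hB) hc l
  refine ⟨Φ, h1, h2, fun θ hθ t ht => ?_⟩
  rw [← rayFun_of_pos Φ _ _ (sub_pos.2 ht), congrFun (h3 θ hθ) (t - j),
    ← congrFun (primitive_iterate_const_mul _ _ l) (t - j),
    ← congrFun (primitive_iterate_translate ((hc θ hθ).1.const_mul _) (Nat.cast_nonneg j) l) t]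
  refine congrFun (congrArg _ (funext fun x => ?_)) t
  rw [derivMul, indicator_apply]
  split_ifs with hx
  · rw [iteratedDeriv_turn, rayFun, rayFun, indicator_apply, indicator_apply, rayPt]
    split_ifs
    · push_cast [dir]; ring_nf
    · simp
  · rw [rayFun, indicator_of_notMem, mul_zero]
    have : (0 : ℝ) ≤ j := Nat.cast_nonneg j
    simp only [mem_Ioi, not_lt] at hx ⊢
    linarith

/-- The function `G` with `G^(mj)(z) = h(z + j) g^(mj)(z)` that vanishes to order `mj` at the origin
relative to `g`. -/
lemma exists_mulPrim_ray (hh : DifferentiableOn ℂ h {z | 0 < z.re})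
    (hb : ∀ z : ℂ, 0 < z.re → ‖h z‖ ≤ C) {θ₀ : ℝ} {B : ℝ≥0∞}
    (hg : DifferentiableOn ℂ g (side s ψ)) (hθ₀ : θ₀ ∈ Ioc 0 ψ) (hB : B < ⊤)
    (hint : RayInt s θ₀ B g) (m j : ℕ) :
    ∃ G : ℂ → ℂ, DifferentiableOn ℂ G (side s ψ) ∧
      (j = 0 → EqOn G (fun z => h z * g z) (side s ψ)) ∧
      ∀ θ ∈ Ioo 0 θ₀, ∀ t : ℝ, t ≠ j → rayFun G s θ (t - j) =
        mulPrim (m * j) (turn (s * θ) j h) (fun t => rayFun g s θ (t - j)) t := by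
  have hex : ∀ l : ℕ, ∃ Φ : ℂ → ℂ, (j = 0 → l = 0) → DifferentiableOn ℂ Φ (side s ψ) ∧
      (∀ z ∈ side s ψ, iteratedDeriv l Φ z = iteratedDeriv l h (z + j) * g z) ∧
      ∀ θ ∈ Ioo 0 θ₀, ∀ t > (j : ℝ), Φ (rayPt s θ (t - j)) =
        (primitive^[l] (derivMul (turn (s * θ) j h) l fun t => rayFun g s θ (t - j))) t := fun l => by
    by_cases hl : j = 0 → l = 0
    · obtain ⟨Φ, h1⟩ := exists_ray_primitive_turn hh hb hg hθ₀ hB hint hl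
      exact ⟨Φ, fun _ => h1⟩
    · exact ⟨0, fun h => absurd h hl⟩
  choose Φ hΦ using hex
  have hl : ∀ l ∈ Finset.range (m * j + 1), j = 0 → l = 0 := fun l hl h => by simpa [h] using hl
  refine ⟨fun z => ∑ l ∈ Finset.range (m * j + 1), (-1) ^ l * (m * j).choose l * Φ l z,
    DifferentiableOn.fun_sum fun l hl' => ((hΦ l (hl l hl')).1).const_mul _, fun h0 z hz => ?_,
    fun θ hθ t ht => ?_⟩
  · have h1 := (hΦ 0 fun _ => rfl).2.1 z hz
    simp only [iteratedDeriv_zero] at h1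
    subst h0
    simp [h1]
  · rcases lt_or_gt_of_ne ht with ht | ht
    · rw [rayFun, indicator_of_notMem (by simpa using ht.le)]
      exact (mulPrim_eq_zero (fun x hx => indicator_of_notMem (by simpa using hx.le) _) t ht).symm
    · rw [rayFun, indicator_of_mem (mem_Ioi.2 (sub_pos.2 ht)), mulPrim]
      exact sum_congr rfl fun l hl' => by rw [(hΦ l (hl l hl')).2.2 θ hθ t ht]

lemma cval_shift_ofFun (hF : Causal F) (m j : ℕ) (hφ : IsTest φ) :
    (shiftDeriv m j (Dist.ofFun F)).cval φ =
      (-1) ^ (m * j) * ∫ t, iteratedDeriv (m * j) φ t * F (t - j) := by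
  obtain ⟨N, hN⟩ := hφ.exists_nat
  have h1 := ((hF.isLoose_level0 m).shift j).pair φ hφ (N + j + 1)
    (hN.trans (Iio_subset_Iio (by push_cast; linarith [(Nat.cast_nonneg j : (0 : ℝ) ≤ j)])))
  rw [h1, loosePair, Finset.sum_eq_single_of_mem j (by simp)]
  · simp [shiftFam, level0]
  · intro n _ hn
    have : ∀ t, shiftFam j (level0 F) n t = 0 := fun t => by
      rw [shiftFam, ite_eq_right_iff]
      exact fun h => by rw [level0, if_neg (by omega)]
    simp [this]

lemma cval_add_test {ψ : ℝ → ℂ} (hφ : IsTest φ) (hψ : IsTest ψ) (T : Dist) :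
    T.cval (fun t => φ t + ψ t) = T.cval φ + T.cval ψ := by
  have h : IsTest (fun t => φ t + ψ t) := ⟨hφ.smooth.add hψ.smooth, hφ.compact.add hψ.compact,
    (tsupport_add φ ψ).trans (union_subset hφ.supp hψ.supp)⟩
  have h1 : h.re = hφ.re + hψ.re := by ext t; rfl
  have h2 : h.im = hφ.im + hψ.im := by ext t; rfl
  rw [h.cval, hφ.cval, hψ.cval, h1, h2, map_add, map_add]; ring

/-- A component of the product of `f` with the bounded analytic function `h`. -/
theorem exists_mul_component (hc : 1 ≤ c) (hh : DifferentiableOn ℂ h {z | 0 < z.re}) (hC : 0 ≤ C)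
    (hb : ∀ z : ℂ, 0 < z.re → ‖h z‖ ≤ C) (hg : DifferentiableOn ℂ g (side s ψ))
    (hD : ∀ᶠ ν in atTop, RayLim c m ν s g D) (j : ℕ) :
    ∃ (G : ℂ → ℂ) (S : Dist), DifferentiableOn ℂ G (side s ψ) ∧
      (j = 0 → EqOn G (fun z => h z * g z) (side s ψ)) ∧ IsStair m S ∧
      (∀ φ, IsTest φ → (shiftDeriv m j S).cval φ = (shiftDeriv m j D).cval fun t => h t * φ t) ∧
      ∀ ν : ℝ, 16 * m + 2 ≤ ν → (stairNorm c m ν S ≤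
        ofReal (2 * C * exp (1 / 2)) * stairNorm c m ν D) ∧
        (RayLim c m ν s g D → RayLim c m ν s G S) := by
  obtain ⟨ν, hν, hlim⟩ := ((eventually_ge_succ m).and hD).exists
  obtain ⟨θ₀, hθ₀, B, hB, hnear⟩ := hlim.near_zero hc (one_le_of_succ_le hν) hg.continuousOn
  obtain ⟨G, hG, hG0, hGr⟩ := exists_mulPrim_ray hh hb hg hθ₀ hB hnear m j
  have hDs := isStair_of_stairNorm hlim.fin
  have h0 := (coneBdd_turn (x := 0) (j := j) hh hb hC (by simp)).1
  rw [turn_zero] at h0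
  obtain ⟨S, hS, hSφ, hSn⟩ := h0.exists_mul hDs
  refine ⟨G, S, hG, hG0, hS, hSφ, fun ν hν => ⟨hSn c ν hν, fun hl => ⟨(hSn c ν hν).trans_lt
    (mul_lt_top ofReal_lt_top hl.fin), ?_⟩⟩⟩
  have hbound : ∀ᶠ θ in 𝓝[>] (0 : ℝ), stairNorm c m ν (Dist.ofFun (rayFun G s θ) - S) ≤
      ofReal (2 * C * exp (1 / 2)) * stairNorm c m ν (Dist.ofFun (rayFun g s θ) - D) +
        ofReal (2 * (5 * C * θ) * exp (1 / 2)) * stairNorm c m ν D := by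
    filter_upwards [Ioo_mem_nhdsGT (show 0 < min θ₀ (1 / 4) from lt_min hθ₀.1 (by norm_num))] with θ hθ
    have hθ' : θ ∈ Ioo 0 θ₀ := ⟨hθ.1, hθ.2.trans_le (min_le_left _ _)⟩
    have hs : |s * θ| = θ := by
      rcases IsSign.out (s := s) with rfl | rfl <;> simp [abs_of_pos hθ.1]
    obtain ⟨b1, b2⟩ := coneBdd_turn (x := s * θ) (j := j) hh hb hC
      (hs.trans_le (hθ.2.le.trans (min_le_right _ _)))
    rw [hs] at b2
    have hcF := (hnear θ hθ').1
    have hsF := hcF.isStair m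
    have hz : ∀ t < (j : ℝ), rayFun g s θ (t - j) = 0 := fun t ht =>
      indicator_of_notMem (by simpa using ht.le) _
    obtain ⟨S₁, hS₁, hφ₁, hn₁⟩ := b1.exists_mul (hsF.sub hDs)
    obtain ⟨S₂, hS₂, hφ₂, hn₂⟩ := b2.exists_mul hDs
    have hcG : Causal (rayFun G s θ) := by
      refine ⟨(((b1.causal_mulPrim (hcF.translate (Nat.cast_nonneg j)) hz hz (m := m)).locInt_comp_add
        j)).congr ?_, fun t ht => indicator_of_notMem (by simpa using ht.le) _⟩
      filter_upwards [ae_ne 0] with t ht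
      have := hGr θ hθ' (t + j) (by simpa using ht)
      rw [← this, add_sub_cancel_right]
    have heq : Dist.ofFun (rayFun G s θ) - S = S₁ + S₂ := by
      refine shift_injective (j := j) ((hcG.isStair m).sub hS) (hS₁.add hS₂)
        (Dist.ext_cval fun φ hφ => ?_)
      rw [shiftDeriv_sub (hcG.isStair m) hS, shiftDeriv_add hS₁ hS₂, cval_sub, cval_add,
        hφ₁ φ hφ, hφ₂ φ hφ, shiftDeriv_sub hsF hDs, cval_sub, hSφ φ hφ, cval_shift_ofFun hcG m j hφ]
      have t0 := fun t ht => h0.an t (hφ.supp ht)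
      have t1 := fun t ht => b1.an t (hφ.supp ht)
      have t2 := fun t ht => b2.an t (hφ.supp ht)
      have e1 := cval_add_test (hφ.analytic_mul t0).1 (hφ.analytic_mul t2).1 (shiftDeriv m j D)
      have e2 : ∀ t : ℝ, h t * φ t + (turn (s * θ) j h t - h t) * φ t = turn (s * θ) j h t * φ t :=
        fun t => by ring
      simp only [e2] at e1
      rw [cval_shift_ofFun hcF m j (hφ.analytic_mul t1).1, e1, ← b1.integral_mulPrim
        (hcF.translate (Nat.cast_nonneg j)) hz hz hφ, integral_congr_ae (g := fun t => iteratedDeriv (m * j) φ t * mulPrim (m * j)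
          (turn (s * θ) j h) (fun t => rayFun g s θ (t - j)) t)]
      · ring
      · filter_upwards [ae_ne j] with t ht
        rw [hGr θ hθ' t ht]
    rw [heq]
    exact (stairNorm_add_le c m ν S₁ S₂).trans (add_le_add (hn₁ c ν hν) (hn₂ c ν hν))
  refine tendsto_zero_of_le ?_ hbound
  have h1 : Continuous fun θ : ℝ => ofReal (2 * (5 * C * θ) * exp (1 / 2)) :=
    ENNReal.continuous_ofReal.comp (by fun_prop)
  simpa using (ENNReal.Tendsto.const_mul hl.lim (Or.inr ofReal_ne_top)).add
    (ENNReal.Tendsto.mul_const (tendsto_nhdsWithin_of_tendsto_nhds (h1.tendsto 0))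
      (Or.inr hl.fin.ne))

lemma HasDecomp.mul (hc : 1 ≤ c) (hh : DifferentiableOn ℂ h {z | 0 < z.re}) (hC : 0 ≤ C)
    (hb : ∀ z : ℂ, 0 < z.re → ‖h z‖ ≤ C) {f : ℂ → ℂ} {D : ℕ → Dist}
    (hD : HasDecomp c m s ψA ψB f D) :
    ∃ D', HasDecomp c m s ψA ψB (fun z => h z * f z) D' ∧
      ∀ (j : ℕ) (ν : ℝ), 16 * m + 2 ≤ ν → stairNorm c m ν (shiftDeriv m j (D' j)) ≤
        ofReal (2 * C * exp (1 / 2)) * stairNorm c m ν (shiftDeriv m j (D j)) := by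
  obtain ⟨T, g, hg⟩ := hD
  obtain ⟨GA, T', hGA, hGA0, hT', hTφ, hTν⟩ :=
    exists_mul_component (m := m) hc hh hC hb hg.diffA hg.limA 0
  choose G S hG hG0 hS hSφ hSν using fun j => exists_mul_component (m := m) hc hh hC hb (hg.diffB j)
    (hg.limB.mono fun ν h => h j) j
  have hf : EqOn (G 0) (fun z => h z * f z) (side s ψB) := hg.zero ▸ hG0 0 rfl
  have hν : ∀ᶠ ν : ℝ in atTop, 16 * m + 2 ≤ ν := eventually_ge_atTop _
  refine ⟨S, ⟨T', fun j => if j = 0 then fun z => h z * f z else G j, rfl,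
    hGA.congr fun z hz => (hGA0 rfl hz).symm, fun j => ?_, ?_, ?_, fun j => ?_⟩, fun j ν hν => ?_⟩
  · split_ifs with h0
    · exact (hG 0).congr fun z hz => (hf hz).symm
    · exact hG j
  · filter_upwards [hν, hg.limA] with ν h1 h2 using ((hTν ν h1).2 h2).congr (hGA0 rfl)
  · filter_upwards [hν, hg.limB] with ν h1 h2 j
    have := (hSν j ν h1).2 (h2 j)
    split_ifs with h0
    · subst h0; exact this.congr hf
    · exact this
  · refine eqBelow_iff.2 fun φ hφ hs => ?_
    obtain ⟨h1, h2⟩ := hφ.analytic_mul fun t ht => analyticAt_of_re_pos hh (by simpa using hφ.supp ht)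
    have h3 := hTφ φ hφ
    rw [shiftDeriv_zero_index hT', shiftDeriv_zero_index hg.isStairA,
      eqBelow_iff.1 (hg.rel j) _ h1 (h2.trans hs), cval_sum] at h3
    rw [h3, cval_sum]
    exact sum_congr rfl fun i _ => (hSφ i φ hφ).symm
  · rw [stairNorm_shift (hS j), stairNorm_shift (hg.isStair j), mul_left_comm]
    exact mul_le_mul_right (hSν j ν hν).1 _

lemma Admits.of_le (hc : 1 ≤ c) {K : ℝ → ℝ≥0} {D D' : ℕ → Dist} (hK : Admits c m K D)
    (hD' : HasDecomp c m s ψA ψB g D') (b : ℝ≥0) (h : ∀ᶠ ν in atTop, ∀ j,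
      stairNorm c m ν (shiftDeriv m j (D' j)) ≤ b * stairNorm c m ν (shiftDeriv m j (D j))) :
    Admits c m (fun ν => (1 + b) * K ν) D' := by
  filter_upwards [hK, h, eventually_stairNorm_le_one hc
    (hD'.limB_zero.2.mono fun ν h => h.fin)] with ν h1 h2 h3 j
  rcases Nat.eq_zero_or_pos j with rfl | hj
  · simpa [shiftDeriv_zero_index (hD'.isStair 0)] using h3
  · refine (h2 j).trans ((mul_le_mul_right (h1 j) _).trans ?_)
    rw [← ENNReal.coe_pow, ← ENNReal.coe_pow, ← ENNReal.coe_mul, ENNReal.coe_le_coe, mul_pow]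
    gcongr
    exact le_self_add.trans ((add_comm b 1).le.trans (le_self_pow₀ le_self_add hj.ne'))

theorem MemF.mul (hc : 1 ≤ c) (hh : DifferentiableOn ℂ h {z | 0 < z.re})
    (hb : ∀ z : ℂ, 0 < z.re → ‖h z‖ ≤ C) {f : ℂ → ℂ} (hf : MemF c m (-ψA) ψB f) :
    MemF c m (-ψA) ψB (fun z => h z * f z) := by
  obtain ⟨Dp, Dm, hD, K, hK, hKp, hKm⟩ := (memF_iff hc).1 hf
  have hC : 0 ≤ C := (norm_nonneg _).trans (hb 1 (by simp))
  obtain ⟨Ep, hEp, hp⟩ := hD.up.mul hc hh hC hb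
  obtain ⟨Em, hEm, hm⟩ := hD.low.mul hc hh hC hb
  have hν : ∀ᶠ ν : ℝ in atTop, 16 * m + 2 ≤ ν := eventually_ge_atTop _
  refine (memF_iff hc).2 ⟨Ep, Em, ⟨fun z hz => (analyticAt_of_re_pos hh ?_).mul (hD.an z hz), hEp, hEm⟩, _, ?_,
    hKp.of_le hc hEp _ (hν.mono fun ν h j => hp j ν h),
    hKm.of_le hc hEm _ (hν.mono fun ν h j => hm j ν h)⟩
  · rcases hz with (hz | ⟨t, ht, rfl⟩) | hz
    · exact re_pos_of_mem_side hz
    · simpa using ht.1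
    · exact re_pos_of_mem_side (by simpa using hz)
  · simpa using hK.const_mul (1 + (2 * C * exp (1 / 2)).toNNReal)

end

section

/-! ### Averages and multiplication -/

variable {s ψ ψA ψB ν : ℝ} [IsSign s] [IsAngle ψ] [IsAngle ψA] [IsAngle ψB] {j m : ℕ}
  {c : ℝ≥0} {h g g' : ℂ → ℂ} {φ : ℝ → ℂ} {T D D' : Dist}

lemma IsTest.integral_iteratedDeriv_mul (hφ : IsTest φ) {k : ℂ → ℂ}
    (hk : ∀ t ∈ tsupport φ, AnalyticAt ℂ k (t : ℝ)) (N : ℕ) :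
    ∫ t, _root_.iteratedDeriv N φ t * k t =
      (-1) ^ N * ∫ t, φ t * _root_.iteratedDeriv N k (t : ℝ) := by
  induction N generalizing φ with
  | zero => simp
  | succ N ih =>
    have hsub : tsupport (_root_.deriv φ) ⊆ tsupport φ := by
      simpa using tsupport_iteratedDeriv_subset (ψ := φ) 1
    have hkN : ∀ t ∈ tsupport φ, AnalyticAt ℂ (_root_.iteratedDeriv N k) (t : ℝ) := fun t ht => by
      rw [iteratedDeriv_eq_iterate]; exact (hk t ht).iterated_deriv N
    have h1 := (hφ.analytic_mul hkN).1
    have h2 := (hφ.analytic_mul fun t ht => (hkN t ht).deriv).1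
    have h3 := (hφ.deriv.analytic_mul fun t ht => hkN t (hsub ht)).1
    have hd : ∀ t : ℝ, HasDerivAt (fun t : ℝ => _root_.iteratedDeriv N k t * φ t)
        (_root_.deriv (_root_.iteratedDeriv N k) t * φ t +
          _root_.iteratedDeriv N k t * _root_.deriv φ t) t := fun t => by
      by_cases ht : t ∈ tsupport φ
      · exact (hkN t ht).differentiableAt.hasDerivAt.comp_ofReal.mul
          (hφ.smooth.differentiable (by simp) t).hasDerivAt
      · have h0 := notMem_tsupport_iff_eventuallyEq.1 ht
        rw [image_eq_zero_of_notMem_tsupport ht,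
          image_eq_zero_of_notMem_tsupport fun h => ht (hsub h), mul_zero, mul_zero, add_zero]
        exact (hasDerivAt_const t (0 : ℂ)).congr_of_eventuallyEq
          (h0.mono fun x hx => by simp [hx])
    have hi : ∀ {ψ : ℝ → ℂ}, IsTest ψ → Integrable ψ := fun h =>
      h.smooth.continuous.integrable_of_hasCompactSupport h.compact
    have h4 := integral_eq_zero_of_hasDerivAt_of_integrable hd ((hi h2).add (hi h3)) (hi h1)
    replace h4 := (integral_add (hi h2) (hi h3)).symm.trans h4
    rw [add_comm] at h4
    rw [iteratedDeriv_succ', ih hφ.deriv fun t ht => hk t (hsub ht), iteratedDeriv_succ,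
      pow_succ, mul_assoc, neg_one_mul]
    congr 1
    rw [← eq_neg_iff_add_eq_zero] at h4
    simpa only [mul_comm (φ _), mul_comm (_root_.deriv φ _)] using h4

/-- Cauchy's estimate for the derivatives of `V φ`. -/
lemma IsTest.exists_bound_mul (hφ : IsTest φ) {r : ℝ} (hr : 0 < r) (K : ℕ) :
    ∃ B : ℝ, 0 ≤ B ∧ ∀ (V : ℂ → ℂ) (ε : ℝ), 0 ≤ ε → (∀ t ∈ tsupport φ, ∀ z ∈
      closedBall ((t : ℝ) : ℂ) r, AnalyticAt ℂ V z ∧ ‖V z‖ ≤ ε) → ∀ k ≤ K, ∀ t,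
        ‖_root_.iteratedDeriv k (fun t : ℝ => V t * φ t) t‖ ≤ ε * B := by
  obtain ⟨B, hB0, hB⟩ := hφ.exists_bound K
  refine ⟨∑ k ∈ Finset.range (K + 1), ∑ l ∈ Finset.range (k + 1),
    k.choose l * (l.factorial / r ^ l) * B, by positivity, fun V ε hε hV k hk t => ?_⟩
  have han : ∀ t ∈ tsupport φ, AnalyticAt ℂ V (t : ℝ) := fun t ht =>
    (hV t ht t (Metric.mem_closedBall_self hr.le)).1
  by_cases ht : t ∈ tsupport φ
  · refine le_trans ?_ (mul_le_mul_of_nonneg_left (Finset.single_le_sum (f := fun k : ℕ =>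
      ∑ l ∈ Finset.range (k + 1), (k.choose l * (l.factorial / r ^ l) * B : ℝ))
        (fun k _ => by positivity) (Finset.mem_range.2 (Nat.lt_succ_of_le hk))) hε)
    rw [hφ.iteratedDeriv_analytic_mul han, mul_sum]
    refine norm_sum_le_of_le _ fun l hl => ?_
    rw [norm_mul, norm_mul, Complex.norm_natCast]
    have h1 := Complex.norm_iteratedDeriv_le_of_forall_mem_sphere_norm_le l hr
      (DifferentiableOn.diffContOnCl_ball (U := closedBall ((t : ℝ) : ℂ) r)
        (fun z hz => (hV t ht z hz).1.differentiableWithinAt) subset_rfl)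
      fun z hz => (hV t ht z (sphere_subset_closedBall hz)).2
    calc _ ≤ k.choose l * (l.factorial * ε / r ^ l) * B := by
          gcongr; exact hB _ (by omega) t
      _ = _ := by ring
  · rw [image_eq_zero_of_notMem_tsupport fun h' =>
      ht ((hφ.analytic_mul han).2 (tsupport_iteratedDeriv_subset k h')), norm_zero]
    positivity

/-- The functions that `h` induces on the rays converge locally uniformly. -/
lemma eventually_turn_close {K : Set ℂ} (hK : IsCompact K) (hh : ∀ z ∈ K, AnalyticAt ℂ h z) (s : ℝ) (j : ℕ) {ε : ℝ} (hε : 0 < ε) :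
    ∀ᶠ θ : ℝ in 𝓝 0, ∀ z ∈ K, AnalyticAt ℂ (turn (s * θ) j h) z ∧
      ‖turn (s * θ) j h z - h z‖ ≤ ε := by
  refine hK.eventually_forall_of_forall_eventually fun z hz => ?_
  have hc : Continuous fun p : ℝ × ℂ => Complex.exp ((s * p.1 : ℝ) * I) * (p.2 - j) + j := by
    fun_prop
  have h0 : Complex.exp ((s * (0 : ℝ) : ℝ) * I) * (z - j) + j = z := by simp
  have hz' := (hh z hz).continuousAt
  have h1 : ContinuousAt (fun p : ℝ × ℂ => turn (s * p.1) j h p.2 - h p.2) (0, z) :=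
    (ContinuousAt.comp (g := h) (by rwa [h0]) hc.continuousAt).sub
      (ContinuousAt.comp (g := h) hz' continuousAt_snd)
  have h2 : turn (s * 0) j h z - h z = 0 := by rw [mul_zero, turn_zero, sub_self]
  have h3 := h1.tendsto
  simp only [h2] at h3
  filter_upwards [hc.continuousAt.eventually
    (h0.symm ▸ (hh z hz).eventually_analyticAt),
    h3.norm.eventually_le_const (by simpa using hε)] with p hp hp'
  exact ⟨AnalyticAt.fun_comp (g := h) hp (by fun_prop), hp'⟩

/-- Passage to the limit in `g'^(mj)(z) = h(z + j) g^(mj)(z)`. -/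
lemma cval_shift_mul (hc : 1 ≤ c) (hν : 1 ≤ ν) (hpos : ∀ t : ℝ, 0 < t → AnalyticAt ℂ h t)
    (hg : DifferentiableOn ℂ g (side s ψ)) (hD : RayLim c m ν s g D)
    (hg' : DifferentiableOn ℂ g' (side s ψ)) (hD' : RayLim c m ν s g' D')
    (heq : ∀ z ∈ side s ψ, iteratedDeriv (m * j) g' z = h (z + j) * iteratedDeriv (m * j) g z)
    (hφ : IsTest φ) (hφj : tsupport φ ⊆ Ioi (j : ℝ)) :
    (shiftDeriv m j D').cval φ = (shiftDeriv m j D).cval fun t => h t * φ t := by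
  obtain ⟨θ₀, hθ₀, _, -, hn⟩ := hD.near_zero hc hν hg.continuousOn
  obtain ⟨θ₁, hθ₁, _, -, hn'⟩ := hD'.near_zero hc hν hg'.continuousOn
  have hs := isStair_of_stairNorm hD.fin
  have hs' := isStair_of_stairNorm hD'.fin
  obtain ⟨r, hr, hrΩ⟩ := (hφ.compact.isCompact.image Complex.continuous_ofReal)
    |>.exists_cthickening_subset_open (isOpen_analyticAt ℂ h) (by rintro _ ⟨t, ht, rfl⟩; exact hpos t (hφ.supp ht))
  have hK := (hφ.compact.isCompact.image Complex.continuous_ofReal).cthickening (r := r)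
  have hball : ∀ t ∈ tsupport φ, closedBall ((t : ℝ) : ℂ) r ⊆
      Metric.cthickening r (Complex.ofReal '' tsupport φ) := fun t ht =>
    Metric.closedBall_subset_cthickening (mem_image_of_mem _ ht) r
  have hhan : ∀ t ∈ tsupport φ, AnalyticAt ℂ h (t : ℝ) := fun t ht =>
    hpos t (hφ.supp ht)
  have hw := hφ.analytic_mul hhan
  obtain ⟨N, hN⟩ := hφ.exists_nat
  obtain ⟨B, hB0, hB⟩ := hφ.exists_bound_mul hr (m * N)
  have hlim : ∀ {g D}, IsStair m D → RayLim c m ν s g D → (∀ θ ∈ Ioo 0 (min θ₀ θ₁),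
      Causal (rayFun g s θ)) → Tendsto (fun θ => stairNorm c m ν (shiftDeriv m j
        (Dist.ofFun (rayFun g s θ)) - shiftDeriv m j D)) (𝓝[>] 0) (𝓝 0) := fun {g D} hD hl hF => by
    have := ENNReal.Tendsto.const_mul hl.lim (a := (ofReal ν ^ m *
      ofReal (exp (-ν))) ^ j) (Or.inr (pow_ne_top (mul_ne_top
        (pow_ne_top ofReal_ne_top) ofReal_ne_top)))
    rw [mul_zero] at this
    refine this.congr' ?_
    filter_upwards [Ioo_mem_nhdsGT (lt_min hθ₀.1 hθ₁.1)] with θ hθ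
    rw [← shiftDeriv_sub ((hF θ hθ).isStair m) hD, stairNorm_shift (((hF θ hθ).isStair m).sub hD)]
  have hF : ∀ θ ∈ Ioo 0 (min θ₀ θ₁), Causal (rayFun g s θ) ∧ Causal (rayFun g' s θ) := fun θ hθ =>
    ⟨(hn θ ⟨hθ.1, hθ.2.trans_le (min_le_left _ _)⟩).1,
      (hn' θ ⟨hθ.1, hθ.2.trans_le (min_le_right _ _)⟩).1⟩
  have l1 := hlim hs hD fun θ hθ => (hF θ hθ).1
  have t1 := tendsto_cval hc hν l1 hw.1
  have t2 := tendsto_cval hc hν (hlim hs' hD' fun θ hθ => (hF θ hθ).2) hφ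
  have hfin : stairNorm c m ν (shiftDeriv m j D) < ⊤ := by
    rw [stairNorm_shift hs]
    exact mul_lt_top (pow_lt_top (mul_lt_top
      (pow_lt_top ofReal_lt_top) ofReal_lt_top)) hD.fin
  set M := (1 + stairNorm c m ν (shiftDeriv m j D)).toReal
  set Q := B * exp (ν * N) * M
  have hQ : 0 ≤ Q := by positivity
  refine sub_eq_zero.1 (tendsto_nhds_unique (t2.sub t1) (Metric.tendsto_nhds.2 fun δ hδ => ?_))
  have hε : 0 < δ / (Q + 1) := by positivity
  filter_upwards [Ioo_mem_nhdsGT (lt_min hθ₀.1 hθ₁.1), nhdsWithin_le_nhds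
    (eventually_turn_close hK hrΩ s j hε), l1.eventually_le_const one_pos,
    Ioo_mem_nhdsGT (IsAngle.pos (ψ := ψ))] with θ hθ hcl hle hθψ
  obtain ⟨hF1, hF2⟩ := hF θ hθ
  have htan : ∀ t ∈ tsupport φ, AnalyticAt ℂ (turn (s * θ) j h) (t : ℝ) := fun t ht =>
    (hcl t (hball t ht (Metric.mem_closedBall_self hr.le))).1
  have hdan := fun t ht => (htan t ht).sub (hhan t ht)
  -- both sides are integrals of `φ` against the `mj`-th derivatives on the translated ray
  have hray : ∀ {g : ℂ → ℂ} {φ : ℝ → ℂ}, DifferentiableOn ℂ g (side s ψ) → IsTest φ →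
      tsupport φ ⊆ Ioi (j : ℝ) → Causal (rayFun g s θ) →
      (shiftDeriv m j (Dist.ofFun (rayFun g s θ))).cval φ = ∫ t, φ t *
        (dir s θ ^ (m * j) *
          iteratedDeriv (m * j) g (rayPt s θ (t - j))) := fun {g φ} hg hφ hφj hF => by
    have hmem : ∀ t ∈ tsupport φ, rayPt s θ (t - j) ∈ side s ψ := fun t ht =>
      rayPt_mem_side hθψ.1 hθψ.2 (sub_pos.2 (hφj ht))
    have h1 : ∀ τ, turn (s * θ) j (fun z => g (z - j)) τ =
        g (dir s θ * (τ - j)) := fun τ => by simp [turn, dir]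
    have h2 := hφ.integral_iteratedDeriv_mul (k := turn (s * θ) j fun z => g (z - j))
      (fun t ht => by
        rw [funext h1]
        refine AnalyticAt.fun_comp (g := g) (hg.analyticAt (isOpen_side.mem_nhds ?_)) (by fun_prop)
        convert hmem t ht using 1
        rw [rayPt]; push_cast [dir]; ring) (m * j)
    rw [cval_shift_ofFun hF m j hφ, integral_congr_ae (g := fun t => iteratedDeriv (m * j) φ t *
      turn (s * θ) j (fun z => g (z - j)) t) (ae_of_all _ fun t => ?_), h2, ← mul_assoc,
      pow_mul_pow_eq_one _ (by norm_num), one_mul]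
    · congr 1 with t
      rw [iteratedDeriv_turn, show (fun z => g (z - j)) = fun z => g (z + -j) from rfl,
        iteratedDeriv_comp_add_const, rayPt]
      push_cast [dir]
      ring_nf
    · beta_reduce
      by_cases ht : t ∈ tsupport φ
      · rw [h1, rayFun, indicator_of_mem (mem_Ioi.2 (sub_pos.2 (hφj ht))), rayPt]
        push_cast [dir]
        ring_nf
      · rw [image_eq_zero_of_notMem_tsupport fun h => ht (tsupport_iteratedDeriv_subset _ h)]
        simp
  have e1 : (shiftDeriv m j (Dist.ofFun (rayFun g' s θ))).cval φ =
      (shiftDeriv m j (Dist.ofFun (rayFun g s θ))).cval fun t => turn (s * θ) j h t * φ t := by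
    obtain ⟨h1, h2⟩ := hφ.analytic_mul htan
    rw [hray hg' hφ hφj hF2, hray hg h1 (h2.trans hφj) hF1]
    congr 1 with t
    by_cases ht : t ∈ tsupport φ
    · rw [heq _ (rayPt_mem_side hθψ.1 hθψ.2 (sub_pos.2 (hφj ht))), turn, rayPt]
      push_cast [dir]
      ring_nf
    · simp [image_eq_zero_of_notMem_tsupport ht]
  have e2 := cval_add_test hw.1 (hφ.analytic_mul hdan).1 (shiftDeriv m j (Dist.ofFun (rayFun g s θ)))
  have e3 : ∀ t : ℝ, h t * φ t + (turn (s * θ) j h - h) t * φ t = turn (s * θ) j h t * φ t :=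
    fun t => by simp only [Pi.sub_apply]; ring
  simp only [e3] at e2
  rw [dist_zero_right, e1, e2, add_sub_cancel_left]
  have hR : stairNorm c m ν (shiftDeriv m j (Dist.ofFun (rayFun g s θ))) ≤
      1 + stairNorm c m ν (shiftDeriv m j D) :=
    (stairNorm_le_sub_add _ _ _ _ (shiftDeriv m j D)).trans (by gcongr)
  have hM : 1 + stairNorm c m ν (shiftDeriv m j D) < ⊤ :=
    ENNReal.add_lt_top.2 ⟨one_lt_top, hfin⟩
  have h5 := (enorm_cval_le hc hν (hφ.analytic_mul hdan).1 ((hφ.analytic_mul hdan).2.trans hN)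
    (hB _ _ hε.le fun t ht z hz => ⟨(hcl z (hball t ht hz)).1.sub
      (hrΩ (hball t ht hz)), (hcl z (hball t ht hz)).2⟩) (hR.trans_lt hM)).trans
        (mul_le_mul_right hR _)
  rw [← ENNReal.ofReal_toReal hM.ne, ← ofReal_mul (by positivity), ← ofReal_norm,
    ENNReal.ofReal_le_ofReal_iff (by positivity)] at h5
  refine h5.trans_lt ?_
  rw [show δ / (Q + 1) * B * exp (ν * N) * M = δ * (Q / (Q + 1)) by simp only [Q]; ring]
  exact mul_lt_of_lt_one_right hδ ((div_lt_one (by positivity)).2 (by linarith))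

lemma Components.iteratedDeriv_mul (hc : 1 ≤ c) (hh : AnalyticOnNhd ℂ h (sector (-ψA) ψB))
    {f : ℂ → ℂ} {T T' : Dist} {g g' : ℕ → ℂ → ℂ} {D D' : ℕ → Dist}
    (hf : Components c m 1 ψA ψB f T g D)
    (hf' : Components c m 1 ψA ψB (fun z => h z * f z) T' g' D') (j : ℕ) :
    ∀ z ∈ side 1 ψB, iteratedDeriv (m * j) (g' j) z =
      h (z + j) * iteratedDeriv (m * j) (g j) z := by
  induction j using Nat.strong_induction_on with
  | _ j ih =>
  intro z hz
  obtain ⟨ν, hν, h1, h2, h3, h4⟩ := ((eventually_ge_succ m).and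
    (hf.limA.and (hf.limB.and (hf'.limA.and hf'.limB)))).exists
  have hν := one_le_of_succ_le hν
  obtain ⟨b, hb, hbf, hbg⟩ := exists_continuation hc hν hf.diffA h1 hf.diffB h2 j (hf.rel j)
  obtain ⟨b', hb', hbf', hbg'⟩ := exists_continuation hc hν hf'.diffA h3 hf'.diffB h4 j (hf'.rel j)
  have hsub : crossing (side (-1) ψA) (side 1 ψB) j ⊆ sector (-ψA) ψB := by
    rintro w ((hw | ⟨t, ht, rfl⟩) | hw)
    · exact side_neg_subset_sector hw
    · exact ofReal_mem_sector (lt_of_le_of_lt (Nat.cast_nonneg j) ht.1)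
    · have := add_ofReal_mem_side hw (Nat.cast_nonneg (α := ℝ) j)
      exact side_one_subset_sector (by simpa using this)
  have hz₀ := rayPt_mem_side (s := -1) (ψ := ψA) (θ := ψA / 2) (t := 1)
    (by linarith [IsAngle.pos (ψ := ψA)]) (by linarith [IsAngle.pos (ψ := ψA)]) one_pos
  have heq := hb'.eqOn_of_preconnected_of_eventuallyEq (g := fun z => h z * b z)
    (fun w hw => (hh w (hsub hw)).mul (hb w hw)) (isPreconnected_crossing (s := 1) j)
    (Or.inl (Or.inl hz₀)) (by
      filter_upwards [isOpen_side.mem_nhds hz₀] with w hw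
      rw [hbf hw, hbf' hw])
  have hzj : z + j - j ∈ side 1 ψB := by simpa using hz
  have h5 := heq (x := z + j) (Or.inr hzj)
  simp only at h5
  rw [hbg _ hzj, hbg' _ hzj, sum_range_succ, sum_range_succ, mul_add, mul_sum,
    sum_congr rfl fun i hi => ?_, add_sub_cancel_right] at h5
  · exact add_left_cancel h5
  · have hi' := Finset.mem_range.1 hi
    have := ih i hi' (z + j - i) (by
      have := add_ofReal_mem_side hz (a := (j - i : ℝ)) (sub_nonneg.2 (by exact_mod_cast hi'.le))
      rwa [Complex.ofReal_sub, Complex.ofReal_natCast, Complex.ofReal_natCast,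
        ← add_sub_assoc] at this)
    rwa [sub_add_cancel] at this

/-- A test function is the sum of one supported below `j + 1` and of one supported above `j`. -/
lemma IsTest.exists_split (hφ : IsTest φ) (j : ℝ) : ∃ φ₁ φ₂, IsTest φ₁ ∧ IsTest φ₂ ∧
    tsupport φ₁ ⊆ Iio (j + 1) ∧ tsupport φ₂ ⊆ Ioi j ∧ φ = fun t => φ₁ t + φ₂ t := by
  have hs : ContDiff ℝ ∞ fun t => ((Real.smoothTransition (3 * (t - j) - 1) : ℝ) : ℂ) :=
    Complex.ofRealCLM.contDiff.comp (Real.smoothTransition.contDiff.comp (by fun_prop))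
  have hm : ∀ χ : ℝ → ℂ, ContDiff ℝ ∞ χ → IsTest fun t => χ t * φ t := fun χ hχ =>
    ⟨hχ.mul hφ.smooth, hφ.compact.mul_left, tsupport_mul_subset_right.trans hφ.supp⟩
  refine ⟨_, _, hm _ ((contDiff_const (c := (1 : ℂ))).sub hs), hm _ hs, ?_, ?_, funext fun t => ?_⟩
  · refine (closure_minimal (t := Iic (j + 2 / 3)) (fun t ht => ?_) isClosed_Iic).trans
      fun t ht => by simp only [mem_Iic, mem_Iio] at *; linarith
    by_contra h
    refine ht ?_
    simp only [mem_Iic, not_le] at h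
    simp [Real.smoothTransition.one_of_one_le (show 1 ≤ 3 * (t - j) - 1 by linarith)]
  · refine (closure_minimal (t := Ici (j + 1 / 3)) (fun t ht => ?_) isClosed_Ici).trans
      fun t ht => by simp only [mem_Ici, mem_Ioi] at *; linarith
    by_contra h
    refine ht ?_
    simp only [mem_Ici, not_le] at h
    simp [Real.smoothTransition.zero_of_nonpos (show 3 * (t - j) - 1 ≤ 0 by linarith)]
  · ring

lemma Components.cval_mul (hc : 1 ≤ c) (hh : AnalyticOnNhd ℂ h (sector (-ψA) ψB))
    {f : ℂ → ℂ} {T T' : Dist} {g g' : ℕ → ℂ → ℂ} {D D' : ℕ → Dist}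
    (hf : Components c m 1 ψA ψB f T g D)
    (hf' : Components c m 1 ψA ψB (fun z => h z * f z) T' g' D') (j : ℕ) (hφ : IsTest φ) :
    (shiftDeriv m j (D' j)).cval φ = (shiftDeriv m j (D j)).cval fun t => h t * φ t := by
  have hpos : ∀ t : ℝ, 0 < t → AnalyticAt ℂ h t := fun t ht => hh t (ofReal_mem_sector ht)
  obtain ⟨ν, hν, h1, h2, h3, h4⟩ := ((eventually_ge_succ m).and
    (hf.limA.and (hf.limB.and (hf'.limA.and hf'.limB)))).exists
  have hν := one_le_of_succ_le hν
  induction j using Nat.strong_induction_on generalizing φ with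
  | _ j ih =>
  obtain ⟨φ₁, φ₂, t1, t2, s1, s2, rfl⟩ := hφ.exists_split j
  have m1 := t1.analytic_mul fun t ht => hpos t (t1.supp ht)
  have m2 := t2.analytic_mul fun t ht => hpos t (t2.supp ht)
  simp only [mul_add]
  rw [cval_add_test t1 t2, cval_add_test m1.1 m2.1]
  congr 1
  · have hT := cval_shift_mul (m := m) (j := 0) hc hν hpos hf.diffA h1 hf'.diffA h3
      (fun z _ => by simp) t1 (by simpa using t1.supp)
    rw [shiftDeriv_zero_index hf'.isStairA, shiftDeriv_zero_index hf.isStairA,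
      eqBelow_iff.1 (hf'.rel j) _ t1 s1, eqBelow_iff.1 (hf.rel j) _ m1.1 (m1.2.trans s1), cval_sum,
      cval_sum, sum_range_succ, sum_range_succ,
      sum_congr rfl fun i hi => ih i (Finset.mem_range.1 hi) t1] at hT
    exact add_left_cancel hT
  · exact cval_shift_mul hc hν hpos (hf.diffB j) (h2 j) (hf'.diffB j) (h4 j)
      (hf.iteratedDeriv_mul hc hh hf' j) t2 s2

theorem IsAverage.exists_mul (hc : 1 ≤ c) (hh : AnalyticOnNhd ℂ h (sector (-ψA) ψB)) {f : ℂ → ℂ}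
    {α : ℂ} {A : Dist} (hf : MemF c m (-ψA) ψB f) (hf' : MemF c m (-ψA) ψB fun z => h z * f z)
    (hA : IsAverage c m (-ψA) ψB α f A) :
    ∃ B, IsMul (fun t => h t) A B ∧ IsAverage c m (-ψA) ψB α (fun z => h z * f z) B := by
  obtain ⟨D, _, hD, K, hK, hKD, -⟩ := (memF_iff hc).1 hf
  obtain ⟨D', _, hD', K', hK', hKD', -⟩ := (memF_iff hc).1 hf'
  obtain ⟨B, hB⟩ := exists_isAvg hc hD'.up.isStair hK' hKD' α
  refine ⟨B, fun φ φr φi hr hi => ?_, (isAverage_iff hc hD'.up hK' hKD').2 hB⟩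
  have hA := (isAverage_iff hc hD.up hK hKD).1 hA
  obtain ⟨T, g, hg⟩ := hD.up
  obtain ⟨T', g', hg'⟩ := hD'.up
  have hφ := isTest_ofReal φ
  have hm := (hφ.analytic_mul fun t ht => hh t (ofReal_mem_sector (hφ.supp ht))).1
  have h1 := hB.hasSum_cval hD'.up.isStair hφ
  simp only [cval_smul, hg.cval_mul hc hh hg' _ hφ] at h1
  have h2 := hA.hasSum_cval hD.up.isStair hm
  simp only [cval_smul] at h2
  have h3 := h1.unique h2
  rw [cval_ofReal, hm.cval] at h3
  have hz : ∀ (χ χ' : 𝓓(posHalfLine, ℝ)), (∀ t > 0, χ t = χ' t) → χ = χ' := fun χ χ' h => by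
    ext t
    by_cases ht : 0 < t
    · exact h t ht
    · rw [image_eq_zero_of_notMem_tsupport fun h' => ht (χ.tsupport_subset h'),
        image_eq_zero_of_notMem_tsupport fun h' => ht (χ'.tsupport_subset h')]
  rw [h3, hz hm.re φr fun t ht => (Complex.re_mul_ofReal _ _).trans (hr t ht).symm,
    hz hm.im φi fun t ht => (Complex.im_mul_ofReal _ _).trans (hi t ht).symm]

end

end Staircase

end

open Staircase in
theorem mainTheorem6 (m : ℕ) (hm : 1 ≤ m) (c : ℝ≥0) (hc : 3 < c) (ψm ψp : ℝ)
    (hψm : -(Real.pi / 2) ≤ ψm) (hψm0 : ψm < 0) (hψp0 : 0 < ψp) (hψp : ψp ≤ Real.pi / 2) :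
    -- the class is closed under convolution
    (∀ f g : ℂ → ℂ, MemF c m ψm ψp f → MemF c m ψm ψp g →
      ∃ h : ℂ → ℂ, MemF c m ψm ψp h ∧ IsConvNearZero f g h) ∧
    -- components and growth bounds of a convolution
    (∀ f g h : ℂ → ℂ, MemF c m ψm ψp f → MemF c m ψm ψp g → MemF c m ψm ψp h →
      IsConvNearZero f g h →
      (∀ D D' : ℕ → Dist, IsUpperDecomp c m ψm ψp f D → IsUpperDecomp c m ψm ψp g D' →
        IsUpperDecomp c m ψm ψp h
          (fun j => ∑ s ∈ Finset.range (j + 1), stairConv m (D s) (D' (j - s)))) ∧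
      (∀ D D' : ℕ → Dist, IsLowerDecomp c m ψm ψp f D → IsLowerDecomp c m ψm ψp g D' →
        IsLowerDecomp c m ψm ψp h
          (fun j => ∑ s ∈ Finset.range (j + 1), stairConv m (D s) (D' (j - s)))) ∧
      (∀ Kf Kg : ℝ → ℝ≥0, IsGrowthBound c m ψm ψp f Kf → IsGrowthBound c m ψm ψp g Kg →
        IsGrowthBound c m ψm ψp h (fun ν => Kf ν + Kg ν))) ∧
    -- multiplication by bounded analytic functions
    (∀ h f : ℂ → ℂ, AnalyticOnNhd ℂ h {z | 0 < z.re} →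
      (∃ C : ℝ, ∀ z : ℂ, 0 < z.re → ‖h z‖ ≤ C) → MemF c m ψm ψp f →
      MemF c m ψm ψp (fun z => h z * f z)) ∧
    -- the averages: they are well defined
    (∀ (α : ℂ) (f : ℂ → ℂ), MemF c m ψm ψp f → ∃! A : Dist, IsAverage c m ψm ψp α f A) ∧
    -- they are linear
    (∀ (α : ℂ) (f g : ℂ → ℂ) (a b : ℂ) (A B : Dist), MemF c m ψm ψp f → MemF c m ψm ψp g →
      IsAverage c m ψm ψp α f A → IsAverage c m ψm ψp α g B →
      MemF c m ψm ψp (fun z => a * f z + b * g z) ∧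
      IsAverage c m ψm ψp α (fun z => a * f z + b * g z) (a • A + b • B)) ∧
    -- they commute with multiplication by functions analytic across the half line
    (∀ (α : ℂ) (h f : ℂ → ℂ) (A : Dist), AnalyticOnNhd ℂ h (sector ψm ψp) →
      MemF c m ψm ψp f → MemF c m ψm ψp (fun z => h z * f z) →
      IsAverage c m ψm ψp α f A →
      ∃ B : Dist, IsMul (fun t => h t) A B ∧
        IsAverage c m ψm ψp α (fun z => h z * f z) B) ∧
    -- they are unital
    (MemF c m ψm ψp (fun _ => 1) ∧
      ∀ α : ℂ, IsAverage c m ψm ψp α (fun _ => 1) (Dist.ofFun fun _ => 1)) ∧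
    -- they commute with convolution
    (∀ (α : ℂ) (f g h : ℂ → ℂ) (A B : Dist), MemF c m ψm ψp f → MemF c m ψm ψp g →
      MemF c m ψm ψp h → IsConvNearZero f g h →
      IsAverage c m ψm ψp α f A → IsAverage c m ψm ψp α g B →
      IsAverage c m ψm ψp α h (stairConv m A B)) ∧
    -- they commute with nonlinear operators and preserve their fixed points
    (∀ (α : ℂ) (n : ℕ) (M : MIdx n → Dist → Fin n → Dist) (F : Fin n → ℂ → ℂ)
      (F₀ : Fin n → Dist), IsAdmissible c m M → CommutesWithAverage c m ψm ψp α M →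
      (∀ i, MemF c m ψm ψp (F i) ∧ IsBoundaryValue c m (F i) (F₀ i) ∧
        IsAverage c m ψm ψp α (F i) (F₀ i)) →
      (∀ (Y Z : Fin n → ℂ → ℂ) (A B : Fin n → Dist), (∀ i, MemF c m ψm ψp (Y i)) →
        (∀ i, MemF c m ψm ψp (Z i)) → IsSurfaceMValue c m ψm ψp M F Y Z →
        (∀ i, IsAverage c m ψm ψp α (Y i) (A i)) → (∀ i, IsAverage c m ψm ψp α (Z i) (B i)) →
        IsMValue c m M F₀ A B) ∧
      (∀ (Y : Fin n → ℂ → ℂ) (A : Fin n → Dist), (∀ i, MemF c m ψm ψp (Y i)) →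
        IsSurfaceMValue c m ψm ψp M F Y Y → (∀ i, IsAverage c m ψm ψp α (Y i) (A i)) →
        IsMValue c m M F₀ A A)) ∧
    -- the case of convolution operators
    (∀ (n : ℕ) (G : MIdx n → Fin n → ℂ → ℂ) (κ : ℝ),
      (∀ l i, AnalyticOnNhd ℂ (G l i) (sector ψm ψp)) →
      (∀ l i, ∀ p ∈ sector ψm ψp, ‖G l i p‖ ≤ Real.exp (κ * ‖p‖)) →
      IsAdmissible c m (convOperator m G) ∧
      (∀ α : ℂ, CommutesWithAverage c m ψm ψp α (convOperator m G)) ∧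
      (∀ (α : ℂ) (F Y Z : Fin n → ℂ → ℂ) (F₀ S T A B : Fin n → Dist),
        (∀ i, MemF c m ψm ψp (F i) ∧ IsBoundaryValue c m (F i) (F₀ i) ∧
          IsAverage c m ψm ψp α (F i) (F₀ i)) →
        (∀ i, MemF c m ψm ψp (Y i) ∧ IsBoundaryValue c m (Y i) (S i) ∧
          IsAverage c m ψm ψp α (Y i) (A i)) →
        (∀ i, MemF c m ψm ψp (Z i) ∧ IsBoundaryValue c m (Z i) (T i) ∧
          IsAverage c m ψm ψp α (Z i) (B i)) →
        IsMValue c m (convOperator m G) F₀ S T →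
        IsMValue c m (convOperator m G) F₀ A B)) := by
  obtain ⟨a, rfl⟩ : ∃ a, ψm = -a := ⟨-ψm, by ring⟩
  have : IsAngle a := ⟨by linarith, by linarith⟩
  have : IsAngle ψp := ⟨hψp0, hψp⟩
  have hc1 : 1 ≤ c := one_le_of_three_lt hc
  have memF : ∀ {f : ℂ → ℂ}, MemF c m (-a) ψp f ↔ ∃ Dp Dm, Belongs c m a ψp f Dp Dm :=
    memF_iff hc1
  have up : ∀ {f : ℂ → ℂ} {D : ℕ → Dist},
      IsUpperDecomp c m (-a) ψp f D ↔ HasDecomp c m 1 a ψp f D :=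
    isUpperDecomp_iff hc1
  have low : ∀ {f : ℂ → ℂ} {D : ℕ → Dist},
      IsLowerDecomp c m (-a) ψp f D ↔ HasDecomp c m (-1) ψp a f D :=
    isLowerDecomp_iff hc1
  have gb : ∀ {f : ℂ → ℂ} {K : ℝ → ℝ≥0}, IsGrowthBound c m (-a) ψp f K ↔
      Tendsto K atTop (𝓝 0) ∧ ∃ Dp Dm, HasDecomp c m 1 a ψp f Dp ∧
        HasDecomp c m (-1) ψp a f Dm ∧ Admits c m K Dp ∧ Admits c m K Dm :=
    isGrowthBound_iff hc1
  refine ⟨?_, ?_, ?_, ?_, ?_, ?_, ?_, ?_, ?_, ?_⟩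
  · intro f g hf hg
    obtain ⟨_, _, hD⟩ := memF.1 hf
    obtain ⟨_, _, hD'⟩ := memF.1 hg
    obtain ⟨h, h1, h2⟩ := hD.exists_conv hc hD'
    exact ⟨h, memF.2 ⟨_, _, h2⟩, h1⟩
  · intro f g h hf hg hh hconv
    obtain ⟨Dp, Dm, hD, -⟩ := memF.1 hf
    obtain ⟨Dp', Dm', hD', -⟩ := memF.1 hg
    obtain ⟨_, _, hE, -⟩ := memF.1 hh
    refine ⟨fun D D' h1 h2 => ?_, fun D D' h1 h2 => ?_, fun K K' h1 h2 => ?_⟩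
    · exact up.2 (HasDecomps.conv hc ⟨hD.an, up.1 h1, hD.low⟩
        ⟨hD'.an, up.1 h2, hD'.low⟩ hE.an hconv).up
    · exact low.2 (HasDecomps.conv hc ⟨hD.an, hD.up, low.1 h1⟩
        ⟨hD'.an, hD'.up, low.1 h2⟩ hE.an hconv).low
    · obtain ⟨t1, P, M, d1, d2, a1, a2⟩ := gb.1 h1
      obtain ⟨t2, P', M', d1', d2', a1', a2'⟩ := gb.1 h2
      have h3 := HasDecomps.conv hc ⟨hD.an, d1, d2⟩ ⟨hD'.an, d1', d2'⟩ hE.an hconv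
      exact gb.2 ⟨by simpa using t1.add t2, _, _, h3.up, h3.low,
        a1.conv hc d1.isStair d1'.isStair a1', a2.conv hc d2.isStair d2'.isStair a2'⟩
  · exact fun h f hh ⟨C, hb⟩ hf => hf.mul hc1 hh.differentiableOn hb
  · intro α f hf
    obtain ⟨_, _, hD⟩ := memF.1 hf
    obtain ⟨K, hK, hKp, -⟩ := hD.2
    obtain ⟨A, hA⟩ := exists_isAvg hc1 hD.isStair hK hKp α
    exact ⟨A, (hD.isAverage_iff hc1).2 hA, fun B hB => ((hD.isAverage_iff hc1).1 hB).unique hA⟩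
  · intro α f g x y A B hf hg h1 h2
    obtain ⟨Dp, Dm, hD, K, hK, hKp, hKm⟩ := memF.1 hf
    obtain ⟨Dp', Dm', hD', K', hK', hKp', hKm'⟩ := memF.1 hg
    have h3 := hD.lin hD' x y
    have h4 := hKp.lin hc1 hD.up.isStair hD'.up.isStair hKp' x y
    have h5 : Tendsto (fun ν => (1 + ‖x‖₊) * K ν + (1 + ‖y‖₊) * K' ν) atTop (𝓝 0) := by
      simpa using (hK.const_mul (1 + ‖x‖₊)).add (hK'.const_mul (1 + ‖y‖₊))
    refine ⟨memF.2 ⟨_, _, h3, _, h5, h4, hKm.lin hc1 hD.low.isStair hD'.low.isStair hKm' x y⟩,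
      (isAverage_iff hc1 h3.up h5 h4).2 ?_⟩
    exact ((isAverage_iff hc1 hD.up hK hKp).1 h1).lin hD.up.isStair hD'.up.isStair
      ((isAverage_iff hc1 hD'.up hK' hKp').1 h2) x y
  · exact fun α h f A hh hf hf' hA => hA.exists_mul hc1 hh hf hf'
  · obtain ⟨h1, h2⟩ := hasDecomps_sector (ψA := a) (ψB := ψp) (c := c) (m := m) (G := fun _ => 1)
      (κ := 0) analyticOnNhd_const (by simp)
    exact ⟨memF.2 ⟨_, _, h1, _, tendsto_const_nhds, h2, h2⟩, fun α =>
      (isAverage_iff hc1 h1.up tendsto_const_nhds h2).2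
        (isAvg_single (h1.up.isStair 0) α)⟩
  · intro α f g h A B hf hg hh hconv h1 h2
    obtain ⟨_, _, hD⟩ := memF.1 hf
    obtain ⟨_, _, hD'⟩ := memF.1 hg
    obtain ⟨_, _, hE⟩ := memF.1 hh
    obtain ⟨K, hK, hKp, -⟩ := hD.2
    obtain ⟨K', hK', hKp', -⟩ := hD'.2
    have h4 := (hD.isAverage_iff hc1).1 h1
    have h5 := (hD'.isAverage_iff hc1).1 h2
    exact (isAverage_iff hc1 (hD.1.conv hc hD'.1 hE.1.an hconv).up (by simpa using hK.add hK')
      (hKp.conv hc hD.isStair hD'.isStair hKp')).2 (h4.conv hD.isStair hD'.isStair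
      (hD.isStair_avg hc1 h4) (hD'.isStair_avg hc1 h5) h5)
  · intro α n M F F₀ hM hcom hF
    exact (and_iff_left_of_imp fun h Y A hY h' h1 => h Y Y A A hY hY h' h1 h1).2
      fun Y Z A B hY hZ hS h1 h2 =>
        isMValue_of_surface hc hM hcom (fun i => ⟨(hF i).1, (hF i).2.2⟩)
          (fun i => ⟨hY i, h1 i⟩) (fun i => ⟨hZ i, h2 i⟩) hS
  · intro n G κ hG hGb
    exact ⟨isAdmissible_convOperator hc hG hGb,
      commutesWithAverage_convOperator hc hG hGb,
      fun α F Y Z F₀ S T A B hF hY hZ hM =>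
        isMValue_convOperator hc hG hGb hF hY hZ hM⟩
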